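/- **Setting.** For $d\ge 2$ let $\mathcal S^{d-1}$ be the unit sphere of $\mathbb R^d$, $\log=\log_2$, $\varepsilon=1/\log^2 d$, and write $a\approx b$ if $|a-b|\le\varepsilon$. Let $p_\alpha=(1-\cos^2\alpha)^{d/2}$, and let $W(\alpha,\beta\mid\theta)$ be the fraction of the area of $\mathcal S^{d-1}$ consisting of the $\mathbf x$ with $\langle \mathbf v,\mathbf x\rangle\ge\cos\alpha$ and $\langle \mathbf w,\mathbf x\rangle\ge\cos\beta$, where $\mathbf v,\mathbf w$ are unit vectors with $\langle \mathbf v,\mathbf w\rangle=\cos\theta$. It is *well-defined* (with constant $\kappa'>0$) if either $\theta\ne0$ and $\kappa'\le\frac{\cos^2\alpha+\cos^2\beta-2\cos\alpha\cos\beta\cos\theta}{\sin^2\theta}\le1-\kappa'$, or $\alpha=\beta$ and $\frac{2\cos^2\alpha}{1+\cos\theta}\le 1-\kappa'$. Write $a=_d b$ if $2^{-o(d)}b\le a\le 2^{o(d)}b$, and $a\le_d b$ if $a\le 2^{o(d)}b$. For finite $L,\mathcal C,\mathcal C'\subseteq\mathcal S^{d-1}$ and angles $\theta,\theta',\alpha,\alpha'$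 put $R(\mathbf x)=\{\mathbf c\in \mathcal C:\langle \mathbf x,\mathbf c\rangle\approx\cos\alpha\}$, $R_L^{-1}(\mathbf c)=\{\mathbf x\in L:\langle \mathbf x,\mathbf c\rangle\approx\cos\alpha\}$, and define $R'(\mathbf x)$, $R_L'^{-1}(\mathbf c')$ in the same way from $\mathcal C',\alpha'$. Write $\mathbf u_{\mathbf x\mathbf y}=\frac{\mathbf x-\mathbf y}{\|\mathbf x-\mathbf y\|}$ (and $\mathbf u_{\mathbf x\mathbf x}=0$). Let - $M_1=\{(\mathbf x,\mathbf y)\in L^2:\langle \mathbf x,\mathbf y\rangle\approx\cos\theta,\ R(\mathbf x)\cap R(\mathbf y)\ne\emptyset\}$ and $M_1^*=\{(\mathbf x,\mathbf y)\in M_1: |R(\mathbf x)|\le2^{d/\log d}\}$; - $\mathcal T=\{(\mathbf x,\mathbf y,\mathbf z)\in L^3:\langle \mathbf x,\mathbf y\rangle\approx\cos\theta,\ \langle \mathbf u_{\mathbf x\mathbf y},\mathbf z\rangle\approx\cos\theta',\ R(\mathbf x)\cap R(\mathbf y)\ne\emptyset,\ R'(\mathbf u_{\mathbf x\mathbf y})\cap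 R'(\mathbf z)\ne\emptyset\}$; - $\mathcal T^*=\{(\mathbf x,\mathbf y,\mathbf z)\in\mathcal T: |R(\mathbf x)|\le 2^{d/\log d},\ |R'(\mathbf u_{\mathbf x\mathbf y})|\le2^{d/\log d}\}$. The triple $(L,\mathcal C,\mathcal C')$ is *good* if 1. $|R_L^{-1}(\mathbf c)|=_d|L|p_\alpha$ for all $\mathbf c\in \mathcal C$ and $|R_L'^{-1}(\mathbf c')|=_d|L|p_{\alpha'}$ for all $\mathbf c'\in \mathcal C'$; 2. $|\{\mathbf z\in L:\langle \mathbf u_{\mathbf x\mathbf y},\mathbf z\rangle\approx\cos\theta',\,R'(\mathbf u_{\mathbf x\mathbf y})\cap R'(\mathbf z)\neq\emptyset\}|\le_d\max\{1,|L|W(\theta',\alpha'\mid\alpha')\}$ for all $\mathbf x,\mathbf y\in L$; 3. $|M_1|=_d|M_1^*|=_d|L|^2W(\theta,\alpha\mid\alpha)$; 4. $|\mathcal T|=_d|\mathcal T^*|=_d|L|^3W(\theta,\alpha\mid\alpha)W(\theta',\alpha'\mid\alpha')$. A *product code description* of $\mathcal C'$ (for $\alpha'$) consists of $q=2^{o(d)}$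 rotations $Q\in\mathrm{SO}(d)$ and, for $b=\lfloor\log d\rfloor$ consecutive coordinate blocks of (nearly) equal length, a code $\mathcal C^{(k)}$ of $\lceil (1/p_{\alpha'})^{1/b}\rceil$ vectors of norm $1/\sqrt b$ in each block, such that $\mathcal C'=\bigcup_Q Q(\mathcal C^{(1)}\times\dots\times \mathcal C^{(b)})$. The data structures $D(R_L)$, $D(R'_L)$ store in QCRAM (classical memory readable in superposition) the vectors of $L,\mathcal C,\mathcal C'$ in sorted order, for every key the sizes and the sorted arrays of $R(\mathbf x)$, $R_L^{-1}(\mathbf c)$, $R'(\mathbf x)$, $R'^{-1}_L(\mathbf c')$ ($\mathbf x\in L$), and the description of $\mathcal C'$. **Algorithm.** $\mathrm{AA}_r(\mathrm{Samp},\mathrm{Check})$ denotes amplitude amplification with $r$ rounds (arbitrary phases in the two reflections of each round), followed by $\mathrm{Check}$ writing a flag qubit. *RCollisionSamp* prepares the uniform superposition over $\mathbf x\in L$, then over $\mathbf c\in R(\mathbf x)$, then over $\mathbf y\in R_L^{-1}(\mathbf c)$ (with a symbol $\bot$ whenever the set is empty). *TupleSamp* applies (1) $\mathrm{AA}_{r_1}$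 to RCollisionSamp with the check $\langle \mathbf x,\mathbf y\rangle\approx\cos\theta$ (and $\mathbf y\neq\bot$); (2) the map creating the uniform superposition over $\mathbf c'\in R'(\mathbf u_{\mathbf x\mathbf y})$, truncated to $\lfloor 2^{d/\log d}\rfloor$ elements; (3) controlled on $\mathbf x,\mathbf c,\mathbf y,\mathbf c'$, $\mathrm{AA}_{r_2}$ to the uniform superposition over $\mathbf z\in R_L'^{-1}(\mathbf c')$ with the check $\langle \mathbf u_{\mathbf x\mathbf y},\mathbf z\rangle\approx\cos\theta'$ (and $\mathbf z\neq\bot$). *SolutionSearch* applies $\mathrm{AA}_{r_3}$ to TupleSamp, checking the flag of step (3), and measures $(\mathbf x,\mathbf y,\mathbf z)$. Algorithms are quantum circuits with QCRAM queries, in the model with exact real arithmetic: a register holds a qubit or a real number; an elementary gate (one-qubit unitary, CNOT, Toffoli, real arithmetic operation or comparison, rotation of a qubit controlled by a real register) is one step; a query or a phase conditioned on registers being zero costs one step plus one per wire; "qubits" counts all quantum registers. **Theorem.** Let $\kappa\in(0,\pi/4)$ and $\kappa'>0$ be constants, let $\theta,\theta',\alpha,\alpha'\in[\kappa,\pi/2-\kappa]$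 be such that $W(\theta,\alpha\mid\alpha)$, $W(\alpha,\alpha\mid\theta)$, $W(\theta',\alpha'\mid\alpha')$, $W(\alpha',\alpha'\mid\theta')$ are well-defined with constant $\kappa'$, and suppose $m=2^{O(d)}$ and $m^3W(\theta,\alpha\mid\alpha)W(\theta',\alpha'\mid\alpha')=2^{\Omega(d)}$. There are implementations of the basic operations above by circuits, a choice of $(r_1,r_2,r_3)$ with phases, and a natural number $\ell_2=_d m^3W(\theta,\alpha\mid\alpha)W(\theta',\alpha'\mid\alpha')$, all depending only on $d$, the parameters and the sizes (not on the sets themselves), such that the following holds for all good $(L,\mathcal C,\mathcal C')$ with $|L|=m$, $|\mathcal C|=2^{O(d)}$ and $\mathcal C'$ given by a product code description. $\mathrm{SolutionSearch}(D(R_L),D(R'_L))$ uses at most $$\frac{1}{\sqrt{\min\{1,mW(\theta',\alpha'\mid\alpha')\}}}\left(\sqrt{\frac{p_\alpha}{W(\theta,\alpha\mid\alpha)}}+\sqrt{mp_{\alpha'}}\right)2^{o(d)}$$ time and QCRAM queries, and $2^{o(d)}$ qubits. Moreover, the outputs of $\ell_2$ independent runs of SolutionSearch contain all elements of $\mathcal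 T^*$, except with probability $e^{-\omega(d)}$ over its internal randomness. The terms $o(d)$ and $\omega(d)$ in the conclusion depend only on $\kappa,\kappa'$ and on the asymptotic bounds in the hypotheses. -/

import Mathlib

open scoped Matrix
open MeasureTheory

noncomputable section

namespace TupleSieve

/-! ## Geometry of the unit sphere -/

/-- Euclidean space of dimension `d`. -/
abbrev Vec (d : ℕ) : Type := EuclideanSpace ℝ (Fin d)

/-- The global tolerance `1 / log² d` (binary logarithm). -/
def tol (d : ℕ) : ℝ := 1 / (Real.logb 2 d) ^ 2

/-- `a` and `b` are equal up to the tolerance. -/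
def Near (d : ℕ) (a b : ℝ) : Prop := |a - b| ≤ tol d

/-- `p_α = (1 - cos² α)^(d/2)`. -/
def capP (d : ℕ) (α : ℝ) : ℝ := (1 - Real.cos α ^ 2) ^ ((d : ℝ) / 2)

/-- The unit vector `cos θ • e₀ + sin θ • e₁` (for `d ≥ 2`). -/
def planeVec (d : ℕ) (θ : ℝ) : Vec d :=
  WithLp.toLp 2 fun i =>
    if i.val = 0 then Real.cos θ else if i.val = 1 then Real.sin θ else 0

/-- The spherical wedge around `v` and `w` with angles `α` and `β`. -/
def wedge (d : ℕ) (v w : Vec d) (α β : ℝ) : Set (Metric.sphere (0 : Vec d) 1) :=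
  {x | Real.cos α ≤ inner ℝ v (x : Vec d) ∧ Real.cos β ≤ inner ℝ w (x : Vec d)}

/-- `W_d(α, β ∣ θ)`: the fraction of the area of the unit sphere occupied by the wedge with angles
`α`, `β` around two unit vectors at angle `θ`. -/
def wedgeRatio (d : ℕ) (α β θ : ℝ) : ℝ :=
  ((volume : Measure (Vec d)).toSphere (wedge d (planeVec d 0) (planeVec d θ) α β)).toReal /
    ((volume : Measure (Vec d)).toSphere Set.univ).toReal

/-- `W_d(α, β ∣ θ)` is well-defined, with constant `κ`. -/
def WellDefined (κ α β θ : ℝ) : Prop :=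
  (θ ≠ 0 ∧
    κ ≤ (Real.cos α ^ 2 + Real.cos β ^ 2 - 2 * Real.cos α * Real.cos β * Real.cos θ)
      / Real.sin θ ^ 2 ∧
    (Real.cos α ^ 2 + Real.cos β ^ 2 - 2 * Real.cos α * Real.cos β * Real.cos θ)
      / Real.sin θ ^ 2 ≤ 1 - κ) ∨
  (α = β ∧ 2 * Real.cos α ^ 2 / (1 + Real.cos θ) ≤ 1 - κ)

/-- `a` and `b` are equal up to a factor `2^s`. -/
def EqUpTo (s a b : ℝ) : Prop := (2 : ℝ) ^ (-s) * b ≤ a ∧ a ≤ (2 : ℝ) ^ s * b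

/-! ## The relations, the solution sets, and good inputs -/

open Classical in
/-- `R(x)` for the relation `R = R_(C,α)`: the centers `c ∈ C` with `⟪x, c⟫ ≈ cos α`. -/
def nbrs {d : ℕ} (α : ℝ) (C : Finset (Vec d)) (x : Vec d) : Finset (Vec d) :=
  C.filter fun c => Near d (inner ℝ x c) (Real.cos α)

open Classical in
/-- `(R_L)⁻¹(c)`: the list vectors `x ∈ L` with `⟪x, c⟫ ≈ cos α`. -/
def bucket {d : ℕ} (α : ℝ) (L : Finset (Vec d)) (c : Vec d) : Finset (Vec d) :=
  L.filter fun x => Near d (inner ℝ x c) (Real.cos α)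

/-- The normalized difference `(x - y) / ‖x - y‖`. -/
def udiff {d : ℕ} (x y : Vec d) : Vec d := (‖x - y‖)⁻¹ • (x - y)

/-- The truncation threshold `2^(d / log d)`. -/
def trunc (d : ℕ) : ℝ := (2 : ℝ) ^ ((d : ℝ) / Real.logb 2 d)

open Classical in
/-- `M₁(R)`. -/
def collPairs {d : ℕ} (θ α : ℝ) (L C : Finset (Vec d)) : Finset (Vec d × Vec d) :=
  (L ×ˢ L).filter fun p =>
    Near d (inner ℝ p.1 p.2) (Real.cos θ) ∧ (nbrs α C p.1 ∩ nbrs α C p.2).Nonempty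

open Classical in
/-- `M₁*(R)`. -/
def collPairsStar {d : ℕ} (θ α : ℝ) (L C : Finset (Vec d)) : Finset (Vec d × Vec d) :=
  (collPairs θ α L C).filter fun p => ((nbrs α C p.1).card : ℝ) ≤ trunc d

open Classical in
/-- `T_sol(L, θ, θ')`. -/
def solTriples {d : ℕ} (θ θ' : ℝ) (L : Finset (Vec d)) : Finset (Vec d × Vec d × Vec d) :=
  (L ×ˢ L ×ˢ L).filter fun t =>
    Near d (inner ℝ t.1 t.2.1) (Real.cos θ) ∧
    Near d (inner ℝ (udiff t.1 t.2.1) t.2.2) (Real.cos θ')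

open Classical in
/-- `T(R, R')`. -/
def collTriples {d : ℕ} (θ θ' α α' : ℝ) (L C C' : Finset (Vec d)) :
    Finset (Vec d × Vec d × Vec d) :=
  (solTriples θ θ' L).filter fun t =>
    (nbrs α C t.1 ∩ nbrs α C t.2.1).Nonempty ∧
    (nbrs α' C' (udiff t.1 t.2.1) ∩ nbrs α' C' t.2.2).Nonempty

open Classical in
/-- `T*(R, R')`. -/
def collTriplesStar {d : ℕ} (θ θ' α α' : ℝ) (L C C' : Finset (Vec d)) :
    Finset (Vec d × Vec d × Vec d) :=
  (collTriples θ θ' α α' L C C').filter fun t =>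
    ((nbrs α C t.1).card : ℝ) ≤ trunc d ∧ ((nbrs α' C' (udiff t.1 t.2.1)).card : ℝ) ≤ trunc d

open Classical in
/-- `(L, C, C')` is `(θ, θ', α, α')`-good, all subexponential factors being `2^(± s)`. -/
structure IsGood {d : ℕ} (s θ θ' α α' : ℝ) (L C C' : Finset (Vec d)) : Prop where
  bucket_card : ∀ c ∈ C, EqUpTo s ((bucket α L c).card : ℝ) (L.card * capP d α)
  bucket_card' : ∀ c ∈ C', EqUpTo s ((bucket α' L c).card : ℝ) (L.card * capP d α')
  third_card : ∀ x ∈ L, ∀ y ∈ L,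
    ((L.filter fun z => Near d (inner ℝ (udiff x y) z) (Real.cos θ') ∧
        (nbrs α' C' (udiff x y) ∩ nbrs α' C' z).Nonempty).card : ℝ)
      ≤ (2 : ℝ) ^ s * max 1 (L.card * wedgeRatio d θ' α' α')
  pairs_star : EqUpTo s ((collPairs θ α L C).card : ℝ) ((collPairsStar θ α L C).card : ℝ)
  pairs_card : EqUpTo s ((collPairsStar θ α L C).card : ℝ)
    ((L.card : ℝ) ^ 2 * wedgeRatio d θ α α)
  triples_star : EqUpTo s ((collTriples θ θ' α α' L C C').card : ℝ)
    ((collTriplesStar θ θ' α α' L C C').card : ℝ)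
  triples_card : EqUpTo s ((collTriplesStar θ θ' α α' L C C').card : ℝ)
    ((L.card : ℝ) ^ 3 * wedgeRatio d θ α α * wedgeRatio d θ' α' α')

/-! ## Random product codes -/

/-- The number `b = ⌊log d⌋` of blocks. -/
def numBlocks (d : ℕ) : ℕ := Nat.log 2 d

/-- The number `⌈M^(1/b)⌉` of codewords per block, for `M = 1 / p_α`. -/
def wordsPerBlock (d : ℕ) (α : ℝ) : ℕ := ⌈(1 / capP d α) ^ (1 / (numBlocks d : ℝ))⌉₊

/-- A description of an element of the support of the random product code distribution in
dimension `d`, with `b` blocks, `N` codewords in each block, and `q` rotations. The coordinates are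
cut into `b` consecutive blocks, coordinate `i` lying in block number `⌊i * b / d⌋` (so all blocks
have `d / b` coordinates if `b` divides `d`); `word k` enumerates the code of block `k`, a set of
`N` vectors of norm `1 / √b` supported on that block. -/
structure ProductCode (d b N q : ℕ) where
  rot : Fin q → Matrix.specialOrthogonalGroup (Fin d) ℝ
  rot_injective : Function.Injective rot
  word : Fin b → Fin N → Vec d
  word_injective : ∀ k, Function.Injective (word k)
  word_support : ∀ k a (i : Fin d), i.val * b / d ≠ k.val → word k a i = 0
  word_norm : ∀ k a, ‖word k a‖ = 1 / Real.sqrt b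

open Classical in
/-- The described code, the union over all rotations `Q` of `Q (C⁽¹⁾ × ⋯ × C⁽ᵇ⁾)`. -/
def ProductCode.points {d b N q : ℕ} (P : ProductCode d b N q) : Finset (Vec d) :=
  Finset.univ.image fun t : Fin q × (Fin b → Fin N) =>
    (WithLp.toLp 2 ((P.rot t.1 : Matrix (Fin d) (Fin d) ℝ) *ᵥ
      (∑ k, P.word k (t.2 k) : Vec d).ofLp) : Vec d)

/-! ## The machine: quantum circuits with QCRAM

A circuit acts on named wires, each being a qubit or holding a real number (real arithmetic is
exact). Elementary gates are arbitrary one-qubit unitaries, CNOT, Toffoli, real arithmetic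
(reversibly accumulated into a fresh register), comparison of two real registers, and the rotation
of a qubit by an amount held in a real register. The QCRAM is classical, read-only for the
circuit, and is queried in superposition. -/

/-- Names of the qubit registers: the registers for `x, c, y, c', z`, one flag for each of the
three levels of amplitude amplification, and workspace. -/
inductive Reg : Type
  | x | c | y | c' | z | flag₁ | flag₂ | flag₃ | work
  deriving DecidableEq

/-- The qubit `(ρ, k)` carries the binary digit of weight `2^k` of register `ρ`. -/
abbrev QWire : Type := Reg × ℕ

/-- A computational basis state: the contents of all qubits and of all real registers. -/
@[ext] structure Config : Type where
  q : QWire → Bool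
  r : ℕ → ℝ

/-- Arrays of bits in QCRAM. `size primed bwd` and `list primed bwd` belong to the data structure of
the relation `R_L` (`primed = false`) or `R'_L` (`primed = true`), for lookup by list vector
(`bwd = false`) or lookup by center (`bwd = true`). -/
inductive BitArray : Type
  | size (primed bwd : Bool)
  | list (primed bwd : Bool)

/-- Arrays of reals in QCRAM: coordinates of the list vectors, of the centers, and of the
description (rotations and codewords) of the second code. -/
inductive RealArray : Type
  | vec
  | center (primed : Bool)
  | rotation
  | codeword

/-- The contents of the QCRAM: every array is addressed by three natural numbers in binary. -/
structure Memory : Type where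
  bit : BitArray → ℕ → ℕ → ℕ → Bool
  real : RealArray → ℕ → ℕ → ℕ → ℝ

/-- Real arithmetic operations. -/
inductive RealOp : Type
  | fst | mul | div | sqrt

/-- Value of a real arithmetic operation. -/
def RealOp.eval : RealOp → ℝ → ℝ → ℝ
  | fst, s, _ => s
  | mul, s, t => s * t
  | div, s, t => s / t
  | sqrt, s, _ => Real.sqrt s

/-- Elementary gates. A Boolean parameter `inv` selects the inverse of the gate. -/
inductive Gate : Type
  /-- apply a one-qubit unitary -/
  | unitary (U : Matrix.unitaryGroup Bool ℂ) (t : QWire)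
  /-- multiply the amplitude by `exp (i φ)` if qubit `t` is one -/
  | phase (φ : ℝ) (t : QWire)
  /-- negate `t` if `a` is one -/
  | cnot (a t : QWire) (h : a ≠ t)
  /-- negate `t` if `a` and `b` are one -/
  | toffoli (a b t : QWire) (ha : a ≠ t) (hb : b ≠ t)
  /-- multiply the amplitude by `exp (i φ)` if all wires in `Q` and `S` are zero -/
  | zeroPhase (φ : ℝ) (Q : Finset QWire) (S : Finset ℕ)
  /-- add (subtract) a constant to real register `k` -/
  | const (inv : Bool) (v : ℝ) (k : ℕ)
  /-- add (subtract) the value of a qubit to real register `k` -/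
  | ofQubit (inv : Bool) (a : QWire) (k : ℕ)
  /-- add (subtract) `op (r i) (r j)` to real register `k` -/
  | arith (inv : Bool) (op : RealOp) (i j k : ℕ) (hi : i ≠ k) (hj : j ≠ k)
  /-- negate `t` if `r i ≤ r j` -/
  | compare (i j : ℕ) (t : QWire)
  /-- rotate qubit `t` by `0 ↦ √(1-p) 0 + √p 1`, `1 ↦ -√p 0 + √(1-p) 1`, where `p` is the
  content of real register `i`, if `0 ≤ p ≤ 1` -/
  | rotate (inv : Bool) (i : ℕ) (t : QWire)
  /-- QCRAM query to a bit array, whose answer is XORed into `t` -/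
  | queryBit (A : BitArray) (a₁ a₂ a₃ : List QWire) (t : QWire) (h : t ∉ a₁ ++ a₂ ++ a₃)
  /-- QCRAM query to an array of reals, whose answer is added to (subtracted from) register `k` -/
  | queryReal (inv : Bool) (A : RealArray) (a₁ a₂ a₃ : List QWire) (k : ℕ)

/-- A circuit is a list of gates, applied from left to right. -/
abbrev Circuit : Type := List Gate

/-- Pure states: finite superpositions of basis states. -/
abbrev State : Type := Config →₀ ℂ

/-- Overwrite a qubit. -/
def Config.setQ (s : Config) (t : QWire) (v : Bool) : Config := ⟨Function.update s.q t v, s.r⟩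

/-- Add to a real register, or subtract from it. -/
def Config.addR (s : Config) (inv : Bool) (k : ℕ) (v : ℝ) : Config :=
  ⟨s.q, Function.update s.r k (if inv then s.r k - v else s.r k + v)⟩

/-- The number written in binary on a list of qubits, least significant digit first. -/
def Config.address (s : Config) : List QWire → ℕ
  | [] => 0
  | w :: l => (s.q w).toNat + 2 * Config.address s l

/-- The entry, in row `v` and column `u`, of the rotation by `p`. -/
def rotEntry (inv : Bool) (p : ℝ) (v u : Bool) : ℝ :=
  if 0 ≤ p ∧ p ≤ 1 then
    if v = u then Real.sqrt (1 - p)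
    else if v = !inv then Real.sqrt p else -Real.sqrt p
  else if v = u then 1 else 0

open Classical in
/-- Action of a gate on a basis state. -/
def Gate.act (mem : Memory) : Gate → Config → State
  | unitary U t, s =>
      ∑ v : Bool, Finsupp.single (s.setQ t v) ((U : Matrix Bool Bool ℂ) v (s.q t))
  | phase φ t, s =>
      Finsupp.single s (if s.q t = true then Complex.exp (φ * Complex.I) else 1)
  | cnot a t _, s => Finsupp.single (s.setQ t (s.q t ^^ s.q a)) 1
  | toffoli a b t _ _, s => Finsupp.single (s.setQ t (s.q t ^^ (s.q a && s.q b))) 1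
  | zeroPhase φ Q S, s =>
      Finsupp.single s
        (if (∀ w ∈ Q, s.q w = false) ∧ (∀ k ∈ S, s.r k = 0) then Complex.exp (φ * Complex.I) else 1)
  | const inv v k, s => Finsupp.single (s.addR inv k v) 1
  | ofQubit inv a k, s => Finsupp.single (s.addR inv k (if s.q a = true then 1 else 0)) 1
  | arith inv op i j k _ _, s => Finsupp.single (s.addR inv k (op.eval (s.r i) (s.r j))) 1
  | compare i j t, s => Finsupp.single (s.setQ t (s.q t ^^ decide (s.r i ≤ s.r j))) 1
  | rotate inv i t, s =>
      ∑ v : Bool, Finsupp.single (s.setQ t v) ((rotEntry inv (s.r i) v (s.q t) : ℝ) : ℂ)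
  | queryBit A a₁ a₂ a₃ t _, s =>
      Finsupp.single
        (s.setQ t (s.q t ^^ mem.bit A (s.address a₁) (s.address a₂) (s.address a₃))) 1
  | queryReal inv A a₁ a₂ a₃ k, s =>
      Finsupp.single
        (s.addR inv k (mem.real A (s.address a₁) (s.address a₂) (s.address a₃))) 1

/-- Action of a gate on a state, by linearity. -/
def Gate.apply (mem : Memory) (g : Gate) (ψ : State) : State :=
  Finsupp.linearCombination ℂ (g.act mem) ψ

/-- Action of a circuit on a state. -/
def Circuit.run (mem : Memory) : Circuit → State → State
  | [], ψ => ψ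
  | g :: l, ψ => Circuit.run mem l (g.apply mem ψ)

/-- The inverse gate. -/
def Gate.inverse : Gate → Gate
  | unitary U t => unitary U⁻¹ t
  | phase φ t => phase (-φ) t
  | cnot a t h => cnot a t h
  | toffoli a b t ha hb => toffoli a b t ha hb
  | zeroPhase φ Q S => zeroPhase (-φ) Q S
  | const inv v k => const (!inv) v k
  | ofQubit inv a k => ofQubit (!inv) a k
  | arith inv op i j k hi hj => arith (!inv) op i j k hi hj
  | compare i j t => compare i j t
  | rotate inv i t => rotate (!inv) i t
  | queryBit A a₁ a₂ a₃ t h => queryBit A a₁ a₂ a₃ t h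
  | queryReal inv A a₁ a₂ a₃ k => queryReal (!inv) A a₁ a₂ a₃ k

/-- The inverse circuit. -/
def Circuit.inverse (S : Circuit) : Circuit := (S.map Gate.inverse).reverse

/-- The qubits on which a gate acts. -/
def Gate.qubits : Gate → Finset QWire
  | unitary _ t => {t}
  | phase _ t => {t}
  | cnot a t _ => {a, t}
  | toffoli a b t _ _ => {a, b, t}
  | zeroPhase _ Q _ => Q
  | const _ _ _ => ∅
  | ofQubit _ a _ => {a}
  | arith _ _ _ _ _ _ _ => ∅
  | compare _ _ t => {t}
  | rotate _ _ t => {t}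
  | queryBit _ a₁ a₂ a₃ t _ => insert t (a₁ ++ a₂ ++ a₃).toFinset
  | queryReal _ _ a₁ a₂ a₃ _ => (a₁ ++ a₂ ++ a₃).toFinset

/-- The real registers on which a gate acts. -/
def Gate.reals : Gate → Finset ℕ
  | zeroPhase _ _ S => S
  | const _ _ k => {k}
  | ofQubit _ _ k => {k}
  | arith _ _ i j k _ _ => {i, j, k}
  | compare i j _ => {i, j}
  | rotate _ i _ => {i}
  | queryReal _ _ _ _ _ k => {k}
  | _ => ∅

/-- Number of steps of a gate: one, plus the number of wires for the two kinds of gates with an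
unbounded number of wires. -/
def Gate.cost : Gate → ℕ
  | zeroPhase _ Q S => 1 + Q.card + S.card
  | queryBit _ a₁ a₂ a₃ _ _ => 1 + (a₁ ++ a₂ ++ a₃).length
  | queryReal _ _ a₁ a₂ a₃ _ => 1 + (a₁ ++ a₂ ++ a₃).length
  | _ => 1

/-- Whether a gate is a QCRAM query. -/
def Gate.isQuery : Gate → Bool
  | queryBit _ _ _ _ _ _ => true
  | queryReal _ _ _ _ _ _ => true
  | _ => false

/-- Time: the total number of steps. -/
def Circuit.time (S : Circuit) : ℕ := (S.map Gate.cost).sum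

/-- The number of QCRAM queries. -/
def Circuit.queries (S : Circuit) : ℕ := S.countP Gate.isQuery

/-- The qubits used by a circuit. -/
def Circuit.qubits (S : Circuit) : Finset QWire := S.foldr (fun g A => g.qubits ∪ A) ∅

/-- The real registers used by a circuit. -/
def Circuit.reals (S : Circuit) : Finset ℕ := S.foldr (fun g A => g.reals ∪ A) ∅

/-- The number of quantum registers (qubits and real registers) used by a circuit. -/
def Circuit.width (S : Circuit) : ℕ := S.qubits.card + S.reals.card

/-- The probability that `ℓ` independent runs, each measuring the state `ψ` in the computational
basis, give a sequence of outcomes with the property `E`. -/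
def runsProb (ψ : State) (ℓ : ℕ) (E : (Fin ℓ → Config) → Prop) [DecidablePred E] : ℝ :=
  ∑ o ∈ (Fintype.piFinset fun _ : Fin ℓ => ψ.support) with E o, ∏ i, ‖ψ (o i)‖ ^ 2

/-! ## The QCRAM data structures -/

open Classical in
/-- The elements of a finite set of vectors as a list, sorted lexicographically by coordinates. -/
def sortedList {d : ℕ} (S : Finset (Vec d)) : List (Lex (Fin d → ℝ)) :=
  (S.image fun v : Vec d => toLex v.ofLp).sort (· ≤ ·)

/-- The `i`-th element (from zero) of `S` in lexicographic order. -/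
def vecAt {d : ℕ} (S : Finset (Vec d)) (i : ℕ) : Vec d :=
  WithLp.toLp 2 (ofLex ((sortedList S).getD i (toLex 0)))

/-- Coordinate `k` of `v`. -/
def coord {d : ℕ} (v : Vec d) (k : ℕ) : ℝ := if h : k < d then v ⟨k, h⟩ else 0

open Classical in
/-- Indices of the elements of `R(u)`. -/
def nbrIdx {d : ℕ} (α : ℝ) (C : Finset (Vec d)) (u : Vec d) : Finset ℕ :=
  (Finset.range C.card).filter fun j => vecAt C j ∈ nbrs α C u

open Classical in
/-- Indices of the elements of `(R_L)⁻¹(c)`, where `c` is the element of `C` with index `j`; empty if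
`j` is not an index. -/
def bucketIdx {d : ℕ} (α : ℝ) (L C : Finset (Vec d)) (j : ℕ) : Finset ℕ :=
  (Finset.range L.card).filter fun i => j < C.card ∧ vecAt L i ∈ bucket α L (vecAt C j)

/-- The set returned by the lookup with key number `i` in the data structure of `R_L`: an array of
indices of centers (`bwd = false`) or of list vectors (`bwd = true`). -/
def lookup {d : ℕ} (α : ℝ) (L C : Finset (Vec d)) (bwd : Bool) (i : ℕ) : Finset ℕ :=
  if bwd then bucketIdx α L C i
  else if i < L.card then nbrIdx α C (vecAt L i) else ∅

/-- The QCRAM contents `D(R_L)`, `D(R'_L)`, together with the description `P` of `C'`. Keys are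
stored in sorted order with their coordinates. For each key the size of its array is stored in
`size`, with its binary digit number `s` at address `(key, s, 0)`; entry number `k` of the array, in
increasing order, is stored in `list`, with its binary digit number `s` at address `(key, k, s)`. -/
def qcram {d b N q : ℕ} (α α' : ℝ) (L C : Finset (Vec d)) (P : ProductCode d b N q) : Memory where
  bit A i k s :=
    match A with
    | .size false bwd => (lookup α L C bwd i).card.testBit k
    | .size true bwd => (lookup α' L P.points bwd i).card.testBit k
    | .list false bwd => (((lookup α L C bwd i).sort (· ≤ ·)).getD k 0).testBit s
    | .list true bwd => (((lookup α' L P.points bwd i).sort (· ≤ ·)).getD k 0).testBit s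
  real A i k l :=
    match A with
    | .vec => coord (vecAt L i) k
    | .center false => coord (vecAt C i) k
    | .center true => coord (vecAt P.points i) k
    | .rotation =>
        if h : i < q ∧ k < d ∧ l < d then
          (P.rot ⟨i, h.1⟩ : Matrix (Fin d) (Fin d) ℝ) ⟨k, h.2.1⟩ ⟨l, h.2.2⟩
        else 0
    | .codeword => if h : i < b ∧ k < N then coord (P.word ⟨i, h.1⟩ ⟨k, h.2⟩) l else 0

/-! ## The algorithm -/

/-- The basis state whose registers hold the given numbers, workspace and real registers being zero.
List vectors and centers are represented by their index in sorted order; the symbol `⊥` of a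
register is represented by the number of vectors of the set in question. -/
def ket (x c y c' z f₁ f₂ f₃ : ℕ) : Config where
  q w :=
    match w with
    | (.x, k) => x.testBit k
    | (.c, k) => c.testBit k
    | (.y, k) => y.testBit k
    | (.c', k) => c'.testBit k
    | (.z, k) => z.testBit k
    | (.flag₁, k) => f₁.testBit k
    | (.flag₂, k) => f₂.testBit k
    | (.flag₃, k) => f₃.testBit k
    | (.work, _) => false
  r _ := 0

/-- The pure state `|x, c, y, c', z⟩ |f₁⟩ |f₂⟩ |f₃⟩`. -/
def ketState (x c y c' z f₁ f₂ f₃ : ℕ) : State := Finsupp.single (ket x c y c' z f₁ f₂ f₃) 1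

/-- The state `|S|^(-1/2) ∑ i ∈ S, F i`, or `F bot` if `S` is empty. -/
def superpose (S : Finset ℕ) (bot : ℕ) (F : ℕ → State) : State :=
  if S = ∅ then F bot else ∑ i ∈ S, ((1 / Real.sqrt S.card : ℝ) : ℂ) • F i

/-- The flag obtained from `f` by XORing the truth value of `E`. -/
def toggle (f : ℕ) (E : Prop) [Decidable E] : ℕ := (f + if E then 1 else 0) % 2

/-- Amplitude amplification `AA_r(samp, check)` with `r = ph.length` rounds. Each round multiplies
the marked part (as decided by `check` through the flag qubit) by a phase, and then reflects with a
phase about the state prepared by `samp`; finally `check` writes the flag. The lists of phases are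
a parameter, as in fixed-point amplitude amplification. The registers in `ctrl` only control `samp`
and `check`. -/
def ampAmp (samp check : Circuit) (flag : QWire) (ctrl : Finset Reg) (ph : List (ℝ × ℝ)) :
    Circuit :=
  samp ++
    ph.flatMap (fun p =>
      check ++ [Gate.phase p.1 flag] ++ Circuit.inverse check ++
      Circuit.inverse samp ++
      [Gate.zeroPhase p.2 ((Circuit.qubits samp).filter fun w => w.1 ∉ ctrl)
        (Circuit.reals samp)] ++
      samp) ++
    check

/-- Circuits for the basic operations of the search phase. -/
structure Subroutines : Type where
  rCollisionSamp : Circuit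
  rCollisionCheck : Circuit
  dec : Circuit
  zSamp : Circuit
  zCheck : Circuit

/-- `TupleSamp`. -/
def tupleSamp (A : Subroutines) (ph₁ ph₂ : List (ℝ × ℝ)) : Circuit :=
  ampAmp A.rCollisionSamp A.rCollisionCheck (.flag₁, 0) ∅ ph₁ ++
  A.dec ++
  ampAmp A.zSamp A.zCheck (.flag₂, 0) {.x, .c, .y, .c'} ph₂

/-- `SolutionSearch` up to its final measurement; its numbers of rounds `r₁, r₂, r₃` are the lengths
of the lists of phases. -/
def solutionSearch (A : Subroutines) (ph₁ ph₂ ph₃ : List (ℝ × ℝ)) : Circuit :=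
  ampAmp (tupleSamp A ph₁ ph₂) [Gate.cnot (.flag₂, 0) (.flag₃, 0) (by decide)] (.flag₃, 0) ∅ ph₃

open Classical in
/-- The circuits in `A` implement the basic operations, for the list `L`, the centers `C`, `C'` and
the given contents of the QCRAM. -/
structure Subroutines.Implements {d : ℕ} (A : Subroutines) (mem : Memory) (θ θ' α α' : ℝ)
    (L C C' : Finset (Vec d)) : Prop where
  /-- the superposition over `x`, then `c ∈ R(x)`, then `y ∈ R⁻¹(c)` -/
  rCollisionSamp :
    Circuit.run mem A.rCollisionSamp (ketState 0 0 0 0 0 0 0 0) =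
      superpose (Finset.range L.card) 0 fun x =>
      superpose (nbrIdx α C (vecAt L x)) C.card fun c =>
      superpose (bucketIdx α L C c) L.card fun y =>
        ketState x c y 0 0 0 0 0
  /-- the check whether `y ≠ ⊥` and `⟪x, y⟫ ≈ cos θ` -/
  rCollisionCheck : ∀ x < L.card, ∀ c ≤ C.card, ∀ y ≤ L.card, ∀ f₁ < 2,
    Circuit.run mem A.rCollisionCheck (ketState x c y 0 0 f₁ 0 0) =
      ketState x c y 0 0
        (toggle f₁ (y < L.card ∧ Near d (inner ℝ (vecAt L x) (vecAt L y)) (Real.cos θ))) 0 0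
  /-- the superposition over `R'(u)`, truncated to `2^(d / log d)` elements, for the normalized
  difference `u` of `x` and `y` -/
  dec : ∃ tr : Vec d → Finset ℕ,
    (∀ u, tr u ⊆ nbrIdx α' C' u ∧ (tr u).card = min (nbrIdx α' C' u).card ⌊trunc d⌋₊) ∧
    ∀ x < L.card, ∀ c < C.card, ∀ y < L.card, ∀ f₁ < 2,
      Circuit.run mem A.dec (ketState x c y 0 0 f₁ 0 0) =
        superpose (tr (udiff (vecAt L x) (vecAt L y))) C'.card fun c' => ketState x c y c' 0 f₁ 0 0
  /-- the superposition over the `z ∈ L` with `c' ∈ R'(z)` -/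
  zSamp : ∀ x < L.card, ∀ c < C.card, ∀ y < L.card, ∀ c' ≤ C'.card, ∀ f₁ < 2,
    Circuit.run mem A.zSamp (ketState x c y c' 0 f₁ 0 0) =
      superpose (bucketIdx α' L C' c') L.card fun z => ketState x c y c' z f₁ 0 0
  /-- the check whether `z ≠ ⊥` and `⟪u, z⟫ ≈ cos θ'` -/
  zCheck : ∀ x < L.card, ∀ c < C.card, ∀ y < L.card, ∀ c' ≤ C'.card, ∀ z ≤ L.card,
    ∀ f₁ < 2, ∀ f₂ < 2,
    Circuit.run mem A.zCheck (ketState x c y c' z f₁ f₂ 0) =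
      ketState x c y c' z f₁
        (toggle f₂ (z < L.card ∧
          Near d (inner ℝ (udiff (vecAt L x) (vecAt L y)) (vecAt L z)) (Real.cos θ'))) 0

/-- Register `ρ` of `s` holds the number `v`. -/
def Config.Holds (s : Config) (ρ : Reg) (v : ℕ) : Prop := ∀ k, s.q (ρ, k) = v.testBit k

/-- The measured basis state `s` shows the triple `t` of elements of `L`. -/
def Config.Outputs {d : ℕ} (s : Config) (L : Finset (Vec d)) (t : Vec d × Vec d × Vec d) : Prop :=
  ∃ x < L.card, ∃ y < L.card, ∃ z < L.card,
    s.Holds .x x ∧ s.Holds .y y ∧ s.Holds .z z ∧ t = (vecAt L x, vecAt L y, vecAt L z)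

open Classical in
/-- The probability that `ℓ` independent runs of `SolutionSearch` miss some element of `T`. -/
def missProb {d : ℕ} (S : Circuit) (mem : Memory) (L : Finset (Vec d))
    (T : Finset (Vec d × Vec d × Vec d)) (ℓ : ℕ) : ℝ :=
  runsProb (Circuit.run mem S (ketState 0 0 0 0 0 0 0 0)) ℓ
    fun o => ∃ t ∈ T, ∀ i, ¬ (o i).Outputs L t

/-- The cost bound for `SolutionSearch`, without the subexponential factor. -/
def searchCost (d m : ℕ) (θ θ' α α' : ℝ) : ℝ :=
  1 / Real.sqrt (min 1 (m * wedgeRatio d θ' α' α')) *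
    (Real.sqrt (capP d α / wedgeRatio d θ α α) + Real.sqrt (m * capP d α'))

end TupleSieve

end

noncomputable section

namespace TupleSieve

section

/-! ## Linearity and unitarity of circuits -/

/-! The proof has three ingredients: an exact description of nested amplitude amplification, an
explicit construction of circuits for the basic operations, and a counting argument on good inputs.

Amplification. Every gate is unitary and its formal inverse is its adjoint, so a circuit preserves
inner products. If the sampler prepares `good + bad` with orthogonal parts, all rounds stay in the
span of these two vectors, and the two coefficients obey a scalar recursion (`aaRun`) that depends
only on the phases and on p, the weight of `good` (`ampAmp_run`). The second and third levels use
ordinary Grover rounds. Their number is computed from an upper bound P on p that depends on the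
sizes alone, so there is no overshooting and probabilities grow by at least 1/(36P)
(`grover_rounds`). The first level then also applies the π/3 fixed-point recursion, each step of
which cubes the failure probability (`cubePhases_snd`). This is needed because the later circuits
run on the failed branch too, where their effect is not controlled. The failed branch must weigh
less than the possibly tiny success probability at the third level, and 1/(2σm²) is small enough
(`Balanced.min_ge`). Here and below, σ = 2^|s| is the slack of the goodness conditions, τ the
truncation threshold, and primes refer to the second code.

Circuits. A small calculus of straight-line computations (`Step`, `Comp`) is compiled once into
compute, use, uncompute circuits. A uniform superposition over a set of integers is prepared digit
by digit from its rank function (`exists_prepare`), and the rank function of a stored sorted array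
is found by binary search (`rankComp_array`). For the product code the neighbours of u are not
stored; they are found block by block. The partial sums of codewords are sorted into cells of width
`tol d` by their inner product with u. In every cell only the T least and the T largest are kept,
where T is the truncation threshold rounded down. If a partial sum that has a valid completion is
dropped, T kept entries on the favourable side have a valid completion as well, so min(T, number of
neighbours) codewords survive (`completions_step`, `ProductCode.le_card_candidates`). There are
subexponentially many rotations and words per block, so decoding takes subexponential time.

Counting. An outcome (x,c,y,c',z) has an explicit amplitude. Weighting outcomes by the reciprocals
of |R(x)| and of the truncated |R'(u)| makes the total weight above one pair or triple at most one
(`sum_inv_card_le`). Goodness then bounds the success probabilities of all three levels from above,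
while a triple of 𝒯* has, by the two truncation conditions, at least one outcome of large amplitude.
Multiplying the gains, each such triple is measured with probability at least `minProb`, which is
1/|𝒯*| up to a subexponential factor (`Balanced.output_prob`). A union bound over at most m³ triples
finishes the probability estimate (`missProb_le`).

Cost. The numbers of rounds combine as r₃(r₁+r₂), each subroutine is subexponential, and the rounds
reuse the same wires (`Balanced.rounds_cost`, `width_solutionSearch_le`). All subexponential factors
are collected in `costFactor`, whose logarithm is the o(d) of the conclusion. -/

/-- Action of a gate as a linear map. -/
def Gate.lin (mem : Memory) (g : Gate) : State →ₗ[ℂ] State :=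
  Finsupp.linearCombination ℂ (g.act mem)

theorem Gate.apply_single (mem : Memory) (g : Gate) (s : Config) (a : ℂ) :
    g.apply mem (Finsupp.single s a) = a • g.act mem s :=
  Finsupp.linearCombination_single ℂ a s

/-- Action of a circuit as a linear map. -/
def Circuit.lin (mem : Memory) : Circuit → State →ₗ[ℂ] State
  | [] => LinearMap.id
  | g :: l => (Circuit.lin mem l).comp (g.lin mem)

theorem Circuit.run_eq_lin (mem : Memory) (S : Circuit) (ψ : State) :
    Circuit.run mem S ψ = Circuit.lin mem S ψ := by
  induction S generalizing ψ with
  | nil => rfl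
  | cons g l ih => exact ih _

theorem Circuit.run_append (mem : Memory) (S T : Circuit) (ψ : State) :
    Circuit.run mem (S ++ T) ψ = Circuit.run mem T (Circuit.run mem S ψ) := by
  induction S generalizing ψ with
  | nil => rfl
  | cons g l ih => exact ih _

theorem Circuit.run_cons (mem : Memory) (g : Gate) (T : Circuit) (ψ : State) :
    Circuit.run mem (g :: T) ψ = Circuit.run mem T (g.apply mem ψ) := rfl

theorem Circuit.run_nil (mem : Memory) (ψ : State) : Circuit.run mem [] ψ = ψ := rfl

theorem Circuit.run_add (mem : Memory) (S : Circuit) (φ ψ : State) :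
    Circuit.run mem S (φ + ψ) = Circuit.run mem S φ + Circuit.run mem S ψ := by
  simp only [Circuit.run_eq_lin, map_add]

theorem Circuit.run_smul (mem : Memory) (S : Circuit) (a : ℂ) (ψ : State) :
    Circuit.run mem S (a • ψ) = a • Circuit.run mem S ψ := by
  simp only [Circuit.run_eq_lin, map_smul]

theorem Circuit.run_sum {ι : Type*} (mem : Memory) (S : Circuit) (I : Finset ι) (f : ι → State) :
    Circuit.run mem S (∑ i ∈ I, f i) = ∑ i ∈ I, Circuit.run mem S (f i) := by
  simp only [Circuit.run_eq_lin, map_sum]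

theorem Config.setQ_setQ (s : Config) (t : QWire) (u v : Bool) :
    (s.setQ t u).setQ t v = s.setQ t v := by
  simp [Config.setQ]

theorem Config.setQ_self (s : Config) (t : QWire) : s.setQ t (s.q t) = s := by
  simp [Config.setQ]

theorem Config.setQ_q_self (s : Config) (t : QWire) (v : Bool) : (s.setQ t v).q t = v := by
  simp [Config.setQ]

theorem Config.setQ_q_ne (s : Config) {t w : QWire} (v : Bool) (h : w ≠ t) :
    (s.setQ t v).q w = s.q w := by
  simp [Config.setQ, h]

theorem Config.setQ_r (s : Config) (t : QWire) (v : Bool) : (s.setQ t v).r = s.r := rfl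

theorem Config.addR_q (s : Config) (inv : Bool) (k : ℕ) (v : ℝ) : (s.addR inv k v).q = s.q := rfl

theorem Config.addR_r_ne (s : Config) (inv : Bool) {k i : ℕ} (v : ℝ) (h : i ≠ k) :
    (s.addR inv k v).r i = s.r i := by
  simp [Config.addR, h]

theorem Config.addR_addR_not (s : Config) (inv : Bool) (k : ℕ) (v : ℝ) :
    (s.addR inv k v).addR (!inv) k v = s := by
  cases inv <;> simp [Config.addR]

theorem Config.address_congr {s s' : Config} {l : List QWire} (h : ∀ w ∈ l, s.q w = s'.q w) :
    s.address l = s'.address l := by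
  induction l with
  | nil => rfl
  | cons w l ih =>
    simp only [Config.address]
    rw [h w (by simp), ih fun w hw => h w (by simp [hw])]

theorem Config.address_addR (s : Config) (inv : Bool) (k : ℕ) (v : ℝ) (l : List QWire) :
    (s.addR inv k v).address l = s.address l :=
  Config.address_congr fun _ _ => rfl

theorem Config.address_setQ (s : Config) {t : QWire} (v : Bool) {l : List QWire} (h : t ∉ l) :
    (s.setQ t v).address l = s.address l :=
  Config.address_congr fun w hw => s.setQ_q_ne v (by rintro rfl; exact h hw)

theorem Config.setQ_xor_xor (s : Config) (t : QWire) (b : Bool) :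
    (s.setQ t (s.q t ^^ b)).setQ t ((s.setQ t (s.q t ^^ b)).q t ^^ b) = s := by
  rw [Config.setQ_setQ, Config.setQ_q_self, Bool.xor_assoc, Bool.xor_self, Bool.xor_false,
    Config.setQ_self]

open Classical in
/-- The action on basis states of the gates that permute the basis states. -/
def Gate.cact (mem : Memory) : Gate → Config → Config
  | .cnot a t _, s => s.setQ t (s.q t ^^ s.q a)
  | .toffoli a b t _ _, s => s.setQ t (s.q t ^^ (s.q a && s.q b))
  | .const inv v k, s => s.addR inv k v
  | .ofQubit inv a k, s => s.addR inv k (if s.q a = true then 1 else 0)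
  | .arith inv op i j k _ _, s => s.addR inv k (op.eval (s.r i) (s.r j))
  | .compare i j t, s => s.setQ t (s.q t ^^ decide (s.r i ≤ s.r j))
  | .queryBit A a₁ a₂ a₃ t _, s =>
      s.setQ t (s.q t ^^ mem.bit A (s.address a₁) (s.address a₂) (s.address a₃))
  | .queryReal inv A a₁ a₂ a₃ k, s =>
      s.addR inv k (mem.real A (s.address a₁) (s.address a₂) (s.address a₃))
  | _, s => s

/-- Whether a gate permutes the basis states. -/
def Gate.IsClassical : Gate → Prop
  | .cnot _ _ _ | .toffoli _ _ _ _ _ | .const _ _ _ | .ofQubit _ _ _ | .arith _ _ _ _ _ _ _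
  | .compare _ _ _ | .queryBit _ _ _ _ _ _ | .queryReal _ _ _ _ _ _ => True
  | _ => False

theorem Gate.act_of_isClassical (mem : Memory) {g : Gate} (hg : g.IsClassical) (s : Config) :
    g.act mem s = Finsupp.single (g.cact mem s) 1 := by
  cases g <;> first | rfl | exact hg.elim

theorem Gate.IsClassical.inverse {g : Gate} (hg : g.IsClassical) : g.inverse.IsClassical := by
  cases g <;> first | exact trivial | exact hg.elim

theorem Gate.inverse_inverse (g : Gate) : g.inverse.inverse = g := by
  cases g <;> simp [Gate.inverse]

/-- A classical gate XORs or adds a value read from wires other than its target. That value is the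
same before and after the gate, so the inverse gate removes exactly what was written. The
nonclassical gates have identity action here. -/
theorem Gate.cact_inverse_cact (mem : Memory) (g : Gate) (s : Config) :
    g.inverse.cact mem (g.cact mem s) = s := by
  cases g with
  | cnot a t h =>
    simp only [Gate.inverse, Gate.cact]
    rw [s.setQ_q_ne _ h, Config.setQ_xor_xor]
  | toffoli a b t ha hb =>
    simp only [Gate.inverse, Gate.cact]
    rw [s.setQ_q_ne _ ha, s.setQ_q_ne _ hb, Config.setQ_xor_xor]
  | const inv v k => exact s.addR_addR_not ..
  | ofQubit inv a k => exact s.addR_addR_not ..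
  | arith inv op i j k hi hj =>
    simp only [Gate.inverse, Gate.cact]
    rw [s.addR_r_ne _ _ hi, s.addR_r_ne _ _ hj, Config.addR_addR_not]
  | compare i j t =>
    simp only [Gate.inverse, Gate.cact, Config.setQ_r]
    exact Config.setQ_xor_xor ..
  | queryBit A a₁ a₂ a₃ t h =>
    simp only [List.mem_append, not_or] at h
    simp only [Gate.inverse, Gate.cact]
    rw [s.address_setQ _ h.1.1, s.address_setQ _ h.1.2, s.address_setQ _ h.2,
      Config.setQ_xor_xor]
  | queryReal inv A a₁ a₂ a₃ k =>
    simp only [Gate.inverse, Gate.cact, Config.address_addR, Config.addR_addR_not]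
  | _ => rfl

theorem Gate.cact_cact_inverse (mem : Memory) (g : Gate) (s : Config) :
    g.cact mem (g.inverse.cact mem s) = s := by
  have := g.inverse.cact_inverse_cact mem s
  rwa [Gate.inverse_inverse] at this

theorem rotEntry_not (inv : Bool) (p : ℝ) (u v : Bool) :
    rotEntry (!inv) p u v = rotEntry inv p v u := by
  cases inv <;> cases u <;> cases v <;> simp [rotEntry]

/-- For `p` outside [0,1] the rotation is defined to be the identity, so invertibility holds
whatever the register contains. -/
theorem rotEntry_inverse (inv : Bool) (p : ℝ) (w u : Bool) :
    ∑ v : Bool, rotEntry inv p v u * rotEntry (!inv) p w v = if w = u then 1 else 0 := by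
  by_cases hp : 0 ≤ p ∧ p ≤ 1
  · have h1 := Real.mul_self_sqrt hp.1
    have h2 := Real.mul_self_sqrt (sub_nonneg.2 hp.2)
    cases inv <;> cases w <;> cases u <;> simp [rotEntry, hp.1, hp.2] <;> nlinarith
  · cases inv <;> cases w <;> cases u <;> simp [rotEntry, hp]

theorem sum_setQ_apply (s s' : Config) (t : QWire) (M : Bool → ℂ)
    [Decidable (s.setQ t (s'.q t) = s')] : (∑ v : Bool, (Finsupp.single (s.setQ t v) (M v) : State)) s' =
      if s.setQ t (s'.q t) = s' then M (s'.q t) else 0 := by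
  classical
  rw [Finsupp.finsetSum_apply]
  have key : ∀ v : Bool, v ≠ s'.q t → (Finsupp.single (s.setQ t v) (M v) : State) s' = 0 := by
    intro v hv
    rw [Finsupp.single_apply, if_neg]
    rintro rfl
    exact hv (by rw [Config.setQ_q_self])
  rw [Finset.sum_eq_single (s'.q t) (fun v _ hv => key v hv) (by simp), Finsupp.single_apply]

theorem setQ_eq_comm {s s' : Config} {t : QWire} :
    s.setQ t (s'.q t) = s' ↔ s'.setQ t (s.q t) = s := by
  constructor <;> intro h <;> rw [← h] <;> simp [Config.setQ_setQ, Config.setQ_self]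

/-- The inverse gate is the adjoint, entry by entry: permutations have transposed 0/1 matrices,
phases are conjugated, and the two one-qubit families have conjugate transposed 2×2 blocks. This is
what makes circuits isometries. -/
theorem Gate.act_apply_conj (mem : Memory) (g : Gate) (s s' : Config) :
    g.act mem s s' = star (g.inverse.act mem s' s) := by
  classical
  by_cases hg : g.IsClassical
  · rw [Gate.act_of_isClassical mem hg, Gate.act_of_isClassical mem hg.inverse,
      Finsupp.single_apply, Finsupp.single_apply]
    have : g.cact mem s = s' ↔ g.inverse.cact mem s' = s := by
      constructor
      · rintro rfl; exact g.cact_inverse_cact mem s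
      · rintro rfl; exact g.cact_cact_inverse mem s'
    simp only [this]
    split_ifs <;> simp
  · cases g with
    | unitary U t =>
      simp only [Gate.act, Gate.inverse]
      rw [sum_setQ_apply s s' t (fun v => (U : Matrix Bool Bool ℂ) v (s.q t)),
        sum_setQ_apply s' s t (fun v => ((U⁻¹ : Matrix.unitaryGroup Bool ℂ) : Matrix Bool Bool ℂ) v (s'.q t))]
      simp only [setQ_eq_comm (s := s) (s' := s')]
      split_ifs
      · change _ = star (star (U : Matrix Bool Bool ℂ) _ _)
        rw [Matrix.star_apply, star_star]
      · simp
    | phase φ t =>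
      simp only [Gate.act, Gate.inverse, Finsupp.single_apply]
      by_cases h : s = s'
      · subst h
        simp only [if_true]
        split_ifs
        · simp [← Complex.exp_conj]
        · simp
      · simp [h, Ne.symm h]
    | zeroPhase φ Q S =>
      simp only [Gate.act, Gate.inverse, Finsupp.single_apply]
      by_cases h : s = s'
      · subst h
        simp only [if_true]
        split_ifs
        · simp [← Complex.exp_conj]
        · simp
      · simp [h, Ne.symm h]
    | rotate inv i t =>
      simp only [Gate.act, Gate.inverse]
      rw [sum_setQ_apply s s' t (fun v => ((rotEntry inv (s.r i) v (s.q t) : ℝ) : ℂ)),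
        sum_setQ_apply s' s t (fun v => ((rotEntry (!inv) (s'.r i) v (s'.q t) : ℝ) : ℂ))]
      rw [setQ_eq_comm (s := s) (s' := s')]
      split_ifs with h
      · have : s.r = s'.r := by rw [← h]; rfl
        rw [rotEntry_not, this]; simp
      · simp
    | _ => exact absurd trivial hg

theorem Gate.apply_inverse_act (mem : Memory) (g : Gate) (s : Config) :
    g.inverse.apply mem (g.act mem s) = Finsupp.single s 1 := by
  by_cases hg : g.IsClassical
  · rw [Gate.act_of_isClassical mem hg, Gate.apply_single, one_smul,
      Gate.act_of_isClassical mem hg.inverse, Gate.cact_inverse_cact]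
  -- Unitaries and rotations are handled together: both act by a 2×2 matrix on one qubit, and it
  -- suffices that the two matrices multiply to the identity.
  · have two : ∀ (t : QWire) (M : Bool → ℂ) (M' : Bool → Bool → ℂ) (h : Gate),
        (∀ v, h.act mem (s.setQ t v) = ∑ w : Bool, Finsupp.single (s.setQ t w) (M' w v)) →
        (∀ w, ∑ v : Bool, M v * M' w v = if w = s.q t then 1 else 0) →
        h.apply mem (∑ v : Bool, Finsupp.single (s.setQ t v) (M v)) = Finsupp.single s 1 := by
      intro t M M' h hh hM
      have : h.apply mem (∑ v : Bool, Finsupp.single (s.setQ t v) (M v)) =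
          ∑ v : Bool, M v • ∑ w : Bool, (Finsupp.single (s.setQ t w) (M' w v) : State) := by
        change h.lin mem _ = _
        rw [map_sum]
        exact Finset.sum_congr rfl fun v _ => by
          change h.apply mem _ = _
          rw [Gate.apply_single, hh]
      rw [this]
      simp only [Finset.smul_sum, Finsupp.smul_single, smul_eq_mul]
      rw [Finset.sum_comm]
      simp only [← Finsupp.single_finsetSum, hM]
      rw [Finset.sum_eq_single (s.q t)]
      · simp [Config.setQ_self]
      · intro b _ hb; simp [hb]
      · simp
    cases g with
    | unitary U t =>
      apply two t (fun v => (U : Matrix Bool Bool ℂ) v (s.q t))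
        (fun w v => ((U⁻¹ : Matrix.unitaryGroup Bool ℂ) : Matrix Bool Bool ℂ) w v)
      · intro v
        simp only [Gate.inverse, Gate.act, Config.setQ_setQ, Config.setQ_q_self]
      · intro w
        have h : (((U⁻¹ * U : Matrix.unitaryGroup Bool ℂ)) : Matrix Bool Bool ℂ) w (s.q t) =
          if w = s.q t then 1 else 0 := by
          rw [inv_mul_cancel]; exact Matrix.one_apply
        rw [← h]
        change _ = ((U⁻¹ : Matrix.unitaryGroup Bool ℂ) * (U : Matrix Bool Bool ℂ) : Matrix Bool Bool ℂ) w _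
        rw [Matrix.mul_apply]
        exact Finset.sum_congr rfl fun v _ => mul_comm _ _
    | phase φ t =>
      simp only [Gate.act, Gate.inverse, Gate.apply_single, Finsupp.smul_single, smul_eq_mul]
      congr 1
      split_ifs
      · rw [← Complex.exp_add]; simp
      · simp
    | zeroPhase φ Q S =>
      simp only [Gate.act, Gate.inverse, Gate.apply_single, Finsupp.smul_single, smul_eq_mul]
      congr 1
      split_ifs
      · rw [← Complex.exp_add]; simp
      · simp
    | rotate inv i t =>
      apply two t (fun v => ((rotEntry inv (s.r i) v (s.q t) : ℝ) : ℂ))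
        (fun w v => ((rotEntry (!inv) (s.r i) w v : ℝ) : ℂ))
      · intro v
        simp only [Gate.inverse, Gate.act, Config.setQ_setQ, Config.setQ_q_self, Config.setQ_r]
      · intro w
        have := rotEntry_inverse inv (s.r i) w (s.q t)
        have h2 := congrArg (fun x : ℝ => (x : ℂ)) this
        push_cast at h2
        rw [h2]
        split_ifs <;> simp
    | _ => exact absurd trivial hg

theorem Gate.lin_inverse_lin (mem : Memory) (g : Gate) (ψ : State) :
    g.inverse.apply mem (g.apply mem ψ) = ψ := by
  change ((g.inverse.lin mem).comp (g.lin mem) : State →ₗ[ℂ] State) ψ =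
    (LinearMap.id : State →ₗ[ℂ] State) ψ
  congr 1
  refine Finsupp.lhom_ext' fun s => LinearMap.ext_ring ?_
  change g.inverse.apply mem (g.apply mem (Finsupp.single s 1)) = Finsupp.single s 1
  rw [Gate.apply_single, one_smul, Gate.apply_inverse_act]

theorem Circuit.inverse_cons (g : Gate) (S : Circuit) :
    Circuit.inverse (g :: S) = Circuit.inverse S ++ [g.inverse] := by
  simp [Circuit.inverse]

theorem Circuit.inverse_inverse (S : Circuit) : Circuit.inverse (Circuit.inverse S) = S := by
  simp only [Circuit.inverse, List.map_reverse, List.reverse_reverse, List.map_map]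
  conv_rhs => rw [← List.map_id S]
  exact List.map_congr_left fun g _ => g.inverse_inverse

theorem Circuit.run_inverse_run (mem : Memory) (S : Circuit) (ψ : State) :
    Circuit.run mem (Circuit.inverse S) (Circuit.run mem S ψ) = ψ := by
  induction S generalizing ψ with
  | nil => rfl
  | cons g S ih =>
    rw [Circuit.inverse_cons, Circuit.run_append, Circuit.run_cons mem g S, ih]
    exact g.lin_inverse_lin mem ψ

/-! ### Inner products and unitarity -/

/-- The inner product of two states. -/
def ip (φ ψ : State) : ℂ := φ.sum fun s a => star a * ψ s

theorem ip_add_left (φ φ' ψ : State) : ip (φ + φ') ψ = ip φ ψ + ip φ' ψ := by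
  classical
  exact Finsupp.sum_add_index' (by simp) (by intros; simp [add_mul])

theorem ip_add_right (φ ψ ψ' : State) : ip φ (ψ + ψ') = ip φ ψ + ip φ ψ' := by
  simp [ip, mul_add, Finsupp.sum_add]

theorem ip_smul_right (φ ψ : State) (a : ℂ) : ip φ (a • ψ) = a * ip φ ψ := by
  simp only [ip, Finsupp.smul_apply, smul_eq_mul, Finsupp.mul_sum]
  exact Finsupp.sum_congr fun s _ => by ring

theorem ip_smul_left (φ ψ : State) (a : ℂ) : ip (a • φ) ψ = star a * ip φ ψ := by
  rw [ip, Finsupp.sum_smul_index' (by simp), ip, Finsupp.mul_sum]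
  exact Finsupp.sum_congr fun s _ => by simp [mul_assoc]

theorem ip_single_left (s : Config) (ψ : State) : ip (Finsupp.single s 1) ψ = ψ s := by
  simp [ip]

theorem ip_zero_left (ψ : State) : ip 0 ψ = 0 := by simp [ip]

theorem ip_zero_right (ψ : State) : ip ψ 0 = 0 := by simp [ip]

theorem ip_single_right (φ : State) (s : Config) : ip φ (Finsupp.single s 1) = star (φ s) := by
  classical
  rw [ip, Finsupp.sum, Finset.sum_eq_single s]
  · simp
  · intro b _ hb; simp [hb.symm]
  · intro h; simp [Finsupp.notMem_support_iff.1 h]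

/-- By sesquilinearity only basis states matter, and there the claim is the identity of matrix
entries `Gate.act_apply_conj`. -/
theorem Gate.ip_apply (mem : Memory) (g : Gate) (φ ψ : State) :
    ip φ (g.apply mem ψ) = ip (g.inverse.apply mem φ) ψ := by
  have lin_add : ∀ (h : Gate) (a b : State), h.apply mem (a + b) = h.apply mem a + h.apply mem b :=
    fun h a b => map_add (h.lin mem) a b
  have lin_zero : ∀ h : Gate, h.apply mem 0 = 0 := fun h => map_zero (h.lin mem)
  induction ψ using Finsupp.induction_linear with
  | zero => rw [lin_zero, ip_zero_right, ip_zero_right]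
  | add a b ha hb => rw [lin_add, ip_add_right, ip_add_right, ha, hb]
  | single s c =>
    induction φ using Finsupp.induction_linear with
    | zero => rw [lin_zero, ip_zero_left, ip_zero_left]
    | add a b ha hb => rw [lin_add, ip_add_left, ip_add_left, ha, hb]
    | single s' c' =>
      have e : ∀ (x : Config) (z : ℂ), (Finsupp.single x z : State) = z • Finsupp.single x 1 := by
        intro x z; simp
      have ls : ∀ (h : Gate) (z : ℂ) (a : State), h.apply mem (z • a) = z • h.apply mem a :=
        fun h z a => map_smul (h.lin mem) z a
      rw [e s c, e s' c', ls, ls, ip_smul_left, ip_smul_left, ip_smul_right, ip_smul_right,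
        Gate.apply_single, Gate.apply_single, one_smul, one_smul, ip_single_left, ip_single_right,
        Gate.act_apply_conj]

theorem Circuit.ip_run (mem : Memory) (S : Circuit) (φ ψ : State) :
    ip φ (Circuit.run mem S ψ) = ip (Circuit.run mem (Circuit.inverse S) φ) ψ := by
  induction S generalizing ψ with
  | nil => rfl
  | cons g S ih =>
    rw [Circuit.run_cons, ih, Gate.ip_apply, Circuit.inverse_cons, Circuit.run_append]
    rfl

theorem Circuit.ip_run_run (mem : Memory) (S : Circuit) (φ ψ : State) :
    ip (Circuit.run mem S φ) (Circuit.run mem S ψ) = ip φ ψ := by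
  rw [Circuit.ip_run, Circuit.run_inverse_run]

/-- The squared norm of a state. -/
def nsq (ψ : State) : ℝ := ∑ s ∈ ψ.support, ‖ψ s‖ ^ 2

theorem ip_self (ψ : State) : ip ψ ψ = (nsq ψ : ℂ) := by
  rw [ip, Finsupp.sum, nsq, Complex.ofReal_sum]
  refine Finset.sum_congr rfl fun s _ => ?_
  rw [Complex.star_def, Complex.conj_mul', Complex.ofReal_pow]

theorem nsq_nonneg (ψ : State) : 0 ≤ nsq ψ := Finset.sum_nonneg fun _ _ => by positivity

theorem Circuit.nsq_run (mem : Memory) (S : Circuit) (ψ : State) :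
    nsq (Circuit.run mem S ψ) = nsq ψ := by
  have := Circuit.ip_run_run mem S ψ ψ
  rw [ip_self, ip_self] at this
  exact_mod_cast this

theorem nsq_eq_sum {ψ : State} {A : Finset Config} (h : ψ.support ⊆ A) :
    nsq ψ = ∑ s ∈ A, ‖ψ s‖ ^ 2 :=
  Finset.sum_subset h fun s _ hs => by simp [Finsupp.notMem_support_iff.1 hs]

theorem nsq_smul (a : ℂ) (ψ : State) : nsq (a • ψ) = ‖a‖ ^ 2 * nsq ψ := by
  have h : ip (a • ψ) (a • ψ) = ((‖a‖ ^ 2 * nsq ψ : ℝ) : ℂ) := by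
    rw [ip_smul_left, ip_smul_right, ip_self, ← mul_assoc, Complex.star_def, Complex.conj_mul']
    push_cast; ring
  rw [ip_self] at h
  exact_mod_cast h

theorem nsq_single (s : Config) (a : ℂ) : nsq (Finsupp.single s a) = ‖a‖ ^ 2 := by
  classical
  rw [nsq_eq_sum (A := {s}) Finsupp.support_single_subset]
  simp

theorem normSq_apply_le (ψ : State) (s : Config) : ‖ψ s‖ ^ 2 ≤ nsq ψ := by
  classical
  rw [nsq_eq_sum (A := insert s ψ.support) (Finset.subset_insert _ _)]
  exact Finset.single_le_sum (f := fun s => ‖ψ s‖ ^ 2) (fun _ _ => by positivity)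
    (Finset.mem_insert_self _ _)

theorem ip_star (φ ψ : State) : star (ip φ ψ) = ip ψ φ := by
  classical
  have h1 : ip φ ψ = ∑ s ∈ φ.support ∪ ψ.support, star (φ s) * ψ s :=
    Finset.sum_subset Finset.subset_union_left
      fun s _ hs => by simp [Finsupp.notMem_support_iff.1 hs]
  have h2 : ip ψ φ = ∑ s ∈ φ.support ∪ ψ.support, star (ψ s) * φ s :=
    Finset.sum_subset Finset.subset_union_right
      fun s _ hs => by simp [Finsupp.notMem_support_iff.1 hs]
  rw [h1, h2, star_sum]
  exact Finset.sum_congr rfl fun s _ => by simp [mul_comm]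

theorem ip_eq_zero_of_disjoint {φ ψ : State} (h : ∀ s ∈ φ.support, s ∉ ψ.support) :
    ip φ ψ = 0 :=
  Finset.sum_eq_zero fun s hs => by simp [Finsupp.notMem_support_iff.1 (h s hs)]

theorem nsq_add_of_ip_eq_zero {φ ψ : State} (h : ip φ ψ = 0) :
    nsq (φ + ψ) = nsq φ + nsq ψ := by
  have h' : ip ψ φ = 0 := by rw [← ip_star, h, star_zero]
  have e : ip (φ + ψ) (φ + ψ) = ((nsq φ + nsq ψ : ℝ) : ℂ) := by
    rw [ip_add_left, ip_add_right, ip_add_right, h, h', ip_self, ip_self]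
    push_cast; ring
  rw [ip_self] at e
  exact_mod_cast e

end

section

/-! ## Registers changed by a circuit -/

/-- The qubits that a gate may change. -/
def Gate.targets : Gate → Finset QWire
  | .unitary _ t | .cnot _ t _ | .toffoli _ _ t _ _ | .compare _ _ t | .rotate _ _ t
  | .queryBit _ _ _ _ t _ => {t}
  | _ => ∅

theorem Gate.targets_subset_qubits (g : Gate) : g.targets ⊆ g.qubits := by
  cases g <;> simp [Gate.targets, Gate.qubits]

theorem Gate.targets_inverse (g : Gate) : g.inverse.targets = g.targets := by
  cases g <;> rfl

theorem Gate.qubits_inverse (g : Gate) : g.inverse.qubits = g.qubits := by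
  cases g <;> rfl

theorem Gate.reals_inverse (g : Gate) : g.inverse.reals = g.reals := by
  cases g <;> rfl

theorem Gate.cost_inverse (g : Gate) : g.inverse.cost = g.cost := by
  cases g <;> rfl

/-- The basis states `s` and `s'` agree outside the qubits `Q` and the real registers `R`. -/
def AgreeOff (Q : Set QWire) (R : Set ℕ) (s s' : Config) : Prop :=
  (∀ w ∉ Q, s'.q w = s.q w) ∧ ∀ k ∉ R, s'.r k = s.r k

/-- All basis states of `ψ` agree with `s` outside `Q` and `R`. -/
def Within (Q : Set QWire) (R : Set ℕ) (s : Config) (ψ : State) : Prop :=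
  ∀ s' ∈ ψ.support, AgreeOff Q R s s'

/-- The circuit changes only the qubits `Q` and uses only the real registers `R`. -/
def Circuit.Writes (Q : Set QWire) (R : Set ℕ) (S : Circuit) : Prop :=
  ∀ g ∈ S, (g.targets : Set QWire) ⊆ Q ∧ (g.reals : Set ℕ) ⊆ R

variable {Q : Set QWire} {R : Set ℕ}

theorem AgreeOff.refl (s : Config) : AgreeOff Q R s s := ⟨fun _ _ => rfl, fun _ _ => rfl⟩

theorem AgreeOff.trans {s s' s'' : Config} (h : AgreeOff Q R s s') (h' : AgreeOff Q R s' s'') :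
    AgreeOff Q R s s'' :=
  ⟨fun w hw => (h'.1 w hw).trans (h.1 w hw), fun k hk => (h'.2 k hk).trans (h.2 k hk)⟩

theorem Within.add {s : Config} {φ ψ : State} (hφ : Within Q R s φ) (hψ : Within Q R s ψ) :
    Within Q R s (φ + ψ) := by
  classical
  intro s' hs'
  rcases Finset.mem_union.1 (Finsupp.support_add hs') with h | h
  exacts [hφ s' h, hψ s' h]

theorem Within.smul {s : Config} {ψ : State} (a : ℂ) (hψ : Within Q R s ψ) :
    Within Q R s (a • ψ) := fun s' hs' => hψ s' (Finsupp.support_smul hs')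

theorem Within.single {s s' : Config} (a : ℂ) (h : AgreeOff Q R s s') :
    Within Q R s (Finsupp.single s' a) := by
  intro s'' hs''
  rw [Finset.mem_singleton.1 (Finsupp.support_single_subset hs'')]
  exact h

theorem Within.sum {ι : Type*} {s : Config} {I : Finset ι} {f : ι → State}
    (h : ∀ i ∈ I, Within Q R s (f i)) : Within Q R s (∑ i ∈ I, f i) := by
  classical
  induction I using Finset.induction_on with
  | empty => intro s' hs'; simp at hs'
  | insert i I hi ih =>
    rw [Finset.sum_insert hi]
    exact (h i (Finset.mem_insert_self ..)).add (ih fun j hj => h j (Finset.mem_insert_of_mem hj))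

theorem agreeOff_setQ {s : Config} {t : QWire} (ht : t ∈ Q) (v : Bool) :
    AgreeOff Q R s (s.setQ t v) :=
  ⟨fun w hw => s.setQ_q_ne v (by rintro rfl; exact hw ht), fun _ _ => rfl⟩

theorem agreeOff_addR {s : Config} {k : ℕ} (hk : k ∈ R) (inv : Bool) (v : ℝ) :
    AgreeOff Q R s (s.addR inv k v) :=
  ⟨fun _ _ => rfl, fun i hi => s.addR_r_ne inv v (by rintro rfl; exact hi hk)⟩

theorem Gate.within_act (mem : Memory) (g : Gate) (s : Config) (hQ : (g.targets : Set QWire) ⊆ Q)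
    (hR : (g.reals : Set ℕ) ⊆ R) : Within Q R s (g.act mem s) := by
  cases g with
  | unitary U t => exact Within.sum fun v _ => Within.single _ (agreeOff_setQ (hQ (by simp [targets])) v)
  | phase φ t => exact Within.single _ (AgreeOff.refl s)
  | cnot a t _ => exact Within.single _ (agreeOff_setQ (hQ (by simp [targets])) _)
  | toffoli a b t _ _ => exact Within.single _ (agreeOff_setQ (hQ (by simp [targets])) _)
  | zeroPhase φ Q S => exact Within.single _ (AgreeOff.refl s)
  | const inv v k => exact Within.single _ (agreeOff_addR (hR (by simp [Gate.reals])) _ _)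
  | ofQubit inv a k => exact Within.single _ (agreeOff_addR (hR (by simp [Gate.reals])) _ _)
  | arith inv op i j k _ _ =>
    exact Within.single _ (agreeOff_addR (hR (by simp [Gate.reals])) _ _)
  | compare i j t => exact Within.single _ (agreeOff_setQ (hQ (by simp [targets])) _)
  | rotate inv i t => exact Within.sum fun v _ => Within.single _ (agreeOff_setQ (hQ (by simp [targets])) v)
  | queryBit A a₁ a₂ a₃ t _ => exact Within.single _ (agreeOff_setQ (hQ (by simp [targets])) _)
  | queryReal inv A a₁ a₂ a₃ k =>
    exact Within.single _ (agreeOff_addR (hR (by simp [Gate.reals])) _ _)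

theorem Gate.apply_eq_sum (mem : Memory) (g : Gate) (ψ : State) :
    g.apply mem ψ = ∑ s ∈ ψ.support, ψ s • g.act mem s :=
  Finsupp.linearCombination_apply ℂ ψ

theorem Within.apply {s : Config} {ψ : State} (h : Within Q R s ψ) (mem : Memory) (g : Gate)
    (hQ : (g.targets : Set QWire) ⊆ Q) (hR : (g.reals : Set ℕ) ⊆ R) :
    Within Q R s (g.apply mem ψ) := by
  rw [Gate.apply_eq_sum]
  exact Within.sum fun s' hs' => Within.smul _ fun s'' hs'' =>
    (h s' hs').trans (g.within_act mem s' hQ hR s'' hs'')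

/-- This is used to recognise the start state after a sampler has been undone: among configurations
that agree off the sampler's own wires, having those wires zero singles out one configuration. -/
theorem Within.run {s : Config} {ψ : State} (h : Within Q R s ψ) (mem : Memory) {S : Circuit}
    (hS : Circuit.Writes Q R S) : Within Q R s (Circuit.run mem S ψ) := by
  induction S generalizing ψ with
  | nil => exact h
  | cons g S ih =>
    have hg := hS g (by simp)
    exact ih (h.apply mem g hg.1 hg.2) fun g' hg' => hS g' (by simp [hg'])

theorem Circuit.Writes.inverse {S : Circuit} (h : Circuit.Writes Q R S) :
    Circuit.Writes Q R (Circuit.inverse S) := by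
  intro g hg
  obtain ⟨g', hg', rfl⟩ : ∃ g' ∈ S, g'.inverse = g := by simpa [Circuit.inverse] using hg
  rw [Gate.targets_inverse, Gate.reals_inverse]
  exact h g' hg'

theorem Circuit.Writes.append {S T : Circuit} (hS : Circuit.Writes Q R S)
    (hT : Circuit.Writes Q R T) : Circuit.Writes Q R (S ++ T) := by
  intro g hg
  rcases List.mem_append.1 hg with h | h
  exacts [hS g h, hT g h]

theorem Circuit.Writes.mono {Q' : Set QWire} {R' : Set ℕ} {S : Circuit}
    (hS : Circuit.Writes Q R S) (hQ : Q ⊆ Q') (hR : R ⊆ R') : Circuit.Writes Q' R' S :=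
  fun g hg => ⟨(hS g hg).1.trans hQ, (hS g hg).2.trans hR⟩

theorem Circuit.qubits_cons (g : Gate) (S : Circuit) :
    Circuit.qubits (g :: S) = g.qubits ∪ Circuit.qubits S := rfl

theorem Circuit.reals_cons (g : Gate) (S : Circuit) :
    Circuit.reals (g :: S) = g.reals ∪ Circuit.reals S := rfl

theorem Circuit.mem_qubits {S : Circuit} {w : QWire} :
    w ∈ Circuit.qubits S ↔ ∃ g ∈ S, w ∈ g.qubits := by
  induction S with
  | nil => simp [Circuit.qubits]
  | cons g S ih => simp [Circuit.qubits_cons, ih]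

theorem Circuit.mem_reals {S : Circuit} {k : ℕ} :
    k ∈ Circuit.reals S ↔ ∃ g ∈ S, k ∈ g.reals := by
  induction S with
  | nil => simp [Circuit.reals]
  | cons g S ih => simp [Circuit.reals_cons, ih]

theorem Circuit.writes_self (S : Circuit) :
    Circuit.Writes (Circuit.qubits S) (Circuit.reals S) S := fun g hg =>
  ⟨fun _ hw => Circuit.mem_qubits.2 ⟨g, hg, g.targets_subset_qubits hw⟩,
    fun _ hk => Circuit.mem_reals.2 ⟨g, hg, hk⟩⟩

/-! ## Amplitude amplification -/

theorem Gate.apply_diag (mem : Memory) (g : Gate) (f : Config → ℂ)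
    (hf : ∀ s, g.act mem s = Finsupp.single s (f s)) (ψ : State) (s : Config) :
    g.apply mem ψ s = f s * ψ s := by
  classical
  rw [Gate.apply_eq_sum, Finsupp.finsetSum_apply]
  simp only [hf, Finsupp.smul_apply, smul_eq_mul]
  rw [Finset.sum_eq_single s]
  · rw [Finsupp.single_eq_same, mul_comm]
  · intro b _ hb; simp [hb.symm]
  · intro h; simp [Finsupp.notMem_support_iff.1 h]

theorem apply_phase_of_forall (mem : Memory) (φ : ℝ) (t : QWire) {ψ : State} {v : Bool}
    (h : ∀ s ∈ ψ.support, s.q t = v) :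
    (Gate.phase φ t).apply mem ψ = (if v then Complex.exp (φ * Complex.I) else 1) • ψ := by
  ext s
  rw [Gate.apply_diag mem _ (fun s => if s.q t = true then Complex.exp (φ * Complex.I) else 1)
    (fun s => rfl)]
  by_cases hs : s ∈ ψ.support
  · simp only [h s hs, Finsupp.smul_apply, smul_eq_mul]
  · simp only [Finsupp.smul_apply, Finsupp.notMem_support_iff.1 hs, mul_zero, smul_zero]

/-- Among the basis states of `ψ`, which differ from `ctx` only on `Q` and `S`, the only one with
all these wires zero is `ctx` itself. The conditional phase is therefore a rank-one modification of
the identity along `ctx`. -/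
theorem apply_zeroPhase_of_within (mem : Memory) (φ : ℝ) (Q : Finset QWire) (S : Finset ℕ)
    {ctx : Config} {ψ : State} (h : Within Q S ctx ψ) (hQ : ∀ w ∈ Q, ctx.q w = false)
    (hS : ∀ k ∈ S, ctx.r k = 0) :
    (Gate.zeroPhase φ Q S).apply mem ψ =
      ψ + ((Complex.exp (φ * Complex.I) - 1) * ψ ctx) • Finsupp.single ctx 1 := by
  classical
  ext s
  rw [Gate.apply_diag mem _ (fun s => if (∀ w ∈ Q, s.q w = false) ∧ (∀ k ∈ S, s.r k = 0) then
    Complex.exp (φ * Complex.I) else 1) (fun s => by simp only [Gate.act])]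
  by_cases hs : s = ctx
  · subst hs
    rw [if_pos ⟨hQ, hS⟩]
    simp; ring
  · rw [Finsupp.add_apply, Finsupp.smul_apply, Finsupp.single_apply, if_neg (Ne.symm hs)]
    by_cases hs' : s ∈ ψ.support
    · have := h s hs'
      rw [if_neg]
      · simp
      · rintro ⟨h1, h2⟩
        apply hs
        ext w
        · by_cases hw : w ∈ Q
          · rw [h1 w hw, hQ w hw]
          · exact this.1 w hw
        · by_cases hw : w ∈ S
          · rw [h2 w hw, hS w hw]
          · exact this.2 w hw
    · simp [Finsupp.notMem_support_iff.1 hs']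

/-- One round of amplitude amplification on the coefficients of the marked and the unmarked part of
the sampled state, if the marked part has weight `p`. -/
def aaStep (p : ℝ) (φ : ℝ × ℝ) (v : ℂ × ℂ) : ℂ × ℂ :=
  let a := Complex.exp (φ.1 * Complex.I) * v.1
  let c := (Complex.exp (φ.2 * Complex.I) - 1) * (p * a + (1 - p) * v.2)
  (a + c, v.2 + c)

/-- The coefficients of the marked and unmarked parts after several rounds, from `v`. -/
def aaRun (p : ℝ) (ph : List (ℝ × ℝ)) (v : ℂ × ℂ) : ℂ × ℂ :=
  ph.foldl (fun v φ => aaStep p φ v) v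

/-- The span of `good` and `bad` is invariant. Marking multiplies the coefficient of `good` by a
phase. Conjugating the zero-phase gate by the sampler gives 1 + (e^{iφ}-1)|ψ⟩⟨ψ| with ψ = `good +
bad`, and the overlap of ψ with a·`good` + b·`bad` is pa + (1-p)b for p = `nsq good`. This is the
recursion `aaStep`. -/
theorem ampAmp_run (mem : Memory) {samp check : Circuit} {flag : QWire} {ctrl : Finset Reg}
    (ph : List (ℝ × ℝ)) {ctx : Config} {good bad good' bad' : State}
    (hsamp : Circuit.run mem samp (Finsupp.single ctx 1) = good + bad)
    (hgood : Circuit.run mem check good = good') (hbad : Circuit.run mem check bad = bad')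
    (hgood' : ∀ s ∈ good'.support, s.q flag = true)
    (hbad' : ∀ s ∈ bad'.support, s.q flag = false)
    (hdisj : ∀ s ∈ good.support, s ∉ bad.support)
    (hw : Circuit.Writes {w | w ∈ (Circuit.qubits samp).filter fun w => w.1 ∉ ctrl}
      (Circuit.reals samp) samp)
    (hq : ∀ w ∈ Circuit.qubits samp, w.1 ∉ ctrl → ctx.q w = false)
    (hr : ∀ k ∈ Circuit.reals samp, ctx.r k = 0) :
    nsq good + nsq bad = 1 ∧
    Circuit.run mem (ampAmp samp check flag ctrl ph) (Finsupp.single ctx 1) =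
      (aaRun (nsq good) ph (1, 1)).1 • good' + (aaRun (nsq good) ph (1, 1)).2 • bad' := by
  have hg : Circuit.run mem (Circuit.inverse check) good' = good := by
    rw [← hgood, Circuit.run_inverse_run]
  have hb : Circuit.run mem (Circuit.inverse check) bad' = bad := by
    rw [← hbad, Circuit.run_inverse_run]
  -- Orthogonality is read off after the check, which is unitary and sends the two parts to states
  -- with different flags.
  have horth : ip good bad = 0 := by
    rw [← Circuit.ip_run_run mem check, hgood, hbad]
    refine ip_eq_zero_of_disjoint fun s h1 h2 => ?_
    have := hgood' s h1
    rw [hbad' s h2] at this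
    cases this
  have horth' : ip bad good = 0 := by rw [← ip_star, horth, star_zero]
  have hone : nsq good + nsq bad = 1 := by
    rw [← nsq_add_of_ip_eq_zero horth, ← hsamp, Circuit.nsq_run, nsq_single]
    simp
  have hone' : ((nsq good + nsq bad : ℝ) : ℂ) = 1 := by rw [hone, Complex.ofReal_one]
  have hbadn : ((nsq bad : ℝ) : ℂ) = 1 - (nsq good : ℝ) := by
    rw [← hone', Complex.ofReal_add]; ring
  refine ⟨hone, ?_⟩
  have hself : Within {w | w ∈ (Circuit.qubits samp).filter fun w => w.1 ∉ ctrl}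
      (Circuit.reals samp) ctx (Circuit.run mem samp (Finsupp.single ctx 1)) :=
    (Within.single 1 (AgreeOff.refl ctx)).run mem hw
  have hmark : ∀ (φ : ℝ) (a b : ℂ),
      Circuit.run mem (check ++ [Gate.phase φ flag] ++ Circuit.inverse check)
        (a • good + b • bad) = (Complex.exp (φ * Complex.I) * a) • good + b • bad := by
    intro φ a b
    have e1 : (Gate.phase φ flag).apply mem (a • good' + b • bad') =
        (Complex.exp (φ * Complex.I) * a) • good' + b • bad' := by
      have e2 := apply_phase_of_forall mem φ flag (ψ := good') hgood'
      have e3 := apply_phase_of_forall mem φ flag (ψ := bad') hbad'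
      change (Gate.phase φ flag).lin mem _ = _ at e2
      change (Gate.phase φ flag).lin mem _ = _ at e3
      change (Gate.phase φ flag).lin mem _ = _
      rw [map_add, map_smul, map_smul, e2, e3]
      simp [smul_smul, mul_comm]
    rw [Circuit.run_append, Circuit.run_append, Circuit.run_add, Circuit.run_smul,
      Circuit.run_smul, hgood, hbad, Circuit.run_cons, Circuit.run_nil, e1, Circuit.run_add,
      Circuit.run_smul, Circuit.run_smul, hg, hb]
  -- Since the supports are disjoint, nothing cancels in the sum, and each part inherits the
  -- locality of the sampled state.
  have hgW : Within {w | w ∈ (Circuit.qubits samp).filter fun w => w.1 ∉ ctrl}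
      (Circuit.reals samp) ctx good ∧
      Within {w | w ∈ (Circuit.qubits samp).filter fun w => w.1 ∉ ctrl}
      (Circuit.reals samp) ctx bad := by
    rw [hsamp] at hself
    constructor
    · intro s hs
      refine hself s ?_
      rw [Finsupp.mem_support_iff, Finsupp.add_apply, Finsupp.notMem_support_iff.1 (hdisj s hs),
        add_zero]
      exact Finsupp.mem_support_iff.1 hs
    · intro s hs
      refine hself s ?_
      rw [Finsupp.mem_support_iff, Finsupp.add_apply,
        Finsupp.notMem_support_iff.1 fun h => hdisj s h hs, zero_add]
      exact Finsupp.mem_support_iff.1 hs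
  have hrefl : ∀ (φ : ℝ) (a b : ℂ),
      Circuit.run mem (Circuit.inverse samp ++
        [Gate.zeroPhase φ ((Circuit.qubits samp).filter fun w => w.1 ∉ ctrl)
          (Circuit.reals samp)] ++ samp) (a • good + b • bad) =
      (a + (Complex.exp (φ * Complex.I) - 1) * (nsq good * a + (1 - nsq good) * b)) • good +
      (b + (Complex.exp (φ * Complex.I) - 1) * (nsq good * a + (1 - nsq good) * b)) • bad := by
    intro φ a b
    have hW := ((hgW.1.smul a).add (hgW.2.smul b)).run mem hw.inverse
    -- The amplitude of the start state after undoing the sampler is the overlap with the sampled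
    -- state.
    have hc : Circuit.run mem (Circuit.inverse samp) (a • good + b • bad) ctx =
        nsq good * a + (1 - nsq good) * b := by
      rw [← ip_single_left, Circuit.ip_run, Circuit.inverse_inverse, hsamp, ip_add_left,
        ip_add_right, ip_add_right, ip_smul_right, ip_smul_right, ip_smul_right, ip_smul_right,
        horth, horth', ip_self, ip_self, hbadn]
      ring
    have hback : Circuit.run mem samp (Circuit.run mem (Circuit.inverse samp)
        (a • good + b • bad)) = a • good + b • bad := by
      have := Circuit.run_inverse_run mem (Circuit.inverse samp) (a • good + b • bad)
      rwa [Circuit.inverse_inverse] at this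
    rw [Circuit.run_append, Circuit.run_append, Circuit.run_cons, Circuit.run_nil,
      apply_zeroPhase_of_within mem φ _ _ hW (fun w h => by
        rw [Finset.mem_filter] at h; exact hq w h.1 h.2) hr, hc, Circuit.run_add,
      Circuit.run_smul, hback, hsamp]
    simp only [smul_add, add_smul]
    abel
  have hrounds : ∀ (ph : List (ℝ × ℝ)) (v : ℂ × ℂ),
      Circuit.run mem (ph.flatMap (fun p =>
        check ++ [Gate.phase p.1 flag] ++ Circuit.inverse check ++ Circuit.inverse samp ++
        [Gate.zeroPhase p.2 ((Circuit.qubits samp).filter fun w => w.1 ∉ ctrl)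
          (Circuit.reals samp)] ++ samp)) (v.1 • good + v.2 • bad) =
      (aaRun (nsq good) ph v).1 • good + (aaRun (nsq good) ph v).2 • bad := by
    intro ph
    induction ph with
    | nil => intro v; rfl
    | cons φ ph ih =>
      intro v
      rw [List.flatMap_cons, Circuit.run_append]
      have := hrefl φ.2 (Complex.exp (φ.1 * Complex.I) * v.1) v.2
      rw [← hmark, ← Circuit.run_append] at this
      rw [show check ++ [Gate.phase φ.1 flag] ++ Circuit.inverse check ++ Circuit.inverse samp ++
        [Gate.zeroPhase φ.2 ((Circuit.qubits samp).filter fun w => w.1 ∉ ctrl)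
          (Circuit.reals samp)] ++ samp =
        (check ++ [Gate.phase φ.1 flag] ++ Circuit.inverse check) ++ (Circuit.inverse samp ++
        [Gate.zeroPhase φ.2 ((Circuit.qubits samp).filter fun w => w.1 ∉ ctrl)
          (Circuit.reals samp)] ++ samp) by simp only [List.append_assoc], this]
      exact ih (aaStep (nsq good) φ v)
  have h1 := hrounds ph (1, 1)
  rw [one_smul, one_smul] at h1
  rw [ampAmp, Circuit.run_append, Circuit.run_append, hsamp, h1, Circuit.run_add,
    Circuit.run_smul, Circuit.run_smul, hgood, hbad]

theorem run_eq_sum (mem : Memory) (S : Circuit) (ψ : State) :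
    Circuit.run mem S ψ = ∑ s ∈ ψ.support, ψ s • Circuit.run mem S (Finsupp.single s 1) := by
  conv_lhs => rw [← Finsupp.sum_single ψ, Finsupp.sum, Circuit.run_sum]
  refine Finset.sum_congr rfl fun s _ => ?_
  rw [← Circuit.run_smul, Finsupp.smul_single, smul_eq_mul, mul_one]

open Classical in
-- This variant serves the third level, where the sampled state is not fully explicit: the marked
-- part is cut out by a predicate on configurations, and the check does nothing but raise the flag.
theorem ampAmp_run_filter (mem : Memory) {samp check : Circuit} {flag : QWire} {ctrl : Finset Reg}
    (ph : List (ℝ × ℝ)) {ctx : Config} {ψ : State} (mark : Config → Prop)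
    (hsamp : Circuit.run mem samp (Finsupp.single ctx 1) = ψ)
    (hflag : ∀ s ∈ ψ.support, s.q flag = false)
    (hcheck : ∀ s ∈ ψ.support, Circuit.run mem check (Finsupp.single s 1) =
      Finsupp.single (if mark s then s.setQ flag true else s) 1)
    (hw : Circuit.Writes {w | w ∈ (Circuit.qubits samp).filter fun w => w.1 ∉ ctrl}
      (Circuit.reals samp) samp)
    (hq : ∀ w ∈ Circuit.qubits samp, w.1 ∉ ctrl → ctx.q w = false)
    (hr : ∀ k ∈ Circuit.reals samp, ctx.r k = 0) :
    nsq (ψ.filter mark) + nsq (ψ.filter fun s => ¬ mark s) = 1 ∧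
    Circuit.run mem (ampAmp samp check flag ctrl ph) (Finsupp.single ctx 1) =
      (aaRun (nsq (ψ.filter mark)) ph (1, 1)).1 •
        (ψ.filter mark).mapDomain (fun s => s.setQ flag true) +
      (aaRun (nsq (ψ.filter mark)) ph (1, 1)).2 • ψ.filter fun s => ¬ mark s := by
  refine ampAmp_run mem ph (by rw [hsamp, Finsupp.filter_add_filter_not]) ?_ ?_ ?_ ?_ ?_ hw hq hr
  · rw [run_eq_sum, Finsupp.mapDomain, Finsupp.sum]
    refine Finset.sum_congr rfl fun s hs => ?_
    rw [Finsupp.support_filter, Finset.mem_filter] at hs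
    rw [hcheck s hs.1, if_pos hs.2]; simp
  · conv_rhs => rw [← Finsupp.sum_single (ψ.filter fun s => ¬ mark s), Finsupp.sum]
    rw [run_eq_sum]
    refine Finset.sum_congr rfl fun s hs => ?_
    rw [Finsupp.support_filter, Finset.mem_filter] at hs
    rw [hcheck s hs.1, if_neg hs.2]; simp
  · intro s hs
    obtain ⟨s', -, rfl⟩ := Finset.mem_image.1 (Finsupp.mapDomain_support hs)
    exact s'.setQ_q_self _ _
  · intro s hs
    rw [Finsupp.support_filter, Finset.mem_filter] at hs
    exact hflag s hs.1
  · intro s hs hs'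
    rw [Finsupp.support_filter, Finset.mem_filter] at hs hs'
    exact hs'.2 hs.2

end

section

/-! ## Analysis of the amplification rounds -/

theorem aaRun_append (p : ℝ) (l l' : List (ℝ × ℝ)) (v : ℂ × ℂ) :
    aaRun p (l ++ l') v = aaRun p l' (aaRun p l v) := List.foldl_append

theorem aaRun_cons (p : ℝ) (φ : ℝ × ℝ) (l : List (ℝ × ℝ)) (v : ℂ × ℂ) :
    aaRun p (φ :: l) v = aaRun p l (aaStep p φ v) := rfl

theorem aaRun_nil (p : ℝ) (v : ℂ × ℂ) : aaRun p [] v = v := rfl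

/-- The inner product of coefficient vectors, if the marked part has weight `p`. -/
def wip (p : ℝ) (v w : ℂ × ℂ) : ℂ := p * (star v.1 * w.1) + (1 - p) * (star v.2 * w.2)

theorem aaStep_add_smul (p : ℝ) (φ : ℝ × ℝ) (k : ℂ) (v w : ℂ × ℂ) :
    aaStep p φ (v + k • w) = aaStep p φ v + k • aaStep p φ w := by
  ext <;> simp [aaStep] <;> ring

theorem aaRun_add_smul (p : ℝ) (l : List (ℝ × ℝ)) (k : ℂ) (v w : ℂ × ℂ) :
    aaRun p l (v + k • w) = aaRun p l v + k • aaRun p l w := by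
  induction l generalizing v w with
  | nil => rfl
  | cons φ l ih => rw [aaRun_cons, aaStep_add_smul, ih]; rfl

theorem star_exp_mul_exp (φ : ℝ) :
    star (Complex.exp (φ * Complex.I)) * Complex.exp (φ * Complex.I) = 1 := by
  rw [Complex.star_def, ← Complex.exp_conj, ← Complex.exp_add]
  simp

/-- A round is unitary on the span of the good and bad parts. In coefficients this means preserving
the form with weights `p` and `1 - p`. -/
theorem wip_aaStep (p : ℝ) (φ : ℝ × ℝ) (v w : ℂ × ℂ) :
    wip p (aaStep p φ v) (aaStep p φ w) = wip p v w := by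
  have h1 := star_exp_mul_exp φ.1
  have h2 := star_exp_mul_exp φ.2
  simp only [wip, aaStep]
  generalize Complex.exp (φ.1 * Complex.I) = e at *
  generalize Complex.exp (φ.2 * Complex.I) = f at *
  simp only [star_add, star_mul', star_sub, star_one]
  have hp : star (p : ℂ) = p := Complex.conj_ofReal p
  rw [hp]
  generalize star e = e' at *
  generalize star f = f' at *
  generalize star v.1 = v1 at *
  generalize star v.2 = v2 at *
  generalize w.1 = w1 at *
  generalize w.2 = w2 at *
  linear_combination (p : ℂ) * v1 * w1 * h1 +
    (p * (e' * v1) + (1 - p) * v2) * (p * (e * w1) + (1 - p) * w2) * h2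

theorem wip_aaRun (p : ℝ) (l : List (ℝ × ℝ)) (v w : ℂ × ℂ) :
    wip p (aaRun p l v) (aaRun p l w) = wip p v w := by
  induction l generalizing v w with
  | nil => rfl
  | cons φ l ih => rw [aaRun_cons, aaRun_cons, ih, wip_aaStep]

theorem wip_self (p : ℝ) (v : ℂ × ℂ) :
    wip p v v = ((p * ‖v.1‖ ^ 2 + (1 - p) * ‖v.2‖ ^ 2 : ℝ) : ℂ) := by
  rw [wip, Complex.star_def, Complex.conj_mul', Complex.conj_mul']
  push_cast; ring

theorem aaRun_norm (p : ℝ) (l : List (ℝ × ℝ)) :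
    p * ‖(aaRun p l (1, 1)).1‖ ^ 2 + (1 - p) * ‖(aaRun p l (1, 1)).2‖ ^ 2 = 1 := by
  have := wip_aaRun p l (1, 1) (1, 1)
  rw [wip_self, wip_self] at this
  have := Complex.ofReal_injective this
  rw [this]; simp

/-- Phases for the inverse sequence of rounds. -/
def invPhases (l : List (ℝ × ℝ)) : List (ℝ × ℝ) :=
  l.reverse.flatMap fun φ => [(0, -φ.2), (-φ.1, 0)]

theorem invPhases_length (l : List (ℝ × ℝ)) : (invPhases l).length = 2 * l.length := by
  simp [invPhases, mul_comm]

theorem exp_neg_mul_exp (φ : ℝ) :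
    Complex.exp ((-φ : ℝ) * Complex.I) * Complex.exp (φ * Complex.I) = 1 := by
  rw [← Complex.exp_add]; simp

/-- A round marks first and reflects second, so its inverse must reflect first. Within the same
format of rounds this takes two rounds, each with one of its two phases zero. -/
theorem aaStep_right_inverse (p : ℝ) (φ : ℝ × ℝ) (v : ℂ × ℂ) :
    aaStep p φ (aaStep p (-φ.1, 0) (aaStep p (0, -φ.2) v)) = v := by
  have h1 := exp_neg_mul_exp φ.1
  have h2 := exp_neg_mul_exp φ.2
  simp only [aaStep]
  simp only [Complex.ofReal_zero, zero_mul, Complex.exp_zero, one_mul, sub_self, add_zero]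
  generalize Complex.exp (φ.1 * Complex.I) = e at *
  generalize Complex.exp (φ.2 * Complex.I) = f at *
  generalize Complex.exp ((-φ.1 : ℝ) * Complex.I) = e' at *
  generalize Complex.exp ((-φ.2 : ℝ) * Complex.I) = f' at *
  obtain ⟨a, b⟩ := v
  have hc : e * (e' * (a + (f' - 1) * (p * a + (1 - p) * b))) =
      a + (f' - 1) * (p * a + (1 - p) * b) := by
    rw [← mul_assoc, mul_comm e, h1, one_mul]
  simp only [hc]
  ext <;> simp only <;> linear_combination (p * a + (1 - p) * b) * h2

theorem aaRun_invPhases (p : ℝ) (l : List (ℝ × ℝ)) (v : ℂ × ℂ) :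
    aaRun p l (aaRun p (invPhases l) v) = v := by
  induction l generalizing v with
  | nil => rfl
  | cons φ l ih =>
    have : invPhases (φ :: l) = invPhases l ++ [(0, -φ.2), (-φ.1, 0)] := by
      simp [invPhases]
    rw [this, aaRun_append, aaRun_cons, aaRun_cons, aaRun_cons, aaRun_nil, aaStep_right_inverse, ih]

/-- Phases for one level of recursion of the `π / 3` fixed-point search. -/
def cubePhases (l : List (ℝ × ℝ)) : List (ℝ × ℝ) :=
  l ++ [(Real.pi / 3, 0)] ++ invPhases l ++ [(0, Real.pi / 3)] ++ l

theorem cubePhases_length (l : List (ℝ × ℝ)) : (cubePhases l).length = 4 * l.length + 2 := by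
  simp [cubePhases, invPhases_length]; ring

theorem exp_pi_third :
    Complex.exp (((Real.pi / 3 : ℝ) : ℂ) * Complex.I) =
      1 / 2 + (Real.sqrt 3 / 2 : ℝ) * Complex.I := by
  rw [Complex.exp_mul_I, ← Complex.ofReal_cos, ← Complex.ofReal_sin, Real.cos_pi_div_three,
    Real.sin_pi_div_three]
  push_cast; ring

/-- Let V be the given sequence and δ its failure probability. The new sequence is V, a marking by
π/3, V⁻¹, a reflection by π/3 about the sampled state, and V again. With e = e^{iπ/3} the unmarked
coefficient v₂ is multiplied by 1 + (e-1)(1+(e-1)(1-δ)), which equals eδ because (e-1)² = -e. Hence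
failure δ becomes δ³. -/
theorem cubePhases_snd (p : ℝ) (l : List (ℝ × ℝ)) :
    (1 - p) * ‖(aaRun p (cubePhases l) (1, 1)).2‖ ^ 2 =
      ((1 - p) * ‖(aaRun p l (1, 1)).2‖ ^ 2) ^ 3 := by
  set v := aaRun p l (1, 1) with hv
  set e := Complex.exp (((Real.pi / 3 : ℝ) : ℂ) * Complex.I) with he
  -- Equivalently e² - e + 1 = 0, the reason for the angle π/3.
  have hsq : (e - 1) ^ 2 = -e := by
    have h3 : ((Real.sqrt 3 : ℝ) : ℂ) ^ 2 = 3 := by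
      rw [← Complex.ofReal_pow, Real.sq_sqrt (by norm_num)]; norm_num
    rw [he, exp_pi_third]
    push_cast
    linear_combination (Complex.I ^ 2 / 4) * h3 + (3 / 4 + 0 : ℂ) * Complex.I_sq
  have hn : ‖e‖ = 1 := by rw [he, Complex.norm_exp_ofReal_mul_I]
  set w : ℂ × ℂ := (e * v.1, v.2) with hw
  have hstep1 : aaStep p (Real.pi / 3, 0) v = w := by
    simp only [aaStep, hw, he]
    simp
  set u := aaRun p (invPhases l) w with hu
  have hVu : aaRun p l u = w := aaRun_invPhases p l w
  -- In coefficients the sampled state is `(1, 1)`, so a round without marking phase adds a multiple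
  -- of that vector.
  have hstep2 : aaStep p (0, Real.pi / 3) u = u + ((e - 1) * wip p (1, 1) u) • ((1, 1) : ℂ × ℂ) := by
    ext <;> simp only [aaStep, wip, ← he] <;> simp
  have hwip : wip p (1, 1) u = wip p v w := by
    rw [← wip_aaRun p l, hVu]
  have hfin : aaRun p (cubePhases l) (1, 1) = w + ((e - 1) * wip p v w) • v := by
    rw [cubePhases, aaRun_append, aaRun_append, aaRun_append, aaRun_append, ← hv,
      aaRun_cons p (Real.pi / 3, 0), aaRun_nil, hstep1, ← hu, aaRun_cons p (0, Real.pi / 3),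
      aaRun_nil, hstep2, aaRun_add_smul, hVu, hwip]
  have hone : ((p * ‖v.1‖ ^ 2 + (1 - p) * ‖v.2‖ ^ 2 : ℝ) : ℂ) = 1 := by
    rw [aaRun_norm]; simp
  have hvw : wip p v w = 1 + (e - 1) * (1 - (1 - p) * ‖v.2‖ ^ 2) := by
    simp only [wip, hw]
    have h1 : star v.1 * v.1 = (‖v.1‖ : ℂ) ^ 2 := Complex.conj_mul' _
    have h2 : star v.2 * v.2 = (‖v.2‖ : ℂ) ^ 2 := Complex.conj_mul' _
    push_cast at hone
    linear_combination (p * e) * h1 + (1 - p) * h2 + e * hone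
  have hb : (aaRun p (cubePhases l) (1, 1)).2 = e * (((1 - p) * ‖v.2‖ ^ 2 : ℝ) : ℂ) * v.2 := by
    rw [hfin, Prod.snd_add, Prod.smul_snd, smul_eq_mul, hvw]
    simp only [hw]
    push_cast
    linear_combination (1 - (1 - p) * (‖v.2‖ : ℂ) ^ 2) * v.2 * hsq
  rw [hb, norm_mul, norm_mul, hn, one_mul, Complex.norm_real, mul_pow, Real.norm_eq_abs, sq_abs]
  ring

/-- Phases of the `k`-fold recursion. -/
def boostPhases (k : ℕ) (l : List (ℝ × ℝ)) : List (ℝ × ℝ) := cubePhases^[k] l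

theorem boostPhases_length (k : ℕ) (l : List (ℝ × ℝ)) :
    (boostPhases k l).length + 1 ≤ 4 ^ k * (l.length + 1) := by
  induction k with
  | zero => simp [boostPhases]
  | succ k ih =>
    rw [boostPhases, Function.iterate_succ_apply', cubePhases_length]
    change 4 * (boostPhases k l).length + 2 + 1 ≤ _
    rw [pow_succ]
    nlinarith

theorem boostPhases_snd (p : ℝ) (k : ℕ) (l : List (ℝ × ℝ)) :
    (1 - p) * ‖(aaRun p (boostPhases k l) (1, 1)).2‖ ^ 2 =
      ((1 - p) * ‖(aaRun p l (1, 1)).2‖ ^ 2) ^ 3 ^ k := by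
  induction k with
  | zero => simp [boostPhases]
  | succ k ih =>
    rw [boostPhases, Function.iterate_succ_apply', cubePhases_snd]
    change ((1 - p) * ‖(aaRun p (boostPhases k l) (1, 1)).2‖ ^ 2) ^ 3 = _
    rw [ih, ← pow_mul, ← pow_succ]

/-- Phases of `r` rounds of ordinary amplitude amplification. -/
def groverPhases (r : ℕ) : List (ℝ × ℝ) := List.replicate r (Real.pi, Real.pi)

/-- After scaling by sin φ and cos φ the coefficients form a unit vector that starts at angle φ. A
round with both phases π rotates it by 2φ and changes its sign, the reflection here being 1 -
2|ψ⟩⟨ψ|. -/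
theorem aaRun_grover (φ : ℝ) (r : ℕ) :
    (aaRun (Real.sin φ ^ 2) (groverPhases r) (1, 1)).1 * Real.sin φ =
        (((-1) ^ r * Real.sin ((2 * r + 1) * φ) : ℝ) : ℂ) ∧
      (aaRun (Real.sin φ ^ 2) (groverPhases r) (1, 1)).2 * Real.cos φ =
        (((-1) ^ r * Real.cos ((2 * r + 1) * φ) : ℝ) : ℂ) := by
  induction r with
  | zero => simp [groverPhases, aaRun]
  | succ r ih =>
    have hg : groverPhases (r + 1) = groverPhases r ++ [(Real.pi, Real.pi)] := by
      simp [groverPhases, List.replicate_succ']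
    rw [hg, aaRun_append, aaRun_cons, aaRun_nil]
    set v := aaRun (Real.sin φ ^ 2) (groverPhases r) (1, 1)
    obtain ⟨h1, h2⟩ := ih
    have hc : (1 : ℂ) - ((Real.sin φ ^ 2 : ℝ) : ℂ) = (Real.cos φ : ℂ) ^ 2 := by
      rw [← Complex.ofReal_one, ← Complex.ofReal_sub, ← Complex.ofReal_pow, Real.cos_sq']
    have hs : Real.sin ((2 * ((r + 1 : ℕ) : ℝ) + 1) * φ) =
        Real.sin ((2 * r + 1) * φ) * (1 - 2 * Real.sin φ ^ 2) +
        Real.cos ((2 * r + 1) * φ) * (2 * Real.sin φ * Real.cos φ) := by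
      rw [show (2 * ((r + 1 : ℕ) : ℝ) + 1) * φ = (2 * r + 1) * φ + 2 * φ by push_cast; ring,
        Real.sin_add, Real.sin_two_mul, Real.cos_two_mul, Real.cos_sq']
      ring
    have hcos : Real.cos ((2 * ((r + 1 : ℕ) : ℝ) + 1) * φ) =
        Real.cos ((2 * r + 1) * φ) * (2 * Real.cos φ ^ 2 - 1) -
        Real.sin ((2 * r + 1) * φ) * (2 * Real.sin φ * Real.cos φ) := by
      rw [show (2 * ((r + 1 : ℕ) : ℝ) + 1) * φ = (2 * r + 1) * φ + 2 * φ by push_cast; ring,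
        Real.cos_add, Real.sin_two_mul, Real.cos_two_mul]
    rw [hs, hcos]
    simp only [aaStep, hc, Complex.exp_pi_mul_I]
    push_cast at h1 h2 ⊢
    constructor
    · linear_combination (-1 + 2 * (Complex.sin φ) ^ 2) * h1 -
        2 * Complex.sin φ * Complex.cos φ * h2
    · linear_combination (1 - 2 * (Complex.cos φ) ^ 2) * h2 +
        2 * Complex.sin φ * Complex.cos φ * h1

theorem abs_sin_nat_mul_le_mul (n : ℕ) (φ : ℝ) :
    |Real.sin (n * φ)| ≤ n * |Real.sin φ| := by
  induction n with
  | zero => simp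
  | succ n ih =>
    rw [show ((n + 1 : ℕ) : ℝ) * φ = n * φ + φ by push_cast; ring, Real.sin_add]
    calc |Real.sin (n * φ) * Real.cos φ + Real.cos (n * φ) * Real.sin φ|
        ≤ |Real.sin (n * φ) * Real.cos φ| + |Real.cos (n * φ) * Real.sin φ| := abs_add_le _ _
      _ = |Real.sin (n * φ)| * |Real.cos φ| + |Real.cos (n * φ)| * |Real.sin φ| := by
          rw [abs_mul, abs_mul]
      _ ≤ |Real.sin (n * φ)| * 1 + 1 * |Real.sin φ| := by
          gcongr
          · exact Real.abs_cos_le_one _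
          · exact Real.abs_cos_le_one _
      _ ≤ ((n + 1 : ℕ) : ℝ) * |Real.sin φ| := by push_cast; linarith

/-- A number of rounds that does not overshoot if the success probability is at most `P`. -/
def rounds (P : ℝ) : ℕ := ⌊(1 / Real.sqrt P - 1) / 2⌋₊

/-- With p = sin²φ the success probability is sin²((2r+1)φ). The upper bound is |sin nφ| ≤ n|sin φ|.
The lower bound is sin x ≥ 2x/π, valid while (2r+1)φ ≤ π/2, followed by 2/π ≥ 1/2 and φ ≥ sin φ.
Without rounds the angle condition holds for every p. -/
theorem grover_bounds {p : ℝ} (hp : 0 ≤ p) (hp1 : p ≤ 1) (r : ℕ) :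
    p * ‖(aaRun p (groverPhases r) (1, 1)).1‖ ^ 2 ≤ (2 * r + 1) ^ 2 * p ∧
    ((r = 0 ∨ (2 * r + 1) * Real.sqrt p ≤ 1) →
      ((2 * r + 1) / 2) ^ 2 * p ≤ p * ‖(aaRun p (groverPhases r) (1, 1)).1‖ ^ 2) := by
  set φ := Real.arcsin (Real.sqrt p)
  have hs1 : Real.sqrt p ≤ 1 := Real.sqrt_le_one.2 hp1
  have hsin : Real.sin φ = Real.sqrt p :=
    Real.sin_arcsin (by linarith [Real.sqrt_nonneg p]) hs1
  have hφ0 : 0 ≤ φ := Real.arcsin_nonneg.2 (Real.sqrt_nonneg p)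
  have hφ1 : φ ≤ Real.pi / 2 := Real.arcsin_le_pi_div_two _
  have hpe : p = Real.sin φ ^ 2 := by rw [hsin, Real.sq_sqrt hp]
  have hval : p * ‖(aaRun p (groverPhases r) (1, 1)).1‖ ^ 2 = Real.sin ((2 * r + 1) * φ) ^ 2 := by
    have h := congrArg (fun z : ℂ => ‖z‖ ^ 2) (aaRun_grover φ r).1
    simp only [← hpe, norm_mul, Complex.norm_real, mul_pow, Real.norm_eq_abs, sq_abs, abs_pow, abs_neg, abs_one, one_pow, one_mul] at h
    rw [← h, mul_comm]
  rw [hval]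
  constructor
  · have h := abs_sin_nat_mul_le_mul (2 * r + 1) φ
    push_cast at h
    rw [← sq_abs (Real.sin ((2 * r + 1) * φ))]
    calc |Real.sin ((2 * r + 1) * φ)| ^ 2 ≤ ((2 * r + 1) * |Real.sin φ|) ^ 2 := by gcongr
      _ = (2 * r + 1) ^ 2 * p := by rw [mul_pow, sq_abs, ← hpe]
  · intro hr
    have hle : (2 * r + 1) * φ ≤ Real.pi / 2 := by
      rcases hr with rfl | hr
      · simpa using hφ1
      · have := Real.mul_le_sin hφ0 hφ1
        rw [hsin] at this
        have h2 : φ ≤ Real.pi / 2 * Real.sqrt p := by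
          rw [div_mul_eq_mul_div, div_le_iff₀ Real.pi_pos] at this
          linarith
        calc (2 * r + 1) * φ ≤ (2 * r + 1) * (Real.pi / 2 * Real.sqrt p) := by gcongr
          _ = Real.pi / 2 * ((2 * r + 1) * Real.sqrt p) := by ring
          _ ≤ Real.pi / 2 * 1 := by gcongr
          _ = Real.pi / 2 := mul_one _
    have hlow := Real.mul_le_sin (x := (2 * r + 1) * φ) (by positivity) hle
    have hsφ : Real.sin φ ≤ φ := Real.sin_le hφ0
    have hπ : 1 / 2 ≤ 2 / Real.pi := by
      rw [div_le_div_iff₀ (by norm_num) Real.pi_pos]; linarith [Real.pi_le_four]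
    rw [hpe]
    rw [← mul_pow]
    have h0 : 0 ≤ Real.sin φ := by rw [hsin]; positivity
    gcongr
    calc (2 * r + 1) / 2 * Real.sin φ = (2 * r + 1) * (1 / 2) * Real.sin φ := by ring
      _ ≤ (2 * r + 1) * (2 / Real.pi) * φ := by gcongr
      _ = 2 / Real.pi * ((2 * r + 1) * φ) := by ring
      _ ≤ _ := hlow

/-- The natural floor of a negative number is zero, so a bound `P` above 1 leads to no rounds; this
is why that case stands apart. -/
theorem rounds_le_one {P p : ℝ} (hP : 0 < P) (hpP : p ≤ P) :
    rounds P = 0 ∨ (2 * (rounds P : ℝ) + 1) * Real.sqrt p ≤ 1 := by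
  rcases Nat.eq_zero_or_pos (rounds P) with h | h
  · exact Or.inl h
  · right
    have h1 : (rounds P : ℝ) ≤ (1 / Real.sqrt P - 1) / 2 := Nat.floor_le (by
      by_contra hneg
      rw [rounds, Nat.floor_of_nonpos (by linarith)] at h
      exact lt_irrefl _ h)
    have hs : 0 < Real.sqrt P := Real.sqrt_pos.2 hP
    calc (2 * (rounds P : ℝ) + 1) * Real.sqrt p ≤ (1 / Real.sqrt P) * Real.sqrt P := by
          gcongr; linarith
      _ = 1 := by field_simp

/-- From the floor, 2r+1 > 1/√P - 2, and also 2r+1 ≥ 1. One third of the first plus two thirds of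
the second gives 2r+1 ≥ 1/(3√P). -/
theorem rounds_lower {P : ℝ} (hP : 0 < P) :
    1 / (9 * P) ≤ (2 * (rounds P : ℝ) + 1) ^ 2 := by
  have h1 : (1 / Real.sqrt P - 1) / 2 < rounds P + 1 := Nat.lt_floor_add_one _
  have hs : 0 < Real.sqrt P := Real.sqrt_pos.2 hP
  have h0 : (0 : ℝ) ≤ rounds P := Nat.cast_nonneg _
  have h2 : 1 / (3 * Real.sqrt P) ≤ 2 * (rounds P : ℝ) + 1 := by
    have : 1 / (3 * Real.sqrt P) = (1 / Real.sqrt P) / 3 := by field_simp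
    rw [this]; linarith
  calc 1 / (9 * P) = (1 / (3 * Real.sqrt P)) ^ 2 := by
        rw [div_pow, mul_pow, Real.sq_sqrt hP.le]; norm_num
    _ ≤ _ := by gcongr

theorem rounds_upper {P : ℝ} (hP : 0 < P) :
    2 * (rounds P : ℝ) + 1 ≤ max 1 (1 / Real.sqrt P) := by
  rcases rounds_le_one hP le_rfl with h | h
  · simp [h]
  · refine le_trans ?_ (le_max_right _ _)
    rwa [le_div_iff₀ (Real.sqrt_pos.2 hP)]

theorem rounds_upper_sq {P : ℝ} (hP : 0 < P) :
    (2 * (rounds P : ℝ) + 1) ^ 2 ≤ max 1 (1 / P) := by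
  rcases rounds_le_one hP le_rfl with h | h
  · simp [h]
  · refine le_trans ?_ (le_max_right _ _)
    rw [le_div_iff₀ hP]
    calc (2 * (rounds P : ℝ) + 1) ^ 2 * P = ((2 * (rounds P : ℝ) + 1) * Real.sqrt P) ^ 2 := by
          rw [mul_pow, Real.sq_sqrt hP.le]
      _ ≤ 1 ^ 2 := by gcongr
      _ = 1 := one_pow 2

/-- The amplification factor of ordinary amplitude amplification without overshooting. -/
theorem grover_rounds {P p : ℝ} (hP : 0 < P) (hp : 0 < p) (hp1 : p ≤ 1) (hpP : p ≤ P) :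
    1 / (36 * P) ≤ ‖(aaRun p (groverPhases (rounds P)) (1, 1)).1‖ ^ 2 := by
  have h1 := (grover_bounds hp.le hp1 (rounds P)).2 (rounds_le_one hP hpP)
  have h2 := rounds_lower hP
  rw [mul_comm] at h1
  have h3 := le_of_mul_le_mul_left h1 hp
  refine le_trans ?_ h3
  -- The 36 is 9 from rounding down the number of rounds times 4 from the linear lower bound on the
  -- sine.
  have : 1 / (36 * P) = 1 / (9 * P) / 4 := by field_simp; norm_num
  rw [this, div_pow]
  linarith

end

section

/-! ## Straight-line computations and their compilation to circuits -/

/-- A quantity computed from an input in `X`: a bit or a real number. -/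
inductive Fn (X : Type) : Type
  | bit (f : X → Bool)
  | real (f : X → ℝ)

variable {X Y : Type}

/-- Precomposition. -/
def Fn.comp (π : Y → X) : Fn X → Fn Y
  | .bit f => .bit (f ∘ π)
  | .real f => .real (f ∘ π)

/-- The number with given binary digits, least significant digit first. -/
def bitsVal : List Bool → ℕ
  | [] => 0
  | b :: l => b.toNat + 2 * bitsVal l

/-- The address given by a list of bits depending on the input. -/
def addr (l : List (X → Bool)) (x : X) : ℕ := bitsVal (l.map fun f => f x)

open Classical in
/-- `Step mem K f c`: the quantity `f` is obtained at cost `c` from the quantities in `K`. -/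
inductive Step (mem : X → Memory) (K : Set (Fn X)) : Fn X → ℕ → Prop
  | const (v : ℝ) : Step mem K (.real fun _ => v) 1
  | ofBit {f : X → Bool} (hf : .bit f ∈ K) : Step mem K (.real fun x => if f x = true then 1 else 0) 1
  | add {f g : X → ℝ} (hf : .real f ∈ K) (hg : .real g ∈ K) :
      Step mem K (.real fun x => f x + g x) 2
  | sub {f g : X → ℝ} (hf : .real f ∈ K) (hg : .real g ∈ K) :
      Step mem K (.real fun x => f x - g x) 2
  | arith (op : RealOp) {f g : X → ℝ} (hf : .real f ∈ K) (hg : .real g ∈ K) :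
      Step mem K (.real fun x => op.eval (f x) (g x)) 1
  | le {f g : X → ℝ} (hf : .real f ∈ K) (hg : .real g ∈ K) :
      Step mem K (.bit fun x => decide (f x ≤ g x)) 1
  | queryBit (A : BitArray) (l₁ l₂ l₃ : List (X → Bool)) (h : ∀ f ∈ l₁ ++ l₂ ++ l₃, .bit f ∈ K) :
      Step mem K (.bit fun x => (mem x).bit A (addr l₁ x) (addr l₂ x) (addr l₃ x))
        (1 + (l₁ ++ l₂ ++ l₃).length)
  | queryReal (A : RealArray) (l₁ l₂ l₃ : List (X → Bool)) (h : ∀ f ∈ l₁ ++ l₂ ++ l₃, .bit f ∈ K) :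
      Step mem K (.real fun x => (mem x).real A (addr l₁ x) (addr l₂ x) (addr l₃ x))
        (1 + (l₁ ++ l₂ ++ l₃).length)

/-- `Der mem K K' t`: starting from the quantities in `K`, a straight-line computation of cost `t`
obtains the quantities in `K'`. -/
inductive Der (mem : X → Memory) (K : Set (Fn X)) : Set (Fn X) → ℕ → Prop
  | refl : Der mem K K 0
  | step {K' : Set (Fn X)} {f : Fn X} {t c : ℕ} (h : Der mem K K' t) (hf : Step mem K' f c) :
      Der mem K (insert f K') (t + c)

/-- `Comp mem K A t`: the quantities in `A` can be computed from those in `K` at cost `t`. -/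
def Comp (mem : X → Memory) (K A : Set (Fn X)) (t : ℕ) : Prop :=
  ∃ K' t', Der mem K K' t' ∧ t' ≤ t ∧ A ⊆ K'

variable {mem : X → Memory} {K K' K₁ A B : Set (Fn X)} {s t : ℕ}

theorem Step.mono {f : Fn X} {c : ℕ} (h : Step mem K f c) (hK : K ⊆ K') : Step mem K' f c := by
  cases h with
  | const v => exact .const v
  | ofBit hf => exact .ofBit (hK hf)
  | add hf hg => exact .add (hK hf) (hK hg)
  | sub hf hg => exact .sub (hK hf) (hK hg)
  | arith op hf hg => exact .arith op (hK hf) (hK hg)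
  | le hf hg => exact .le (hK hf) (hK hg)
  | queryBit A l₁ l₂ l₃ h => exact .queryBit A l₁ l₂ l₃ fun f hf => hK (h f hf)
  | queryReal A l₁ l₂ l₃ h => exact .queryReal A l₁ l₂ l₃ fun f hf => hK (h f hf)

theorem Der.subset (h : Der mem K K' t) : K ⊆ K' := by
  induction h with
  | refl => exact subset_rfl
  | step _ _ ih => exact ih.trans (Set.subset_insert _ _)

theorem Der.mono (h : Der mem K K' t) (hK : K ⊆ K₁) : Der mem K₁ (K' ∪ K₁) t := by
  induction h with
  | refl => rw [Set.union_eq_self_of_subset_left hK]; exact .refl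
  | step _ hf ih =>
    rw [Set.insert_union]
    exact ih.step (hf.mono Set.subset_union_left)

theorem Der.trans {K'' : Set (Fn X)} (h : Der mem K K' s) (h' : Der mem K' K'' t) :
    Der mem K K'' (s + t) := by
  induction h' with
  | refl => exact h
  | step _ hf ih => rw [← add_assoc]; exact ih.step hf

theorem Comp.mono (h : Comp mem K A s) (hK : K ⊆ K') (hA : B ⊆ A) (hst : s ≤ t) :
    Comp mem K' B t := by
  obtain ⟨L, t', hD, ht', hL⟩ := h
  exact ⟨L ∪ K', t', hD.mono hK, ht'.trans hst, (hA.trans hL).trans Set.subset_union_left⟩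

theorem Comp.mono_cost (h : Comp mem K A s) (hst : s ≤ t) : Comp mem K A t :=
  h.mono subset_rfl subset_rfl hst

theorem Comp.weaken (h : Comp mem K A s) (hK : K ⊆ K') : Comp mem K' A s :=
  h.mono hK subset_rfl le_rfl

theorem Comp.subset (hA : A ⊆ K) (t : ℕ) : Comp mem K A t :=
  ⟨K, 0, .refl, Nat.zero_le _, hA⟩

theorem Comp.union_trans (h : Comp mem K A s) (h' : Comp mem (K ∪ A) B t) :
    Comp mem K (A ∪ B) (s + t) := by
  obtain ⟨L, s', hD, hs', hL⟩ := h
  obtain ⟨L', t', hD', ht', hL'⟩ := h'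
  refine ⟨_, _, hD.trans (hD'.mono (Set.union_subset hD.subset hL)), by omega, ?_⟩
  exact Set.union_subset (hL.trans Set.subset_union_right) (hL'.trans Set.subset_union_left)

theorem Comp.trans (h : Comp mem K A s) (h' : Comp mem (K ∪ A) B t) : Comp mem K B (s + t) :=
  (h.union_trans h').mono subset_rfl Set.subset_union_right le_rfl

theorem Comp.union (h : Comp mem K A s) (h' : Comp mem K B t) : Comp mem K (A ∪ B) (s + t) :=
  h.union_trans (h'.weaken Set.subset_union_left)

theorem Comp.ofStep {f : Fn X} {c : ℕ} (h : Step mem K f c) : Comp mem K {f} c :=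
  ⟨insert f K, 0 + c, Der.refl.step h, by omega, by simp⟩

theorem addr_comp (π : Y → X) (l : List (X → Bool)) (y : Y) :
    addr (l.map (· ∘ π)) y = addr l (π y) := by
  simp [addr, Function.comp_def]

theorem Step.pullback (π : Y → X) {f : Fn X} {c : ℕ} (h : Step mem K f c) :
    Step (mem ∘ π) (Fn.comp π '' K) (f.comp π) c := by
  cases h with
  | const v => exact .const v
  | ofBit hf => exact .ofBit (f := _ ∘ π) ⟨_, hf, rfl⟩
  | add hf hg => exact .add (f := _ ∘ π) (g := _ ∘ π) ⟨_, hf, rfl⟩ ⟨_, hg, rfl⟩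
  | sub hf hg => exact .sub (f := _ ∘ π) (g := _ ∘ π) ⟨_, hf, rfl⟩ ⟨_, hg, rfl⟩
  | arith op hf hg => exact .arith op (f := _ ∘ π) (g := _ ∘ π) ⟨_, hf, rfl⟩ ⟨_, hg, rfl⟩
  | le hf hg => exact .le (f := _ ∘ π) (g := _ ∘ π) ⟨_, hf, rfl⟩ ⟨_, hg, rfl⟩
  | queryBit A l₁ l₂ l₃ h =>
    have := Step.queryBit (mem := mem ∘ π) (K := Fn.comp π '' K) A (l₁.map (· ∘ π))
      (l₂.map (· ∘ π)) (l₃.map (· ∘ π)) (by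
        intro f hf
        rw [← List.map_append, ← List.map_append, List.mem_map] at hf
        obtain ⟨g, hg, rfl⟩ := hf
        exact ⟨_, h g hg, rfl⟩)
    rw [← List.map_append, ← List.map_append, List.length_map] at this
    simp only [addr_comp] at this
    exact this
  | queryReal A l₁ l₂ l₃ h =>
    have := Step.queryReal (mem := mem ∘ π) (K := Fn.comp π '' K) A (l₁.map (· ∘ π))
      (l₂.map (· ∘ π)) (l₃.map (· ∘ π)) (by
        intro f hf
        rw [← List.map_append, ← List.map_append, List.mem_map] at hf
        obtain ⟨g, hg, rfl⟩ := hf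
        exact ⟨_, h g hg, rfl⟩)
    rw [← List.map_append, ← List.map_append, List.length_map] at this
    simp only [addr_comp] at this
    exact this

/-- Substitution into the argument: a computation with a free parameter can be instantiated at a
parameter that has itself been computed. -/
theorem Comp.pullback (π : Y → X) (h : Comp mem K A t) :
    Comp (mem ∘ π) (Fn.comp π '' K) (Fn.comp π '' A) t := by
  obtain ⟨L, t', hD, ht', hL⟩ := h
  refine ⟨Fn.comp π '' L, t', ?_, ht', Set.image_mono hL⟩
  clear hL ht'
  induction hD with
  | refl => exact .refl
  | step _ hf ih => rw [Set.image_insert_eq]; exact ih.step (hf.pullback π)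

/-! ### Compilation into reversible circuits -/

/-- Action on basis states of a circuit of classical gates. -/
def Circuit.cact (mem : Memory) (S : Circuit) (s : Config) : Config :=
  S.foldl (fun s g => g.cact mem s) s

theorem Circuit.cact_append (mem : Memory) (S T : Circuit) (s : Config) :
    Circuit.cact mem (S ++ T) s = Circuit.cact mem T (Circuit.cact mem S s) := List.foldl_append

theorem Circuit.run_of_classical (mem : Memory) {S : Circuit} (hS : ∀ g ∈ S, g.IsClassical)
    (s : Config) : Circuit.run mem S (Finsupp.single s 1) =
      Finsupp.single (Circuit.cact mem S s) 1 := by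
  induction S generalizing s with
  | nil => rfl
  | cons g S ih =>
    rw [Circuit.run_cons, Gate.apply_single, one_smul, Gate.act_of_isClassical mem (hS g (by simp)),
      ih fun g' hg' => hS g' (by simp [hg'])]
    rfl

theorem Circuit.time_append (S T : Circuit) :
    Circuit.time (S ++ T) = Circuit.time S + Circuit.time T := by
  simp [Circuit.time]

theorem Circuit.time_inverse (S : Circuit) :
    Circuit.time (Circuit.inverse S) = Circuit.time S := by
  simp [Circuit.time, Circuit.inverse, List.sum_reverse, Function.comp_def, Gate.cost_inverse]

/-- Wire `w` is an input wire in `W` or one of the first `n` workspace qubits. -/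
def InOrWork (W : Set QWire) (n : ℕ) (w : QWire) : Prop := w ∈ W ∨ ∃ k < n, w = (.work, k)

/-- The quantity is held in a wire of the configuration. -/
def Held (cfg : X → Config) (W : Set QWire) (nb nr : ℕ) : Fn X → Prop
  | .bit f => ∃ w, InOrWork W nb w ∧ ∀ x, (cfg x).q w = f x
  | .real f => ∃ k < nr, ∀ x, (cfg x).r k = f x

/-- The workspace from qubit `nb` and from real register `nr` on is blank. -/
def Blank (cfg : X → Config) (nb nr : ℕ) : Prop :=
  ∀ x, (∀ k, nb ≤ k → (cfg x).q (.work, k) = false) ∧ ∀ k, nr ≤ k → (cfg x).r k = 0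

theorem InOrWork.ne {W : Set QWire} (hW : ∀ w ∈ W, w.1 ≠ .work) {n : ℕ} {w : QWire}
    (h : InOrWork W n w) : w ≠ (.work, n) := by
  rintro rfl
  rcases h with h | ⟨k, hk, h⟩
  · exact hW _ h rfl
  · injection h with _ h; omega

theorem InOrWork.succ {W : Set QWire} {n : ℕ} {w : QWire} (h : InOrWork W n w) :
    InOrWork W (n + 1) w := by
  rcases h with h | ⟨k, hk, h⟩
  exacts [Or.inl h, Or.inr ⟨k, by omega, h⟩]

theorem Held.real_step {cfg cfg' : X → Config} {W : Set QWire} {nb nr : ℕ} {v : X → ℝ}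
    (hbl : Blank cfg nb nr) (hK : ∀ f ∈ K, Held cfg W nb nr f)
    (hq : ∀ x, (cfg' x).q = (cfg x).q)
    (hr : ∀ x, (cfg' x).r = Function.update (cfg x).r nr ((cfg x).r nr + v x)) :
    Blank cfg' nb (nr + 1) ∧ ∀ f ∈ insert (Fn.real v) K, Held cfg' W nb (nr + 1) f := by
  constructor
  · intro x
    refine ⟨fun k hk => by rw [hq]; exact (hbl x).1 k hk, fun k hk => ?_⟩
    rw [hr, Function.update_of_ne (by omega)]
    exact (hbl x).2 k (by omega)
  · rintro f (rfl | hf)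
    · exact ⟨nr, by omega, fun x => by rw [hr, Function.update_self, (hbl x).2 nr le_rfl, zero_add]⟩
    · have := hK f hf
      cases f with
      | bit f =>
        obtain ⟨w, hw, h⟩ := this
        exact ⟨w, hw, fun x => by rw [hq, h]⟩
      | real f =>
        obtain ⟨k, hk, h⟩ := this
        exact ⟨k, by omega, fun x => by rw [hr, Function.update_of_ne (by omega), h]⟩

theorem Held.bit_step {cfg cfg' : X → Config} {W : Set QWire} (hW : ∀ w ∈ W, w.1 ≠ .work)
    {nb nr : ℕ} {v : X → Bool}
    (hbl : Blank cfg nb nr) (hK : ∀ f ∈ K, Held cfg W nb nr f)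
    (hc : ∀ x, cfg' x = (cfg x).setQ (.work, nb) ((cfg x).q (.work, nb) ^^ v x)) :
    Blank cfg' (nb + 1) nr ∧ ∀ f ∈ insert (Fn.bit v) K, Held cfg' W (nb + 1) nr f := by
  constructor
  · intro x
    refine ⟨fun k hk => ?_, fun k hk => by rw [hc]; exact (hbl x).2 k hk⟩
    rw [hc, Config.setQ_q_ne _ _ (by intro h; injection h with _ h; omega)]
    exact (hbl x).1 k (by omega)
  · rintro f (rfl | hf)
    · exact ⟨_, Or.inr ⟨nb, by omega, rfl⟩, fun x => by
        rw [hc, Config.setQ_q_self, (hbl x).1 nb le_rfl, Bool.false_xor]⟩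
    · have := hK f hf
      cases f with
      | bit f =>
        obtain ⟨w, hw, h⟩ := this
        exact ⟨w, hw.succ, fun x => by rw [hc, Config.setQ_q_ne _ _ (hw.ne hW), h]⟩
      | real f =>
        obtain ⟨k, hk, h⟩ := this
        exact ⟨k, hk, fun x => by rw [hc]; exact h x⟩

/-- The gates are classical, change only workspace, and otherwise read only wires in `W`. -/
def Circuit.Tame (W : Set QWire) (D : Circuit) : Prop :=
  ∀ g ∈ D, g.IsClassical ∧ (∀ w ∈ g.targets, w.1 = .work) ∧ ∀ w ∈ g.qubits, w ∈ W ∨ w.1 = .work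

theorem exists_address {cfg : X → Config} {W : Set QWire} {nb nr : ℕ}
    (hK : ∀ f ∈ K, Held cfg W nb nr f) (l : List (X → Bool)) (hl : ∀ f ∈ l, Fn.bit f ∈ K) :
    ∃ a : List QWire, a.length = l.length ∧ (∀ w ∈ a, InOrWork W nb w) ∧
      ∀ x, (cfg x).address a = addr l x := by
  induction l with
  | nil => exact ⟨[], rfl, by simp, fun x => rfl⟩
  | cons f l ih =>
    obtain ⟨a, h1, h2, h3⟩ := ih fun g hg => hl g (by simp [hg])
    obtain ⟨w, hw, hf⟩ := hK _ (hl f (by simp))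
    refine ⟨w :: a, by simp [h1], ?_, fun x => ?_⟩
    · intro w' hw'
      rcases List.mem_cons.1 hw' with rfl | h
      exacts [hw, h2 _ h]
    · simp only [Config.address, hf, h3]
      rfl

theorem InOrWork.or_work {W : Set QWire} {n : ℕ} {w : QWire} (h : InOrWork W n w) :
    w ∈ W ∨ w.1 = .work := by
  rcases h with h | ⟨k, -, rfl⟩
  exacts [Or.inl h, Or.inr rfl]

theorem exists_addresses {cfg : X → Config} {W : Set QWire} (hW : ∀ w ∈ W, w.1 ≠ .work)
    {nb nr : ℕ} (hK : ∀ f ∈ K, Held cfg W nb nr f) (l₁ l₂ l₃ : List (X → Bool))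
    (hl : ∀ f ∈ l₁ ++ l₂ ++ l₃, Fn.bit f ∈ K) :
    ∃ a₁ a₂ a₃ : List QWire, (a₁ ++ a₂ ++ a₃).length = (l₁ ++ l₂ ++ l₃).length ∧
      ((.work, nb) : QWire) ∉ a₁ ++ a₂ ++ a₃ ∧ (∀ w ∈ a₁ ++ a₂ ++ a₃, w ∈ W ∨ w.1 = .work) ∧
      ∀ x, (cfg x).address a₁ = addr l₁ x ∧ (cfg x).address a₂ = addr l₂ x ∧
        (cfg x).address a₃ = addr l₃ x := by
  obtain ⟨a₁, h₁, i₁, j₁⟩ := exists_address hK l₁ fun f hf => hl f (by simp [hf])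
  obtain ⟨a₂, h₂, i₂, j₂⟩ := exists_address hK l₂ fun f hf => hl f (by simp [hf])
  obtain ⟨a₃, h₃, i₃, j₃⟩ := exists_address hK l₃ fun f hf => hl f (by simp [hf])
  have hall : ∀ w ∈ a₁ ++ a₂ ++ a₃, InOrWork W nb w := by
    intro w hw
    simp only [List.mem_append] at hw
    rcases hw with (h | h) | h
    exacts [i₁ w h, i₂ w h, i₃ w h]
  exact ⟨a₁, a₂, a₃, by simp [h₁, h₂, h₃], fun h => (hall _ h).ne hW rfl,
    fun w hw => (hall w hw).or_work, fun x => ⟨j₁ x, j₂ x, j₃ x⟩⟩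

open Classical in
-- Each result goes into the first blank qubit or real register, and nothing is erased, so all
-- earlier quantities stay available. Sums and differences take two gates because arithmetic gates
-- accumulate into their target.
theorem Step.compile {f : Fn X} {c : ℕ} (h : Step mem K f c) {cfg : X → Config} {W : Set QWire}
    (hW : ∀ w ∈ W, w.1 ≠ .work) {nb nr : ℕ} (hbl : Blank cfg nb nr)
    (hK : ∀ f ∈ K, Held cfg W nb nr f) :
    ∃ (D : Circuit) (nb' nr' : ℕ), Circuit.Tame W D ∧ Circuit.time D = c ∧
      Blank (fun x => Circuit.cact (mem x) D (cfg x)) nb' nr' ∧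
      ∀ f' ∈ insert f K, Held (fun x => Circuit.cact (mem x) D (cfg x)) W nb' nr' f' := by
  cases h with
  | const v =>
    exact ⟨[.const false v nr], nb, nr + 1, by simp [Circuit.Tame, Gate.IsClassical, Gate.targets, Gate.qubits],
      rfl, Held.real_step hbl hK (fun x => rfl) fun x => rfl⟩
  | @ofBit f hf =>
    obtain ⟨w, hw, h⟩ := hK _ hf
    refine ⟨[.ofQubit false w nr], nb, nr + 1, ?_, rfl,
      Held.real_step hbl hK (fun x => rfl) fun x => ?_⟩
    · intro g hg
      rw [List.mem_singleton.1 hg]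
      refine ⟨trivial, by simp [Gate.targets], fun w' hw' => ?_⟩
      rw [Finset.mem_singleton.1 hw']
      exact hw.or_work
    · simp [Circuit.cact, Gate.cact, Config.addR, h]
  | @add f g hf hg =>
    obtain ⟨i, hi, h⟩ := hK _ hf
    obtain ⟨j, hj, h'⟩ := hK _ hg
    refine ⟨[.arith false .fst i i nr hi.ne hi.ne, .arith false .fst j j nr hj.ne hj.ne], nb,
      nr + 1, ?_, rfl, Held.real_step hbl hK (fun x => rfl) fun x => ?_⟩
    · simp [Circuit.Tame, Gate.IsClassical, Gate.targets, Gate.qubits]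
    · simp [Circuit.cact, Gate.cact, Config.addR, h, h', RealOp.eval, Function.update_of_ne hj.ne,
        add_assoc]
  | @sub f g hf hg =>
    obtain ⟨i, hi, h⟩ := hK _ hf
    obtain ⟨j, hj, h'⟩ := hK _ hg
    refine ⟨[.arith false .fst i i nr hi.ne hi.ne, .arith true .fst j j nr hj.ne hj.ne], nb,
      nr + 1, ?_, rfl, Held.real_step hbl hK (fun x => rfl) fun x => ?_⟩
    · simp [Circuit.Tame, Gate.IsClassical, Gate.targets, Gate.qubits]
    · simp [Circuit.cact, Gate.cact, Config.addR, h, h', RealOp.eval, Function.update_of_ne hj.ne,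
        add_sub_assoc]
  | @arith op f g hf hg =>
    obtain ⟨i, hi, h⟩ := hK _ hf
    obtain ⟨j, hj, h'⟩ := hK _ hg
    refine ⟨[.arith false op i j nr hi.ne hj.ne], nb,
      nr + 1, ?_, rfl, Held.real_step hbl hK (fun x => rfl) fun x => ?_⟩
    · simp [Circuit.Tame, Gate.IsClassical, Gate.targets, Gate.qubits]
    · simp [Circuit.cact, Gate.cact, Config.addR, h, h']
  | @le f g hf hg =>
    obtain ⟨i, hi, h⟩ := hK _ hf
    obtain ⟨j, hj, h'⟩ := hK _ hg
    refine ⟨[.compare i j (.work, nb)], nb + 1, nr, ?_, rfl, Held.bit_step hW hbl hK fun x => ?_⟩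
    · simp [Circuit.Tame, Gate.IsClassical, Gate.targets, Gate.qubits]
    · simp [Circuit.cact, Gate.cact, h, h']
  | queryBit A l₁ l₂ l₃ hl =>
    obtain ⟨a₁, a₂, a₃, h1, h2, h3, h4⟩ := exists_addresses hW hK l₁ l₂ l₃ hl
    refine ⟨[.queryBit A a₁ a₂ a₃ (.work, nb) h2], nb + 1, nr, ?_, ?_,
      Held.bit_step hW hbl hK fun x => ?_⟩
    · intro g hg
      rw [List.mem_singleton.1 hg]
      refine ⟨trivial, by simp [Gate.targets], fun w hw => ?_⟩
      simp only [Gate.qubits, Finset.mem_insert, List.mem_toFinset] at hw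
      rcases hw with rfl | hw
      exacts [Or.inr rfl, h3 w hw]
    · simp only [Circuit.time, List.map_cons, List.map_nil, List.sum_cons, List.sum_nil, Gate.cost,
        h1, add_zero]
    · simp [Circuit.cact, Gate.cact, h4]
  | queryReal A l₁ l₂ l₃ hl =>
    obtain ⟨a₁, a₂, a₃, h1, h2, h3, h4⟩ := exists_addresses hW hK l₁ l₂ l₃ hl
    refine ⟨[.queryReal false A a₁ a₂ a₃ nr], nb, nr + 1, ?_, ?_,
      Held.real_step hbl hK (fun x => rfl) fun x => ?_⟩
    · intro g hg
      rw [List.mem_singleton.1 hg]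
      refine ⟨trivial, by simp [Gate.targets], fun w hw => ?_⟩
      simp only [Gate.qubits, List.mem_toFinset] at hw
      exact h3 w hw
    · simp only [Circuit.time, List.map_cons, List.map_nil, List.sum_cons, List.sum_nil, Gate.cost,
        h1, add_zero]
    · simp [Circuit.cact, Gate.cact, Config.addR, h4]

theorem Circuit.Tame.append {W : Set QWire} {D E : Circuit} (hD : Circuit.Tame W D)
    (hE : Circuit.Tame W E) : Circuit.Tame W (D ++ E) := by
  intro g hg
  rcases List.mem_append.1 hg with h | h
  exacts [hD g h, hE g h]

/-- The quantities in `K` are bits held in wires of `W`, and the workspace is blank. -/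
structure Inputs (cfg : X → Config) (W : Set QWire) (K : Set (Fn X)) : Prop where
  ne_work : ∀ w ∈ W, w.1 ≠ .work
  blank : Blank cfg 0 0
  held : ∀ f ∈ K, Held cfg W 0 0 f

theorem Comp.compile (h : Comp mem K A t) {cfg : X → Config} {W : Set QWire}
    (hin : Inputs cfg W K) :
    ∃ (D : Circuit) (nb nr : ℕ), Circuit.Tame W D ∧ Circuit.time D ≤ t ∧
      ∀ f ∈ A, Held (fun x => Circuit.cact (mem x) D (cfg x)) W nb nr f := by
  obtain ⟨L, t', hD, ht', hL⟩ := h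
  suffices ∃ (D : Circuit) (nb nr : ℕ), Circuit.Tame W D ∧ Circuit.time D = t' ∧
      Blank (fun x => Circuit.cact (mem x) D (cfg x)) nb nr ∧
      ∀ f ∈ L, Held (fun x => Circuit.cact (mem x) D (cfg x)) W nb nr f by
    obtain ⟨D, nb, nr, h1, h2, -, h3⟩ := this
    exact ⟨D, nb, nr, h1, by omega, fun f hf => h3 f (hL hf)⟩
  clear hL ht'
  induction hD with
  | refl => exact ⟨[], 0, 0, by simp [Circuit.Tame], rfl, hin.blank, hin.held⟩
  | step _ hf ih =>
    obtain ⟨D, nb, nr, h1, h2, h3, h4⟩ := ih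
    obtain ⟨E, nb', nr', i1, i2, i3, i4⟩ := hf.compile hin.ne_work h3 h4
    refine ⟨D ++ E, nb', nr', h1.append i1, by rw [Circuit.time_append, h2, i2], ?_, ?_⟩
    · simpa only [Circuit.cact_append] using i3
    · simpa only [Circuit.cact_append] using i4

/-- A gate commutes with writing a qubit it does not touch. This allows a result to be written
between a computation and its reversal. -/
theorem Gate.cact_setQ (mem : Memory) {g : Gate} (hg : g.IsClassical) {t : QWire}
    (ht : t ∉ g.qubits) (s : Config) (v : Bool) :
    g.cact mem (s.setQ t v) = (g.cact mem s).setQ t v := by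
  have comm : ∀ {w : QWire} (u : Bool), t ≠ w → (s.setQ t v).setQ w u = (s.setQ w u).setQ t v := by
    intro w u h
    simp only [Config.setQ, Function.update_comm h]
  cases g with
  | cnot a w h =>
    simp only [Gate.qubits, Finset.mem_insert, Finset.mem_singleton, not_or] at ht
    simp only [Gate.cact]
    rw [s.setQ_q_ne _ (Ne.symm ht.1), s.setQ_q_ne _ (Ne.symm ht.2), comm _ ht.2]
  | toffoli a b w ha hb =>
    simp only [Gate.qubits, Finset.mem_insert, Finset.mem_singleton, not_or] at ht
    simp only [Gate.cact]
    rw [s.setQ_q_ne _ (Ne.symm ht.1), s.setQ_q_ne _ (Ne.symm ht.2.1),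
      s.setQ_q_ne _ (Ne.symm ht.2.2), comm _ ht.2.2]
  | const inv v k => rfl
  | ofQubit inv a k =>
    simp only [Gate.qubits, Finset.mem_singleton] at ht
    simp only [Gate.cact]
    rw [s.setQ_q_ne _ (Ne.symm ht)]; rfl
  | arith inv op i j k _ _ => rfl
  | compare i j w =>
    simp only [Gate.qubits, Finset.mem_singleton] at ht
    simp only [Gate.cact]
    rw [s.setQ_q_ne _ (Ne.symm ht), comm _ ht, Config.setQ_r]
  | queryBit A a₁ a₂ a₃ w h =>
    simp only [Gate.qubits, Finset.mem_insert, List.mem_toFinset, List.mem_append, not_or] at ht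
    simp only [Gate.cact]
    rw [s.setQ_q_ne _ (Ne.symm ht.1), comm _ ht.1, s.address_setQ _ ht.2.1.1,
      s.address_setQ _ ht.2.1.2, s.address_setQ _ ht.2.2]
  | queryReal inv A a₁ a₂ a₃ k =>
    simp only [Gate.qubits, List.mem_toFinset, List.mem_append, not_or] at ht
    simp only [Gate.cact]
    rw [s.address_setQ _ ht.1.1, s.address_setQ _ ht.1.2, s.address_setQ _ ht.2]; rfl
  | _ => exact hg.elim

theorem Circuit.cact_setQ (mem : Memory) {D : Circuit} (hD : ∀ g ∈ D, g.IsClassical) {t : QWire}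
    (ht : ∀ g ∈ D, t ∉ g.qubits) (s : Config) (v : Bool) :
    Circuit.cact mem D (s.setQ t v) = (Circuit.cact mem D s).setQ t v := by
  induction D generalizing s with
  | nil => rfl
  | cons g D ih =>
    change Circuit.cact mem D (g.cact mem (s.setQ t v)) = (Circuit.cact mem D (g.cact mem s)).setQ t v
    rw [Gate.cact_setQ mem (hD g (by simp)) (ht g (by simp)),
      ih (fun g' h => hD g' (by simp [h])) fun g' h => ht g' (by simp [h])]

theorem Gate.cact_q_of_notMem_targets (mem : Memory) (g : Gate) (s : Config) {w : QWire}
    (hw : w ∉ g.targets) : (g.cact mem s).q w = s.q w := by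
  cases g <;> simp only [Gate.cact, Config.addR_q]
  all_goals
    simp only [Gate.targets, Finset.mem_singleton] at hw
    exact s.setQ_q_ne _ hw

theorem Circuit.cact_q_of_notMem_targets (mem : Memory) {D : Circuit} {w : QWire}
    (hw : ∀ g ∈ D, w ∉ g.targets) (s : Config) : (Circuit.cact mem D s).q w = s.q w := by
  induction D generalizing s with
  | nil => rfl
  | cons g D ih =>
    exact (ih (fun g' h => hw g' (by simp [h])) _).trans
      (g.cact_q_of_notMem_targets mem s (hw g (by simp)))

/-- Uncomputation: the output qubit `t` is invisible to `D`, so changing it after `D` is the same as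
changing it before, and `D` cancels. -/
theorem Circuit.run_inverse_setQ (mem : Memory) {W : Set QWire} {D : Circuit}
    (hD : Circuit.Tame W D) {t : QWire} (htW : t ∉ W) (ht : t.1 ≠ .work) (s : Config) (v : Bool) :
    Circuit.run mem (Circuit.inverse D) (Finsupp.single ((Circuit.cact mem D s).setQ t v) 1) =
      Finsupp.single (s.setQ t v) 1 := by
  rw [← Circuit.cact_setQ mem (fun g hg => (hD g hg).1)
    (fun g hg h => ((hD g hg).2.2 t h).elim htW ht),
    ← Circuit.run_of_classical mem fun g hg => (hD g hg).1, Circuit.run_inverse_run]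

/-- The circuit changes only qubits in `T` and in the workspace, and otherwise reads only qubits
in `W`. -/
def Circuit.Changes (W T : Set QWire) (D : Circuit) : Prop :=
  ∀ g ∈ D, (∀ w ∈ g.targets, w ∈ T ∨ w.1 = .work) ∧ ∀ w ∈ g.qubits, w ∈ W ∪ T ∨ w.1 = .work

theorem Circuit.Tame.changes {W T : Set QWire} {D : Circuit} (h : Circuit.Tame W D) :
    Circuit.Changes W T D := fun g hg =>
  ⟨fun w hw => Or.inr ((h g hg).2.1 w hw), fun w hw => ((h g hg).2.2 w hw).imp_left Or.inl⟩

theorem Circuit.Changes.append {W T : Set QWire} {D E : Circuit} (hD : Circuit.Changes W T D)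
    (hE : Circuit.Changes W T E) : Circuit.Changes W T (D ++ E) := by
  intro g hg
  rcases List.mem_append.1 hg with h | h
  exacts [hD g h, hE g h]

theorem Circuit.Changes.mono {W W' T T' : Set QWire} {D : Circuit} (hD : Circuit.Changes W T D)
    (hW : W ⊆ W' ∪ T') (hT : T ⊆ T') : Circuit.Changes W' T' D :=
  fun g hg => ⟨fun w hw => ((hD g hg).1 w hw).imp_left fun h' => hT h',
    fun w hw => ((hD g hg).2 w hw).imp_left fun h' => h'.elim (fun h => hW h) fun h => Or.inr (hT h)⟩

theorem Circuit.Changes.inverse {W T : Set QWire} {D : Circuit} (hD : Circuit.Changes W T D) :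
    Circuit.Changes W T (Circuit.inverse D) := by
  intro g hg
  obtain ⟨g', hg', rfl⟩ : ∃ g' ∈ D, g'.inverse = g := by simpa [Circuit.inverse] using hg
  rw [Gate.targets_inverse, Gate.qubits_inverse]
  exact hD g' hg'

/-- A computed bit can be XORed into a qubit. -/
theorem exists_xor_circuit {f : X → Bool} (h : Comp mem K {.bit f} t) {cfg : X → Config}
    {W : Set QWire} (hin : Inputs cfg W K) {w : QWire} (hwW : w ∉ W) (hw : w.1 ≠ .work) :
    ∃ D : Circuit, Circuit.time D ≤ 2 * t + 1 ∧ Circuit.Changes W {w} D ∧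
      ∀ x, Circuit.run (mem x) D (Finsupp.single (cfg x) 1) =
        Finsupp.single ((cfg x).setQ w ((cfg x).q w ^^ f x)) 1 := by
  obtain ⟨D, nb, nr, h1, h2, h3⟩ := h.compile hin
  obtain ⟨a, ha, hf⟩ := h3 _ rfl
  have haw : a ≠ w := by rintro rfl; exact ha.or_work.elim hwW hw
  -- Compute, copy, uncompute; hence the cost 2t+1.
  refine ⟨D ++ [.cnot a w haw] ++ Circuit.inverse D, ?_, ?_, fun x => ?_⟩
  · rw [Circuit.time_append, Circuit.time_append, Circuit.time_inverse]
    simp only [Circuit.time, List.map_cons, List.map_nil, List.sum_cons, List.sum_nil,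
      Gate.cost] at h2 ⊢
    omega
  · refine (h1.changes.append ?_).append h1.changes.inverse
    intro g hg
    rw [List.mem_singleton.1 hg]
    refine ⟨fun w' hw' => Or.inl (by simpa [Gate.targets] using hw'), fun w' hw' => ?_⟩
    rcases Finset.mem_insert.1 hw' with rfl | hw'
    · exact ha.or_work.imp_left Or.inl
    · exact Or.inl (Or.inr (Finset.mem_singleton.1 hw'))
  · rw [Circuit.run_append, Circuit.run_append, Circuit.run_of_classical _ fun g hg => (h1 g hg).1,
      Circuit.run_cons, Circuit.run_nil, Gate.apply_single, one_smul]
    have hcq : (Circuit.cact (mem x) D (cfg x)).q w = (cfg x).q w :=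
      Circuit.cact_q_of_notMem_targets _ (fun g hg h => hw ((h1 g hg).2.1 w h)) _
    simp only [Gate.act]
    rw [hcq, hf x, Circuit.run_inverse_setQ _ h1 hwW hw]

/-- A qubit can be rotated by a computed real number. -/
theorem exists_rotate_circuit {f : X → ℝ} (h : Comp mem K {.real f} t) {cfg : X → Config}
    {W : Set QWire} (hin : Inputs cfg W K) {w : QWire} (hwW : w ∉ W) (hw : w.1 ≠ .work) :
    ∃ D : Circuit, Circuit.time D ≤ 2 * t + 1 ∧ Circuit.Changes W {w} D ∧
      ∀ x, Circuit.run (mem x) D (Finsupp.single (cfg x) 1) =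
        ∑ v : Bool, ((rotEntry false (f x) v ((cfg x).q w) : ℝ) : ℂ) •
          Finsupp.single ((cfg x).setQ w v) 1 := by
  obtain ⟨D, nb, nr, h1, h2, h3⟩ := h.compile hin
  obtain ⟨i, hi, hf⟩ := h3 _ rfl
  refine ⟨D ++ [.rotate false i w] ++ Circuit.inverse D, ?_, ?_, fun x => ?_⟩
  · rw [Circuit.time_append, Circuit.time_append, Circuit.time_inverse]
    simp only [Circuit.time, List.map_cons, List.map_nil, List.sum_cons, List.sum_nil,
      Gate.cost] at h2 ⊢
    omega
  · refine (h1.changes.append ?_).append h1.changes.inverse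
    intro g hg
    rw [List.mem_singleton.1 hg]
    exact ⟨fun w' hw' => Or.inl (by simpa [Gate.targets] using hw'),
      fun w' hw' => Or.inl (Or.inr (by simpa [Gate.qubits] using hw'))⟩
  · rw [Circuit.run_append, Circuit.run_append, Circuit.run_of_classical _ fun g hg => (h1 g hg).1,
      Circuit.run_cons, Circuit.run_nil, Gate.apply_single, one_smul]
    have hcq : (Circuit.cact (mem x) D (cfg x)).q w = (cfg x).q w :=
      Circuit.cact_q_of_notMem_targets _ (fun g hg h => hw ((h1 g hg).2.1 w h)) _
    simp only [Gate.act]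
    rw [hcq, hf x, Circuit.run_sum]
    refine Finset.sum_congr rfl fun v _ => ?_
    rw [← Circuit.run_inverse_setQ (mem x) h1 hwW hw (cfg x) v, ← Circuit.run_smul]
    simp

end

section

/-! ## A library of straight-line computations -/

variable {X Y : Type} {mem : X → Memory} {K K' A B : Set (Fn X)} {s t u : ℕ}

/-- The real quantity `f` can be computed from `K` at cost `t`. -/
def CompR (mem : X → Memory) (K : Set (Fn X)) (f : X → ℝ) (t : ℕ) : Prop :=
  Comp mem K {.real f} t

open Classical in
/-- The truth value of `p` can be computed from `K` at cost `t`. -/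
def CompP (mem : X → Memory) (K : Set (Fn X)) (p : X → Prop) (t : ℕ) : Prop :=
  Comp mem K {.bit fun x => decide (p x)} t

theorem CompR.congr {f g : X → ℝ} (h : CompR mem K f t) (hfg : ∀ x, g x = f x) :
    CompR mem K g t := by
  rwa [funext hfg]

theorem CompP.congr {p q : X → Prop} (h : CompP mem K p t) (hpq : ∀ x, q x ↔ p x) :
    CompP mem K q t := by
  rwa [funext fun x => propext (hpq x)]

theorem CompR.mono {f : X → ℝ} (h : CompR mem K f s) (hst : s ≤ t) : CompR mem K f t :=
  Comp.mono_cost h hst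

theorem CompP.mono {p : X → Prop} (h : CompP mem K p s) (hst : s ≤ t) : CompP mem K p t :=
  Comp.mono_cost h hst

theorem CompR.weaken {f : X → ℝ} (h : CompR mem K f s) (hK : K ⊆ K') : CompR mem K' f s :=
  Comp.weaken h hK

theorem CompP.weaken {p : X → Prop} (h : CompP mem K p s) (hK : K ⊆ K') : CompP mem K' p s :=
  Comp.weaken h hK

theorem CompR.of_mem {f : X → ℝ} (h : .real f ∈ K) : CompR mem K f 0 :=
  Comp.subset (by simpa using h) 0

theorem CompP.of_mem {f : X → Bool} (h : .bit f ∈ K) : CompP mem K (fun x => f x = true) 0 := by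
  refine Comp.subset ?_ 0
  simpa using h

theorem CompP.to_bit {f : X → Bool} (h : CompP mem K (fun x => f x = true) t) :
    Comp mem K {.bit f} t := by
  simpa [CompP] using h

theorem CompR.const (v : ℝ) : CompR mem K (fun _ => v) 1 := Comp.ofStep (.const v)

theorem CompR.step₂ {f g h : X → ℝ} {c : ℕ} (hf : CompR mem K f s) (hg : CompR mem K g t)
    (H : ∀ L : Set (Fn X), .real f ∈ L → .real g ∈ L → Step mem L (.real h) c) :
    CompR mem K h (s + t + c) :=
  (Comp.union hf hg).trans (Comp.ofStep (H _ (by simp) (by simp)))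

theorem CompR.add {f g : X → ℝ} (hf : CompR mem K f s) (hg : CompR mem K g t) :
    CompR mem K (fun x => f x + g x) (s + t + 2) := hf.step₂ hg fun _ h h' => .add h h'

theorem CompR.sub {f g : X → ℝ} (hf : CompR mem K f s) (hg : CompR mem K g t) :
    CompR mem K (fun x => f x - g x) (s + t + 2) := hf.step₂ hg fun _ h h' => .sub h h'

theorem CompR.mul {f g : X → ℝ} (hf : CompR mem K f s) (hg : CompR mem K g t) :
    CompR mem K (fun x => f x * g x) (s + t + 1) := hf.step₂ hg fun _ h h' => .arith .mul h h'

theorem CompR.div {f g : X → ℝ} (hf : CompR mem K f s) (hg : CompR mem K g t) :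
    CompR mem K (fun x => f x / g x) (s + t + 1) := hf.step₂ hg fun _ h h' => .arith .div h h'

theorem CompR.sqrt {f : X → ℝ} (hf : CompR mem K f s) :
    CompR mem K (fun x => Real.sqrt (f x)) (s + 1) :=
  Comp.trans hf (Comp.ofStep (.arith .sqrt (f := f) (g := f) (by simp) (by simp)))

theorem CompP.le {f g : X → ℝ} (hf : CompR mem K f s) (hg : CompR mem K g t) :
    CompP mem K (fun x => f x ≤ g x) (s + t + 1) :=
  (Comp.union hf hg).trans (Comp.ofStep (Step.le (by simp) (by simp)))

open Classical in
theorem CompP.ind {p : X → Prop} (hp : CompP mem K p t) :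
    CompR mem K (fun x => if p x then 1 else 0) (t + 1) := by
  have := Comp.trans hp (Comp.ofStep (.ofBit (f := fun x => decide (p x)) (by simp)))
  simpa [CompR] using this

/-- Only comparisons and memory queries produce bits, so logical connectives are evaluated by
turning truth values into the reals 0 and 1, combining these, and comparing. -/
theorem CompP.not {p : X → Prop} (hp : CompP mem K p t) : CompP mem K (fun x => ¬ p x) (t + 3) :=
  (CompP.le hp.ind (.const 0)).congr fun x => by by_cases h : p x <;> simp [h]

theorem CompP.and {p q : X → Prop} (hp : CompP mem K p s) (hq : CompP mem K q t) :
    CompP mem K (fun x => p x ∧ q x) (s + t + 5) :=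
  ((CompP.le (.const 1) (hp.ind.mul hq.ind)).congr fun x => by
    by_cases h : p x <;> by_cases h' : q x <;> simp [h, h']).mono (by omega)

theorem CompP.or {p q : X → Prop} (hp : CompP mem K p s) (hq : CompP mem K q t) :
    CompP mem K (fun x => p x ∨ q x) (s + t + 6) :=
  ((CompP.le (.const 1) (hp.ind.add hq.ind)).congr fun x => by
    by_cases h : p x <;> by_cases h' : q x <;> simp [h, h']).mono (by omega)

theorem CompP.lt {f g : X → ℝ} (hf : CompR mem K f s) (hg : CompR mem K g t) :
    CompP mem K (fun x => f x < g x) (s + t + 4) :=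
  ((CompP.le hg hf).not.congr fun x => by simp).mono (by omega)

theorem CompR.letIn {f g : X → ℝ} (hf : CompR mem K f s)
    (hg : CompR mem (K ∪ {.real f}) g t) : CompR mem K g (s + t) := Comp.trans hf hg

theorem CompP.eq {f g : X → ℝ} (hf : CompR mem K f s) (hg : CompR mem K g t) :
    CompP mem K (fun x => f x = g x) (s + t + 7) := by
  have h1 : CompP mem (K ∪ ({.real f} ∪ {.real g})) (fun x => f x ≤ g x ∧ g x ≤ f x) 7 :=
    (CompP.le (.of_mem (by simp)) (.of_mem (by simp))).and
      (CompP.le (.of_mem (by simp)) (.of_mem (by simp)))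
  exact CompP.congr (Comp.trans (Comp.union hf hg) h1) fun x => le_antisymm_iff

open Classical in
-- The value is g + 1_p·(f - g). The quantity `g` occurs twice and is therefore computed first and
-- stored, so that its cost enters once.
theorem CompR.ite {p : X → Prop} {f g : X → ℝ} (hp : CompP mem K p u) (hf : CompR mem K f s)
    (hg : CompR mem K g t) : CompR mem K (fun x => if p x then f x else g x) (u + s + t + 10) := by
  have h2 : CompR mem (K ∪ {.real g}) (fun x => if p x then f x else g x) (u + s + 8) := by
    refine CompR.mono (CompR.congr (CompR.add (CompR.of_mem (f := g) (by simp))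
      ((hp.weaken Set.subset_union_left).ind.mul ((hf.weaken Set.subset_union_left).sub
        (CompR.of_mem (f := g) (by simp))))) fun x => ?_) (by omega)
    by_cases h : p x <;> simp [h]
  exact (hg.letIn h2).mono (by omega)

theorem Comp.biUnion {ι : Type*} (I : Finset ι) {A : ι → Set (Fn X)}
    (h : ∀ i ∈ I, Comp mem K (A i) t) : Comp mem K (⋃ i ∈ I, A i) (I.card * t) := by
  classical
  induction I using Finset.induction_on with
  | empty => exact Comp.subset (by simp) _
  | insert i I hi ih =>
    rw [Finset.set_biUnion_insert, Finset.card_insert_of_notMem hi]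
    exact ((h i (by simp)).union (ih fun j hj => h j (by simp [hj]))).mono_cost
      (by rw [add_mul]; omega)

theorem CompR.sum {ι : Type*} (I : Finset ι) {f : ι → X → ℝ}
    (h : ∀ i ∈ I, CompR mem K (f i) t) :
    CompR mem K (fun x => ∑ i ∈ I, f i x) (I.card * (t + 2) + 1) := by
  classical
  induction I using Finset.induction_on with
  | empty => simpa using CompR.const (K := K) (mem := mem) 0
  | insert i I hi ih =>
    refine CompR.mono (CompR.congr ((h i (by simp)).add (ih fun j hj => h j (by simp [hj])))
      fun x => Finset.sum_insert hi) ?_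
    rw [Finset.card_insert_of_notMem hi, add_mul]
    omega

open Classical in
theorem CompR.card {ι : Type*} (I : Finset ι) {p : ι → X → Prop}
    (h : ∀ i ∈ I, CompP mem K (p i) t) :
    CompR mem K (fun x => ((I.filter fun i => p i x).card : ℝ)) (I.card * (t + 3) + 1) :=
  (CompR.sum I fun i hi => (h i hi).ind).congr fun x => by simp

theorem CompP.bex {ι : Type*} (I : Finset ι) {p : ι → X → Prop}
    (h : ∀ i ∈ I, CompP mem K (p i) t) :
    CompP mem K (fun x => ∃ i ∈ I, p i x) (I.card * (t + 3) + 3) := by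
  classical
  refine ((CompP.le (.const 1) (CompR.card I h)).congr fun x => ?_).mono (by omega)
  rw [← Nat.cast_one, Nat.cast_le, Nat.one_le_iff_ne_zero, ← Nat.pos_iff_ne_zero,
    Finset.card_pos, Finset.filter_nonempty_iff]

theorem CompP.ball {ι : Type*} (I : Finset ι) {p : ι → X → Prop}
    (h : ∀ i ∈ I, CompP mem K (p i) t) :
    CompP mem K (fun x => ∀ i ∈ I, p i x) (I.card * (t + 6) + 6) :=
  ((CompP.bex I fun i hi => (h i hi).not).not.congr fun x => by simp).mono
    (by rw [show t + 3 + 3 = t + 6 from rfl])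

/-! ### Natural numbers given by their digits -/

/-- The binary digits of weight below `2 ^ B`. -/
def bitsOf (B : ℕ) (k : X → ℕ) : Set (Fn X) := {f | ∃ j < B, f = .bit fun x => (k x).testBit j}

theorem bitsOf_eq_biUnion (B : ℕ) (k : X → ℕ) :
    bitsOf B k = ⋃ j ∈ Finset.range B, {.bit fun x => (k x).testBit j} := by
  ext f; simp [bitsOf]

theorem bitsOf_comp (π : Y → X) (B : ℕ) (k : X → ℕ) :
    Fn.comp π '' bitsOf B k = bitsOf B (k ∘ π) := by
  ext f
  constructor
  · rintro ⟨_, ⟨j, hj, rfl⟩, rfl⟩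
    exact ⟨j, hj, rfl⟩
  · rintro ⟨j, hj, rfl⟩
    exact ⟨_, ⟨j, hj, rfl⟩, rfl⟩

theorem Comp.bitsOf {B : ℕ} {k : X → ℕ}
    (h : ∀ j < B, CompP mem K (fun x => (k x).testBit j = true) t) :
    Comp mem K (bitsOf B k) (B * t) := by
  rw [bitsOf_eq_biUnion]
  have := Comp.biUnion (Finset.range B) (A := fun j => {.bit fun x => (k x).testBit j})
    fun j hj => (h j (Finset.mem_range.1 hj)).to_bit
  rwa [Finset.card_range] at this

theorem CompP.const (p : Prop) : CompP mem K (fun _ => p) 3 := by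
  by_cases h : p
  · exact (CompP.le (.const 0) (.const 0)).congr fun x => by simp [h]
  · exact (CompP.le (.const 1) (.const 0)).congr fun x => by simp [h]

theorem Comp.bitsOf_const (B k : ℕ) : Comp mem K (TupleSieve.bitsOf B fun _ => k) (B * 3) :=
  Comp.bitsOf fun _ _ => CompP.const _

theorem bitsVal_testBit (B k : ℕ) :
    bitsVal ((List.range B).map k.testBit) = k % 2 ^ B := by
  induction B generalizing k with
  | zero => simp [bitsVal, Nat.mod_one]
  | succ B ih =>
    rw [List.range_succ_eq_map, List.map_cons, List.map_map, bitsVal]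
    have : (k.testBit ∘ Nat.succ) = (k / 2).testBit := by
      funext i; simp [Nat.testBit_succ]
    rw [this, ih, Nat.testBit_zero, pow_succ', Nat.mod_mul]
    rcases Nat.mod_two_eq_zero_or_one k with h | h <;> simp [h]

/-- The digits of `k`, as a list of quantities. -/
def digits (B : ℕ) (k : X → ℕ) : List (X → Bool) :=
  (List.range B).map fun j x => (k x).testBit j

theorem addr_digits {B : ℕ} {k : X → ℕ} {x : X} (h : k x < 2 ^ B) : addr (digits B k) x = k x := by
  rw [addr, digits, List.map_map]
  exact (bitsVal_testBit B (k x)).trans (Nat.mod_eq_of_lt h)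

theorem mem_digits {B : ℕ} {k : X → ℕ} (h : bitsOf B k ⊆ K) :
    ∀ f ∈ digits B k, .bit f ∈ K := by
  intro f hf
  obtain ⟨j, hj, rfl⟩ := List.mem_map.1 hf
  exact h ⟨j, List.mem_range.1 hj, rfl⟩

theorem Comp.queryBit (R : BitArray) {B : ℕ} {k₁ k₂ k₃ : X → ℕ} {t₁ t₂ t₃ : ℕ}
    (h₁ : Comp mem K (TupleSieve.bitsOf B k₁) t₁) (h₂ : Comp mem K (TupleSieve.bitsOf B k₂) t₂)
    (h₃ : Comp mem K (TupleSieve.bitsOf B k₃) t₃) (b₁ : ∀ x, k₁ x < 2 ^ B)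
    (b₂ : ∀ x, k₂ x < 2 ^ B) (b₃ : ∀ x, k₃ x < 2 ^ B) :
    CompP mem K (fun x => (mem x).bit R (k₁ x) (k₂ x) (k₃ x) = true)
      (t₁ + t₂ + t₃ + (1 + 3 * B)) := by
  have := ((h₁.union h₂).union h₃).trans (Comp.ofStep (Step.queryBit R (digits B k₁) (digits B k₂)
    (digits B k₃) (by
      intro f hf
      simp only [List.mem_append] at hf
      rcases hf with (h | h) | h
      · exact mem_digits (by intro g hg; simp [hg]) f h
      · exact mem_digits (by intro g hg; simp [hg]) f h
      · exact mem_digits (by intro g hg; simp [hg]) f h)))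
  simp only [addr_digits, b₁, b₂, b₃] at this
  rw [CompP]
  simp only [Bool.decide_eq_true]
  refine this.mono_cost ?_
  simp [digits]; omega

theorem CompR.queryReal (R : RealArray) {B : ℕ} {k₁ k₂ k₃ : X → ℕ} {t₁ t₂ t₃ : ℕ}
    (h₁ : Comp mem K (TupleSieve.bitsOf B k₁) t₁) (h₂ : Comp mem K (TupleSieve.bitsOf B k₂) t₂)
    (h₃ : Comp mem K (TupleSieve.bitsOf B k₃) t₃) (b₁ : ∀ x, k₁ x < 2 ^ B)
    (b₂ : ∀ x, k₂ x < 2 ^ B) (b₃ : ∀ x, k₃ x < 2 ^ B) :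
    CompR mem K (fun x => (mem x).real R (k₁ x) (k₂ x) (k₃ x))
      (t₁ + t₂ + t₃ + (1 + 3 * B)) := by
  have := ((h₁.union h₂).union h₃).trans (Comp.ofStep (Step.queryReal R (digits B k₁) (digits B k₂)
    (digits B k₃) (by
      intro f hf
      simp only [List.mem_append] at hf
      rcases hf with (h | h) | h
      · exact mem_digits (by intro g hg; simp [hg]) f h
      · exact mem_digits (by intro g hg; simp [hg]) f h
      · exact mem_digits (by intro g hg; simp [hg]) f h)))
  simp only [addr_digits, b₁, b₂, b₃] at this
  refine this.mono_cost ?_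
  simp [digits]; omega

theorem sum_testBit (B k : ℕ) (hk : k < 2 ^ B) :
    (k : ℝ) = ∑ j ∈ Finset.range B, 2 ^ j * (if k.testBit j = true then 1 else 0) := by
  induction B generalizing k with
  | zero => simp at hk; simp [hk]
  | succ B ih =>
    rw [Finset.sum_range_succ']
    have h := ih (k / 2) (by rw [pow_succ'] at hk; omega)
    simp only [Nat.testBit_succ, pow_succ', mul_assoc]
    rw [← Finset.mul_sum, ← h, Nat.testBit_zero]
    have h2 : (k : ℝ) = ((2 * (k / 2) + k % 2 : ℕ) : ℝ) := by rw [Nat.div_add_mod]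
    rw [h2]
    push_cast
    rcases Nat.mod_two_eq_zero_or_one k with h | h <;> simp [h]

/-- A natural number as a real quantity, from its digits. -/
theorem CompR.ofDigits {B : ℕ} {k : X → ℕ} (hk : ∀ x, k x < 2 ^ B)
    (h : ∀ j < B, CompP mem K (fun x => (k x).testBit j = true) t) :
    CompR mem K (fun x => (k x : ℝ)) (B * (t + 5) + 1) := by
  classical
  refine CompR.mono (CompR.congr (CompR.sum (Finset.range B) fun j hj =>
    (CompR.const ((2 : ℝ) ^ j)).mul (h j (Finset.mem_range.1 hj)).ind) fun x =>
      (sum_testBit B (k x) (hk x)).trans ?_) (le_of_eq ?_)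
  · exact Finset.sum_congr rfl fun j _ => by congr 1; split_ifs <;> rfl
  · rw [Finset.card_range]; ring

theorem CompR.ofBitsOf {B : ℕ} {k : X → ℕ} (hk : ∀ x, k x < 2 ^ B) (h : bitsOf B k ⊆ K) :
    CompR mem K (fun x => (k x : ℝ)) (B * 5 + 1) :=
  CompR.mono (CompR.ofDigits (t := 0) hk fun j hj => CompP.of_mem (h ⟨j, hj, rfl⟩)) (by simp)

/-- Digit j of c is one exactly when c exceeds the number with the same higher digits, digit j zero
and all lower digits one. So a comparison with c reveals the digit once the higher digits are known.
-/
theorem testBit_eq_decide_lt (c j : ℕ) :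
    c.testBit j = decide (2 ^ (j + 1) * (c / 2 ^ (j + 1)) + (2 ^ j - 1) < c) := by
  rw [Nat.testBit_eq_decide_div_mod_eq]
  have h1 : c / 2 ^ (j + 1) = c / 2 ^ j / 2 := by rw [Nat.div_div_eq_div_mul, pow_succ]
  have h2 := Nat.div_add_mod c (2 ^ j)
  have h3 := Nat.mod_lt c (Nat.two_pow_pos j)
  rw [h1, pow_succ]
  generalize c / 2 ^ j = v at *
  generalize c % 2 ^ j = w at *
  generalize 2 ^ j = P at *
  rw [decide_eq_decide]
  have h4 := Nat.div_add_mod v 2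
  rcases Nat.mod_two_eq_zero_or_one v with h | h
  · rw [h] at h4
    have : P * v = P * 2 * (v / 2) := by rw [mul_assoc]; congr 1; omega
    omega
  · rw [h] at h4
    have : P * v = P * 2 * (v / 2) + P := by
      calc P * v = P * (2 * (v / 2) + 1) := by rw [h4]
        _ = _ := by ring
    omega

theorem testBit_search (c j i : ℕ) :
    (2 ^ (j + 1) * (c / 2 ^ (j + 1)) + (2 ^ j - 1)).testBit i =
      if i ≤ j then decide (i < j) else c.testBit i := by
  rw [Nat.testBit_two_pow_mul_add _ (by
    have := Nat.two_pow_pos j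
    rw [pow_succ]; omega)]
  by_cases h : i < j + 1
  · rw [if_pos h, if_pos (by omega), Nat.testBit_two_pow_sub_one]
  · rw [if_neg h, if_neg (by omega), Nat.testBit_div_two_pow]
    congr 1; omega

theorem image_comp_fst (π : Y → X) {Z : Type} (g : Y → Z) (K : Set (Fn X)) :
    Fn.comp (fun y => (π y, g y)) '' (Fn.comp Prod.fst '' K) = Fn.comp π '' K := by
  rw [Set.image_image]
  congr 1
  funext f
  cases f <;> rfl

theorem Fn.comp_id_image (K : Set (Fn X)) : Fn.comp id '' K = K := by
  have : (Fn.comp id : Fn X → Fn X) = id := by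
    funext f; cases f <;> rfl
  rw [this, Set.image_id]

/-- Binary search for the number `c` of addresses with a monotone property. -/
theorem Comp.search {B : ℕ} {c : X → ℕ} (hc : ∀ x, c x < 2 ^ B)
    (h : CompP (X := X × Fin (2 ^ B)) (mem ∘ Prod.fst)
      (Fn.comp Prod.fst '' K ∪ TupleSieve.bitsOf B fun p => p.2.val) (fun p => p.2.val < c p.1) t) :
    Comp mem K (TupleSieve.bitsOf B c) (B * (t + 3 * B)) := by
  -- Digits are found from the most significant downwards; after j stages the top j digits are
  -- known.
  have key : ∀ j ≤ B, Comp mem K {f | ∃ i, B - j ≤ i ∧ i < B ∧ f = .bit fun x => (c x).testBit i}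
      (j * (t + 3 * B)) := by
    intro j
    induction j with
    | zero =>
      intro _
      refine Comp.subset ?_ _
      rintro f ⟨i, h1, h2, -⟩
      omega
    | succ j ih =>
      intro hj
      set e := B - (j + 1) with he
      have hprev := ih (by omega)
      set L := {f : Fn X | ∃ i, B - j ≤ i ∧ i < B ∧ f = .bit fun x => (c x).testBit i}
      -- The probe address uses only digits already found and constants.
      let ad : X → ℕ := fun x => 2 ^ (e + 1) * (c x / 2 ^ (e + 1)) + (2 ^ e - 1)
      have had : ∀ x, ad x < 2 ^ B := by
        intro x
        by_contra hcon
        push Not at hcon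
        have h1 : c x / 2 ^ (e + 1) < 2 ^ (B - (e + 1)) := by
          rw [Nat.div_lt_iff_lt_mul (Nat.two_pow_pos _), ← pow_add]
          convert hc x using 2; omega
        have h2 : 2 ^ B = 2 ^ (e + 1) * 2 ^ (B - (e + 1)) := by
          rw [← pow_add]; congr 1; omega
        have h3 : 2 ^ (e + 1) * (c x / 2 ^ (e + 1) + 1) ≤ 2 ^ (e + 1) * 2 ^ (B - (e + 1)) :=
          Nat.mul_le_mul_left _ h1
        have h4 : 2 ^ e - 1 < 2 ^ (e + 1) := by
          have := Nat.two_pow_pos e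
          rw [pow_succ]; omega
        have h5 : ad x < 2 ^ (e + 1) * (c x / 2 ^ (e + 1) + 1) := by
          rw [mul_add, mul_one]
          exact Nat.add_lt_add_left h4 _
        omega
      have hbits : Comp mem (K ∪ L) (TupleSieve.bitsOf B ad) (B * 3) := by
        refine Comp.bitsOf fun i hi => ?_
        by_cases hie : i ≤ e
        · exact (CompP.const (i < e)).congr fun x => by
            simp only [ad, testBit_search, if_pos hie, decide_eq_true_eq]
        · refine CompP.mono (CompP.congr (CompP.of_mem (f := fun x => (c x).testBit i)
            (Or.inr ⟨i, by omega, hi, rfl⟩)) fun x => ?_) (Nat.zero_le 3)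
          simp only [ad, testBit_search, if_neg hie]
      have hpull := Comp.pullback (fun x => (x, (⟨ad x, had x⟩ : Fin (2 ^ B)))) h
      rw [Set.image_union, image_comp_fst (fun x : X => x) (fun x => (⟨ad x, had x⟩ : Fin (2 ^ B))),
        bitsOf_comp, show (fun x : X => x) = id from rfl, Fn.comp_id_image,
        Set.image_singleton] at hpull
      have hbit : Comp mem (K ∪ L) {.bit fun x => (c x).testBit e} (B * 3 + t) := by
        refine hbits.trans (hpull.mono ?_ ?_ le_rfl)
        · exact Set.union_subset_union_left _ Set.subset_union_left
        · rw [Set.singleton_subset_iff, Set.mem_singleton_iff]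
          simp only [Fn.comp, Fn.bit.injEq]
          funext x
          simp only [Function.comp, testBit_eq_decide_lt, ad]
          congr
      refine (hprev.union_trans hbit).mono subset_rfl ?_ (by rw [add_mul j 1]; omega)
      rintro f ⟨i, h1, h2, rfl⟩
      by_cases hi : i = e
      · subst hi; exact Or.inr rfl
      · exact Or.inl ⟨i, by omega, h2, rfl⟩
  refine (key B le_rfl).mono subset_rfl ?_ le_rfl
  rintro f ⟨i, hi, rfl⟩
  exact ⟨i, by omega, hi, rfl⟩

/-! ### Rank functions -/

/-- The number of elements of `S` below `t`. -/
def rank (S : Finset ℕ) (t : ℕ) : ℕ := (S.filter fun i => i < t).card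

/-- The rank function of the set `S x` can be computed at cost `t`. -/
def RankComp (mem : X → Memory) (K : Set (Fn X)) (S : X → Finset ℕ) (t : ℕ) : Prop :=
  CompR (X := X × ℕ) (mem ∘ Prod.fst) (Fn.comp Prod.fst '' K ∪ {.real fun p => (p.2 : ℝ)})
    (fun p => (rank (S p.1) p.2 : ℝ)) t

theorem RankComp.at {S : X → Finset ℕ} (h : RankComp mem K S t) (π : Y → X) (n : Y → ℕ)
    {L : Set (Fn Y)} (hL : Fn.comp π '' K ⊆ L) (hn : CompR (mem ∘ π) L (fun y => (n y : ℝ)) s) :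
    CompR (mem ∘ π) L (fun y => (rank (S (π y)) (n y) : ℝ)) (s + t) := by
  have hpull := Comp.pullback (fun y => (π y, n y)) h
  rw [Set.image_union, image_comp_fst, Set.image_singleton, Set.image_singleton] at hpull
  exact Comp.trans hn (hpull.weaken (Set.union_subset_union_left _ hL))

end

section

/-! ## Preparation of uniform superpositions -/

variable {X Y : Type} {mem : X → Memory} {K K' A B : Set (Fn X)} {s t u : ℕ}

/-- Write the number `v` into register `ρ`. -/
def Config.setReg (s : Config) (ρ : Reg) (v : ℕ) : Config :=
  ⟨fun w => if w.1 = ρ then v.testBit w.2 else s.q w, s.r⟩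

theorem Config.setReg_zero {s : Config} {ρ : Reg} (h : ∀ k, s.q (ρ, k) = false) :
    s.setReg ρ 0 = s := by
  ext w
  · obtain ⟨ρ', k⟩ := w
    by_cases hρ : ρ' = ρ
    · subst hρ; simp [Config.setReg, h]
    · simp [Config.setReg, hρ]
  · rfl

theorem Config.setReg_setQ (s : Config) (ρ : Reg) (e v : ℕ) (b : Bool) :
    (s.setReg ρ (2 ^ (e + 1) * v)).setQ (ρ, e) b = s.setReg ρ (2 ^ e * (2 * v + b.toNat)) := by
  ext w
  · obtain ⟨ρ', k⟩ := w
    by_cases hρ : ρ' = ρ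
    · subst hρ
      by_cases hk : k = e
      · subst hk
        rw [Config.setQ_q_self]
        simp only [Config.setReg, if_true, Nat.testBit_two_pow_mul, le_refl, decide_true,
          Nat.sub_self, Bool.true_and, Nat.testBit_zero]
        cases b <;> simp
      · rw [Config.setQ_q_ne _ _ (by simp [hk])]
        simp only [Config.setReg, if_true, Nat.testBit_two_pow_mul]
        rcases lt_or_gt_of_ne hk with h | h
        · have h1 : ¬ e + 1 ≤ k := by omega
          have h2 : ¬ e ≤ k := by omega
          simp [h1, h2]
        · have h1 : e + 1 ≤ k := by omega
          have h2 : e ≤ k := by omega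
          obtain ⟨m, rfl⟩ := Nat.exists_eq_add_of_lt h
          have e1 : e + m + 1 - (e + 1) = m := by omega
          have e2 : e + m + 1 - e = m + 1 := by omega
          have e3 : (2 * v + b.toNat) / 2 = v := by cases b <;> (simp; try omega)
          simp [h1, h2, e1, e2, Nat.testBit_succ, e3]
    · rw [Config.setQ_q_ne _ _ (by simp [hρ])]
      simp [Config.setReg, hρ]
  · rfl

/-- The number of elements of `S` with binary prefix `v` above the last `e` digits. -/
def prefixCount (S : Finset ℕ) (e v : ℕ) : ℕ := (S.filter fun i => i / 2 ^ e = v).card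

/-- The numbers with prefix v form the interval from 2^e·v to 2^e·(v+1), so the count is a
difference of two ranks. This is how the rotation angles below become computable. -/
theorem rank_add_prefixCount (S : Finset ℕ) (e v : ℕ) :
    rank S (2 ^ e * (v + 1)) = rank S (2 ^ e * v) + prefixCount S e v := by
  classical
  rw [rank, rank, prefixCount, ← Finset.card_union_of_disjoint]
  · congr 1
    ext i
    simp only [Finset.mem_filter, Finset.mem_union, ← and_or_left]
    refine and_congr_right fun _ => ?_
    have h := Nat.div_lt_iff_lt_mul (x := i) (y := v + 1) (Nat.two_pow_pos e)
    have h' := Nat.div_lt_iff_lt_mul (x := i) (y := v) (Nat.two_pow_pos e)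
    rw [mul_comm (2 ^ e) (v + 1), mul_comm (2 ^ e) v, ← h, ← h']
    omega
  · rw [Finset.disjoint_filter]
    intro i _ h1 h2
    have h' := Nat.div_lt_iff_lt_mul (x := i) (y := v) (Nat.two_pow_pos e)
    rw [mul_comm, ← h'] at h1
    omega

theorem prefixCount_succ (S : Finset ℕ) (e v : ℕ) :
    prefixCount S (e + 1) v = prefixCount S e (2 * v) + prefixCount S e (2 * v + 1) := by
  classical
  rw [prefixCount, prefixCount, prefixCount, ← Finset.card_union_of_disjoint]
  · congr 1
    ext i
    simp only [Finset.mem_filter, Finset.mem_union, ← and_or_left]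
    refine and_congr_right fun _ => ?_
    rw [pow_succ, ← Nat.div_div_eq_div_mul]
    omega
  · rw [Finset.disjoint_filter]
    intro i _ h1 h2
    omega

theorem sum_range_two_mul {M : Type*} [AddCommMonoid M] (f : ℕ → M) (n : ℕ) :
    ∑ i ∈ Finset.range (2 * n), f i = ∑ v ∈ Finset.range n, (f (2 * v) + f (2 * v + 1)) := by
  induction n with
  | zero => simp
  | succ n ih =>
    rw [show 2 * (n + 1) = 2 * n + 1 + 1 from by ring, Finset.sum_range_succ, Finset.sum_range_succ,
      Finset.sum_range_succ, ih, add_assoc]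

/-- One digit of the preparation: the qubit of weight `2 ^ e` is rotated according to the numbers of
elements of `S` with either value of that digit. -/
theorem exists_prepare_digit {S : X → Finset ℕ} (hrank : RankComp mem K S t) {cfg : X → Config}
    {W : Set QWire} (hin : Inputs cfg W K) {ρ : Reg} (hρ : ρ ≠ .work) (hWρ : ∀ w ∈ W, w.1 ≠ ρ)
    {B e : ℕ} (he : e < B) :
    ∃ D : Circuit, Circuit.time D ≤ 8 * t + 10 * B + 200 ∧ Circuit.Changes W {w | w.1 = ρ} D ∧
      ∀ x, ∀ v < 2 ^ (B - (e + 1)), Circuit.run (mem x) D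
        (Finsupp.single ((cfg x).setReg ρ (2 ^ (e + 1) * v)) 1) =
        ((Real.sqrt (1 - prefixCount (S x) e (2 * v + 1) / prefixCount (S x) (e + 1) v) : ℝ) : ℂ) •
          Finsupp.single ((cfg x).setReg ρ (2 ^ e * (2 * v))) 1 +
        ((Real.sqrt (prefixCount (S x) e (2 * v + 1) / prefixCount (S x) (e + 1) v) : ℝ) : ℂ) •
          Finsupp.single ((cfg x).setReg ρ (2 ^ e * (2 * v + 1))) 1 := by
  set b := B - (e + 1) with hb
  let cfg' : X × Fin (2 ^ b) → Config := fun p => (cfg p.1).setReg ρ (2 ^ (e + 1) * p.2.val)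
  -- The digits of the register other than number `e` may be read, since the prefix prepared so far
  -- controls the rotation; digit `e` itself is the rotated qubit.
  let W' : Set QWire := W ∪ {w | w.1 = ρ ∧ w.2 ≠ e}
  let L : Set (Fn (X × Fin (2 ^ b))) := Fn.comp Prod.fst '' K ∪ bitsOf b fun p => p.2.val
  have hin' : Inputs cfg' W' L := by
    refine ⟨?_, ?_, ?_⟩
    · rintro w (hw | ⟨hw, -⟩)
      · exact hin.ne_work w hw
      · rwa [hw]
    · intro p
      refine ⟨fun k hk => ?_, fun k hk => (hin.blank p.1).2 k hk⟩
      simp only [cfg', Config.setReg, if_neg hρ.symm]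
      exact (hin.blank p.1).1 k hk
    · rintro f (⟨f, hf, rfl⟩ | ⟨j, hj, rfl⟩)
      · have := hin.held f hf
        cases f with
        | bit f =>
          obtain ⟨w, hw, h⟩ := this
          rcases hw with hw | ⟨k, hk, -⟩
          · refine ⟨w, Or.inl (Or.inl hw), fun p => ?_⟩
            simp only [cfg', Config.setReg, if_neg (hWρ w hw)]
            exact h p.1
          · omega
        | real f => obtain ⟨k, hk, -⟩ := this; omega
      · refine ⟨(ρ, e + 1 + j), Or.inl (Or.inr ⟨rfl, by simp only; omega⟩), fun p => ?_⟩
        simp only [cfg', Config.setReg, if_true, Nat.testBit_two_pow_mul]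
        simp
  have hreal : CompR (mem ∘ Prod.fst) L (fun p => (p.2.val : ℝ)) (b * 5 + 1) :=
    CompR.ofBitsOf (fun p => p.2.isLt) Set.subset_union_right
  have hrk : ∀ c : ℕ, CompR (mem ∘ Prod.fst) (L ∪ {.real fun p => (p.2.val : ℝ)})
      (fun p => (rank (S p.1) (2 ^ (e + 1) * p.2.val + c) : ℝ)) (5 + t) := by
    intro c
    have hv : CompR (mem ∘ Prod.fst) (L ∪ {.real fun p => (p.2.val : ℝ)})
        (fun p => (p.2.val : ℝ)) 0 := CompR.of_mem (Set.mem_union_right _ rfl)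
    have harg : CompR (mem ∘ Prod.fst) (L ∪ {.real fun p => (p.2.val : ℝ)})
        (fun p => ((2 ^ (e + 1) * p.2.val + c : ℕ) : ℝ)) 5 :=
      (((CompR.const ((2 : ℝ) ^ (e + 1))).mul hv).add (CompR.const (c : ℝ))).congr fun p => by
        push_cast; ring
    exact RankComp.at (Y := X × Fin (2 ^ b)) hrank Prod.fst
      (fun p => 2 ^ (e + 1) * p.2.val + c) (fun f hf => Or.inl (Or.inl hf)) harg
  have hp : CompR (mem ∘ Prod.fst) L (fun p => (prefixCount (S p.1) e (2 * p.2.val + 1) : ℝ) /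
      prefixCount (S p.1) (e + 1) p.2.val) (b * 5 + 1 + (4 * (5 + t) + 5)) := by
    -- Both counts are differences of ranks at the start, middle and end of the interval of numbers
    -- with the given prefix.
    refine hreal.letIn (CompR.mono (CompR.congr
      (((hrk (2 * 2 ^ e)).sub (hrk (2 ^ e))).div ((hrk (2 * 2 ^ e)).sub (hrk 0))) fun p => ?_)
      (by omega))
    have e1 := rank_add_prefixCount (S p.1) e (2 * p.2.val + 1)
    have e2 := rank_add_prefixCount (S p.1) (e + 1) p.2.val
    rw [show 2 ^ e * (2 * p.2.val + 1 + 1) = 2 ^ (e + 1) * p.2.val + 2 * 2 ^ e by ring,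
      show 2 ^ e * (2 * p.2.val + 1) = 2 ^ (e + 1) * p.2.val + 2 ^ e by ring] at e1
    rw [show 2 ^ (e + 1) * (p.2.val + 1) = 2 ^ (e + 1) * p.2.val + 2 * 2 ^ e by ring] at e2
    congr 1
    · rw [e1]; push_cast; ring
    · rw [e2, add_zero]; push_cast; ring
  obtain ⟨D, h1, h2, h3⟩ := exists_rotate_circuit hp hin' (w := (ρ, e))
    (by rintro (h | ⟨-, h⟩)
        · exact hWρ _ h rfl
        · exact h rfl) hρ
  refine ⟨D, by omega, h2.mono ?_ ?_, fun x v hv => ?_⟩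
  · rintro w (hw | hw)
    exacts [Or.inl hw, Or.inr hw.1]
  · rintro w rfl; rfl
  · have := h3 (x, ⟨v, hv⟩)
    have hq : (cfg' (x, ⟨v, hv⟩)).q (ρ, e) = false := by
      simp only [cfg', Config.setReg, if_true, Nat.testBit_two_pow_mul]
      simp
    rw [hq] at this
    simp only [Function.comp] at this
    simp only [cfg'] at this
    rw [this, Fintype.sum_bool, Config.setReg_setQ, Config.setReg_setQ, add_comm]
    -- An empty prefix gives 0/0 = 0, an admissible angle.
    have hcond : 0 ≤ (prefixCount (S x) e (2 * v + 1) : ℝ) / prefixCount (S x) (e + 1) v ∧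
        (prefixCount (S x) e (2 * v + 1) : ℝ) / prefixCount (S x) (e + 1) v ≤ 1 := by
      refine ⟨by positivity, div_le_one_of_le₀ ?_ (by positivity)⟩
      rw [prefixCount_succ]; push_cast
      linarith [(Nat.cast_nonneg (prefixCount (S x) e (2 * v)) : (0 : ℝ) ≤ _)]
    simp [rotEntry, hcond]

/-- Induction on the number of leading digits. The squared amplitude of a prefix is the fraction of
`S` below it, and one more digit multiplies it by a conditional probability, so the product
telescopes. -/
theorem exists_prepare_prefix {S : X → Finset ℕ} {B : ℕ} (hS : ∀ x, (S x).Nonempty)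
    (hlt : ∀ x, ∀ i ∈ S x, i < 2 ^ B)
    (hrank : RankComp mem K S t) {cfg : X → Config}
    {W : Set QWire} (hin : Inputs cfg W K) {ρ : Reg} (hρ : ρ ≠ .work) (hWρ : ∀ w ∈ W, w.1 ≠ ρ)
    (hzero : ∀ x k, (cfg x).q (ρ, k) = false) (n : ℕ) (hn : n ≤ B) :
    ∃ D : Circuit, Circuit.time D ≤ n * (8 * t + 10 * B + 200) ∧
      Circuit.Changes W {w | w.1 = ρ} D ∧
      ∀ x, Circuit.run (mem x) D (Finsupp.single (cfg x) 1) =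
        ∑ v ∈ Finset.range (2 ^ n),
          ((Real.sqrt (prefixCount (S x) (B - n) v / (S x).card) : ℝ) : ℂ) •
            Finsupp.single ((cfg x).setReg ρ (2 ^ (B - n) * v)) 1 := by
  induction n with
  | zero =>
    refine ⟨[], by simp [Circuit.time], by simp [Circuit.Changes], fun x => ?_⟩
    have : prefixCount (S x) B 0 = (S x).card := by
      rw [prefixCount, Finset.filter_true_of_mem fun i hi => Nat.div_eq_of_lt (hlt x i hi)]
    have hc : ((S x).card : ℝ) ≠ 0 := by
      exact_mod_cast (Finset.card_pos.2 (hS x)).ne'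
    simp [Circuit.run, this, Config.setReg_zero (hzero x), hc]
  | succ n ih =>
    obtain ⟨D, h1, h2, h3⟩ := ih (by omega)
    set e := B - (n + 1) with he
    have hBn : B - n = e + 1 := by omega
    obtain ⟨E, i1, i2, i3⟩ := exists_prepare_digit hrank hin hρ hWρ (B := B) (e := e)
      (by omega)
    refine ⟨D ++ E, by rw [Circuit.time_append, add_mul n 1]; omega, h2.append i2, fun x => ?_⟩
    rw [Circuit.run_append, h3, Circuit.run_sum, pow_succ', sum_range_two_mul, hBn]
    refine Finset.sum_congr rfl fun v hv => ?_
    rw [Circuit.run_smul, i3 x v (by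
      have := Finset.mem_range.1 hv
      rwa [show B - (e + 1) = n by omega]), smul_add, smul_smul, smul_smul,
      ← Complex.ofReal_mul, ← Complex.ofReal_mul, ← Real.sqrt_mul (by positivity),
      ← Real.sqrt_mul (by positivity)]
    have hsucc := prefixCount_succ (S x) e v
    have hc : (prefixCount (S x) (e + 1) v : ℝ) =
        prefixCount (S x) e (2 * v) + prefixCount (S x) e (2 * v + 1) := by exact_mod_cast hsucc
    have a0 : (0 : ℝ) ≤ prefixCount (S x) e (2 * v) := Nat.cast_nonneg _
    have b0 : (0 : ℝ) ≤ prefixCount (S x) e (2 * v + 1) := Nat.cast_nonneg _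
    congr 3
    · congr 1
      rw [hc]
      -- If no element has the prefix, both sides vanish; otherwise the count cancels.
      rcases eq_or_lt_of_le (add_nonneg a0 b0) with h | h
      · have : (prefixCount (S x) e (2 * v) : ℝ) = 0 := by linarith
        rw [← h, this]; simp
      · field_simp; ring
    · congr 1
      rw [hc]
      rcases eq_or_lt_of_le (add_nonneg a0 b0) with h | h
      · have : (prefixCount (S x) e (2 * v + 1) : ℝ) = 0 := by linarith
        rw [← h, this]; simp
      · field_simp

/-- A uniform superposition over a nonempty set can be prepared if the rank function of the set can
be computed. -/
theorem exists_prepare {S : X → Finset ℕ} {B : ℕ} (hS : ∀ x, (S x).Nonempty)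
    (hlt : ∀ x, ∀ i ∈ S x, i < 2 ^ B)
    (hrank : RankComp mem K S t) {cfg : X → Config}
    {W : Set QWire} (hin : Inputs cfg W K) {ρ : Reg} (hρ : ρ ≠ .work) (hWρ : ∀ w ∈ W, w.1 ≠ ρ)
    (hzero : ∀ x k, (cfg x).q (ρ, k) = false) :
    ∃ D : Circuit, Circuit.time D ≤ B * (8 * t + 10 * B + 200) ∧
      Circuit.Changes W {w | w.1 = ρ} D ∧
      ∀ x, Circuit.run (mem x) D (Finsupp.single (cfg x) 1) =
        ∑ i ∈ S x, ((1 / Real.sqrt (S x).card : ℝ) : ℂ) •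
          Finsupp.single ((cfg x).setReg ρ i) 1 := by
  obtain ⟨D, h1, h2, h3⟩ := exists_prepare_prefix hS hlt hrank hin hρ hWρ hzero B le_rfl
  refine ⟨D, h1, h2, fun x => ?_⟩
  rw [h3 x]
  symm
  have hsub : S x ⊆ Finset.range (2 ^ B) := fun i hi => Finset.mem_range.2 (hlt x i hi)
  have hcount : ∀ v, prefixCount (S x) (B - B) v = if v ∈ S x then 1 else 0 := by
    intro v
    simp only [prefixCount, Nat.sub_self, pow_zero, Nat.div_one]
    split_ifs with h
    · rw [Finset.filter_eq' , if_pos h, Finset.card_singleton]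
    · rw [Finset.filter_eq', if_neg h, Finset.card_empty]
  rw [Finset.sum_subset_zero_on_sdiff hsub (g := fun v =>
    ((Real.sqrt (prefixCount (S x) (B - B) v / (S x).card) : ℝ) : ℂ) •
      Finsupp.single ((cfg x).setReg ρ (2 ^ (B - B) * v)) 1)]
  · intro v hv
    rw [hcount, if_neg (Finset.mem_sdiff.1 hv).2]; simp
  · intro v hv
    rw [hcount, if_pos hv]
    simp

/-! ## Rank functions of stored arrays -/

/-- Entry number k, counted from zero, lies below t exactly when more than k elements do. The rank
is thus the threshold of a monotone property of addresses and is accessible to binary search. -/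
theorem lt_card_filter_sort_iff (S : Finset ℕ) (t k : ℕ) :
    k < rank S t ↔ k < S.card ∧ (S.sort (· ≤ ·)).getD k 0 < t := by
  classical
  have hcard : rank S t ≤ S.card := Finset.card_filter_le _ _
  by_cases hk : k < S.card
  swap
  · simp only [hk, false_and, iff_false]; omega
  simp only [hk, true_and]
  have hlen : (S.sort (· ≤ ·)).length = S.card := Finset.length_sort _
  rw [List.getD_eq_getElem _ _ (by omega)]
  have hmono : StrictMono fun i : Fin S.card => (S.sort (· ≤ ·))[i.val]'(by omega) := by
    intro i j hij
    exact List.pairwise_iff_getElem.1 (Finset.sortedLT_sort S).pairwise _ _ (by omega) (by omega) hij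
  have himg : rank S t = (Finset.univ.filter fun i : Fin S.card =>
      (S.sort (· ≤ ·))[i.val]'(by omega) < t).card := by
    rw [rank]
    symm
    refine Finset.card_bij (fun i _ => (S.sort (· ≤ ·))[i.val]'(by omega)) ?_ ?_ ?_
    · intro i hi
      rw [Finset.mem_filter] at hi ⊢
      exact ⟨(Finset.mem_sort (· ≤ ·)).1 (List.getElem_mem _), hi.2⟩
    · intro i _ j _ h
      exact hmono.injective h
    · intro v hv
      rw [Finset.mem_filter] at hv
      obtain ⟨i, hi, h⟩ := List.getElem_of_mem ((Finset.mem_sort (· ≤ ·)).2 hv.1)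
      exact ⟨⟨i, by omega⟩, by simp [h, hv.2], h⟩
  constructor
  · intro h
    by_contra hcon
    have : (Finset.univ.filter fun i : Fin S.card => (S.sort (· ≤ ·))[i.val]'(by omega) < t) ⊆
        Finset.univ.filter fun i : Fin S.card => i.val < k := by
      intro i hi
      rw [Finset.mem_filter] at hi ⊢
      refine ⟨hi.1, ?_⟩
      by_contra hik
      push Not at hcon hik
      have : (S.sort (· ≤ ·))[k]'(by omega) ≤ (S.sort (· ≤ ·))[i.val]'(by omega) :=
        hmono.monotone (a := ⟨k, hk⟩) (b := i) hik
      omega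
    have h1 := Finset.card_le_card this
    rw [← himg] at h1
    have h2 : (Finset.univ.filter fun i : Fin S.card => i.val < k).card ≤ k := by
      calc _ ≤ (Finset.range k).card := Finset.card_le_card_of_injOn (fun i => i.val)
            (fun i hi => by simpa using hi) (fun i _ j _ h => Fin.ext h)
        _ = k := Finset.card_range k
    omega
  · intro h
    have : (Finset.univ.filter fun i : Fin S.card => i.val < k + 1) ⊆
        Finset.univ.filter fun i : Fin S.card => (S.sort (· ≤ ·))[i.val]'(by omega) < t := by
      intro i hi
      rw [Finset.mem_filter] at hi ⊢
      refine ⟨hi.1, lt_of_le_of_lt ?_ h⟩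
      exact hmono.monotone (a := i) (b := ⟨k, hk⟩) (by
        rw [Fin.le_def]; simp only; omega)
    have h1 := Finset.card_le_card this
    rw [← himg] at h1
    have h2 : k + 1 ≤ (Finset.univ.filter fun i : Fin S.card => i.val < k + 1).card := by
      calc k + 1 = (Finset.range (k + 1)).card := (Finset.card_range _).symm
        _ ≤ _ := Finset.card_le_card_of_surjOn (fun i => i.val) (fun v hv => by
            have hv : v < k + 1 := Finset.mem_range.1 hv
            exact ⟨⟨v, by omega⟩, by simpa using Nat.le_of_lt_succ hv, rfl⟩)
    omega

theorem lt_of_mem_getD_sort {S : Finset ℕ} {N : ℕ} (hN : 0 < N) (h : ∀ i ∈ S, i < N) (k : ℕ) :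
    (S.sort (· ≤ ·)).getD k 0 < N := by
  by_cases hk : k < (S.sort (· ≤ ·)).length
  · rw [List.getD_eq_getElem _ _ hk]
    exact h _ ((Finset.mem_sort (· ≤ ·)).1 (List.getElem_mem _))
  · rw [List.getD_eq_default _ _ (by omega)]
    exact hN

/-- The rank function of a set stored as a sorted array can be computed by binary search. -/
theorem rankComp_array {S : X → Finset ℕ} {B : ℕ} (hB : B < 2 ^ B) {key : X → ℕ}
    (hkey : ∀ x, key x < 2 ^ B) (hcard : ∀ x, (S x).card < 2 ^ B) (hlt : ∀ x, ∀ i ∈ S x, i < 2 ^ B)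
    (R₁ R₂ : BitArray) (h₁ : ∀ x k, (mem x).bit R₁ (key x) k 0 = (S x).card.testBit k)
    (h₂ : ∀ x k j, (mem x).bit R₂ (key x) k j = (((S x).sort (· ≤ ·)).getD k 0).testBit j)
    (hK : bitsOf B key ⊆ K) :
    RankComp mem K S (1000 * (B + 1) ^ 3) := by
  have hsize : CompR mem K (fun x => ((S x).card : ℝ)) (B * ((0 + B * 3 + B * 3 + (1 + 3 * B)) + 5) + 1) := by
    refine CompR.ofDigits hcard fun j hj => ?_
    refine CompP.congr (Comp.queryBit R₁ (k₁ := key) (k₂ := fun _ => j) (k₃ := fun _ => 0)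
      (Comp.subset hK 0) (Comp.bitsOf_const B j) (Comp.bitsOf_const B 0) hkey
      (fun _ => by omega) (fun _ => Nat.two_pow_pos B)) fun x => ?_
    rw [h₁]
  have hsize' : CompR (X := X × ℕ) (mem ∘ Prod.fst)
      (Fn.comp Prod.fst '' K ∪ {.real fun p => (p.2 : ℝ)})
      (fun p => ((S p.1).card : ℝ)) (B * ((0 + B * 3 + B * 3 + (1 + 3 * B)) + 5) + 1) := by
    have := (Comp.pullback (Prod.fst : X × ℕ → X) hsize)
    rw [Set.image_singleton] at this
    exact Comp.weaken this Set.subset_union_left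
  set L : Set (Fn (X × ℕ)) := (Fn.comp Prod.fst '' K ∪ {.real fun p => (p.2 : ℝ)}) ∪
    {.real fun p => ((S p.1).card : ℝ)} with hL
  have hlow : CompP (X := (X × ℕ) × Fin (2 ^ B)) ((mem ∘ Prod.fst) ∘ Prod.fst)
      (Fn.comp Prod.fst '' L ∪ bitsOf B fun p => p.2.val)
      (fun p => p.2.val < rank (S p.1.1) p.1.2)
      ((B * 5 + 1 + 0 + 4) + (B * (0 + 0 + B * 3 + (1 + 3 * B) + 5) + 1 + 0 + 4) + 5) := by
    have hk : CompR ((mem ∘ Prod.fst) ∘ Prod.fst)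
        (Fn.comp Prod.fst '' L ∪ bitsOf B fun p : (X × ℕ) × Fin (2 ^ B) => p.2.val)
        (fun p => (p.2.val : ℝ)) (B * 5 + 1) :=
      CompR.ofBitsOf (fun p => p.2.isLt) Set.subset_union_right
    have hent : CompR ((mem ∘ Prod.fst) ∘ Prod.fst)
        (Fn.comp Prod.fst '' L ∪ bitsOf B fun p : (X × ℕ) × Fin (2 ^ B) => p.2.val)
        (fun p => ((((S p.1.1).sort (· ≤ ·)).getD p.2.val 0 : ℕ) : ℝ))
        (B * (0 + 0 + B * 3 + (1 + 3 * B) + 5) + 1) := by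
      refine CompR.ofDigits (fun p => lt_of_mem_getD_sort (Nat.two_pow_pos B) (hlt p.1.1) _)
        fun j hj => ?_
      refine CompP.congr (Comp.queryBit R₂ (k₁ := fun p : (X × ℕ) × Fin (2 ^ B) => key p.1.1)
        (k₂ := fun p => p.2.val) (k₃ := fun _ => j)
        (Comp.subset ?_ 0) (Comp.subset Set.subset_union_right 0) (Comp.bitsOf_const B j)
        (fun p => hkey _) (fun p => p.2.isLt) (fun _ => by omega)) fun p => ?_
      · rintro f ⟨i, hi, rfl⟩
        exact Or.inl ⟨_, Or.inl (Or.inl ⟨_, hK ⟨i, hi, rfl⟩, rfl⟩), rfl⟩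
      · simp only [Function.comp]
        rw [h₂]
    have c1 := CompP.lt hk (CompR.of_mem (f := fun p : (X × ℕ) × Fin (2 ^ B) =>
      ((S p.1.1).card : ℝ)) (Or.inl ⟨_, Or.inr rfl, rfl⟩))
    have c2 := CompP.lt hent (CompR.of_mem (f := fun p : (X × ℕ) × Fin (2 ^ B) =>
      (p.1.2 : ℝ)) (Or.inl ⟨_, Or.inl (Or.inr rfl), rfl⟩))
    refine (c1.and c2).congr fun p => ?_
    rw [lt_card_filter_sort_iff, Nat.cast_lt, Nat.cast_lt]
  have hle : ∀ x t, rank (S x) t < 2 ^ B := fun x t =>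
    lt_of_le_of_lt (Finset.card_filter_le _ _) (hcard x)
  have hs := Comp.search (K := L) (mem := mem ∘ Prod.fst) (c := fun p : X × ℕ => rank (S p.1) p.2)
    (fun p => hle _ _) hlow
  have hfin := hs.trans (CompR.ofBitsOf (K := L ∪ _) (fun p : X × ℕ => hle p.1 p.2)
    Set.subset_union_right)
  refine CompR.mono (hsize'.letIn hfin) ?_
  have e : 1000 * (B + 1) ^ 3 = 1000 * B ^ 3 + 3000 * B ^ 2 + 3000 * B + 1000 := by ring
  rw [e]
  nlinarith [Nat.zero_le B, Nat.zero_le (B ^ 2), Nat.zero_le (B ^ 3)]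

end

section

/-! ## Sampling and checking circuits -/

/-- Inputs of the search with prescribed sizes. -/
structure Inst (d b N q m n n' : ℕ) : Type where
  L : Finset (Vec d)
  C : Finset (Vec d)
  P : ProductCode d b N q
  hL : L.card = m
  hC : C.card = n
  hP : P.points.card = n'

/-- The QCRAM contents for an input. -/
def Inst.mem {d b N q m n n' : ℕ} (α α' : ℝ) (I : Inst d b N q m n n') : Memory :=
  qcram α α' I.L I.C I.P

/-- The set over which `superpose` sums. -/
def nonbot (S : Finset ℕ) (bot : ℕ) : Finset ℕ := if S = ∅ then {bot} else S

theorem nonbot_nonempty (S : Finset ℕ) (bot : ℕ) : (nonbot S bot).Nonempty := by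
  unfold nonbot
  split_ifs with h
  · exact Finset.singleton_nonempty _
  · exact Finset.nonempty_iff_ne_empty.2 h

theorem superpose_eq_sum (S : Finset ℕ) (bot : ℕ) (F : ℕ → State) :
    superpose S bot F =
      ∑ i ∈ nonbot S bot, ((1 / Real.sqrt (nonbot S bot).card : ℝ) : ℂ) • F i := by
  unfold superpose nonbot
  split_ifs with h <;> simp

theorem superpose_congr {S : Finset ℕ} {bot : ℕ} {F G : ℕ → State}
    (h : ∀ i ∈ nonbot S bot, F i = G i) : superpose S bot F = superpose S bot G := by
  rw [superpose_eq_sum, superpose_eq_sum]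
  exact Finset.sum_congr rfl fun i hi => by rw [h i hi]

theorem run_superpose (mem : Memory) (D : Circuit) (S : Finset ℕ) (bot : ℕ) (F : ℕ → State) :
    Circuit.run mem D (superpose S bot F) = superpose S bot fun i => Circuit.run mem D (F i) := by
  rw [superpose_eq_sum, superpose_eq_sum, Circuit.run_sum]
  exact Finset.sum_congr rfl fun i _ => Circuit.run_smul ..

theorem nonbot_subset {S T : Finset ℕ} {bot : ℕ} (h : S ⊆ T) (hb : bot ∈ T) : nonbot S bot ⊆ T := by
  unfold nonbot
  split_ifs
  · simpa using hb
  · exact h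

section
variable {X : Type} {mem : X → Memory} {K : Set (Fn X)} {t : ℕ}

/-- Emptiness is detected by the rank at `N`, which is the cardinality; in that case the rank
function of {`bot`} is used. -/
theorem rankComp_nonbot {S : X → Finset ℕ} {N : ℕ} (hN : ∀ x, ∀ i ∈ S x, i < N)
    (h : RankComp mem K S t) (bot : ℕ) : RankComp mem K (fun x => nonbot (S x) bot) (2 * t + 30) := by
  classical
  have h0 : CompR (X := X × ℕ) (mem ∘ Prod.fst)
      (Fn.comp Prod.fst '' K ∪ {.real fun p => (p.2 : ℝ)})
      (fun p => (rank (S p.1) N : ℝ)) (1 + t) :=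
    RankComp.at h Prod.fst (fun _ => N) Set.subset_union_left (CompR.const _)
  have h1 : CompP (X := X × ℕ) (mem ∘ Prod.fst)
      (Fn.comp Prod.fst '' K ∪ {.real fun p => (p.2 : ℝ)}) (fun p => bot < p.2) (1 + 0 + 4) :=
    (CompP.lt (CompR.const (bot : ℝ)) (CompR.of_mem (Or.inr rfl))).congr fun p => by
      simp
  refine CompR.mono (CompR.congr (CompR.ite (CompP.le h0 (.const 0)) h1.ind h) fun p => ?_)
    (by omega)
  have hrank : rank (S p.1) N = (S p.1).card := by
    rw [rank, Finset.filter_true_of_mem (hN p.1)]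
  rw [hrank]
  unfold nonbot
  by_cases hS : S p.1 = ∅
  · simp only [hS, if_true, Finset.card_empty, Nat.cast_zero, le_refl]
    rw [rank, Finset.filter_singleton]
    split_ifs <;> simp
  · have : ¬ (((S p.1).card : ℝ) ≤ 0) := by
      rw [not_le]; exact_mod_cast Finset.card_pos.2 (Finset.nonempty_iff_ne_empty.2 hS)
    simp only [if_neg hS, if_neg this]

theorem rank_range (m t : ℕ) : rank (Finset.range m) t = min t m := by
  have : (Finset.range m).filter (fun i => i < t) = Finset.range (min t m) := by
    ext i; simp; omega
  rw [rank, this, Finset.card_range]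

theorem rankComp_range (m : ℕ) : RankComp mem K (fun _ => Finset.range m) 30 := by
  classical
  have h : CompR (X := X × ℕ) (mem ∘ Prod.fst)
      (Fn.comp Prod.fst '' K ∪ {.real fun p => (p.2 : ℝ)}) (fun p => (p.2 : ℝ)) 0 :=
    CompR.of_mem (Or.inr rfl)
  refine CompR.mono (CompR.congr (CompR.ite (CompP.le h (.const (m : ℝ))) h (.const (m : ℝ)))
    fun p => ?_) (by omega)
  rw [rank_range, Nat.cast_min, min_def]

/-- The basis state used by the sampling circuits, as an input with digits of `v` in register `σ`. -/
theorem inputs_of_reg {cfg : X → Config} {B : ℕ} {σ : Reg} (hσ : σ ≠ .work) {v : X → ℕ}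
    (hblank : Blank cfg 0 0) (hv : ∀ x k, (cfg x).q (σ, k) = (v x).testBit k) :
    Inputs cfg {w | w.1 = σ} (bitsOf B v) := by
  refine ⟨by rintro w rfl; exact hσ, hblank, ?_⟩
  rintro f ⟨j, -, rfl⟩
  exact ⟨(σ, j), Or.inl rfl, fun x => hv x j⟩

theorem Inputs.union {cfg : X → Config} {W W' : Set QWire} {K K' : Set (Fn X)}
    (h : Inputs cfg W K) (h' : Inputs cfg W' K') : Inputs cfg (W ∪ W') (K ∪ K') := by
  refine ⟨?_, h.blank, ?_⟩
  · rintro w (hw | hw)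
    exacts [h.ne_work w hw, h'.ne_work w hw]
  · have key : ∀ {V : Set QWire}, V ⊆ W ∪ W' → ∀ f, Held cfg V 0 0 f → Held cfg (W ∪ W') 0 0 f := by
      intro V hV f hf
      cases f with
      | bit f =>
        obtain ⟨w, hw, h⟩ := hf
        exact ⟨w, hw.imp_left fun h => hV h, h⟩
      | real f => exact hf
    rintro f (hf | hf)
    · exact key Set.subset_union_left f (h.held f hf)
    · exact key Set.subset_union_right f (h'.held f hf)

theorem exists_superpose {S : X → Finset ℕ} {B bot : ℕ} (hbot : bot < 2 ^ B)
    (hlt : ∀ x, ∀ i ∈ S x, i < 2 ^ B) (hrank : RankComp mem K S t) {cfg : X → Config}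
    {W : Set QWire} (hin : Inputs cfg W K) {ρ : Reg} (hρ : ρ ≠ .work) (hWρ : ∀ w ∈ W, w.1 ≠ ρ)
    (hzero : ∀ x k, (cfg x).q (ρ, k) = false) :
    ∃ D : Circuit, Circuit.time D ≤ B * (16 * t + 10 * B + 500) ∧
      Circuit.Changes W {w | w.1 = ρ} D ∧
      ∀ x, Circuit.run (mem x) D (Finsupp.single (cfg x) 1) =
        superpose (S x) bot fun i => Finsupp.single ((cfg x).setReg ρ i) 1 := by
  have hlt' : ∀ x, ∀ i ∈ nonbot (S x) bot, i < 2 ^ B := by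
    intro x i hi
    have : nonbot (S x) bot ⊆ Finset.range (2 ^ B) :=
      nonbot_subset (fun i hi => Finset.mem_range.2 (hlt x i hi)) (Finset.mem_range.2 hbot)
    exact Finset.mem_range.1 (this hi)
  obtain ⟨D, h1, h2, h3⟩ := exists_prepare (B := B) (fun x => nonbot_nonempty (S x) bot)
    hlt' (rankComp_nonbot hlt hrank bot) hin hρ hWρ hzero
  refine ⟨D, h1.trans (Nat.mul_le_mul_left _ (by omega)), h2, fun x => ?_⟩
  rw [h3, superpose_eq_sum]

end

theorem ket_blank {X : Type} (x c y c' z f₁ f₂ f₃ : X → ℕ) :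
    Blank (fun p => ket (x p) (c p) (y p) (c' p) (z p) (f₁ p) (f₂ p) (f₃ p)) 0 0 :=
  fun _ => ⟨fun _ _ => rfl, fun _ _ => rfl⟩

theorem ket_setReg_x (x c y c' z f₁ f₂ f₃ v : ℕ) :
    (ket x c y c' z f₁ f₂ f₃).setReg .x v = ket v c y c' z f₁ f₂ f₃ := by
  ext w
  · obtain ⟨ρ, k⟩ := w
    cases ρ <;> simp [Config.setReg, ket]
  · rfl

theorem ket_setReg_c (x c y c' z f₁ f₂ f₃ v : ℕ) :
    (ket x c y c' z f₁ f₂ f₃).setReg .c v = ket x v y c' z f₁ f₂ f₃ := by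
  ext w
  · obtain ⟨ρ, k⟩ := w
    cases ρ <;> simp [Config.setReg, ket]
  · rfl

theorem ket_setReg_y (x c y c' z f₁ f₂ f₃ v : ℕ) :
    (ket x c y c' z f₁ f₂ f₃).setReg .y v = ket x c v c' z f₁ f₂ f₃ := by
  ext w
  · obtain ⟨ρ, k⟩ := w
    cases ρ <;> simp [Config.setReg, ket]
  · rfl

theorem ket_setReg_c' (x c y c' z f₁ f₂ f₃ v : ℕ) :
    (ket x c y c' z f₁ f₂ f₃).setReg .c' v = ket x c y v z f₁ f₂ f₃ := by
  ext w
  · obtain ⟨ρ, k⟩ := w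
    cases ρ <;> simp [Config.setReg, ket]
  · rfl

theorem ket_setReg_z (x c y c' z f₁ f₂ f₃ v : ℕ) :
    (ket x c y c' z f₁ f₂ f₃).setReg .z v = ket x c y c' v f₁ f₂ f₃ := by
  ext w
  · obtain ⟨ρ, k⟩ := w
    cases ρ <;> simp [Config.setReg, ket]
  · rfl

theorem toggle_testBit {f : ℕ} (hf : f < 2) (E : Prop) [Decidable E] (k : ℕ) :
    (toggle f E).testBit k = if k = 0 then (f.testBit 0 ^^ decide E) else f.testBit k := by
  have h2 : ∀ g < 2, ∀ j, g.testBit (j + 1) = false := by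
    intro g hg j
    exact Nat.testBit_lt_two_pow (lt_of_lt_of_le hg (by
      rw [pow_succ]; have := Nat.two_pow_pos j; omega))
  have ht : toggle f E < 2 := Nat.mod_lt _ (by norm_num)
  cases k with
  | zero =>
    by_cases hE : E
    · simp only [toggle, hE, if_true, decide_true]
      interval_cases f <;> simp
    · simp only [toggle, hE, if_false, decide_false]
      interval_cases f <;> simp
  | succ k => simp [h2 _ ht, h2 _ hf]

theorem ket_toggle_flag₁ (x c y c' z f₂ f₃ : ℕ) {f₁ : ℕ} (hf : f₁ < 2) (E : Prop) [Decidable E] :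
    (ket x c y c' z f₁ f₂ f₃).setQ (.flag₁, 0)
      ((ket x c y c' z f₁ f₂ f₃).q (.flag₁, 0) ^^ decide E) =
      ket x c y c' z (toggle f₁ E) f₂ f₃ := by
  ext w
  · obtain ⟨ρ, k⟩ := w
    by_cases h : (ρ, k) = ((.flag₁, 0) : QWire)
    · rw [h, Config.setQ_q_self]
      simp [ket, toggle_testBit hf]
    · rw [Config.setQ_q_ne _ _ h]
      cases ρ <;> try rfl
      have hk : k ≠ 0 := by rintro rfl; exact h rfl
      simp [ket, toggle_testBit hf, hk]
  · rfl

theorem ket_toggle_flag₂ (x c y c' z f₁ f₃ : ℕ) {f₂ : ℕ} (hf : f₂ < 2) (E : Prop) [Decidable E] :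
    (ket x c y c' z f₁ f₂ f₃).setQ (.flag₂, 0)
      ((ket x c y c' z f₁ f₂ f₃).q (.flag₂, 0) ^^ decide E) =
      ket x c y c' z f₁ (toggle f₂ E) f₃ := by
  ext w
  · obtain ⟨ρ, k⟩ := w
    by_cases h : (ρ, k) = ((.flag₂, 0) : QWire)
    · rw [h, Config.setQ_q_self]
      simp [ket, toggle_testBit hf]
    · rw [Config.setQ_q_ne _ _ h]
      cases ρ <;> try rfl
      have hk : k ≠ 0 := by rintro rfl; exact h rfl
      simp [ket, toggle_testBit hf, hk]
  · rfl

section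
variable {d b N q m n n' : ℕ} (α α' : ℝ) {B : ℕ}

theorem nbrIdx_lt {C : Finset (Vec d)} {u : Vec d} {i : ℕ} (h : i ∈ nbrIdx α C u) :
    i < C.card := Finset.mem_range.1 (Finset.mem_filter.1 h).1

theorem bucketIdx_lt {L C : Finset (Vec d)} {i j : ℕ} (h : i ∈ bucketIdx α L C j) :
    i < L.card := Finset.mem_range.1 (Finset.mem_filter.1 h).1

theorem lookup_lt {L C : Finset (Vec d)} {bwd : Bool} {i j : ℕ} (h : i ∈ lookup α L C bwd j) :
    i < if bwd then L.card else C.card := by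
  unfold lookup at h
  cases bwd with
  | true => exact bucketIdx_lt α h
  | false =>
    simp only [Bool.false_eq_true, if_false] at h ⊢
    split_ifs at h
    · exact nbrIdx_lt α h
    · simp at h

theorem lookup_card_le {L C : Finset (Vec d)} {bwd : Bool} {j : ℕ} :
    (lookup α L C bwd j).card ≤ if bwd then L.card else C.card := by
  refine (Finset.card_le_card (t := Finset.range (if bwd then L.card else C.card)) fun i hi =>
    Finset.mem_range.2 (lookup_lt α hi)).trans_eq (Finset.card_range _)

/-- The circuit for `RCollisionSamp`. -/
theorem exists_rCollisionSamp (hpos : 0 < m) (hm : m < 2 ^ B) (hn : n < 2 ^ B) :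
    ∃ D : Circuit, Circuit.time D ≤ 100000 * (B + 1) ^ 4 ∧
      ∀ I : Inst d b N q m n n', Circuit.run (I.mem α α') D (ketState 0 0 0 0 0 0 0 0) =
        superpose (Finset.range m) 0 fun x =>
        superpose (nbrIdx α I.C (vecAt I.L x)) n fun c =>
        superpose (bucketIdx α I.L I.C c) m fun y => ketState x c y 0 0 0 0 0 := by
  have hB : B < 2 ^ B := Nat.lt_two_pow_self
  -- The instance is part of the argument type `X` of the computations, so one and the same circuit
  -- serves all instances of these sizes.
  obtain ⟨D₁, a1, -, a3⟩ := exists_superpose (X := Inst d b N q m n n')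
    (mem := fun I => I.mem α α') (K := ∅) (S := fun _ => Finset.range m) (B := B) (bot := 0)
    (Nat.two_pow_pos B) (fun _ i hi => (Finset.mem_range.1 hi).trans hm) (rankComp_range m)
    (cfg := fun _ => ket 0 0 0 0 0 0 0 0) (W := ∅)
    ⟨by simp, ket_blank _ _ _ _ _ _ _ _, by simp⟩ (ρ := .x) (by decide) (by simp)
    (fun _ k => Nat.zero_testBit k)
  obtain ⟨D₂, b1, -, b3⟩ := exists_superpose (X := Inst d b N q m n n' × Fin m)
    (mem := fun p => p.1.mem α α') (K := bitsOf B fun p => p.2.val)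
    (S := fun p => lookup α p.1.L p.1.C false p.2) (B := B) (bot := n) hn
    (fun p i hi => by
      have := lookup_lt α hi
      rw [p.1.hC] at this
      exact lt_trans this hn)
    (rankComp_array hB (fun p => p.2.isLt.trans hm)
      (fun p => by
        have := lookup_card_le α (L := p.1.L) (C := p.1.C) (bwd := false) (j := p.2)
        rw [p.1.hC] at this
        exact lt_of_le_of_lt this hn)
      (fun p i hi => by
        have := lookup_lt α hi
        rw [p.1.hC] at this
        exact lt_trans this hn)
      (.size false false) (.list false false) (fun _ _ => rfl) (fun _ _ _ => rfl) subset_rfl)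
    (cfg := fun p => ket p.2 0 0 0 0 0 0 0) (W := {w | w.1 = .x})
    (inputs_of_reg (by decide) (ket_blank _ _ _ _ _ _ _ _) fun _ _ => rfl)
    (ρ := .c) (by decide) (fun w hw => by rw [show w.1 = _ from hw]; decide) (fun _ k => Nat.zero_testBit k)
  -- The index of c ranges over n + 1 values: the value n stands for ⊥, and its lookup is empty, so
  -- y becomes ⊥ too.
  obtain ⟨D₃, c1, -, c3⟩ := exists_superpose
    (X := Inst d b N q m n n' × Fin m × Fin (n + 1))
    (mem := fun p => p.1.mem α α') (K := bitsOf B fun p => p.2.2.val)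
    (S := fun p => lookup α p.1.L p.1.C true p.2.2) (B := B) (bot := m) hm
    (fun p i hi => by
      have := lookup_lt α hi
      rw [p.1.hL] at this
      exact lt_trans this hm)
    (rankComp_array hB (fun p => lt_of_le_of_lt (Nat.le_of_lt_succ p.2.2.isLt) hn)
      (fun p => by
        have := lookup_card_le α (L := p.1.L) (C := p.1.C) (bwd := true) (j := p.2.2)
        rw [p.1.hL] at this
        exact lt_of_le_of_lt this hm)
      (fun p i hi => by
        have := lookup_lt α hi
        rw [p.1.hL] at this
        exact lt_trans this hm)
      (.size false true) (.list false true) (fun _ _ => rfl) (fun _ _ _ => rfl) subset_rfl)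
    (cfg := fun p => ket p.2.1 p.2.2 0 0 0 0 0 0) (W := {w | w.1 = .c})
    (inputs_of_reg (by decide) (ket_blank _ _ _ _ _ _ _ _) fun _ _ => rfl)
    (ρ := .y) (by decide) (fun w hw => by rw [show w.1 = _ from hw]; decide) (fun _ k => Nat.zero_testBit k)
  refine ⟨D₁ ++ D₂ ++ D₃, ?_, fun I => ?_⟩
  · rw [Circuit.time_append, Circuit.time_append]
    have e : 100000 * (B + 1) ^ 4 = 100000 * B ^ 4 + 400000 * B ^ 3 + 600000 * B ^ 2 + 400000 * B
      + 100000 := by ring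
    refine (add_le_add (add_le_add a1 b1) c1).trans ?_
    rw [e]
    ring_nf
    nlinarith [Nat.zero_le B, Nat.zero_le (B ^ 2), Nat.zero_le (B ^ 3), Nat.zero_le (B ^ 4)]
  · rw [Circuit.run_append, Circuit.run_append, ketState, a3 I, run_superpose, run_superpose]
    simp only [ket_setReg_x]
    refine superpose_congr fun x hx => ?_
    have hx : x < m := by
      have : nonbot (Finset.range m) 0 ⊆ Finset.range m :=
        nonbot_subset subset_rfl (Finset.mem_range.2 hpos)
      exact Finset.mem_range.1 (this hx)
    have := b3 (I, ⟨x, hx⟩)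
    simp only at this
    rw [this, run_superpose]
    have hlk : lookup α I.L I.C false x = nbrIdx α I.C (vecAt I.L x) := by
      simp [lookup, I.hL, hx]
    rw [hlk]
    simp only [ket_setReg_c]
    refine superpose_congr fun c hc => ?_
    have hc : c < n + 1 := by
      have : nonbot (nbrIdx α I.C (vecAt I.L x)) n ⊆ Finset.range (n + 1) :=
        nonbot_subset (fun i hi => Finset.mem_range.2 (by
          have := nbrIdx_lt α hi
          rw [I.hC] at this; omega)) (by simp)
      exact Finset.mem_range.1 (this hc)
    have := c3 (I, ⟨x, hx⟩, ⟨c, hc⟩)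
    simp only at this
    rw [this]
    simp only [ket_setReg_y]
    rfl

/-- The circuit for the superposition over `z`. -/
theorem exists_zSamp (hm : m < 2 ^ B) (hn' : n' < 2 ^ B) :
    ∃ D : Circuit, Circuit.time D ≤ 100000 * (B + 1) ^ 4 ∧ Circuit.Changes {w | w.1 = .c'} {w | w.1 = .z} D ∧
      ∀ (I : Inst d b N q m n n') (x c y c' f₁ : ℕ), c' ≤ n' →
        Circuit.run (I.mem α α') D (ketState x c y c' 0 f₁ 0 0) =
        superpose (bucketIdx α' I.L I.P.points c') m fun z => ketState x c y c' z f₁ 0 0 := by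
  have hB : B < 2 ^ B := Nat.lt_two_pow_self
  obtain ⟨D, c1, c2, c3⟩ := exists_superpose
    (X := Inst d b N q m n n' × (ℕ × ℕ × ℕ × ℕ) × Fin (n' + 1))
    (mem := fun p => p.1.mem α α') (K := bitsOf B fun p => p.2.2.val)
    (S := fun p => lookup α' p.1.L p.1.P.points true p.2.2) (B := B) (bot := m) hm
    (fun p i hi => by
      have := lookup_lt α' hi
      rw [p.1.hL] at this
      exact lt_trans this hm)
    (rankComp_array hB (fun p => lt_of_le_of_lt (Nat.le_of_lt_succ p.2.2.isLt) hn')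
      (fun p => by
        have := lookup_card_le α' (L := p.1.L) (C := p.1.P.points) (bwd := true) (j := p.2.2)
        rw [p.1.hL] at this
        exact lt_of_le_of_lt this hm)
      (fun p i hi => by
        have := lookup_lt α' hi
        rw [p.1.hL] at this
        exact lt_trans this hm)
      (.size true true) (.list true true) (fun _ _ => rfl) (fun _ _ _ => rfl) subset_rfl)
    (cfg := fun p => ket p.2.1.1 p.2.1.2.1 p.2.1.2.2.1 p.2.2 0 p.2.1.2.2.2 0 0)
    (W := {w | w.1 = .c'})
    (inputs_of_reg (by decide) (ket_blank _ _ _ _ _ _ _ _) fun _ _ => rfl)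
    (ρ := .z) (by decide) (fun w hw => by rw [show w.1 = _ from hw]; decide) (fun _ k => Nat.zero_testBit k)
  refine ⟨D, c1.trans ?_, c2, fun I x c y c' f₁ hc' => ?_⟩
  · have e : 100000 * (B + 1) ^ 4 = 100000 * B ^ 4 + 400000 * B ^ 3 + 600000 * B ^ 2 + 400000 * B
      + 100000 := by ring
    rw [e]
    ring_nf
    nlinarith [Nat.zero_le B, Nat.zero_le (B ^ 2), Nat.zero_le (B ^ 3), Nat.zero_le (B ^ 4)]
  · have := c3 (I, (x, c, y, f₁), ⟨c', by omega⟩)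
    simp only [ket_setReg_z] at this
    exact this

end

end

/-! ### Coordinates, inner products and the checking circuits -/

section

section
variable {X : Type} {mem : X → Memory} {K : Set (Fn X)} {t : ℕ}

theorem compR_vec {k : X → ℕ} {B : ℕ} (hk : ∀ x, k x < 2 ^ B) (hK : bitsOf B k ⊆ K) (R : RealArray)
    {j : ℕ} (hj : j < 2 ^ B) : CompR mem K (fun x => (mem x).real R (k x) j 0) (9 * B + 1) :=
  CompR.mono (CompR.queryReal R (Comp.subset hK 0) (Comp.bitsOf_const B j) (Comp.bitsOf_const B 0)
    hk (fun _ => hj) fun _ => Nat.two_pow_pos B) (by omega)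

theorem coord_fin {d : ℕ} (v : Vec d) (j : Fin d) : coord v j = v j := by
  simp [coord]

theorem inner_eq_sum {d : ℕ} (v w : Vec d) : inner ℝ v w = ∑ j, v j * w j := by
  rw [PiLp.inner_apply]
  exact Finset.sum_congr rfl fun j _ => by simp [mul_comm]

theorem CompR.inner {d : ℕ} {v w : X → Vec d} {s : ℕ} (hv : ∀ j, CompR mem K (fun x => v x j) s)
    (hw : ∀ j, CompR mem K (fun x => w x j) t) :
    CompR mem K (fun x => inner ℝ (v x) (w x)) (d * (s + t + 3) + 1) := by
  refine CompR.mono (CompR.congr (CompR.sum Finset.univ fun j _ => (hv j).mul (hw j))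
    fun x => inner_eq_sum _ _) ?_
  rw [Finset.card_univ, Fintype.card_fin]

theorem CompP.near {f : X → ℝ} (d : ℕ) (hf : CompR mem K f t) (b : ℝ) :
    CompP mem K (fun x => Near d (f x) b) (2 * t + 9) := by
  refine ((CompP.le (.const (b - tol d)) hf).and (CompP.le hf (.const (b + tol d)))).congr
    (fun _ => ?_) |>.mono (by omega)
  rw [Near, abs_le]
  constructor <;> rintro ⟨h1, h2⟩ <;> constructor <;> linarith

/-- For x = y both sides are zero, because division by zero gives zero; the machine's division thus
produces the convention for u_xx by itself. -/
theorem udiff_apply {d : ℕ} (x y : Vec d) (j : Fin d) :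
    udiff x y j = (x j - y j) / Real.sqrt (∑ i, (x i - y i) * (x i - y i)) := by
  rw [udiff, EuclideanSpace.norm_eq]
  simp only [PiLp.smul_apply, PiLp.sub_apply, smul_eq_mul, Real.norm_eq_abs, sq_abs]
  rw [div_eq_inv_mul]
  simp only [sq]

/-- The coordinates of the normalized difference. -/
theorem comp_udiff {d : ℕ} {v w : X → Vec d} {s : ℕ} (hv : ∀ j, CompR mem K (fun x => v x j) s)
    (hw : ∀ j, CompR mem K (fun x => w x j) t) :
    Comp mem K {f | ∃ j : Fin d, f = .real fun x => udiff (v x) (w x) j}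
      (d * (3 * (s + t + 2) + 4) + 2) := by
  have hsub : ∀ j, CompR mem K (fun x => v x j - w x j) (s + t + 2) := fun j => (hv j).sub (hw j)
  have hnorm : CompR mem K (fun x => Real.sqrt (∑ i, (v x i - w x i) * (v x i - w x i)))
      (d * (2 * (s + t + 2) + 3) + 2) :=
    CompR.mono (CompR.sum Finset.univ fun j _ => (hsub j).mul (hsub j)).sqrt (by
      rw [Finset.card_univ, Fintype.card_fin]
      have : s + t + 2 + (s + t + 2) + 1 + 2 = 2 * (s + t + 2) + 3 := by omega
      rw [this])
  have hcoord : Comp mem (K ∪ {.real fun x => Real.sqrt (∑ i, (v x i - w x i) * (v x i - w x i))})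
      {f | ∃ j : Fin d, f = .real fun x => udiff (v x) (w x) j} (d * ((s + t + 2) + 1)) := by
    have := Comp.biUnion (mem := mem)
      (K := K ∪ {.real fun x => Real.sqrt (∑ i, (v x i - w x i) * (v x i - w x i))})
      (Finset.univ : Finset (Fin d)) (A := fun j => {.real fun x => udiff (v x) (w x) j})
      (t := (s + t + 2) + 1) fun j _ => by
        have hn : CompR mem
            (K ∪ {.real fun x => Real.sqrt (∑ i, (v x i - w x i) * (v x i - w x i))})
            (fun x => Real.sqrt (∑ i, (v x i - w x i) * (v x i - w x i))) 0 :=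
          CompR.of_mem (Or.inr rfl)
        exact (((hsub j).weaken Set.subset_union_left).div hn).congr fun x => udiff_apply _ _ _
    rw [Finset.card_univ, Fintype.card_fin] at this
    refine this.mono subset_rfl ?_ le_rfl
    rintro f ⟨j, rfl⟩
    exact Set.mem_biUnion (Finset.mem_univ j) rfl
  exact (Comp.trans hnorm hcoord).mono_cost (by ring_nf; omega)

end

section
variable {d b N q m n n' : ℕ} (α α' : ℝ) {B : ℕ}

theorem compR_vecAt {X : Type} {K : Set (Fn X)} (I : X → Inst d b N q m n n') {k : X → ℕ}
    (hk : ∀ x, k x < 2 ^ B) (hK : bitsOf B k ⊆ K) (hd : d ≤ 2 ^ B) (j : Fin d) :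
    CompR (fun x => (I x).mem α α') K (fun x => vecAt (I x).L (k x) j) (9 * B + 1) :=
  (compR_vec hk hK .vec (j.isLt.trans_le hd)).congr fun _ => (coord_fin _ j).symm

open Classical in
theorem exists_rCollisionCheck (hm : m < 2 ^ B) (hd : d ≤ 2 ^ B) (θ : ℝ) :
    ∃ D : Circuit, Circuit.time D ≤ 1000 * (d + 1) * (B + 1) ∧
      ∀ (I : Inst d b N q m n n') (x c y f₁ : ℕ), x < m → y ≤ m → f₁ < 2 →
        Circuit.run (I.mem α α') D (ketState x c y 0 0 f₁ 0 0) =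
          ketState x c y 0 0
          (toggle f₁ (y < m ∧ Near d (inner ℝ (vecAt I.L x) (vecAt I.L y)) (Real.cos θ))) 0 0 := by
  let X := Inst d b N q m n n' × (Fin m × Fin (m + 1)) × ℕ × Fin 2
  let K : Set (Fn X) := bitsOf B (fun p => p.2.1.1.val) ∪ bitsOf B (fun p => p.2.1.2.val)
  have hy : ∀ p : X, p.2.1.2.val < 2 ^ B :=
    fun p => lt_of_le_of_lt (Nat.le_of_lt_succ p.2.1.2.isLt) hm
  have hx : ∀ p : X, p.2.1.1.val < 2 ^ B := fun p => p.2.1.1.isLt.trans hm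
  have hin : CompR (fun p : X => p.1.mem α α') K (fun p => inner ℝ (vecAt p.1.L p.2.1.1)
      (vecAt p.1.L p.2.1.2)) (d * ((9 * B + 1) + (9 * B + 1) + 3) + 1) :=
    CompR.inner (fun j => compR_vecAt α α' (fun p : X => p.1) hx Set.subset_union_left hd j)
      (fun j => compR_vecAt α α' (fun p : X => p.1) hy Set.subset_union_right hd j)
  have hyr : CompR (fun p : X => p.1.mem α α') K (fun p => (p.2.1.2.val : ℝ)) (B * 5 + 1) :=
    CompR.ofBitsOf hy Set.subset_union_right
  have hcomp := ((CompP.lt hyr (.const (m : ℝ))).congr fun p => Nat.cast_lt.symm).and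
    (CompP.near d hin (Real.cos θ))
  have hinp : Inputs (fun p : X => ket p.2.1.1 p.2.2.1 p.2.1.2 0 0 p.2.2.2 0 0)
      ({w | w.1 = .x} ∪ {w | w.1 = .y}) K :=
    (inputs_of_reg (by decide) (ket_blank _ _ _ _ _ _ _ _) fun _ _ => rfl).union
      (inputs_of_reg (by decide) (ket_blank _ _ _ _ _ _ _ _) fun _ _ => rfl)
  obtain ⟨D, h1, -, h3⟩ := exists_xor_circuit hcomp hinp (w := (.flag₁, 0)) (by simp) (by decide)
  refine ⟨D, h1.trans ?_, fun I x c y f₁ hx hy hf => ?_⟩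
  · ring_nf; nlinarith [Nat.zero_le d, Nat.zero_le B, Nat.zero_le (d * B)]
  · have := h3 (I, (⟨x, hx⟩, ⟨y, by omega⟩), c, ⟨f₁, hf⟩)
    rw [ket_toggle_flag₁ _ _ _ _ _ _ _ hf] at this
    rw [ketState, ketState]
    convert this

open Classical in
theorem exists_zCheck (hm : m < 2 ^ B) (hd : d ≤ 2 ^ B) (θ' : ℝ) :
    ∃ D : Circuit, Circuit.time D ≤ 1000 * (d + 1) * (B + 1) ∧
      Circuit.Changes (({w | w.1 = .x} ∪ {w | w.1 = .y}) ∪ {w | w.1 = .z}) {(.flag₂, 0)} D ∧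
      ∀ (I : Inst d b N q m n n') (x c y c' z f₁ f₂ : ℕ), x < m → y < m → z ≤ m → f₂ < 2 →
        Circuit.run (I.mem α α') D (ketState x c y c' z f₁ f₂ 0) =
          ketState x c y c' z f₁ (toggle f₂ (z < m ∧
          Near d (inner ℝ (udiff (vecAt I.L x) (vecAt I.L y)) (vecAt I.L z)) (Real.cos θ'))) 0 := by
  let X := Inst d b N q m n n' × (Fin m × Fin m × Fin (m + 1)) × (ℕ × ℕ × ℕ) × Fin 2
  let K : Set (Fn X) := (bitsOf B (fun p => p.2.1.1.val) ∪ bitsOf B (fun p => p.2.1.2.1.val)) ∪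
    bitsOf B (fun p => p.2.1.2.2.val)
  have hx : ∀ p : X, p.2.1.1.val < 2 ^ B := fun p => p.2.1.1.isLt.trans hm
  have hy : ∀ p : X, p.2.1.2.1.val < 2 ^ B := fun p => p.2.1.2.1.isLt.trans hm
  have hz : ∀ p : X, p.2.1.2.2.val < 2 ^ B :=
    fun p => lt_of_le_of_lt (Nat.le_of_lt_succ p.2.1.2.2.isLt) hm
  have hu := comp_udiff (mem := fun p : X => p.1.mem α α') (K := K)
    (fun j => compR_vecAt α α' (fun p : X => p.1) hx (fun f hf => Or.inl (Or.inl hf)) hd j)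
    (fun j => compR_vecAt α α' (fun p : X => p.1) hy (fun f hf => Or.inl (Or.inr hf)) hd j)
  have hin : CompR (fun p : X => p.1.mem α α') (K ∪ {f | ∃ j : Fin d, f = .real fun p =>
      udiff (vecAt p.1.L p.2.1.1) (vecAt p.1.L p.2.1.2.1) j})
      (fun p => inner ℝ (udiff (vecAt p.1.L p.2.1.1) (vecAt p.1.L p.2.1.2.1))
      (vecAt p.1.L p.2.1.2.2)) (d * (0 + (9 * B + 1) + 3) + 1) :=
    CompR.inner (fun j => CompR.of_mem (Or.inr ⟨j, rfl⟩))
      (fun j => compR_vecAt α α' (fun p : X => p.1) hz (fun f hf => Or.inl (Or.inr hf)) hd j)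
  have hzr : CompR (fun p : X => p.1.mem α α') K (fun p => (p.2.1.2.2.val : ℝ)) (B * 5 + 1) :=
    CompR.ofBitsOf hz Set.subset_union_right
  have hcomp := ((CompP.lt hzr (.const (m : ℝ))).congr fun p => Nat.cast_lt.symm).and
    (CompP.near d (hu.trans hin) (Real.cos θ'))
  have hinp : Inputs (fun p : X => ket p.2.1.1 p.2.2.1.1 p.2.1.2.1 p.2.2.1.2.1 p.2.1.2.2
      p.2.2.1.2.2 p.2.2.2 0) (({w | w.1 = .x} ∪ {w | w.1 = .y}) ∪ {w | w.1 = .z}) K :=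
    ((inputs_of_reg (by decide) (ket_blank _ _ _ _ _ _ _ _) fun _ _ => rfl).union
      (inputs_of_reg (by decide) (ket_blank _ _ _ _ _ _ _ _) fun _ _ => rfl)).union
      (inputs_of_reg (by decide) (ket_blank _ _ _ _ _ _ _ _) fun _ _ => rfl)
  obtain ⟨D, h1, h2, h3⟩ := exists_xor_circuit hcomp hinp (w := (.flag₂, 0)) (by simp) (by decide)
  refine ⟨D, h1.trans ?_, h2, fun I x c y c' z f₁ f₂ hx hy hz hf => ?_⟩
  · ring_nf; nlinarith [Nat.zero_le d, Nat.zero_le B, Nat.zero_le (d * B)]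
  · have := h3 (I, (⟨x, hx⟩, ⟨y, hy⟩, ⟨z, by omega⟩), (c, c', f₁), ⟨f₂, hf⟩)
    rw [ket_toggle_flag₂ _ _ _ _ _ _ _ hf] at this
    rw [ketState, ketState]
    convert this

end

end

section

/-! ## Decoding product codes -/

section rank
variable {κ : Type*} [Fintype κ] (r : κ → κ → Prop) [IsStrictTotalOrder κ r] (P : κ → Prop)

open Classical in
/-- The number of elements with property `P` before `i`. -/
def rankIn (i : κ) : ℕ := (Finset.univ.filter fun j => P j ∧ r j i).card

variable {r P}

theorem rankIn_lt {i j : κ} (hi : P i) (h : r i j) : rankIn r P i < rankIn r P j := by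
  classical
  refine Finset.card_lt_card ⟨fun k hk => ?_, fun hcon => ?_⟩
  · rw [Finset.mem_filter] at hk ⊢
    exact ⟨hk.1, hk.2.1, trans_of r hk.2.2 h⟩
  · have : i ∈ Finset.univ.filter fun k => P k ∧ r k j := by simp [hi, h]
    have := hcon this
    rw [Finset.mem_filter] at this
    exact irrefl_of r i this.2.2

theorem rankIn_inj {i j : κ} (hi : P i) (hj : P j) (h : rankIn r P i = rankIn r P j) : i = j := by
  rcases trichotomous_of r i j with h' | h' | h'
  · exact absurd h (rankIn_lt hi h').ne
  · exact h'
  · exact absurd h (rankIn_lt hj h').ne'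

/-- The elements with property `P` before `a` have distinct ranks below the rank of `a`, and there
are exactly that many of them, so every smaller rank occurs. -/
theorem exists_rankIn_eq {a : κ} {t : ℕ} (ht : t < rankIn r P a) :
    ∃ i, P i ∧ r i a ∧ rankIn r P i = t := by
  classical
  set A := Finset.univ.filter fun j => P j ∧ r j a with hA
  have himg : A.image (rankIn r P) = Finset.range (rankIn r P a) := by
    apply Finset.eq_of_subset_of_card_le
    · intro v hv
      obtain ⟨i, hi, rfl⟩ := Finset.mem_image.1 hv
      rw [hA, Finset.mem_filter] at hi
      exact Finset.mem_range.2 (rankIn_lt hi.2.1 hi.2.2)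
    · rw [Finset.card_image_of_injOn, Finset.card_range]
      · exact le_of_eq (by unfold rankIn; rw [hA])
      · intro i hi j hj h
        rw [hA, Finset.mem_coe, Finset.mem_filter] at hi hj
        exact rankIn_inj hi.2.1 hj.2.1 h
  have : t ∈ A.image (rankIn r P) := by rw [himg]; exact Finset.mem_range.2 ht
  obtain ⟨i, hi, h⟩ := Finset.mem_image.1 this
  rw [hA, Finset.mem_filter] at hi
  exact ⟨i, hi.2.1, hi.2.2, h⟩

end rank

/-- An array of vectors, each entry being valid or not. -/
abbrev Arr (ι : Type) (d : ℕ) : Type := ι → Prop × Vec d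

/-- Array positions: a cell, a position in the cell, and a direction. -/
abbrev Slot (G T : ℕ) : Type := Fin G × Fin T × Bool

section sparsify
variable {κ : Type} [Fintype κ] {d : ℕ} (G T : ℕ) (u : Vec d) (lo ε : ℝ) (A : Arr κ d)

/-- The order by scores, with ties broken by position. -/
def Before (i j : κ) : Prop :=
  (inner ℝ u (A i).2 : ℝ) < inner ℝ u (A j).2 ∨
    (inner ℝ u (A i).2 : ℝ) = inner ℝ u (A j).2 ∧ Fintype.equivFin κ i < Fintype.equivFin κ j

instance : IsStrictTotalOrder κ (Before u A) where
  irrefl i h := by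
    rcases h with h | ⟨-, h⟩
    exacts [lt_irrefl _ h, lt_irrefl _ h]
  trans i j k h h' := by
    rcases h with h | ⟨h1, h⟩ <;> rcases h' with h' | ⟨h1', h'⟩
    · exact Or.inl (h.trans h')
    · exact Or.inl (h1' ▸ h)
    · exact Or.inl (h1 ▸ h')
    · exact Or.inr ⟨h1.trans h1', h.trans h'⟩
  trichotomous i j h h' := by
    simp only [Before, not_or, not_and, not_lt] at h h'
    have e := le_antisymm h'.1 h.1
    have := le_antisymm (h'.2 e.symm) (h.2 e)
    exact (Fintype.equivFin κ).injective this

/-- Entry `i` is valid, with score in cell `g`. -/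
def InCell (g : ℕ) (i : κ) : Prop :=
  (A i).1 ∧ lo + g * ε ≤ inner ℝ u (A i).2 ∧ (inner ℝ u (A i).2 : ℝ) < lo + (g + 1) * ε

/-- Entry `i` is in cell `g` and not among the `T` least of the cell. -/
def InTail (g : ℕ) (i : κ) : Prop :=
  InCell u lo ε A g i ∧ T ≤ rankIn (Before u A) (InCell u lo ε A g) i

/-- Entry `i` is selected for the given slot. -/
def Selected : Slot G T → κ → Prop
  | (g, t, false), i =>
      InCell u lo ε A g i ∧ rankIn (Before u A) (InCell u lo ε A g) i = t
  | (g, t, true), i =>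
      InTail T u lo ε A g i ∧
        rankIn (Function.swap (Before u A)) (InTail T u lo ε A g) i = t

open Classical in
/-- Keep, in every cell, the `T` entries of least score and the `T` entries of largest score. -/
def sparsify : Arr (Slot G T) d := fun s =>
  (∃ i, Selected G T u lo ε A s i, ∑ i, (if Selected G T u lo ε A s i then (1 : ℝ) else 0) • (A i).2)

variable {G T u lo ε A}

theorem Selected.inCell {s : Slot G T} {i : κ} (h : Selected G T u lo ε A s i) :
    InCell u lo ε A s.1 i := by
  obtain ⟨g, t, _ | _⟩ := s
  exacts [h.1, h.1.1]

instance swap_isStrictTotalOrder : IsStrictTotalOrder κ (Function.swap (Before u A)) :=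
  inferInstance

theorem Selected.unique {s : Slot G T} {i j : κ} (h : Selected G T u lo ε A s i)
    (h' : Selected G T u lo ε A s j) : i = j := by
  obtain ⟨g, t, _ | _⟩ := s
  · exact rankIn_inj h.1 h'.1 (h.2.trans h'.2.symm)
  · exact rankIn_inj h.1 h'.1 (h.2.trans h'.2.symm)

/-- Cells are disjoint half-open intervals, and within a cell the upper selection is taken only from
entries that are not among the `T` least. So no entry is stored twice. -/
theorem Selected.slot_unique (hε : 0 < ε) {s s' : Slot G T} {i : κ}
    (h : Selected G T u lo ε A s i) (h' : Selected G T u lo ε A s' i) : s = s' := by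
  have hc := h.inCell.2
  have hc' := h'.inCell.2
  have hg : s.1 = s'.1 := by
    have h1 : ((s.1 : ℕ) : ℝ) < (s'.1 : ℕ) + 1 := by
      have := hc.1.trans_lt hc'.2
      by_contra hcon
      push Not at hcon
      have := mul_le_mul_of_nonneg_right hcon hε.le
      linarith
    have h2 : ((s'.1 : ℕ) : ℝ) < (s.1 : ℕ) + 1 := by
      have := hc'.1.trans_lt hc.2
      by_contra hcon
      push Not at hcon
      have := mul_le_mul_of_nonneg_right hcon hε.le
      linarith
    have h1' : (s.1 : ℕ) < s'.1 + 1 := by exact_mod_cast h1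
    have h2' : (s'.1 : ℕ) < s.1 + 1 := by exact_mod_cast h2
    exact Fin.ext (by omega)
  obtain ⟨g, t, b⟩ := s
  obtain ⟨g', t', b'⟩ := s'
  simp only at hg
  subst hg
  cases b <;> cases b'
  · have := h.2.symm.trans h'.2
    rw [Fin.ext this]
  · have h1 := h.2
    have h2 := h'.1.2
    have := t.isLt
    omega
  · have h1 := h'.2
    have h2 := h.1.2
    have := t'.isLt
    omega
  · have := h.2.symm.trans h'.2
    rw [Fin.ext this]

/-- The sum over all entries with selection indicators has a single nonzero term. The array is
defined by such a sum because a sum is directly a straight-line computation. -/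
theorem sparsify_snd {s : Slot G T} {i : κ} (h : Selected G T u lo ε A s i) :
    (sparsify G T u lo ε A s).2 = (A i).2 := by
  classical
  simp only [sparsify]
  rw [Finset.sum_eq_single i]
  · rw [if_pos h, one_smul]
  · intro j _ hj
    rw [if_neg fun h' => hj (h'.unique h), zero_smul]
  · simp

theorem sparsify_distinct (hε : 0 < ε)
    (hA : ∀ i j, (A i).1 → (A j).1 → (A i).2 = (A j).2 → i = j) {s s' : Slot G T}
    (hs : (sparsify G T u lo ε A s).1) (hs' : (sparsify G T u lo ε A s').1)
    (h : (sparsify G T u lo ε A s).2 = (sparsify G T u lo ε A s').2) : s = s' := by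
  obtain ⟨i, hi⟩ := hs
  obtain ⟨j, hj⟩ := hs'
  rw [sparsify_snd hi, sparsify_snd hj] at h
  have := hA i j hi.inCell.1 hj.inCell.1 h
  subst this
  exact hi.slot_unique hε hj

/-- Every valid entry with score in a cell is kept, or there are `T` kept entries on either side of
it in the same cell. -/
theorem sparsify_spec {i : κ} {g : Fin G} (hi : InCell u lo ε A g i) :
    (∃ s, (sparsify G T u lo ε A s).1 ∧ (sparsify G T u lo ε A s).2 = (A i).2) ∨
    (∀ t : Fin T, ∃ j, Selected G T u lo ε A (g, t, false) j ∧
      (inner ℝ u (A j).2 : ℝ) ≤ inner ℝ u (A i).2) ∧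
    ∀ t : Fin T, ∃ j, Selected G T u lo ε A (g, t, true) j ∧
      (inner ℝ u (A i).2 : ℝ) ≤ inner ℝ u (A j).2 := by
  have hle : ∀ {j k : κ}, Before u A j k → (inner ℝ u (A j).2 : ℝ) ≤ inner ℝ u (A k).2 := by
    rintro j k (h | h)
    exacts [h.le, h.1.le]
  by_cases h1 : rankIn (Before u A) (InCell u lo ε A g) i < T
  · left
    have hsel : Selected G T u lo ε A (g, ⟨_, h1⟩, false) i := ⟨hi, rfl⟩
    exact ⟨_, ⟨i, hsel⟩, sparsify_snd hsel⟩
  push Not at h1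
  have htail : InTail T u lo ε A g i := ⟨hi, h1⟩
  by_cases h2 : rankIn (Function.swap (Before u A)) (InTail T u lo ε A g) i < T
  · left
    have hsel : Selected G T u lo ε A (g, ⟨_, h2⟩, true) i := ⟨htail, rfl⟩
    exact ⟨_, ⟨i, hsel⟩, sparsify_snd hsel⟩
  push Not at h2
  right
  constructor
  · intro t
    obtain ⟨j, hj, hr, he⟩ := exists_rankIn_eq (t.isLt.trans_le h1)
    exact ⟨j, ⟨hj, he⟩, hle hr⟩
  · intro t
    obtain ⟨j, hj, hr, he⟩ := exists_rankIn_eq (t.isLt.trans_le h2)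
    exact ⟨j, ⟨hj, he⟩, hle hr⟩

end sparsify

/-! ### Decoding block by block -/

section decode
variable {d N G T : ℕ}

/-- All sums of an array entry and a codeword. -/
def extendArr (A : Arr (Slot G T) d) (w : Fin N → Vec d) : Arr (Slot G T × Fin N) d :=
  fun p => ((A p.1).1, (A p.1).2 + w p.2)

/-- The array with the zero vector as its only valid entry. -/
def initArr (G T d : ℕ) : Arr (Slot G T) d := fun s => (s.1.val = 0 ∧ s.2.1.val = 0 ∧ s.2.2 = false, 0)

/-- The array of partial codewords after `k` blocks. -/
def decodeArr (G T : ℕ) (u : Vec d) (lo ε : ℝ) (w : ℕ → Fin N → Vec d) : ℕ → Arr (Slot G T) d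
  | 0 => initArr G T d
  | k + 1 => sparsify G T u lo ε (extendArr (decodeArr G T u lo ε w k) (w k))

/-- The sums of codewords of the last blocks. -/
def suffixes (b : ℕ) (w : ℕ → Fin N → Vec d) : ℕ → Set (Vec d)
  | 0 => {0}
  | k + 1 => {v | ∃ a, ∃ v' ∈ suffixes b w k, v = w (b - (k + 1)) a + v'}

/-- The completions of array entries with score near `c`. -/
def Completions (A : Arr (Slot G T) d) (S : Set (Vec d)) (u : Vec d) (c ε : ℝ) : Set (Vec d) :=
  {v | ∃ s, (A s).1 ∧ ∃ v' ∈ S, v = (A s).2 + v' ∧ |(inner ℝ u v : ℝ) - c| ≤ ε}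

/-- Conditions on the blocks of a product code that make partial sums distinct and bounded. -/
structure Blocks (b : ℕ) (w : ℕ → Fin N → Vec d) (blk : Fin d → ℕ) : Prop where
  inj : ∀ k < b, Function.Injective (w k)
  supp : ∀ k < b, ∀ a i, blk i ≠ k → w k a i = 0
  norm_le : ∀ k < b, ∀ a, ‖w k a‖ ≤ 1

variable {b : ℕ} {w : ℕ → Fin N → Vec d} {blk : Fin d → ℕ} {u : Vec d} {lo ε c : ℝ}

/-- Partial sums vanish on the coordinates of later blocks. Hence the last word of a sum is read off
on its own block, and by induction a partial sum occurs only once in the array. Norms grow by at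
most one per block. -/
theorem decodeArr_inv (hw : Blocks b w blk) (hε : 0 < ε) {k : ℕ} (hk : k ≤ b) :
    (∀ s s', (decodeArr G T u lo ε w k s).1 → (decodeArr G T u lo ε w k s').1 →
      (decodeArr G T u lo ε w k s).2 = (decodeArr G T u lo ε w k s').2 → s = s') ∧
    ∀ s, (decodeArr G T u lo ε w k s).1 → ‖(decodeArr G T u lo ε w k s).2‖ ≤ k ∧
      ∀ i, k ≤ blk i → (decodeArr G T u lo ε w k s).2 i = 0 := by
  induction k with
  | zero =>
    refine ⟨fun s s' hs hs' _ => ?_, fun s _ => ?_⟩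
    · obtain ⟨h1, h2, h3⟩ := hs
      obtain ⟨h1', h2', h3'⟩ := hs'
      exact Prod.ext (Fin.ext (h1.trans h1'.symm)) (Prod.ext (Fin.ext (h2.trans h2'.symm))
        (h3.trans h3'.symm))
    · simp [decodeArr, initArr]
  | succ k ih =>
    obtain ⟨h1, h2⟩ := ih (by omega)
    refine ⟨fun s s' hs hs' h => ?_, fun s hs => ?_⟩
    · refine sparsify_distinct hε ?_ hs hs' h
      rintro ⟨p, a⟩ ⟨p', a'⟩ hp hp' heq
      simp only [extendArr] at hp hp' heq
      have hwa : w k a = w k a' := by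
        ext i
        by_cases hi : blk i = k
        · have := congrArg (fun v : Vec d => v i) heq
          simp only [PiLp.add_apply, (h2 p hp).2 i hi.ge, (h2 p' hp').2 i hi.ge, zero_add] at this
          exact this
        · rw [hw.supp k (by omega) a i hi, hw.supp k (by omega) a' i hi]
      rw [hwa] at heq
      rw [h1 p p' hp hp' (add_right_cancel heq), hw.inj k (by omega) hwa]
    · obtain ⟨⟨p, a⟩, hi⟩ := hs
      have e : (decodeArr G T u lo ε w (k + 1) s).2 = (decodeArr G T u lo ε w k p).2 + w k a :=
        sparsify_snd hi
      have hp : (decodeArr G T u lo ε w k p).1 := hi.inCell.1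
      rw [e]
      constructor
      · refine (norm_add_le _ _).trans ?_
        push_cast
        exact add_le_add (h2 p hp).1 (hw.norm_le k (by omega) a)
      · intro i hki
        rw [PiLp.add_apply, (h2 p hp).2 i (by omega), hw.supp k (by omega) a i (by omega), add_zero]

/-- If no entry with a valid completion is dropped, all completions survive. Suppose such an entry,
with completion v', is dropped. Its cell then contains `T` kept entries of smaller score and `T` of
larger score. Combine v' with those on the side of the target `c`: their scores differ from the
dropped one by less than the cell width ε, in the direction of `c`, so the totals remain within ε of
`c`. Distinct entries give distinct sums with the same v', so there are `T` completions. -/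
theorem completions_step (hw : Blocks b w blk) (hε : 0 < ε) (hu : ‖u‖ ≤ 1) (hlo : lo = -b)
    (hG : (2 * b : ℝ) < G * ε) {k : ℕ} (hk : k < b)
    (hfin : (Completions (decodeArr G T u lo ε w (k + 1)) (suffixes b w (b - (k + 1))) u c ε).Finite) :
    min T (Completions (decodeArr G T u lo ε w k) (suffixes b w (b - k)) u c ε).ncard ≤
      (Completions (decodeArr G T u lo ε w (k + 1)) (suffixes b w (b - (k + 1))) u c ε).ncard := by
  set A := decodeArr G T u lo ε w k with hA
  set E := extendArr A (w k) with hE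
  have hA' : decodeArr G T u lo ε w (k + 1) = sparsify G T u lo ε E := rfl
  obtain ⟨hinv1, hinv2⟩ := decodeArr_inv (G := G) (T := T) (u := u) (lo := lo) hw hε hk.le
  obtain ⟨hdist, -⟩ := decodeArr_inv (G := G) (T := T) (u := u) (lo := lo) hw hε
    (show k + 1 ≤ b from hk)
  have hsuf : suffixes b w (b - k) =
      {v | ∃ a, ∃ v' ∈ suffixes b w (b - (k + 1)), v = w k a + v'} := by
    obtain ⟨j, hj⟩ : ∃ j, b - k = j + 1 := ⟨b - (k + 1), by omega⟩
    rw [hj, suffixes, show b - (j + 1) = k by omega, show b - (k + 1) = j by omega]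
  -- Partial sums have norm at most b, so scores lie in [-b, b], which the `G` cells starting at
  -- `lo` cover.
  have hcell : ∀ p, (E p).1 → ∃ g : Fin G, InCell u lo ε E g p := by
    intro p hp
    have hn : ‖(E p).2‖ ≤ b := by
      refine (norm_add_le _ _).trans ?_
      have h1 := (hinv2 p.1 hp).1
      have h2 := hw.norm_le k hk p.2
      have h3 : ((k : ℝ) + 1) ≤ b := by exact_mod_cast hk
      linarith
    have hs := abs_real_inner_le_norm u (E p).2
    have hs2 : ‖u‖ * ‖(E p).2‖ ≤ 1 * b := mul_le_mul hu hn (norm_nonneg _) zero_le_one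
    have hs3 := abs_le.1 (hs.trans hs2)
    set x : ℝ := (inner ℝ u (E p).2 - lo) / ε with hx
    have hx0 : 0 ≤ x := div_nonneg (by rw [hlo]; linarith [hs3.1]) hε.le
    have hxe : x * ε = inner ℝ u (E p).2 - lo := div_mul_cancel₀ _ hε.ne'
    have hf1 := Nat.floor_le hx0
    have hf2 := Nat.lt_floor_add_one x
    have hxG : x < G := by
      by_contra hcon
      push Not at hcon
      have := mul_le_mul_of_nonneg_right hcon hε.le
      rw [hxe, hlo] at this
      linarith [hs3.2]
    refine ⟨⟨⌊x⌋₊, (Nat.floor_lt hx0).2 hxG⟩, hp, ?_, ?_⟩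
    · have := mul_le_mul_of_nonneg_right hf1 hε.le
      simp only; linarith
    · have := mul_lt_mul_of_pos_right hf2 hε
      simp only; linarith
  by_cases hdrop : ∃ p, (E p).1 ∧ (∃ v' ∈ suffixes b w (b - (k + 1)),
      |(inner ℝ u ((E p).2 + v') : ℝ) - c| ≤ ε) ∧
      ¬ ∃ s, (sparsify G T u lo ε E s).1 ∧ (sparsify G T u lo ε E s).2 = (E p).2
  · obtain ⟨p, hp, ⟨v', hv', hwin⟩, hno⟩ := hdrop
    obtain ⟨g, hg⟩ := hcell p hp
    obtain ⟨hlow, hhigh⟩ := (sparsify_spec (T := T) hg).resolve_left hno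
    have main : ∀ dir : Bool, (∀ t : Fin T, ∃ j, Selected G T u lo ε E (g, t, dir) j ∧
        |(inner ℝ u ((E j).2 + v') : ℝ) - c| ≤ ε) →
        T ≤ (Completions (decodeArr G T u lo ε w (k + 1)) (suffixes b w (b - (k + 1))) u c ε).ncard := by
      intro dir h
      choose j hj hjw using h
      have hinj : Function.Injective fun t : Fin T => (E (j t)).2 + v' := by
        intro t t' htt
        have htt := add_right_cancel htt
        rw [← sparsify_snd (hj t), ← sparsify_snd (hj t'), ← hA'] at htt
        have := hdist (g, t, dir) (g, t', dir) ⟨_, hj t⟩ ⟨_, hj t'⟩ htt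
        simpa using this
      have hsub : Set.range (fun t : Fin T => (E (j t)).2 + v') ⊆
          Completions (decodeArr G T u lo ε w (k + 1)) (suffixes b w (b - (k + 1))) u c ε := by
        rintro _ ⟨t, rfl⟩
        exact ⟨(g, t, dir), ⟨_, hj t⟩, v', hv', by rw [hA', sparsify_snd (hj t)], hjw t⟩
      have := Set.ncard_le_ncard hsub hfin
      rw [← Set.image_univ, Set.ncard_image_of_injective _ hinj, Set.ncard_univ,
        Nat.card_eq_fintype_card, Fintype.card_fin] at this
      exact this
    refine (min_le_left _ _).trans ?_
    rw [inner_add_right, abs_le] at hwin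
    -- A total score at or above `c` may decrease by up to ε, and one below `c` may increase by up
    -- to ε.
    by_cases hc : c ≤ inner ℝ u (E p).2 + inner ℝ u v'
    · refine main false fun t => ?_
      obtain ⟨j, hj, hle⟩ := hlow t
      refine ⟨j, hj, ?_⟩
      have h1 := hj.inCell.2.1
      have h2 := hg.2.2
      rw [inner_add_right, abs_le]
      simp only at h1
      constructor <;> linarith
    · push Not at hc
      refine main true fun t => ?_
      obtain ⟨j, hj, hle⟩ := hhigh t
      refine ⟨j, hj, ?_⟩
      have h1 := hj.inCell.2.2
      have h2 := hg.2.1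
      rw [inner_add_right, abs_le]
      simp only at h1
      constructor <;> linarith
  · push Not at hdrop
    refine (min_le_right _ _).trans (Set.ncard_le_ncard ?_ hfin)
    rintro v ⟨s, hs, v', hv', rfl, hwin⟩
    rw [hsuf] at hv'
    obtain ⟨a, v'', hv'', rfl⟩ := hv'
    rw [← add_assoc] at hwin ⊢
    obtain ⟨s', hs', he⟩ := hdrop (s, a) hs ⟨v'', hv'', hwin⟩
    exact ⟨s', hs', v'', hv'', by rw [hA', he]; rfl, hwin⟩

theorem suffixes_finite (b : ℕ) (w : ℕ → Fin N → Vec d) (k : ℕ) : (suffixes b w k).Finite := by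
  induction k with
  | zero => exact Set.finite_singleton _
  | succ k ih =>
    refine ((Set.finite_univ (α := Fin N)).prod ih |>.image
      fun p => w (b - (k + 1)) p.1 + p.2).subset ?_
    rintro v ⟨a, v', hv', rfl⟩
    exact ⟨(a, v'), ⟨trivial, hv'⟩, rfl⟩

theorem completions_finite (A : Arr (Slot G T) d) {S : Set (Vec d)} (hS : S.Finite) (u : Vec d)
    (c ε : ℝ) : (Completions A S u c ε).Finite := by
  refine ((Set.finite_univ (α := Slot G T)).prod hS |>.image fun p => (A p.1).2 + p.2).subset ?_
  rintro v ⟨s, -, v', hv', rfl, -⟩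
  exact ⟨(s, v'), ⟨trivial, hv'⟩, rfl⟩

/-- Sparsification only selects existing sums, so undoing it block by block shows that nothing
except full codewords in the window is ever produced. -/
theorem completions_subset {k : ℕ} (hk : k ≤ b) :
    Completions (decodeArr G T u lo ε w k) (suffixes b w (b - k)) u c ε ⊆
      {v ∈ suffixes b w b | |(inner ℝ u v : ℝ) - c| ≤ ε} := by
  induction k with
  | zero =>
    rintro v ⟨s, -, v', hv', rfl, h⟩
    have : (decodeArr G T u lo ε w 0 s).2 = 0 := rfl
    rw [this, zero_add] at h ⊢
    exact ⟨hv', h⟩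
  | succ k ih =>
    rintro v ⟨s, ⟨⟨p, a⟩, hi⟩, v', hv', rfl, h⟩
    have e : (decodeArr G T u lo ε w (k + 1) s).2 = (decodeArr G T u lo ε w k p).2 + w k a :=
      sparsify_snd hi
    refine ih (by omega) ⟨p, hi.inCell.1, w k a + v', ?_, by rw [e, add_assoc], h⟩
    obtain ⟨j, hj⟩ : ∃ j, b - k = j + 1 := ⟨b - (k + 1), by omega⟩
    rw [hj, suffixes]
    exact ⟨a, v', by rwa [show j = b - (k + 1) by omega], by rw [show b - (j + 1) = k by omega]⟩

/-- The decoding array contains, up to the threshold `T`, all codewords with score near `c`. -/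
theorem decodeArr_complete (hw : Blocks b w blk) (hε : 0 < ε) (hu : ‖u‖ ≤ 1) (hlo : lo = -b)
    (hG : (2 * b : ℝ) < G * ε) (hT : 0 < T) :
    min T {v ∈ suffixes b w b | |(inner ℝ u v : ℝ) - c| ≤ ε}.ncard ≤
      {v | ∃ s, (decodeArr G T u lo ε w b s).1 ∧ v = (decodeArr G T u lo ε w b s).2 ∧
        |(inner ℝ u v : ℝ) - c| ≤ ε}.ncard := by
  have hG0 : 0 < G := by
    rcases Nat.eq_zero_or_pos G with h | h
    · have h0 : (0 : ℝ) ≤ 2 * b := by positivity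
      simp only [h, Nat.cast_zero, zero_mul] at hG; linarith
    · exact h
  have key : ∀ k ≤ b, min T {v ∈ suffixes b w b | |(inner ℝ u v : ℝ) - c| ≤ ε}.ncard ≤
      (Completions (decodeArr G T u lo ε w k) (suffixes b w (b - k)) u c ε).ncard := by
    intro k
    induction k with
    | zero =>
      intro _
      refine (min_le_right _ _).trans (Set.ncard_le_ncard ?_
        (completions_finite _ (suffixes_finite _ _ _) _ _ _))
      rintro v ⟨hv, h⟩
      exact ⟨(⟨0, hG0⟩, ⟨0, hT⟩, false), ⟨rfl, rfl, rfl⟩, v, hv, by simp [decodeArr, initArr], h⟩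
    | succ k ih =>
      intro hk
      have h1 := ih (by omega)
      have h2 := completions_step (c := c) (T := T) (G := G) hw hε hu hlo hG (k := k) hk
        (completions_finite _ (suffixes_finite _ _ _) _ _ _)
      exact (le_min (min_le_left _ _) h1).trans h2
  refine (key b le_rfl).trans (le_of_eq ?_)
  congr 1
  ext v
  rw [Nat.sub_self]
  constructor
  · rintro ⟨s, hs, v', hv', rfl, h⟩
    rw [show v' = 0 from hv', add_zero] at h ⊢
    exact ⟨s, hs, rfl, h⟩
  · rintro ⟨s, hs, rfl, h⟩
    exact ⟨s, hs, 0, rfl, by rw [add_zero], h⟩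

theorem decodeArr_sound {s : Slot G T} (hs : (decodeArr G T u lo ε w b s).1)
    (h : |(inner ℝ u (decodeArr G T u lo ε w b s).2 : ℝ) - c| ≤ ε) :
    (decodeArr G T u lo ε w b s).2 ∈ suffixes b w b := by
  have := completions_subset (w := w) (u := u) (lo := lo) (ε := ε) (c := c) (G := G) (T := T)
    (le_refl b)
  refine (this ⟨s, hs, 0, ?_, (add_zero _).symm, h⟩).1
  rw [Nat.sub_self]; exact rfl

end decode

end

section

/-! ## Computing the decoding array -/

section
variable {X : Type} {mem : X → Memory} {K : Set (Fn X)} {s t : ℕ} {d : ℕ}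

/-- The coordinates of a vector. -/
def vecFns (v : X → Vec d) : Set (Fn X) := ⋃ j, {.real fun x => v x j}

theorem mem_vecFns (v : X → Vec d) (j : Fin d) : .real (fun x => v x j) ∈ vecFns v :=
  Set.mem_iUnion.2 ⟨j, rfl⟩

theorem comp_vecFns {v : X → Vec d} (h : ∀ j, CompR mem K (fun x => v x j) t) :
    Comp mem K (vecFns v) (d * t) := by
  have := Comp.biUnion (mem := mem) (K := K) (Finset.univ : Finset (Fin d))
    (A := fun j => {Fn.real fun x => v x j}) (t := t) fun j _ => h j
  simpa [vecFns] using this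

variable {κ κ' : Type}

open Classical in
/-- The entries of an array. -/
def arrFns (A : X → Arr κ d) : Set (Fn X) :=
  ⋃ i, ({.bit fun x => decide (A x i).1} ∪ vecFns fun x => (A x i).2)

open Classical in
theorem comp_arrFns [Fintype κ] {A : X → Arr κ d} (h₁ : ∀ i, CompP mem K (fun x => (A x i).1) s)
    (h₂ : ∀ i j, CompR mem K (fun x => (A x i).2 j) t) :
    Comp mem K (arrFns A) (Fintype.card κ * (s + d * t)) := by
  have := Comp.biUnion (mem := mem) (K := K) (Finset.univ : Finset κ)
    (A := fun i => {Fn.bit fun x => decide (A x i).1} ∪ vecFns fun x => (A x i).2)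
    (t := s + d * t) fun i _ => Comp.union (h₁ i) (comp_vecFns (h₂ i))
  simpa [arrFns] using this

theorem compP_arr {A : X → Arr κ d} (h : arrFns A ⊆ K) (i : κ) :
    CompP mem K (fun x => (A x i).1) 0 :=
  Comp.subset (by
    rintro _ rfl
    exact h (Set.mem_iUnion.2 ⟨i, Or.inl rfl⟩)) 0

theorem compR_arr {A : X → Arr κ d} (h : arrFns A ⊆ K) (i : κ) (j : Fin d) :
    CompR mem K (fun x => (A x i).2 j) 0 :=
  CompR.of_mem (h (Set.mem_iUnion.2 ⟨i, Or.inr (mem_vecFns _ j)⟩))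

theorem comp_initArr (G T : ℕ) :
    Comp mem K (arrFns fun _ => initArr G T d) (Fintype.card (Slot G T) * (3 + d * 1)) :=
  comp_arrFns (fun _ => CompP.const _) fun _ _ => (CompR.const 0).congr fun _ => rfl

theorem comp_extendArr {G T N : ℕ} {A : X → Arr (Slot G T) d} (hA : arrFns A ⊆ K)
    {w : X → Fin N → Vec d} (hw : ∀ a j, CompR mem K (fun x => w x a j) t) :
    Comp mem K (arrFns fun x => extendArr (A x) (w x))
      (Fintype.card (Slot G T × Fin N) * (0 + d * (0 + t + 2))) :=
  comp_arrFns (fun p => compP_arr hA p.1) fun p j => (compR_arr hA p.1 j).add (hw p.2 j)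

variable {G T : ℕ} {u : X → Vec d} {lo ε : ℝ} {A : X → Arr κ d}

/-- The scores of the entries of an array. -/
def scoreFns (u : X → Vec d) (A : X → Arr κ d) : Set (Fn X) :=
  ⋃ i, {.real fun x => inner ℝ (u x) (A x i).2}

theorem comp_scoreFns [Fintype κ] (hA : arrFns A ⊆ K) (hu : vecFns u ⊆ K) :
    Comp mem K (scoreFns u A) (Fintype.card κ * (d * 3 + 1)) := by
  have := Comp.biUnion (mem := mem) (K := K) (Finset.univ : Finset κ)
    (A := fun i => {Fn.real fun x => inner ℝ (u x) (A x i).2}) (t := d * 3 + 1) fun i _ =>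
      (CompR.mono (CompR.inner (fun j => CompR.of_mem (hu (mem_vecFns _ j))) (compR_arr hA i))
        (by omega))
  simpa [scoreFns] using this

theorem compR_score (hS : scoreFns u A ⊆ K) (i : κ) :
    CompR mem K (fun x => inner ℝ (u x) (A x i).2) 0 :=
  CompR.of_mem (hS (Set.mem_iUnion.2 ⟨i, rfl⟩))

theorem compP_before [Fintype κ] (hS : scoreFns u A ⊆ K) (i j : κ) :
    CompP mem K (fun x => Before (u x) (A x) i j) 25 :=
  (CompP.lt (compR_score hS i) (compR_score hS j)).or
    ((CompP.eq (compR_score hS i) (compR_score hS j)).and (CompP.const _))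

theorem compP_inCell (hA : arrFns A ⊆ K) (hS : scoreFns u A ⊆ K) (g : ℕ) (i : κ) :
    CompP mem K (fun x => InCell (u x) lo ε (A x) g i) 17 :=
  (compP_arr hA i).and ((CompP.le (.const _) (compR_score hS i)).and
    (CompP.lt (compR_score hS i) (.const _)))

theorem compR_rankIn [Fintype κ] {r : X → κ → κ → Prop} {P : X → κ → Prop}
    (hr : ∀ i j, CompP mem K (fun x => r x i j) s) (hP : ∀ i, CompP mem K (fun x => P x i) t)
    (i : κ) :
    CompR mem K (fun x => (rankIn (r x) (P x) i : ℝ)) (Fintype.card κ * (t + s + 5 + 3) + 1) := by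
  classical
  exact (CompR.card Finset.univ fun j _ => (hP j).and (hr j i)).congr fun x => by
    unfold rankIn; congr!

theorem compP_selected [Fintype κ] (hA : arrFns A ⊆ K) (hS : scoreFns u A ⊆ K) (σ : Slot G T) (i : κ) :
    CompP mem K (fun x => Selected G T (u x) lo ε (A x) σ i)
      (50 * Fintype.card κ ^ 2 + 108 * Fintype.card κ + 50) := by
  have hB := compP_before (mem := mem) hS
  have hC := fun g => compP_inCell (mem := mem) (lo := lo) (ε := ε) hA hS g
  have hR := fun g i => compR_rankIn (mem := mem) (K := K) hB (hC g) i
  have hT : ∀ g i, CompP mem K (fun x => InTail T (u x) lo ε (A x) g i)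
      (50 * Fintype.card κ + 25) := fun g i =>
    (((hC g i).and (CompP.le (.const (T : ℝ)) (hR g i))).mono (by omega)).congr fun x => by
      rw [InTail, Nat.cast_le]
  obtain ⟨g, τ, _ | _⟩ := σ
  · refine CompP.congr (((hC g i).and (CompP.eq (hR g i) (.const (τ : ℝ)))).mono (by nlinarith))
      fun x => ?_
    rw [Selected, Nat.cast_inj]
  · refine CompP.congr (((hT g i).and (CompP.eq (compR_rankIn (fun i j => hB j i) (hT g) i)
      (.const (τ : ℝ)))).mono ?_) fun x => ?_
    · ring_nf; omega
    · rw [Selected, Nat.cast_inj]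

/-- One number `Z` bounds all the sizes involved. Only polynomial dependence on `Z` matters, since
`Z` will be subexponential; the exponents here and below are crude. -/
theorem comp_sparsify [Fintype κ] (hA : arrFns A ⊆ K) (hu : vecFns u ⊆ K) {Z : ℕ}
    (hκ : Fintype.card κ ≤ Z) (hd : d + 1 ≤ Z) (hs : Fintype.card (Slot G T) ≤ Z) :
    Comp mem K (arrFns fun x => sparsify G T (u x) lo ε (A x)) (300 * Z ^ 5) := by
  classical
  have hsel : ∀ σ i, CompP mem (K ∪ scoreFns u A)
      (fun x => Selected G T (u x) lo ε (A x) σ i) (208 * Z ^ 2) := fun σ i =>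
    (compP_selected (hA.trans Set.subset_union_left) Set.subset_union_right σ i).mono (by
      have h1 : 1 ≤ Z := by omega
      have h2 : Fintype.card κ ^ 2 ≤ Z ^ 2 := Nat.pow_le_pow_left hκ 2
      have h3 : Z ≤ Z ^ 2 := Nat.le_self_pow two_ne_zero Z
      omega)
  have hmain := comp_arrFns (mem := mem) (K := K ∪ scoreFns u A)
    (A := fun x => sparsify G T (u x) lo ε (A x))
    (fun σ => (CompP.bex Finset.univ fun i _ => hsel σ i).congr fun x => by simp [sparsify])
    (fun σ j => (CompR.sum Finset.univ fun i _ => (hsel σ i).ind.mul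
      ((compR_arr hA i j).weaken Set.subset_union_left)).congr fun x => by
        simp only [sparsify, WithLp.ofLp_sum, Finset.sum_apply, WithLp.ofLp_smul, Pi.smul_apply,
          smul_eq_mul])
  refine ((comp_scoreFns hA hu).trans hmain).mono_cost ?_
  rw [Finset.card_univ]
  have h1 : 1 ≤ Z := by omega
  have e1 : Fintype.card κ * (208 * Z ^ 2 + 3) + 3 ≤ 220 * Z ^ 3 := by
    calc _ ≤ Z * (208 * Z ^ 2 + 3) + 3 := by gcongr
      _ ≤ 220 * Z ^ 3 := by nlinarith [Nat.one_le_pow 3 Z h1, Nat.pow_le_pow_right h1 (show 1 ≤ 3 by norm_num)]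
  have e2 : Fintype.card κ * (208 * Z ^ 2 + 1 + 0 + 1 + 2) + 1 ≤ 220 * Z ^ 3 := by
    calc _ ≤ Z * (208 * Z ^ 2 + 1 + 0 + 1 + 2) + 1 := by gcongr
      _ ≤ 220 * Z ^ 3 := by nlinarith [Nat.one_le_pow 3 Z h1, Nat.pow_le_pow_right h1 (show 1 ≤ 3 by norm_num)]
  have e3 : Fintype.card κ * (d * 3 + 1) ≤ 3 * Z ^ 5 := by
    calc _ ≤ Z * (3 * Z) := by gcongr; omega
      _ = 3 * Z ^ 2 := by ring
      _ ≤ 3 * Z ^ 5 := by gcongr <;> omega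
  calc _ ≤ 3 * Z ^ 5 + Z * (220 * Z ^ 3 + d * (220 * Z ^ 3)) := by gcongr
    _ = 3 * Z ^ 5 + (220 * Z ^ 4) * (d + 1) := by ring
    _ ≤ 3 * Z ^ 5 + (220 * Z ^ 4) * Z := by gcongr
    _ ≤ 300 * Z ^ 5 := by ring_nf; omega

theorem comp_decodeArr {N : ℕ} {w : X → ℕ → Fin N → Vec d} {b : ℕ} (hu : vecFns u ⊆ K)
    (hw : ∀ k < b, ∀ a j, CompR mem K (fun x => w x k a j) t) {Z : ℕ}
    (hκ : Fintype.card (Slot G T × Fin N) ≤ Z) (hd : d + 1 ≤ Z)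
    (hs : Fintype.card (Slot G T) ≤ Z) (ht : t ≤ Z) {k : ℕ} (hk : k ≤ b) :
    Comp mem K (arrFns fun x => decodeArr G T (u x) lo ε (w x) k) ((k + 1) * (310 * Z ^ 5)) := by
  have h1 : 1 ≤ Z := by omega
  induction k with
  | zero =>
    refine (comp_initArr G T).mono_cost ?_
    calc _ ≤ Z * (3 * Z) := by gcongr; omega
      _ = 3 * Z ^ 2 := by ring
      _ ≤ 3 * Z ^ 5 := by gcongr <;> omega
      _ ≤ _ := by omega
  | succ k ih =>
    have h2 := comp_extendArr (mem := mem) (A := fun x => decodeArr G T (u x) lo ε (w x) k)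
      (K := K ∪ arrFns fun x => decodeArr G T (u x) lo ε (w x) k) Set.subset_union_right
      (w := fun x => w x k) (t := t) fun a j => (hw k hk a j).weaken Set.subset_union_left
    have h3 := comp_sparsify (mem := mem) (G := G) (T := T) (lo := lo) (ε := ε) (u := u)
      (K := (K ∪ arrFns fun x => decodeArr G T (u x) lo ε (w x) k) ∪ arrFns fun x =>
        extendArr (decodeArr G T (u x) lo ε (w x) k) (w x k)) Set.subset_union_right
      (fun f hf => Or.inl (Or.inl (hu hf))) hκ hd hs
    refine ((ih (by omega)).trans (h2.trans h3)).mono_cost ?_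
    have : Fintype.card (Slot G T × Fin N) * (0 + d * (0 + t + 2)) ≤ 3 * Z ^ 5 := by
      calc _ ≤ Z * (0 + Z * (0 + Z + 2)) := by gcongr; omega
        _ ≤ Z * (Z * (3 * Z)) := Nat.mul_le_mul_left _ (by nlinarith)
        _ = 3 * Z ^ 3 := by ring
        _ ≤ 3 * Z ^ 5 := by gcongr <;> omega
    have e : (k + 1 + 1) * (310 * Z ^ 5) = (k + 1) * (310 * Z ^ 5) + 310 * Z ^ 5 := by ring
    omega

end

end

section

/-! ## Sorted lists of vectors -/

section
variable {d : ℕ} (S : Finset (Vec d))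

theorem length_sortedList : (sortedList S).length = S.card := by
  classical
  unfold sortedList
  rw [Finset.length_sort, Finset.card_image_of_injective]
  exact fun v w h => WithLp.ofLp_injective 2 h

variable {S}

theorem toLex_vecAt {k : ℕ} (hk : k < S.card) :
    toLex (vecAt S k).ofLp = (sortedList S)[k]'(by rwa [length_sortedList]) := by
  unfold vecAt
  rw [List.getD_eq_getElem _ _ (by rwa [length_sortedList])]
  rfl

theorem vecAt_mem {k : ℕ} (hk : k < S.card) : vecAt S k ∈ S := by
  classical
  have h := toLex_vecAt hk
  have h2 : (sortedList S)[k]'(by rwa [length_sortedList]) ∈ sortedList S := List.getElem_mem _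
  rw [← h] at h2
  have h3 := (Finset.mem_sort (· ≤ ·)).1 h2
  obtain ⟨v, hv, e⟩ := Finset.mem_image.1 h3
  have : v = vecAt S k := WithLp.ofLp_injective 2 e
  rwa [← this]

theorem exists_vecAt {c : Vec d} (hc : c ∈ S) : ∃ k < S.card, vecAt S k = c := by
  classical
  have h : toLex c.ofLp ∈ sortedList S :=
    (Finset.mem_sort (· ≤ ·)).2 (Finset.mem_image_of_mem _ hc)
  obtain ⟨k, hk, e⟩ := List.getElem_of_mem h
  rw [length_sortedList] at hk
  refine ⟨k, hk, WithLp.ofLp_injective 2 ?_⟩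
  rw [← toLex_vecAt hk] at e
  exact e

theorem vecAt_lt {i j : ℕ} (hij : i < j) (hj : j < S.card) :
    toLex (vecAt S i).ofLp < toLex (vecAt S j).ofLp := by
  rw [toLex_vecAt (hij.trans hj), toLex_vecAt hj]
  exact List.pairwise_iff_getElem.1 (Finset.sortedLT_sort _).pairwise _ _ _ _ hij

theorem vecAt_lt_iff {i j : ℕ} (hi : i < S.card) (hj : j < S.card) :
    toLex (vecAt S i).ofLp < toLex (vecAt S j).ofLp ↔ i < j := by
  rcases lt_trichotomy i j with h | rfl | h
  · exact iff_of_true (vecAt_lt h hj) h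
  · exact iff_of_false (lt_irrefl _) (lt_irrefl _)
  · exact iff_of_false (vecAt_lt h hi).asymm (by omega)

theorem vecAt_inj {i j : ℕ} (hi : i < S.card) (hj : j < S.card) (h : vecAt S i = vecAt S j) :
    i = j := by
  rcases lt_trichotomy i j with h' | h' | h'
  · exact absurd (vecAt_lt h' hj) (by rw [h]; exact lt_irrefl _)
  · exact h'
  · exact absurd (vecAt_lt h' hi) (by rw [h]; exact lt_irrefl _)

variable (S)

open Classical in
/-- The number of elements of `S` below `c`. -/
def vecRank (c : Vec d) : ℕ :=
  ((Finset.range S.card).filter fun k => toLex (vecAt S k).ofLp < toLex c.ofLp).card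

variable {S}

theorem vecRank_le (c : Vec d) : vecRank S c ≤ S.card := by
  classical
  exact (Finset.card_filter_le _ _).trans_eq (Finset.card_range _)

theorem vecRank_vecAt {k : ℕ} (hk : k < S.card) : vecRank S (vecAt S k) = k := by
  classical
  have : ((Finset.range S.card).filter fun i => toLex (vecAt S i).ofLp < toLex (vecAt S k).ofLp) =
      Finset.range k := by
    ext i
    rw [Finset.mem_filter, Finset.mem_range, Finset.mem_range]
    constructor
    · rintro ⟨hi, h⟩; exact (vecAt_lt_iff hi hk).1 h
    · intro h; exact ⟨h.trans hk, vecAt_lt h hk⟩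
  rw [vecRank, this, Finset.card_range]

/-- The sorted array analogue of `lt_card_filter_sort_iff`: the position of a vector is the
threshold of a monotone property of addresses, so the index of a decoded center can be found by
binary search. -/
theorem lt_vecRank_iff {k : ℕ} {c : Vec d} :
    k < vecRank S c ↔ k < S.card ∧ toLex (vecAt S k).ofLp < toLex c.ofLp := by
  classical
  constructor
  · intro h
    have hk : k < S.card := h.trans_le (vecRank_le c)
    refine ⟨hk, ?_⟩
    by_contra hcon
    have : ((Finset.range S.card).filter fun i => toLex (vecAt S i).ofLp < toLex c.ofLp) ⊆
        Finset.range k := by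
      intro i hi
      rw [Finset.mem_filter, Finset.mem_range] at hi
      rw [Finset.mem_range]
      by_contra hik
      push Not at hik
      replace hcon := not_lt.1 hcon
      rcases hik.eq_or_lt with rfl | hik
      · exact absurd hi.2 hcon.not_gt
      · exact absurd (hcon.trans_lt (vecAt_lt hik hi.1)) hi.2.asymm
    have := (Finset.card_le_card this).trans_eq (Finset.card_range k)
    unfold vecRank at h
    omega
  · rintro ⟨hk, h⟩
    have : Finset.range (k + 1) ⊆
        ((Finset.range S.card).filter fun i => toLex (vecAt S i).ofLp < toLex c.ofLp) := by
      intro i hi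
      rw [Finset.mem_range] at hi
      rw [Finset.mem_filter, Finset.mem_range]
      refine ⟨by omega, ?_⟩
      rcases (Nat.lt_succ_iff.1 hi).eq_or_lt with rfl | hi
      · exact h
      · exact (vecAt_lt hi hk).trans h
    have := Finset.card_le_card this
    rw [Finset.card_range] at this
    exact this

theorem toLex_lt_iff {a b : Fin d → ℝ} :
    toLex a < toLex b ↔ ∃ i, (∀ j, j < i → a j = b j) ∧ a i < b i := Iff.rfl

end

/-! ## Truncated sets and deduplication -/

/-- The `T` least elements of `D`. -/
def least (T : ℕ) (D : Finset ℕ) : Finset ℕ := D.filter fun i => rank D i < T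

theorem rank_lt_rank {D : Finset ℕ} {i j : ℕ} (hi : i ∈ D) (h : i < j) : rank D i < rank D j := by
  refine Finset.card_lt_card ⟨fun k hk => ?_, fun hcon => ?_⟩
  · rw [Finset.mem_filter] at hk ⊢
    exact ⟨hk.1, hk.2.trans h⟩
  · have : i ∈ D.filter fun k => k < i := hcon (Finset.mem_filter.2 ⟨hi, h⟩)
    exact absurd (Finset.mem_filter.1 this).2 (lt_irrefl _)

theorem image_rank (D : Finset ℕ) (t : ℕ) :
    (D.filter fun i => i < t).image (rank D) = Finset.range (rank D t) := by
  apply Finset.eq_of_subset_of_card_le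
  · intro v hv
    obtain ⟨i, hi, rfl⟩ := Finset.mem_image.1 hv
    rw [Finset.mem_filter] at hi
    exact Finset.mem_range.2 (rank_lt_rank hi.1 hi.2)
  · rw [Finset.card_image_of_injOn, Finset.card_range]
    · rfl
    · intro i hi j hj h
      rw [Finset.mem_coe, Finset.mem_filter] at hi hj
      rcases lt_trichotomy i j with h' | h' | h'
      · exact absurd h (rank_lt_rank hi.1 h').ne
      · exact h'
      · exact absurd h (rank_lt_rank hj.1 h').ne'

/-- Ranks enumerate a set increasingly, so keeping the ranks below `T` caps the rank function at
`T`. Truncation therefore costs a single comparison. -/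
theorem rank_least (T : ℕ) (D : Finset ℕ) (t : ℕ) : rank (least T D) t = min T (rank D t) := by
  have h1 : (least T D).filter (fun i => i < t) =
      (D.filter fun i => i < t).filter fun i => rank D i < T := by
    ext i; simp only [least, Finset.mem_filter]; tauto
  have hinj : Set.InjOn (rank D) (((D.filter fun i => i < t).filter fun i => rank D i < T : Finset ℕ) :
      Set ℕ) := by
    intro i hi j hj h
    rw [Finset.mem_coe, Finset.mem_filter, Finset.mem_filter] at hi hj
    rcases lt_trichotomy i j with h' | h' | h'
    · exact absurd h (rank_lt_rank hi.1.1 h').ne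
    · exact h'
    · exact absurd h (rank_lt_rank hj.1.1 h').ne'
  have h2 : ((D.filter fun i => i < t).filter fun i => rank D i < T).image (rank D) =
      Finset.range (min T (rank D t)) := by
    have := image_rank D t
    ext v
    rw [Finset.mem_range, lt_min_iff, ← Finset.mem_range (n := rank D t), ← this]
    simp only [Finset.mem_image, Finset.mem_filter]
    constructor
    · rintro ⟨i, ⟨hi, hT⟩, rfl⟩; exact ⟨hT, i, hi, rfl⟩
    · rintro ⟨hT, i, hi, rfl⟩; exact ⟨i, ⟨hi, hT⟩, rfl⟩
  rw [rank, h1, ← Finset.card_image_of_injOn hinj, h2, Finset.card_range]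

theorem rank_eq_card {D : Finset ℕ} {N : ℕ} (h : ∀ i ∈ D, i < N) : rank D N = D.card := by
  rw [rank, Finset.filter_true_of_mem h]

theorem card_least {T : ℕ} {D : Finset ℕ} : (least T D).card = min T D.card := by
  obtain ⟨N, hN⟩ := D.bddAbove
  have h : ∀ i ∈ D, i < N + 1 := fun i hi => Nat.lt_succ_of_le (hN hi)
  rw [← rank_eq_card h, ← rank_least, rank_eq_card]
  exact fun i hi => h i (Finset.filter_subset _ _ hi)

open Classical in
/-- The set of values of the valid entries. -/
def valueSet {κ : Type} [Fintype κ] (valid : κ → Prop) (idx : κ → ℕ) : Finset ℕ :=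
  (Finset.univ.filter valid).image idx

open Classical in
-- Repeated values are counted only at their first occurrence in a fixed enumeration. Repetitions do
-- arise, since different rotations may produce the same center.
theorem rank_valueSet {κ : Type} [Fintype κ] (valid : κ → Prop) (idx : κ → ℕ) (t : ℕ) :
    rank (valueSet valid idx) t = (Finset.univ.filter fun e => valid e ∧ idx e < t ∧
      ∀ e' ∈ Finset.univ.filter fun e' => Fintype.equivFin κ e' < Fintype.equivFin κ e,
        ¬ (valid e' ∧ idx e' = idx e)).card := by
  symm
  refine Finset.card_bij (fun e _ => idx e) ?_ ?_ ?_
  · intro e he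
    rw [Finset.mem_filter] at he
    rw [Finset.mem_filter]
    exact ⟨Finset.mem_image_of_mem _ (Finset.mem_filter.2 ⟨Finset.mem_univ _, he.2.1⟩), he.2.2.1⟩
  · intro e he e' he' h
    rw [Finset.mem_filter] at he he'
    rcases lt_trichotomy (Fintype.equivFin κ e) (Fintype.equivFin κ e') with hlt | heq | hlt
    · exact absurd ⟨he.2.1, h⟩ (he'.2.2.2 e (by simpa using hlt))
    · exact (Fintype.equivFin κ).injective heq
    · exact absurd ⟨he'.2.1, h.symm⟩ (he.2.2.2 e' (by simpa using hlt))
  · intro v hv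
    rw [Finset.mem_filter] at hv
    obtain ⟨hv, hvt⟩ := hv
    obtain ⟨e, he, rfl⟩ := Finset.mem_image.1 hv
    have hne : (Finset.univ.filter fun e' => valid e' ∧ idx e' = idx e).Nonempty :=
      ⟨e, by simpa using he⟩
    obtain ⟨f, hf, hmin⟩ := Finset.exists_min_image _ (Fintype.equivFin κ) hne
    rw [Finset.mem_filter] at hf
    refine ⟨f, Finset.mem_filter.2 ⟨Finset.mem_univ _, hf.2.1, by rw [hf.2.2]; exact hvt, ?_⟩,
      hf.2.2⟩
    intro e' he' hcon
    rw [Finset.mem_filter] at he'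
    exact absurd (hmin e' (by simp [hcon.1, hcon.2, hf.2.2])) (not_le.2 he'.2)

section
variable {X : Type} {mem : X → Memory} {K A : Set (Fn X)} {s t : ℕ}

theorem RankComp.trans {S : X → Finset ℕ} (hA : Comp mem K A s) (h : RankComp mem (K ∪ A) S t) :
    RankComp mem K S (s + t) := by
  refine Comp.trans ((hA.pullback (Y := X × ℕ) Prod.fst).weaken Set.subset_union_left) ?_
  refine Comp.weaken h ?_
  rw [Set.image_union]
  rintro f ((hf | hf) | hf)
  exacts [Or.inl (Or.inl hf), Or.inr hf, Or.inl (Or.inr hf)]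

theorem RankComp.mono {S : X → Finset ℕ} (h : RankComp mem K S s) (hst : s ≤ t) :
    RankComp mem K S t := CompR.mono h hst

theorem rankComp_least {D : X → Finset ℕ} (h : RankComp mem K D t) (T : ℕ) :
    RankComp mem K (fun x => least T (D x)) (2 * t + 20) := by
  classical
  refine CompR.mono (CompR.congr (CompR.ite (CompP.le (.const (T : ℝ)) h) (.const (T : ℝ)) h)
    fun p => ?_) (by omega)
  rw [rank_least, Nat.cast_min, min_def]

theorem rankComp_valueSet {κ : Type} [Fintype κ] {valid : X → κ → Prop} {idx : X → κ → ℕ}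
    (hv : ∀ e, CompP mem K (fun x => valid x e) 0)
    (hi : ∀ e, CompR mem K (fun x => (idx x e : ℝ)) 0) :
    RankComp mem K (fun x => valueSet (valid x) (idx x))
      (Fintype.card κ * (21 * Fintype.card κ + 30) + 1) := by
  classical
  set K' : Set (Fn (X × ℕ)) := Fn.comp Prod.fst '' K ∪ {.real fun p => (p.2 : ℝ)}
  have hv' : ∀ e, CompP (mem ∘ Prod.fst) K' (fun p : X × ℕ => valid p.1 e) 0 := fun e => by
    have := ((hv e : Comp mem K _ 0).pullback (Y := X × ℕ) Prod.fst)
    rw [Set.image_singleton] at this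
    exact this.weaken Set.subset_union_left
  have hi' : ∀ e, CompR (mem ∘ Prod.fst) K' (fun p : X × ℕ => (idx p.1 e : ℝ)) 0 := fun e => by
    have := ((hi e : Comp mem K _ 0).pullback (Y := X × ℕ) Prod.fst)
    rw [Set.image_singleton] at this
    exact this.weaken Set.subset_union_left
  have ht : CompR (mem ∘ Prod.fst) K' (fun p : X × ℕ => (p.2 : ℝ)) 0 := .of_mem (Or.inr rfl)
  refine CompR.mono (CompR.congr (CompR.card (t := 21 * Fintype.card κ + 20) Finset.univ fun e _ =>
    CompP.mono ((hv' e).and ((CompP.lt (hi' e) ht).and (CompP.ball (Finset.univ.filter fun e' =>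
      Fintype.equivFin κ e' < Fintype.equivFin κ e) fun e' _ =>
        ((hv' e').and (CompP.eq (hi' e') (hi' e))).not))) ?_) fun p => ?_) ?_
  · have : (Finset.univ.filter fun e' => Fintype.equivFin κ e' < Fintype.equivFin κ e).card ≤
      Fintype.card κ := Finset.card_le_univ _
    omega
  · rw [rank_valueSet]
    congr! 3
    simp only [Nat.cast_lt, Nat.cast_inj]
  · rw [Finset.card_univ]
    exact Nat.add_le_add_right (Nat.mul_le_mul_left _ (by omega)) _

end

end

section

/-! ## The candidates obtained by decoding -/

section
variable {d b N q : ℕ} (P : ProductCode d b N q)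

/-- The codewords of the blocks. -/
def ProductCode.words (k : ℕ) (a : Fin N) : Vec d := if h : k < b then P.word ⟨k, h⟩ a else 0

theorem ProductCode.blocks : Blocks b P.words fun i => i.val * b / d where
  inj k hk a a' h := by
    simp only [words, dif_pos hk] at h
    exact P.word_injective _ h
  supp k hk a i hi := by
    simp only [words, dif_pos hk]
    exact P.word_support _ _ _ hi
  norm_le k hk a := by
    simp only [words, dif_pos hk, P.word_norm]
    have : (1 : ℝ) ≤ Real.sqrt b := by
      rw [Real.one_le_sqrt]
      exact_mod_cast (by omega : 1 ≤ b)
    exact div_le_one_of_le₀ this (by positivity)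

theorem mem_suffixes_iff {w : ℕ → Fin N → Vec d} {j : ℕ} (hj : j ≤ b) {v : Vec d} :
    v ∈ suffixes b w j ↔ ∃ t : Fin j → Fin N, v = ∑ i : Fin j, w (b - j + i) (t i) := by
  induction j generalizing v with
  | zero => simp [suffixes]
  | succ j ih =>
    constructor
    · rintro ⟨a, v', hv', rfl⟩
      obtain ⟨t, rfl⟩ := (ih (by omega)).1 hv'
      refine ⟨Fin.cons a t, ?_⟩
      rw [Fin.sum_univ_succ]
      simp only [Fin.cons_zero, Fin.cons_succ, Fin.val_zero, add_zero, Fin.val_succ]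
      congr 1
      refine Finset.sum_congr rfl fun i _ => ?_
      rw [show b - j + i.val = b - (j + 1) + (i.val + 1) by omega]
    · rintro ⟨t, rfl⟩
      refine ⟨t 0, ∑ i : Fin j, w (b - j + i) (t i.succ), (ih (by omega)).2 ⟨_, rfl⟩, ?_⟩
      rw [Fin.sum_univ_succ]
      simp only [Fin.val_zero, add_zero, Fin.val_succ]
      congr 1
      refine Finset.sum_congr rfl fun i _ => ?_
      rw [show b - j + i.val = b - (j + 1) + (i.val + 1) by omega]

theorem ProductCode.mem_suffixes {v : Vec d} :
    v ∈ suffixes b P.words b ↔ ∃ t : Fin b → Fin N, v = ∑ k, P.word k (t k) := by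
  rw [mem_suffixes_iff le_rfl]
  refine exists_congr fun t => ?_
  rw [show ∑ i : Fin b, P.words (b - b + i) (t i) = ∑ k, P.word k (t k) from
    Finset.sum_congr rfl fun i _ => by simp [words]]

/-- The rotated vector. -/
def ProductCode.rotate (r : Fin q) (v : Vec d) : Vec d :=
  WithLp.toLp 2 ((P.rot r : Matrix (Fin d) (Fin d) ℝ) *ᵥ v.ofLp)

/-- The vector rotated backwards. -/
def ProductCode.unrotate (r : Fin q) (u : Vec d) : Vec d :=
  WithLp.toLp 2 ((P.rot r : Matrix (Fin d) (Fin d) ℝ)ᵀ *ᵥ u.ofLp)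

theorem ProductCode.mem_points {c : Vec d} :
    c ∈ P.points ↔ ∃ r, ∃ v ∈ suffixes b P.words b, P.rotate r v = c := by
  classical
  unfold points
  rw [Finset.mem_image]
  constructor
  · rintro ⟨t, -, rfl⟩
    exact ⟨t.1, _, P.mem_suffixes.2 ⟨t.2, rfl⟩, rfl⟩
  · rintro ⟨r, v, hv, rfl⟩
    obtain ⟨t, rfl⟩ := P.mem_suffixes.1 hv
    exact ⟨(r, t), Finset.mem_univ _, rfl⟩

theorem inner_eq_dotProduct (u v : Vec d) : inner ℝ u v = u.ofLp ⬝ᵥ v.ofLp := inner_eq_sum u v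

/-- Searching the rotated code near u is searching the unrotated product near Qᵀu, to which block
decoding applies. -/
theorem ProductCode.inner_rotate (r : Fin q) (u v : Vec d) :
    inner ℝ u (P.rotate r v) = inner ℝ (P.unrotate r u) v := by
  rw [inner_eq_dotProduct, inner_eq_dotProduct, rotate, unrotate, Matrix.dotProduct_mulVec,
    Matrix.mulVec_transpose]

theorem ProductCode.rot_mul_transpose (r : Fin q) :
    (P.rot r : Matrix (Fin d) (Fin d) ℝ) * (P.rot r : Matrix (Fin d) (Fin d) ℝ)ᵀ = 1 := by
  have h := (Matrix.mem_specialOrthogonalGroup_iff.1 (P.rot r).2).1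
  exact (Matrix.mem_orthogonalGroup_iff (Fin d) ℝ).1 h

theorem ProductCode.rotate_unrotate (r : Fin q) (u : Vec d) : P.rotate r (P.unrotate r u) = u := by
  rw [rotate, unrotate]
  simp only [Matrix.mulVec_mulVec, P.rot_mul_transpose, Matrix.one_mulVec]

theorem ProductCode.norm_unrotate (r : Fin q) (u : Vec d) : ‖P.unrotate r u‖ = ‖u‖ := by
  have h : (inner ℝ (P.unrotate r u) (P.unrotate r u) : ℝ) = inner ℝ u u := by
    rw [← P.inner_rotate, P.rotate_unrotate]
  rw [real_inner_self_eq_norm_sq, real_inner_self_eq_norm_sq] at h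
  exact (sq_eq_sq₀ (norm_nonneg _) (norm_nonneg _)).1 h

theorem ProductCode.rotate_injective (r : Fin q) : Function.Injective (P.rotate r) := by
  intro v w h
  have h1 : ∀ u : Vec d, (inner ℝ (P.unrotate r u) v : ℝ) = inner ℝ (P.unrotate r u) w := fun u => by
    rw [← P.inner_rotate, ← P.inner_rotate, h]
  have h2 : ∀ u, P.unrotate r (P.rotate r u) = u := by
    intro u
    have := mul_eq_one_comm.1 (P.rot_mul_transpose r)
    rw [unrotate, rotate]
    simp only [Matrix.mulVec_mulVec, this, Matrix.one_mulVec]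
  refine ext_inner_left ℝ fun u => ?_
  rw [← h2 u]
  exact h1 _

variable (α' : ℝ) (G T : ℕ) (u : Vec d)

/-- The array of codewords found for one rotation. -/
def ProductCode.decoded (r : Fin q) : Arr (Slot G T) d :=
  decodeArr G T (P.unrotate r u) (-b) (tol d) P.words b

/-- A decoded codeword is a candidate if its score is correct. -/
def ProductCode.Valid (e : Fin q × Slot G T) : Prop :=
  (P.decoded G T u e.1 e.2).1 ∧
    Near d (inner ℝ (P.unrotate e.1 u) (P.decoded G T u e.1 e.2).2) (Real.cos α')

/-- The vector of a candidate. -/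
def ProductCode.candidate (e : Fin q × Slot G T) : Vec d :=
  P.rotate e.1 (P.decoded G T u e.1 e.2).2

variable {α' G T u}

theorem ProductCode.candidate_mem {e : Fin q × Slot G T} (h : P.Valid α' G T u e) :
    P.candidate G T u e ∈ nbrs α' P.points u := by
  classical
  have hs := decodeArr_sound h.1 h.2
  exact Finset.mem_filter.2 ⟨P.mem_points.2 ⟨_, _, hs, rfl⟩, by
    rw [candidate, P.inner_rotate]; exact h.2⟩

open Classical in
-- If some rotation has at least `T` codewords in the window, decoding that rotation alone gives `T`
-- distinct candidates. Otherwise decoding is exhaustive for every rotation, and every neighbour of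
-- `u` is a candidate.
theorem ProductCode.le_card_candidates (hu : ‖u‖ ≤ 1) (htol : 0 < tol d)
    (hG : (2 * b : ℝ) < G * tol d) (hT : 0 < T) :
    min T (nbrs α' P.points u).card ≤
      ((Finset.univ.filter (P.Valid α' G T u)).image (P.candidate G T u)).card := by
  set D := (Finset.univ.filter (P.Valid α' G T u)).image (P.candidate G T u) with hD
  set V : Fin q → Set (Vec d) := fun r => {v ∈ suffixes b P.words b |
    |(inner ℝ (P.unrotate r u) v : ℝ) - Real.cos α'| ≤ tol d} with hV
  set W : Fin q → Set (Vec d) := fun r => {v | ∃ s, (P.decoded G T u r s).1 ∧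
    v = (P.decoded G T u r s).2 ∧ |(inner ℝ (P.unrotate r u) v : ℝ) - Real.cos α'| ≤ tol d} with hW
  have hVW : ∀ r, min T (V r).ncard ≤ (W r).ncard := fun r =>
    decodeArr_complete P.blocks htol ((P.norm_unrotate r u).trans_le hu) rfl hG hT
  have hWV : ∀ r, W r ⊆ V r := by
    rintro r v ⟨s, hs, rfl, h⟩
    exact ⟨decodeArr_sound hs h, h⟩
  have hWD : ∀ r, ∀ v ∈ W r, P.rotate r v ∈ D := by
    rintro r v ⟨s, hs, rfl, h⟩
    exact Finset.mem_image.2 ⟨(r, s), Finset.mem_filter.2 ⟨Finset.mem_univ _, hs, h⟩, rfl⟩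
  by_cases hcase : ∃ r, T ≤ (V r).ncard
  · obtain ⟨r, hr⟩ := hcase
    refine (min_le_left _ _).trans ?_
    calc T ≤ (W r).ncard := by rw [← min_eq_left hr]; exact hVW r
      _ = (P.rotate r '' W r).ncard := (Set.ncard_image_of_injective _ (P.rotate_injective r)).symm
      _ ≤ (D : Set (Vec d)).ncard := Set.ncard_le_ncard (by
          rintro _ ⟨v, hv, rfl⟩; exact hWD r v hv) D.finite_toSet
      _ = D.card := Set.ncard_coe_finset D
  · push Not at hcase
    refine (min_le_right _ _).trans (Finset.card_le_card fun c hc => ?_)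
    obtain ⟨hc, hn⟩ := Finset.mem_filter.1 hc
    obtain ⟨r, v, hv, rfl⟩ := P.mem_points.1 hc
    rw [P.inner_rotate] at hn
    have hfin : (V r).Finite := (suffixes_finite _ _ _).subset fun v hv => hv.1
    have heq : W r = V r := Set.eq_of_subset_of_ncard_le (hWV r)
      (by have := hVW r; rwa [min_eq_right (hcase r).le] at this) hfin
    exact hWD r v (heq ▸ ⟨hv, hn⟩)

open Classical in
/-- The indices of the candidates. -/
def ProductCode.candidateIdx (α' : ℝ) (G T : ℕ) (u : Vec d) : Finset ℕ :=
  valueSet (P.Valid α' G T u) fun e => vecRank P.points (P.candidate G T u e)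

theorem vecRank_mem_nbrIdx {S : Finset (Vec d)} {c : Vec d} (hc : c ∈ nbrs α' S u) :
    vecRank S c ∈ nbrIdx α' S u := by
  classical
  obtain ⟨k, hk, rfl⟩ := exists_vecAt (Finset.mem_filter.1 hc).1
  rw [vecRank_vecAt hk]
  exact Finset.mem_filter.2 ⟨Finset.mem_range.2 hk, hc⟩

theorem vecRank_injOn (S : Finset (Vec d)) : Set.InjOn (vecRank S) (S : Set (Vec d)) := by
  intro c hc c' hc' h
  obtain ⟨k, hk, rfl⟩ := exists_vecAt (Finset.mem_coe.1 hc)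
  obtain ⟨k', hk', rfl⟩ := exists_vecAt (Finset.mem_coe.1 hc')
  rw [vecRank_vecAt hk, vecRank_vecAt hk'] at h
  rw [h]

theorem card_nbrIdx (S : Finset (Vec d)) : (nbrIdx α' S u).card = (nbrs α' S u).card := by
  classical
  refine Finset.card_bij (fun k _ => vecAt S k) (fun k hk => (Finset.mem_filter.1 hk).2) ?_ ?_
  · intro i hi j hj h
    exact vecAt_inj (nbrIdx_lt _ hi) (nbrIdx_lt _ hj) h
  · intro c hc
    obtain ⟨k, hk, rfl⟩ := exists_vecAt (Finset.mem_filter.1 hc).1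
    exact ⟨k, Finset.mem_filter.2 ⟨Finset.mem_range.2 hk, hc⟩, rfl⟩

theorem ProductCode.candidateIdx_subset : P.candidateIdx α' G T u ⊆ nbrIdx α' P.points u := by
  classical
  intro i hi
  obtain ⟨e, he, rfl⟩ := Finset.mem_image.1 hi
  exact vecRank_mem_nbrIdx (P.candidate_mem (Finset.mem_filter.1 he).2)

/-- Candidates are neighbours, and there are at least `min T` of the number of neighbours of them.
Truncating both numbers at `T` therefore gives the same result; passing to indices changes no
cardinality. -/
theorem ProductCode.card_least_candidateIdx (hu : ‖u‖ ≤ 1) (htol : 0 < tol d)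
    (hG : (2 * b : ℝ) < G * tol d) (hT : 0 < T) :
    (least T (P.candidateIdx α' G T u)).card = min (nbrIdx α' P.points u).card T := by
  classical
  rw [card_least, min_comm]
  have h1 := Finset.card_le_card (P.candidateIdx_subset (α' := α') (G := G) (T := T) (u := u))
  have h2 := P.le_card_candidates (α' := α') hu htol hG hT
  have h3 : (P.candidateIdx α' G T u).card =
      ((Finset.univ.filter (P.Valid α' G T u)).image (P.candidate G T u)).card := by
    rw [candidateIdx, valueSet,
      ← Finset.card_image_of_injOn (f := vecRank P.points)
        (s := (Finset.univ.filter (P.Valid α' G T u)).image (P.candidate G T u)), Finset.image_image]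
    · rfl
    · refine (vecRank_injOn P.points).mono fun c hc => ?_
      obtain ⟨e, he, rfl⟩ := Finset.mem_image.1 (Finset.mem_coe.1 hc)
      exact (Finset.mem_filter.1 (P.candidate_mem (Finset.mem_filter.1 he).2)).1
  rw [card_nbrIdx] at h1 ⊢
  rw [h3] at h1 ⊢
  omega

end

end

section

/-! ## The decoding circuit -/

section
variable {d b N q m n n' : ℕ} (α α' : ℝ) {B : ℕ} {X : Type} (I : X → Inst d b N q m n n')
  {K : Set (Fn X)}

theorem compR_words (hd : d ≤ 2 ^ B) (hb : b ≤ 2 ^ B) (hN : N ≤ 2 ^ B) {k : ℕ} (hk : k < b)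
    (a : Fin N) (j : Fin d) :
    CompR (fun x => (I x).mem α α') K (fun x => (I x).P.words k a j) (12 * B + 1) := by
  refine (CompR.queryReal .codeword (Comp.bitsOf_const B k) (Comp.bitsOf_const B a)
    (Comp.bitsOf_const B j) (fun _ => hk.trans_le hb) (fun _ => a.isLt.trans_le hN)
    (fun _ => j.isLt.trans_le hd)).congr (fun x => ?_) |>.mono (by omega)
  simp [Inst.mem, qcram, ProductCode.words, hk, coord_fin]

theorem compR_rot (hd : d ≤ 2 ^ B) (hq : q ≤ 2 ^ B) (r : Fin q) (i j : Fin d) :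
    CompR (fun x => (I x).mem α α') K
      (fun x => ((I x).P.rot r : Matrix (Fin d) (Fin d) ℝ) i j) (12 * B + 1) := by
  refine (CompR.queryReal .rotation (Comp.bitsOf_const B r) (Comp.bitsOf_const B i)
    (Comp.bitsOf_const B j) (fun _ => r.isLt.trans_le hq) (fun _ => i.isLt.trans_le hd)
    (fun _ => j.isLt.trans_le hd)).congr (fun x => ?_) |>.mono (by omega)
  simp [Inst.mem, qcram]

variable {I} {u c : X → Vec d}

theorem comp_unrotate (hd : d ≤ 2 ^ B) (hq : q ≤ 2 ^ B) (hu : vecFns u ⊆ K) (r : Fin q) :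
    Comp (fun x => (I x).mem α α') K (vecFns fun x => (I x).P.unrotate r (u x))
      (d * (d * (12 * B + 4) + 1)) := by
  refine comp_vecFns fun j => CompR.mono (CompR.congr (CompR.sum Finset.univ fun i _ =>
    (compR_rot α α' I hd hq r i j).mul (.of_mem (hu (mem_vecFns u i)))) fun x => ?_) ?_
  · simp [ProductCode.unrotate, Matrix.mulVec, dotProduct]
  · rw [Finset.card_univ, Fintype.card_fin]

theorem comp_rotate (hd : d ≤ 2 ^ B) (hq : q ≤ 2 ^ B)
    (hu : ∀ j, CompR (fun x => (I x).mem α α') K (fun x => u x j) 0) (r : Fin q) :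
    Comp (fun x => (I x).mem α α') K (vecFns fun x => (I x).P.rotate r (u x))
      (d * (d * (12 * B + 4) + 1)) := by
  refine comp_vecFns fun j => CompR.mono (CompR.congr (CompR.sum Finset.univ fun i _ =>
    (compR_rot α α' I hd hq r j i).mul (hu i)) fun x => ?_) ?_
  · simp [ProductCode.rotate, Matrix.mulVec, dotProduct]
  · rw [Finset.card_univ, Fintype.card_fin]

/-- Binary search in the stored sorted array of centers, each probe being a lexicographic comparison
of d coordinates. The guard on the address is needed because the search range is a power of two and
may exceed the array. -/
theorem compR_vecRank (hd : d ≤ 2 ^ B) (hn' : n' < 2 ^ B) (hc : vecFns c ⊆ K) :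
    CompR (fun x => (I x).mem α α') K (fun x => (vecRank (I x).P.points (c x) : ℝ))
      (B * (d * (d * (9 * B + 14) + 9 * B + 20) + 8 * B + 20) + (B * 5 + 1)) := by
  have hlt : ∀ x, vecRank (I x).P.points (c x) < 2 ^ B := fun x => by
    have := vecRank_le (S := (I x).P.points) (c x)
    rw [(I x).hP] at this
    omega
  set K' : Set (Fn (X × Fin (2 ^ B))) := Fn.comp Prod.fst '' K ∪ bitsOf B fun p => p.2.val
  set mem' : X × Fin (2 ^ B) → Memory := (fun x => (I x).mem α α') ∘ Prod.fst
  have hcj : ∀ j, CompR mem' K' (fun p => c p.1 j) 0 := fun j =>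
    .of_mem (Or.inl ⟨_, hc (mem_vecFns c j), rfl⟩)
  have hpj : ∀ j, CompR mem' K' (fun p => vecAt (I p.1).P.points p.2 j) (9 * B + 1) := fun j =>
    (compR_vec (mem := mem') (k := fun p => p.2.val) (fun p => p.2.isLt) Set.subset_union_right
      (.center true) (j.isLt.trans_le hd)).congr fun p => (coord_fin _ j).symm
  have hkr : CompR mem' K' (fun p => (p.2.val : ℝ)) (B * 5 + 1) :=
    CompR.ofBitsOf (fun p => p.2.isLt) Set.subset_union_right
  have hlex := CompP.bex (t := d * (9 * B + 14) + 9 * B + 17) (Finset.univ : Finset (Fin d))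
    fun i _ => CompP.mono ((CompP.ball (Finset.univ.filter fun j => j < i) fun j _ =>
      CompP.eq (hpj j) (hcj j)).and (CompP.lt (hpj i) (hcj i))) (by
        have : (Finset.univ.filter fun j => j < i).card ≤ d := by
          simpa using Finset.card_le_univ (Finset.univ.filter fun j => j < i)
        have := Nat.mul_le_mul_right (9 * B + 14) this
        have e : 9 * B + 1 + 0 + 7 + 6 = 9 * B + 14 := by omega
        rw [e]
        omega)
  have hsearch := Comp.search (mem := fun x => (I x).mem α α') (K := K) hlt
    (t := d * (d * (9 * B + 14) + 9 * B + 20) + 5 * B + 20)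
    (CompP.congr (((CompP.lt hkr (.const (n' : ℝ))).and hlex).mono (by
      rw [Finset.card_univ, Fintype.card_fin]
      have e : d * (9 * B + 14) + 9 * B + 17 + 3 = d * (9 * B + 14) + 9 * B + 20 := by omega
      rw [e]
      omega)) fun p => by
      rw [lt_vecRank_iff, toLex_lt_iff, (I p.1).hP, Nat.cast_lt]
      simp)
  refine Comp.mono_cost (Comp.trans hsearch (CompR.ofBitsOf hlt Set.subset_union_right)) ?_
  have e : d * (d * (9 * B + 14) + 9 * B + 20) + 5 * B + 20 + 3 * B =
    d * (d * (9 * B + 14) + 9 * B + 20) + 8 * B + 20 := by omega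
  rw [e]

open Classical in
theorem comp_candidate {G T Z : ℕ} (hd : d ≤ 2 ^ B) (hq : q ≤ 2 ^ B) (hb : b ≤ 2 ^ B)
    (hN : N ≤ 2 ^ B) (hn' : n' < 2 ^ B)
    (z₁ : Fintype.card (Slot G T × Fin N) ≤ Z) (z₂ : Fintype.card (Slot G T) ≤ Z) (z₃ : d + 1 ≤ Z)
    (z₄ : b + 1 ≤ Z) (z₅ : 12 * B + 4 ≤ Z) (hu : vecFns u ⊆ K) (e : Fin q × Slot G T) :
    Comp (fun x => (I x).mem α α') K
      ({.bit fun x => decide ((I x).P.Valid α' G T (u x) e)} ∪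
        {.real fun x => (vecRank (I x).P.points ((I x).P.candidate G T (u x) e) : ℝ)})
      (400 * Z ^ 6) := by
  set mem : X → Memory := fun x => (I x).mem α α'
  set K₁ := K ∪ vecFns fun x => (I x).P.unrotate e.1 (u x) with hK₁
  set K₂ := K₁ ∪ arrFns fun x => (I x).P.decoded G T (u x) e.1 with hK₂
  set K₃ := K₂ ∪ vecFns fun x => (I x).P.candidate G T (u x) e with hK₃
  have h₁ : Comp mem K _ _ := comp_unrotate α α' hd hq hu e.1
  have h₂ : Comp mem K₁ (arrFns fun x => (I x).P.decoded G T (u x) e.1) ((b + 1) * (310 * Z ^ 5)) :=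
    comp_decodeArr (w := fun x => (I x).P.words) Set.subset_union_right
      (fun k hk a j => compR_words α α' I hd hb hN hk a j) z₁ z₃ z₂ (by omega) le_rfl
  have h₃ : Comp mem K₂ (vecFns fun x => (I x).P.candidate G T (u x) e) _ :=
    comp_rotate α α' hd hq (compR_arr Set.subset_union_right e.2) e.1
  have h₄ : CompP mem K₃ (fun x => (I x).P.Valid α' G T (u x) e) _ :=
    (compP_arr (A := fun x => (I x).P.decoded G T (u x) e.1)
      (fun f hf => Or.inl (Or.inr hf)) e.2).and (CompP.near d (CompR.inner
        (fun j => .of_mem (Or.inl (Or.inl (Or.inr (mem_vecFns _ j)))))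
        (compR_arr (A := fun x => (I x).P.decoded G T (u x) e.1)
          (fun f hf => Or.inl (Or.inr hf)) e.2)) _)
  have h₅ : CompR mem K₃ _ _ := compR_vecRank α α' (c := fun x => (I x).P.candidate G T (u x) e)
    hd hn' Set.subset_union_right
  refine (h₁.trans (h₂.trans (h₃.trans (Comp.union h₄ h₅)))).mono_cost ?_
  have hZ : 4 ≤ Z := by omega
  have e1 : d * (d * (12 * B + 4) + 1) ≤ 2 * Z ^ 6 := by
    calc _ ≤ Z * (Z * Z + Z * Z) := by gcongr <;> nlinarith
      _ = 2 * Z ^ 3 := by ring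
      _ ≤ 2 * Z ^ 6 := by gcongr <;> omega
  have e2 : (b + 1) * (310 * Z ^ 5) ≤ 310 * Z ^ 6 := by
    calc _ ≤ Z * (310 * Z ^ 5) := by gcongr
      _ = _ := by ring
  have hZ1 : Z ≤ Z ^ 6 := Nat.le_self_pow (by norm_num) Z
  have e3 : d * (9 * B + 14) + 9 * B + 20 ≤ 12 * Z ^ 2 := by
    have : d * (9 * B + 14) ≤ Z * (5 * Z) := Nat.mul_le_mul (by omega) (by omega)
    nlinarith
  have e4 : B * (d * (d * (9 * B + 14) + 9 * B + 20) + 8 * B + 20) ≤ 20 * Z ^ 6 := by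
    have h1 : d * (d * (9 * B + 14) + 9 * B + 20) ≤ Z * (12 * Z ^ 2) :=
      Nat.mul_le_mul (by omega) e3
    calc _ ≤ Z * (Z * (12 * Z ^ 2) + 6 * Z) := Nat.mul_le_mul (by omega) (by omega)
      _ ≤ Z * (Z * (12 * Z ^ 2) + 6 * (Z * Z ^ 2)) := by gcongr; nlinarith
      _ = 18 * Z ^ 4 := by ring
      _ ≤ 20 * Z ^ 6 := by gcongr <;> omega
  omega

theorem rankComp_candidates {G T Z : ℕ} (hd : d ≤ 2 ^ B) (hq : q ≤ 2 ^ B) (hb : b ≤ 2 ^ B)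
    (hN : N ≤ 2 ^ B) (hn' : n' < 2 ^ B)
    (z₁ : Fintype.card (Slot G T × Fin N) ≤ Z) (z₂ : Fintype.card (Fin q × Slot G T) ≤ Z)
    (z₆ : Fintype.card (Slot G T) ≤ Z) (z₃ : d + 1 ≤ Z)
    (z₄ : b + 1 ≤ Z) (z₅ : 12 * B + 4 ≤ Z) (hu : vecFns u ⊆ K) :
    RankComp (fun x => (I x).mem α α') K
      (fun x => least T ((I x).P.candidateIdx α' G T (u x))) (480 * Z ^ 7) := by
  classical
  let A : Fin q × Slot G T → Set (Fn X) := fun e =>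
    {.bit fun x => decide ((I x).P.Valid α' G T (u x) e)} ∪
      {.real fun x => (vecRank (I x).P.points ((I x).P.candidate G T (u x) e) : ℝ)}
  have hcand := Comp.biUnion (mem := fun x => (I x).mem α α') (K := K) Finset.univ (A := A)
    fun e _ => comp_candidate α α' hd hq hb hN hn' z₁ z₆ z₃ z₄ z₅ hu e
  refine (RankComp.trans hcand (rankComp_least (rankComp_valueSet
      (valid := fun x => (I x).P.Valid α' G T (u x))
      (idx := fun x e => vecRank (I x).P.points ((I x).P.candidate G T (u x) e))
      (fun e => Comp.subset (by
        rintro _ rfl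
        exact Or.inr (Set.mem_biUnion (Finset.mem_univ e) (Or.inl (by congr!)))) 0)
      (fun e => .of_mem
        (Or.inr (Set.mem_biUnion (Finset.mem_univ e) (Or.inr rfl))))) T)).mono ?_
  rw [Finset.card_univ]
  have hZ : 4 ≤ Z := by omega
  have hZ1 : Z ≤ Z ^ 7 := Nat.le_self_pow (by norm_num) Z
  have hZ2 : Z ^ 2 ≤ Z ^ 7 := Nat.pow_le_pow_right (by omega) (by norm_num)
  have e2 : Fintype.card (Fin q × Slot G T) * (400 * Z ^ 6) ≤ 400 * Z ^ 7 := by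
    calc _ ≤ Z * (400 * Z ^ 6) := by gcongr
      _ = _ := by ring
  have e3 : Fintype.card (Fin q × Slot G T) * (21 * Fintype.card (Fin q × Slot G T) + 30) ≤
      30 * Z ^ 7 := by
    calc _ ≤ Z * (21 * Z + 30) := by gcongr
      _ ≤ 30 * Z ^ 2 := by nlinarith
      _ ≤ 30 * Z ^ 7 := by omega
  omega

/-- The circuit for the superposition over the truncated set of centers near `u`. -/
theorem exists_dec {G T Z : ℕ} (hm : m < 2 ^ B) (hd : d ≤ 2 ^ B) (hq : q ≤ 2 ^ B) (hb : b ≤ 2 ^ B)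
    (hN : N ≤ 2 ^ B) (hn' : n' < 2 ^ B)
    (z₁ : Fintype.card (Slot G T × Fin N) ≤ Z) (z₂ : Fintype.card (Fin q × Slot G T) ≤ Z)
    (z₆ : Fintype.card (Slot G T) ≤ Z) (z₃ : d + 1 ≤ Z)
    (z₄ : b + 1 ≤ Z) (z₅ : 12 * B + 4 ≤ Z) :
    ∃ D : Circuit, Circuit.time D ≤ 20000 * Z ^ 8 ∧ Circuit.Changes ({w | w.1 = .x} ∪ {w | w.1 = .y}) {w | w.1 = .c'} D ∧
      ∀ (I : Inst d b N q m n n') (x c y f₁ : ℕ), x < m → y < m →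
        Circuit.run (I.mem α α') D (ketState x c y 0 0 f₁ 0 0) =
        superpose (least T (I.P.candidateIdx α' G T (udiff (vecAt I.L x) (vecAt I.L y)))) n'
          fun c' => ketState x c y c' 0 f₁ 0 0 := by
  let X := Inst d b N q m n n' × (Fin m × Fin m) × ℕ × ℕ
  let K : Set (Fn X) := bitsOf B (fun p => p.2.1.1.val) ∪ bitsOf B (fun p => p.2.1.2.val)
  let mem : X → Memory := fun p => p.1.mem α α'
  let u : X → Vec d := fun p => udiff (vecAt p.1.L p.2.1.1) (vecAt p.1.L p.2.1.2)
  have hx : ∀ p : X, p.2.1.1.val < 2 ^ B := fun p => p.2.1.1.isLt.trans hm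
  have hy : ∀ p : X, p.2.1.2.val < 2 ^ B := fun p => p.2.1.2.isLt.trans hm
  have hu : Comp mem K (vecFns u) (d * (3 * ((9 * B + 1) + (9 * B + 1) + 2) + 4) + 2) :=
    (comp_udiff (mem := mem) (K := K)
      (fun j => compR_vecAt α α' (fun p : X => p.1) hx Set.subset_union_left hd j)
      (fun j => compR_vecAt α α' (fun p : X => p.1) hy Set.subset_union_right hd j)).mono subset_rfl
      (by
        intro f hf
        obtain ⟨j, rfl⟩ := Set.mem_iUnion.1 hf
        exact ⟨j, rfl⟩) le_rfl
  have hrank : RankComp mem K (fun p => least T (p.1.P.candidateIdx α' G T (u p))) _ :=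
    RankComp.trans hu (rankComp_candidates α α' (I := fun p : X => p.1) (u := u) hd hq hb hN hn'
      z₁ z₂ z₆ z₃ z₄ z₅ Set.subset_union_right)
  obtain ⟨D, c1, c2, c3⟩ := exists_superpose (X := X) (mem := mem) (B := B) (bot := n') hn'
    (fun p i hi => by
      have h1 := p.1.P.candidateIdx_subset (Finset.filter_subset _ _ hi)
      have h2 := nbrIdx_lt _ h1
      rw [p.1.hP] at h2
      exact h2.trans hn') hrank
    (cfg := fun p => ket p.2.1.1 p.2.2.1 p.2.1.2 0 0 p.2.2.2 0 0)
    (W := {w | w.1 = .x} ∪ {w | w.1 = .y})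
    ((inputs_of_reg (by decide) (ket_blank _ _ _ _ _ _ _ _) fun _ _ => rfl).union
      (inputs_of_reg (by decide) (ket_blank _ _ _ _ _ _ _ _) fun _ _ => rfl)) (ρ := .c') (by decide)
    (by
      rintro w (hw | hw) <;> rw [show w.1 = _ from hw] <;> decide)
    (fun _ k => Nat.zero_testBit k)
  refine ⟨D, c1.trans ?_, c2, fun I x c y f₁ hx hy => ?_⟩
  · have hZ : 4 ≤ Z := by omega
    have hZ1 : Z ≤ Z ^ 7 := Nat.le_self_pow (by norm_num) Z
    have hZ2 : Z ^ 2 ≤ Z ^ 7 := Nat.pow_le_pow_right (by omega) (by norm_num)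
    have e1 : d * (3 * ((9 * B + 1) + (9 * B + 1) + 2) + 4) + 2 ≤ 8 * Z ^ 7 := by
      have := Nat.mul_le_mul (show d ≤ Z by omega)
        (show 3 * ((9 * B + 1) + (9 * B + 1) + 2) + 4 ≤ 6 * Z by omega)
      rw [show Z * (6 * Z) = 6 * Z ^ 2 by ring] at this
      omega
    have e2 : 16 * (d * (3 * ((9 * B + 1) + (9 * B + 1) + 2) + 4) + 2 + 480 * Z ^ 7) + 10 * B + 500 ≤
        20000 * Z ^ 7 := by omega
    calc _ ≤ Z * (20000 * Z ^ 7) := Nat.mul_le_mul (by omega) e2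
      _ = _ := by ring
  · have := c3 (I, (⟨x, hx⟩, ⟨y, hy⟩), (c, f₁))
    simp only [ket_setReg_c'] at this
    exact this

end

end

section

/-! ## Amplitude amplification of explicit superpositions -/

section
variable {ι : Type*} {I : Finset ι} {a : ι → ℂ} {k k' : ι → Config}

/-- The superposition of the basis states `k i` with amplitudes `a i`. -/
def combo (I : Finset ι) (a : ι → ℂ) (k : ι → Config) : State :=
  ∑ i ∈ I, a i • Finsupp.single (k i) 1

theorem exists_of_mem_support_combo {s : Config} (h : s ∈ (combo I a k).support) :
    ∃ i ∈ I, s = k i := by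
  classical
  by_contra hcon
  push Not at hcon
  refine Finsupp.mem_support_iff.1 h ?_
  rw [combo, Finsupp.finsetSum_apply]
  exact Finset.sum_eq_zero fun i hi => by
    rw [Finsupp.smul_apply, Finsupp.single_apply, if_neg (hcon i hi).symm, smul_zero]

theorem combo_apply (hk : Set.InjOn k I) {i : ι} (hi : i ∈ I) : combo I a k (k i) = a i := by
  classical
  rw [combo, Finsupp.finsetSum_apply, Finset.sum_eq_single i]
  · simp
  · intro j hj hji
    rw [Finsupp.smul_apply, Finsupp.single_apply, if_neg fun h => hji (hk hj hi h), smul_zero]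
  · exact fun h => absurd hi h

theorem nsq_combo (hk : Set.InjOn k I) : nsq (combo I a k) = ∑ i ∈ I, ‖a i‖ ^ 2 := by
  classical
  have hsub : (combo I a k).support ⊆ I.image k := fun s hs => by
    obtain ⟨i, hi, rfl⟩ := exists_of_mem_support_combo hs
    exact Finset.mem_image_of_mem _ hi
  rw [nsq_eq_sum hsub, Finset.sum_image hk]
  exact Finset.sum_congr rfl fun i hi => by rw [combo_apply hk hi]

theorem run_combo (mem : Memory) {S : Circuit}
    (h : ∀ i ∈ I, Circuit.run mem S (Finsupp.single (k i) 1) = Finsupp.single (k' i) 1) :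
    Circuit.run mem S (combo I a k) = combo I a k' := by
  rw [combo, Circuit.run_sum]
  exact Finset.sum_congr rfl fun i hi => by rw [Circuit.run_smul, h i hi]

open Classical in
-- When the outcomes label distinct basis states, the marked weight is a plain sum of squared
-- amplitudes, and both parts after amplification are again explicit.
theorem ampAmp_run_combo (mem : Memory) {samp check : Circuit} {flag : QWire} {ctrl : Finset Reg}
    (ph : List (ℝ × ℝ)) {ctx : Config} (hk : Set.InjOn k I) (M : ι → Prop)
    (hsamp : Circuit.run mem samp (Finsupp.single ctx 1) = combo I a k)
    (hcheck : ∀ i ∈ I, Circuit.run mem check (Finsupp.single (k i) 1) = Finsupp.single (k' i) 1)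
    (hflag : ∀ i ∈ I, (k' i).q flag = true ↔ M i)
    (hw : Circuit.Writes {w | w ∈ (Circuit.qubits samp).filter fun w => w.1 ∉ ctrl}
      (Circuit.reals samp) samp)
    (hq : ∀ w ∈ Circuit.qubits samp, w.1 ∉ ctrl → ctx.q w = false)
    (hr : ∀ k ∈ Circuit.reals samp, ctx.r k = 0) {p : ℝ}
    (hp : p = ∑ i ∈ I.filter M, ‖a i‖ ^ 2) :
    p + ∑ i ∈ I.filter fun i => ¬ M i, ‖a i‖ ^ 2 = 1 ∧
    Circuit.run mem (ampAmp samp check flag ctrl ph) (Finsupp.single ctx 1) =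
      (aaRun p ph (1, 1)).1 • combo (I.filter M) a k' +
      (aaRun p ph (1, 1)).2 • combo (I.filter fun i => ¬ M i) a k' := by
  have hsub : ∀ N : ι → Prop, ((I.filter N : Finset ι) : Set ι) ⊆ I := fun N =>
    Finset.coe_subset.2 (Finset.filter_subset _ _)
  have hp' : p = nsq (combo (I.filter M) a k) := by rw [nsq_combo (hk.mono (hsub M)), hp]
  have hp2 : ∑ i ∈ I.filter (fun i => ¬ M i), ‖a i‖ ^ 2 =
      nsq (combo (I.filter fun i => ¬ M i) a k) :=
    (nsq_combo (hk.mono (Finset.coe_subset.2 (Finset.filter_subset _ _)))).symm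
  rw [hp', hp2]
  refine ampAmp_run mem ph (good := combo (I.filter M) a k)
    (bad := combo (I.filter fun i => ¬ M i) a k) ?_ ?_ ?_ ?_ ?_ ?_ hw hq hr
  · rw [hsamp, combo, combo, combo, Finset.sum_filter_add_sum_filter_not]
  · exact run_combo mem fun i hi => hcheck i (Finset.mem_filter.1 hi).1
  · exact run_combo mem fun i hi => hcheck i (Finset.mem_filter.1 hi).1
  · intro s hs
    obtain ⟨i, hi, rfl⟩ := exists_of_mem_support_combo hs
    rw [Finset.mem_filter] at hi
    exact (hflag i hi.1).2 hi.2
  · intro s hs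
    obtain ⟨i, hi, rfl⟩ := exists_of_mem_support_combo hs
    rw [Finset.mem_filter] at hi
    exact Bool.eq_false_iff.2 fun h => hi.2 ((hflag i hi.1).1 h)
  · intro s hs hs'
    obtain ⟨i, hi, rfl⟩ := exists_of_mem_support_combo hs
    obtain ⟨j, hj, h⟩ := exists_of_mem_support_combo hs'
    rw [Finset.mem_filter] at hi hj
    rw [hk hi.1 hj.1 h] at hi
    exact hj.2 hi.2

theorem combo_smul (I : Finset ι) (a : ι → ℂ) (b : ℂ) (k : ι → Config) :
    b • combo I a k = combo I (fun i => b * a i) k := by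
  rw [combo, combo, Finset.smul_sum]
  exact Finset.sum_congr rfl fun i _ => by rw [smul_smul]

theorem combo_sigma {κ : ι → Type*} (I : Finset ι) (J : ∀ i, Finset (κ i)) (a : ι → ℂ)
    (b : ∀ i, κ i → ℂ) (k : ∀ i, κ i → Config) :
    ∑ i ∈ I, a i • combo (J i) (b i) (k i) =
      combo (I.sigma J) (fun j => a j.1 * b j.1 j.2) fun j => k j.1 j.2 := by
  rw [combo, Finset.sum_sigma]
  refine Finset.sum_congr rfl fun i _ => ?_
  rw [combo_smul]
  rfl

theorem superpose_ket (S : Finset ℕ) (bot : ℕ) (k : ℕ → Config) :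
    superpose S bot (fun i => Finsupp.single (k i) 1) =
      combo (nonbot S bot) (fun _ => ((1 / Real.sqrt (nonbot S bot).card : ℝ) : ℂ)) k :=
  superpose_eq_sum S bot _

theorem nsq_filter_le (ψ : State) (p : Config → Prop) [DecidablePred p] :
    nsq (ψ.filter p) ≤ nsq ψ := by
  rw [nsq_eq_sum (ψ := ψ.filter p) (Finsupp.support_filter p ψ ▸ Finset.filter_subset _ _), nsq]
  refine Finset.sum_le_sum fun s _ => ?_
  rw [Finsupp.filter_apply]
  split_ifs
  · exact le_rfl
  · simp

theorem Circuit.Changes.writes {W T : Set QWire} {D : Circuit} (h : Circuit.Changes W T D) :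
    Circuit.Writes (T ∪ {w | w.1 = .work}) Set.univ D :=
  fun g hg => ⟨fun w hw => (h g hg).1 w hw, Set.subset_univ _⟩

/-- A sampler that only reads its control registers writes just the wires tested by the reflection,
as the amplification theorem requires. -/
theorem Circuit.Changes.writes_qubits {W T : Set QWire} {D : Circuit} (h : Circuit.Changes W T D)
    {ctrl : Finset Reg} (hT : ∀ w ∈ T, w.1 ∉ ctrl) (hw : Reg.work ∉ ctrl) :
    Circuit.Writes {w | w ∈ (Circuit.qubits D).filter fun w => w.1 ∉ ctrl} (Circuit.reals D) D := by
  intro g hg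
  refine ⟨fun w hw' => ?_, (Circuit.writes_self D g hg).2⟩
  refine Finset.mem_filter.2 ⟨(Circuit.writes_self D g hg).1 hw', ?_⟩
  rcases (h g hg).1 w hw' with h | h
  exacts [hT w h, h ▸ hw]

theorem Circuit.Changes.qubits {W T : Set QWire} {D : Circuit} (h : Circuit.Changes W T D)
    {w : QWire} (hw : w ∈ Circuit.qubits D) : w ∈ W ∪ T ∨ w.1 = .work := by
  obtain ⟨g, hg, hw⟩ := Circuit.mem_qubits.1 hw
  exact (h g hg).2 w hw

theorem Circuit.Writes.ampAmp {Q : Set QWire} {samp check : Circuit}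
    (hs : Circuit.Writes Q Set.univ samp) (hc : Circuit.Writes Q Set.univ check) (flag : QWire)
    (ctrl : Finset Reg) (ph : List (ℝ × ℝ)) :
    Circuit.Writes Q Set.univ (ampAmp samp check flag ctrl ph) := by
  refine (hs.append ?_).append hc
  intro g hg
  obtain ⟨p, -, hg⟩ := List.mem_flatMap.1 hg
  have h1 : ∀ φ, Circuit.Writes Q Set.univ [Gate.phase φ flag] := fun φ g hg => by
    rw [List.mem_singleton.1 hg]
    exact ⟨by simp [Gate.targets], Set.subset_univ _⟩
  have h2 : ∀ φ A B, Circuit.Writes Q Set.univ [Gate.zeroPhase φ A B] := fun φ A B g hg => by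
    rw [List.mem_singleton.1 hg]
    exact ⟨by simp [Gate.targets], Set.subset_univ _⟩
  exact (((((hc.append (h1 _)).append hc.inverse).append hs.inverse).append (h2 _ _ _)).append hs)
    g hg

theorem ket_inj {x c y c' z f₁ f₂ f₃ x₂ c₂ y₂ c₂' z₂ g₁ g₂ g₃ : ℕ}
    (h : ket x c y c' z f₁ f₂ f₃ = ket x₂ c₂ y₂ c₂' z₂ g₁ g₂ g₃) :
    x = x₂ ∧ c = c₂ ∧ y = y₂ ∧ c' = c₂' ∧ z = z₂ := by
  have h' : ∀ w, (ket x c y c' z f₁ f₂ f₃).q w = (ket x₂ c₂ y₂ c₂' z₂ g₁ g₂ g₃).q w :=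
    fun w => by rw [h]
  exact ⟨Nat.eq_of_testBit_eq fun j => h' (.x, j), Nat.eq_of_testBit_eq fun j => h' (.c, j),
    Nat.eq_of_testBit_eq fun j => h' (.y, j), Nat.eq_of_testBit_eq fun j => h' (.c', j),
    Nat.eq_of_testBit_eq fun j => h' (.z, j)⟩

end

end

section

/-! ## The state prepared by the search -/

theorem run_support_q (mem : Memory) {S : Circuit} {Q : Set QWire} {R : Set ℕ}
    (hS : Circuit.Writes Q R S) {ψ : State} {w : QWire} (hw : w ∉ Q) {v : Bool}
    (h : ∀ s ∈ ψ.support, s.q w = v) : ∀ s ∈ (Circuit.run mem S ψ).support, s.q w = v := by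
  classical
  intro s hs
  rw [run_eq_sum] at hs
  obtain ⟨s', hs', h'⟩ := Finset.mem_biUnion.1 (Finsupp.support_finsetSum hs)
  have := ((Within.single (Q := Q) (R := R) 1 (AgreeOff.refl s')).run mem hS) s
    (Finsupp.support_smul h')
  rw [this.1 w hw, h s' hs']

section
open Classical
variable {d : ℕ}

/-- The circuits implement the basic operations, and change only their own registers. -/
structure Routine (A : Subroutines) (mem : Memory) (θ θ' α α' : ℝ) (L C C' : Finset (Vec d))
    (tr : Vec d → Finset ℕ) : Prop where
  tr_subset : ∀ u, tr u ⊆ nbrIdx α' C' u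
  tr_card : ∀ u, (tr u).card = min (nbrIdx α' C' u).card ⌊trunc d⌋₊
  rCollisionSamp :
    Circuit.run mem A.rCollisionSamp (ketState 0 0 0 0 0 0 0 0) =
      superpose (Finset.range L.card) 0 fun x =>
      superpose (nbrIdx α C (vecAt L x)) C.card fun c =>
      superpose (bucketIdx α L C c) L.card fun y =>
        ketState x c y 0 0 0 0 0
  rCollisionCheck : ∀ x < L.card, ∀ c ≤ C.card, ∀ y ≤ L.card, ∀ f₁ < 2,
    Circuit.run mem A.rCollisionCheck (ketState x c y 0 0 f₁ 0 0) =
      ketState x c y 0 0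
        (toggle f₁ (y < L.card ∧ Near d (inner ℝ (vecAt L x) (vecAt L y)) (Real.cos θ))) 0 0
  dec : ∀ x < L.card, ∀ c < C.card, ∀ y < L.card, ∀ f₁ < 2,
      Circuit.run mem A.dec (ketState x c y 0 0 f₁ 0 0) =
        superpose (tr (udiff (vecAt L x) (vecAt L y))) C'.card fun c' => ketState x c y c' 0 f₁ 0 0
  zSamp : ∀ x < L.card, ∀ c < C.card, ∀ y < L.card, ∀ c' ≤ C'.card, ∀ f₁ < 2,
    Circuit.run mem A.zSamp (ketState x c y c' 0 f₁ 0 0) =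
      superpose (bucketIdx α' L C' c') L.card fun z => ketState x c y c' z f₁ 0 0
  zCheck : ∀ x < L.card, ∀ c < C.card, ∀ y < L.card, ∀ c' ≤ C'.card, ∀ z ≤ L.card,
    ∀ f₁ < 2, ∀ f₂ < 2,
    Circuit.run mem A.zCheck (ketState x c y c' z f₁ f₂ 0) =
      ketState x c y c' z f₁
        (toggle f₂ (z < L.card ∧
          Near d (inner ℝ (udiff (vecAt L x) (vecAt L y)) (vecAt L z)) (Real.cos θ'))) 0
  dec_changes : Circuit.Changes ({w | w.1 = .x} ∪ {w | w.1 = .y}) {w | w.1 = .c'} A.dec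
  zSamp_changes : Circuit.Changes {w | w.1 = .c'} {w | w.1 = .z} A.zSamp
  zCheck_changes : Circuit.Changes (({w | w.1 = .x} ∪ {w | w.1 = .y}) ∪ {w | w.1 = .z})
    {(.flag₂, 0)} A.zCheck

theorem Routine.implements {A : Subroutines} {mem : Memory} {θ θ' α α' : ℝ}
    {L C C' : Finset (Vec d)} {tr : Vec d → Finset ℕ} (h : Routine A mem θ θ' α α' L C C' tr) :
    A.Implements mem θ θ' α α' L C C' :=
  ⟨h.rCollisionSamp, h.rCollisionCheck, ⟨tr, fun u => ⟨h.tr_subset u, h.tr_card u⟩, h.dec⟩,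
    h.zSamp, h.zCheck⟩

variable (θ θ' α α' : ℝ) (L C C' : Finset (Vec d)) (tr : Vec d → Finset ℕ)

/-- Outcomes `(x, c, y)` of the first sampling operation. -/
abbrev Idx₁ : Type := Σ _ : ℕ, Σ _ : ℕ, ℕ

/-- Outcomes `(x, c, y, c', z)` of both sampling operations. -/
abbrev Idx₃ : Type := Σ _ : Idx₁, Σ _ : ℕ, ℕ

/-- The outcomes of the first sampling operation. -/
def samples₁ : Finset Idx₁ :=
  (Finset.range L.card).sigma fun x => (nonbot (nbrIdx α C (vecAt L x)) C.card).sigma fun c =>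
    nonbot (bucketIdx α L C c) L.card

/-- The pair `(x, y)` has the correct angle. -/
def Marked₁ (t : Idx₁) : Prop :=
  t.2.2 < L.card ∧ Near d (inner ℝ (vecAt L t.1) (vecAt L t.2.2)) (Real.cos θ)

/-- The good outcomes of the first sampling operation. -/
def good₁ : Finset Idx₁ := (samples₁ α L C).filter (Marked₁ θ L)

/-- The amplitudes of the first sampling operation. -/
def amp₁ (t : Idx₁) : ℂ :=
  ((1 / Real.sqrt L.card : ℝ) : ℂ) *
    (((1 / Real.sqrt (nonbot (nbrIdx α C (vecAt L t.1)) C.card).card : ℝ) : ℂ) *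
      ((1 / Real.sqrt (nonbot (bucketIdx α L C t.2.1) L.card).card : ℝ) : ℂ))

/-- The probability of a good outcome of the first sampling operation. -/
def prob₁ : ℝ := ∑ t ∈ good₁ θ α L C, ‖amp₁ α L C t‖ ^ 2

/-- The normalized difference of the vectors of an outcome. -/
def diff₁ (t : Idx₁) : Vec d := udiff (vecAt L t.1) (vecAt L t.2.2)

/-- The vector `z` has the correct angle with the normalized difference. -/
def Marked₂ (t : Idx₁) (z : ℕ) : Prop :=
  z < L.card ∧ Near d (inner ℝ (diff₁ L t) (vecAt L z)) (Real.cos θ')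

/-- The amplitude of the second sampling operation. -/
def amp₂ (c' : ℕ) : ℂ :=
  ((1 / Real.sqrt (nonbot (bucketIdx α' L C' c') L.card).card : ℝ) : ℂ)

/-- The probability of a good outcome of the second sampling operation. -/
def prob₂ (t : Idx₁) (c' : ℕ) : ℝ :=
  ∑ z ∈ (nonbot (bucketIdx α' L C' c') L.card).filter (Marked₂ θ' L t), ‖amp₂ α' L C' c'‖ ^ 2

/-- The good outcomes of both sampling operations. -/
def good₃ : Finset Idx₃ :=
  (good₁ θ α L C).sigma fun t => (nonbot (tr (diff₁ L t)) C'.card).sigma fun c' =>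
    (nonbot (bucketIdx α' L C' c') L.card).filter (Marked₂ θ' L t)

/-- The amplitudes of the good outcomes after both amplifications. -/
def amp₃ (ph₁ ph₂ : List (ℝ × ℝ)) (j : Idx₃) : ℂ :=
  (aaRun (prob₁ θ α L C) ph₁ (1, 1)).1 * amp₁ α L C j.1 *
    (((1 / Real.sqrt (nonbot (tr (diff₁ L j.1)) C'.card).card : ℝ) : ℂ) *
      ((aaRun (prob₂ θ' α' L C' j.1 j.2.1) ph₂ (1, 1)).1 * amp₂ α' L C' j.2.1))

/-- The basis state of an outcome. -/
def ket₃ (f₂ f₃ : ℕ) (j : Idx₃) : Config := ket j.1.1 j.1.2.1 j.1.2.2 j.2.1 j.2.2 1 f₂ f₃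

theorem ket₃_injective (f₂ f₃ : ℕ) : Function.Injective (ket₃ f₂ f₃) := by
  rintro ⟨⟨x, c, y⟩, c', z⟩ ⟨⟨x₂, c₂, y₂⟩, c₂', z₂⟩ h
  obtain ⟨rfl, rfl, rfl, rfl, rfl⟩ := ket_inj h
  rfl

variable {θ θ' α α' L C C' tr}

/-- The symbol ⊥ disappears among good outcomes: the check rejects y = ⊥, and c = ⊥ would force y =
⊥ because its bucket is empty. -/
theorem mem_good₁ {t : Idx₁} : t ∈ good₁ θ α L C ↔ t.1 < L.card ∧
    t.2.1 ∈ nbrIdx α C (vecAt L t.1) ∧ t.2.2 ∈ bucketIdx α L C t.2.1 ∧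
    Near d (inner ℝ (vecAt L t.1) (vecAt L t.2.2)) (Real.cos θ) := by
  rw [good₁, Finset.mem_filter, samples₁, Finset.mem_sigma, Finset.mem_sigma, Finset.mem_range,
    Marked₁]
  constructor
  · rintro ⟨⟨hx, hc, hy⟩, hlt, hn⟩
    have hy' : t.2.2 ∈ bucketIdx α L C t.2.1 := by
      unfold nonbot at hy
      split_ifs at hy
      · exact absurd (Finset.mem_singleton.1 hy) hlt.ne
      · exact hy
    refine ⟨hx, ?_, hy', hn⟩
    unfold nonbot at hc
    split_ifs at hc
    · have := (Finset.mem_filter.1 hy').2.1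
      exact absurd (Finset.mem_singleton.1 hc) this.ne
    · exact hc
  · rintro ⟨hx, hc, hy, hn⟩
    refine ⟨⟨hx, ?_, ?_⟩, bucketIdx_lt α hy, hn⟩
    · rwa [nonbot, if_neg (Finset.ne_empty_of_mem hc)]
    · rwa [nonbot, if_neg (Finset.ne_empty_of_mem hy)]

theorem sq_norm_inv_sqrt (k : ℕ) : ‖((1 / Real.sqrt k : ℝ) : ℂ)‖ ^ 2 = 1 / k := by
  rw [Complex.norm_real, Real.norm_eq_abs, sq_abs, div_pow, one_pow, Real.sq_sqrt (Nat.cast_nonneg k)]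

theorem nonbot_eq {S : Finset ℕ} {i bot : ℕ} (h : i ∈ S) : nonbot S bot = S :=
  if_neg (Finset.ne_empty_of_mem h)

theorem sq_norm_amp₁ {t : Idx₁} (ht : t ∈ good₁ θ α L C) :
    ‖amp₁ α L C t‖ ^ 2 = 1 / (L.card * ((nbrIdx α C (vecAt L t.1)).card *
      (bucketIdx α L C t.2.1).card)) := by
  obtain ⟨-, hc, hy, -⟩ := mem_good₁.1 ht
  rw [amp₁, norm_mul, norm_mul, mul_pow, mul_pow, sq_norm_inv_sqrt, sq_norm_inv_sqrt,
    sq_norm_inv_sqrt, nonbot_eq hc, nonbot_eq hy]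
  field_simp

section
variable {A : Subroutines} {mem : Memory} (h : Routine A mem θ θ' α α' L C C' tr)
include h

theorem Routine.samp_run (hL : 0 < L.card) :
    Circuit.run mem A.rCollisionSamp (ketState 0 0 0 0 0 0 0 0) =
      combo (samples₁ α L C) (amp₁ α L C) fun t => ket t.1 t.2.1 t.2.2 0 0 0 0 0 := by
  rw [h.rCollisionSamp]
  simp only [ketState, superpose_ket]
  simp only [superpose_eq_sum, combo_sigma]
  have : nonbot (Finset.range L.card) 0 = Finset.range L.card :=
    nonbot_eq (Finset.mem_range.2 hL)
  rw [this, Finset.card_range]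
  rfl

theorem Routine.amp₁_run (hL : 0 < L.card) (ph : List (ℝ × ℝ)) :
    prob₁ θ α L C + ∑ t ∈ (samples₁ α L C).filter (fun t => ¬ Marked₁ θ L t), ‖amp₁ α L C t‖ ^ 2
      = 1 ∧
    Circuit.run mem (ampAmp A.rCollisionSamp A.rCollisionCheck (.flag₁, 0) ∅ ph)
        (ketState 0 0 0 0 0 0 0 0) =
      (aaRun (prob₁ θ α L C) ph (1, 1)).1 • combo (good₁ θ α L C) (amp₁ α L C)
        (fun t => ket t.1 t.2.1 t.2.2 0 0 1 0 0) +
      (aaRun (prob₁ θ α L C) ph (1, 1)).2 • combo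
        ((samples₁ α L C).filter fun t => ¬ Marked₁ θ L t) (amp₁ α L C)
        (fun t => ket t.1 t.2.1 t.2.2 0 0 0 0 0) := by
  have key := ampAmp_run_combo mem (I := samples₁ α L C) (a := amp₁ α L C)
    (k := fun t => ket t.1 t.2.1 t.2.2 0 0 0 0 0)
    (k' := fun t => ket t.1 t.2.1 t.2.2 0 0 (toggle 0 (Marked₁ θ L t)) 0 0)
    (samp := A.rCollisionSamp) (check := A.rCollisionCheck) (flag := (.flag₁, 0)) (ctrl := ∅) ph
    (ctx := ket 0 0 0 0 0 0 0 0)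
    (by
      rintro ⟨x, c, y⟩ - ⟨x₂, c₂, y₂⟩ - h
      obtain ⟨rfl, rfl, rfl, -⟩ := ket_inj h
      rfl)
    (Marked₁ θ L) (h.samp_run hL)
    (by
      intro t ht
      rw [samples₁, Finset.mem_sigma, Finset.mem_sigma] at ht
      obtain ⟨hx, hc, hy⟩ := ht
      refine (h.rCollisionCheck t.1 (Finset.mem_range.1 hx) t.2.1 ?_ t.2.2 ?_ 0
        (by norm_num)).trans (by unfold ketState Marked₁; congr!)
      · have : nonbot (nbrIdx α C (vecAt L t.1)) C.card ⊆ Finset.range (C.card + 1) :=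
          nonbot_subset (fun i hi => Finset.mem_range.2 (by have := nbrIdx_lt α hi; omega)) (by simp)
        exact Nat.lt_succ_iff.1 (Finset.mem_range.1 (this hc))
      · have : nonbot (bucketIdx α L C t.2.1) L.card ⊆ Finset.range (L.card + 1) :=
          nonbot_subset (fun i hi => Finset.mem_range.2 (by have := bucketIdx_lt α hi; omega))
            (by simp)
        exact Nat.lt_succ_iff.1 (Finset.mem_range.1 (this hy)))
    (by
      intro t _
      by_cases hm : Marked₁ θ L t <;> simp [ket, toggle, hm])
    ((Circuit.writes_self A.rCollisionSamp).mono (fun w hw => by simpa using hw) subset_rfl)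
    (fun w _ _ => by obtain ⟨ρ, k⟩ := w; cases ρ <;> simp [ket]) (fun _ _ => rfl)
    (p := prob₁ θ α L C) (by rw [prob₁, good₁])
  refine ⟨by convert key.1, key.2.trans ?_⟩
  congr 2
  · refine Finset.sum_congr rfl fun t ht => ?_
    simp [toggle, (Finset.mem_filter.1 ht).2]
  · unfold combo
    refine Finset.sum_congr (by congr!) fun t ht => ?_
    simp [toggle, (Finset.mem_filter.1 ht).2]

theorem Routine.amp₂_run {t : Idx₁} (ht : t ∈ good₁ θ α L C) {c' : ℕ} (hc' : c' ≤ C'.card)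
    (ph : List (ℝ × ℝ)) :
    Circuit.run mem (ampAmp A.zSamp A.zCheck (.flag₂, 0) {.x, .c, .y, .c'} ph)
        (ketState t.1 t.2.1 t.2.2 c' 0 1 0 0) =
      (aaRun (prob₂ θ' α' L C' t c') ph (1, 1)).1 • combo
        ((nonbot (bucketIdx α' L C' c') L.card).filter (Marked₂ θ' L t))
        (fun _ => amp₂ α' L C' c') (fun z => ket t.1 t.2.1 t.2.2 c' z 1 1 0) +
      (aaRun (prob₂ θ' α' L C' t c') ph (1, 1)).2 • combo
        ((nonbot (bucketIdx α' L C' c') L.card).filter fun z => ¬ Marked₂ θ' L t z)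
        (fun _ => amp₂ α' L C' c') (fun z => ket t.1 t.2.1 t.2.2 c' z 1 0 0) := by
  obtain ⟨hx, hc, hy, -⟩ := mem_good₁.1 ht
  have hc := nbrIdx_lt α hc
  have hy := bucketIdx_lt α hy
  have key := ampAmp_run_combo mem (I := nonbot (bucketIdx α' L C' c') L.card)
    (a := fun _ => amp₂ α' L C' c') (k := fun z => ket t.1 t.2.1 t.2.2 c' z 1 0 0)
    (k' := fun z => ket t.1 t.2.1 t.2.2 c' z 1 (toggle 0 (Marked₂ θ' L t z)) 0)
    (samp := A.zSamp) (check := A.zCheck) (flag := (.flag₂, 0)) (ctrl := {.x, .c, .y, .c'}) ph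
    (ctx := ket t.1 t.2.1 t.2.2 c' 0 1 0 0)
    (fun _ _ _ _ h => (ket_inj h).2.2.2.2)
    (Marked₂ θ' L t) (by
      have := h.zSamp t.1 hx t.2.1 hc t.2.2 hy c' hc' 1 (by norm_num)
      simp only [ketState, superpose_ket] at this
      exact this)
    (by
      intro z hz
      refine (h.zCheck t.1 hx t.2.1 hc t.2.2 hy c' hc' z ?_ 1 (by norm_num) 0
        (by norm_num)).trans (by unfold ketState Marked₂ diff₁; congr!)
      have : nonbot (bucketIdx α' L C' c') L.card ⊆ Finset.range (L.card + 1) :=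
        nonbot_subset (fun i hi => Finset.mem_range.2 (by have := bucketIdx_lt α' hi; omega))
          (by simp)
      exact Nat.lt_succ_iff.1 (Finset.mem_range.1 (this hz)))
    (by
      intro z _
      by_cases hm : Marked₂ θ' L t z <;> simp [ket, toggle, hm])
    (h.zSamp_changes.writes_qubits (by rintro w hw; rw [show w.1 = _ from hw]; decide) (by decide))
    (by
      rintro ⟨ρ, k⟩ hw hρ
      rcases h.zSamp_changes.qubits hw with (h | h) | h
      · rw [show ρ = _ from h] at hρ; simp at hρ
      · rw [show ρ = _ from h]; simp [ket]
      · rw [show ρ = _ from h]; simp [ket])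
    (fun _ _ => rfl) (p := prob₂ θ' α' L C' t c') (by rw [prob₂])
  refine key.2.trans ?_
  congr 2
  · refine Finset.sum_congr rfl fun t ht => ?_
    simp [toggle, (Finset.mem_filter.1 ht).2]
  · unfold combo
    refine Finset.sum_congr (by congr!) fun t ht => ?_
    simp [toggle, (Finset.mem_filter.1 ht).2]

end

end

end

/-! ### The states after both samplings and after the third amplification -/

section

section
open Classical
variable {d : ℕ} {θ θ' α α' : ℝ} {L C C' : Finset (Vec d)} {tr : Vec d → Finset ℕ}
  {A : Subroutines} {mem : Memory} (h : Routine A mem θ θ' α α' L C C' tr)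
include h

theorem Routine.second_run (ph₂ : List (ℝ × ℝ)) {t : Idx₁} (ht : t ∈ good₁ θ α L C) :
    Circuit.run mem (A.dec ++ ampAmp A.zSamp A.zCheck (.flag₂, 0) {.x, .c, .y, .c'} ph₂)
        (Finsupp.single (ket t.1 t.2.1 t.2.2 0 0 1 0 0) 1) =
      combo ((nonbot (tr (diff₁ L t)) C'.card).sigma fun c' =>
          (nonbot (bucketIdx α' L C' c') L.card).filter (Marked₂ θ' L t))
        (fun j => ((1 / Real.sqrt (nonbot (tr (diff₁ L t)) C'.card).card : ℝ) : ℂ) *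
          ((aaRun (prob₂ θ' α' L C' t j.1) ph₂ (1, 1)).1 * amp₂ α' L C' j.1))
        (fun j => ket t.1 t.2.1 t.2.2 j.1 j.2 1 1 0) +
      combo ((nonbot (tr (diff₁ L t)) C'.card).sigma fun c' =>
          (nonbot (bucketIdx α' L C' c') L.card).filter fun z => ¬ Marked₂ θ' L t z)
        (fun j => ((1 / Real.sqrt (nonbot (tr (diff₁ L t)) C'.card).card : ℝ) : ℂ) *
          ((aaRun (prob₂ θ' α' L C' t j.1) ph₂ (1, 1)).2 * amp₂ α' L C' j.1))
        (fun j => ket t.1 t.2.1 t.2.2 j.1 j.2 1 0 0) := by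
  obtain ⟨hx, hc, hy, -⟩ := mem_good₁.1 ht
  have hc := nbrIdx_lt α hc
  have hy := bucketIdx_lt α hy
  have hdec := h.dec t.1 hx t.2.1 hc t.2.2 hy 1 (by norm_num)
  rw [show Finsupp.single (ket t.1 t.2.1 t.2.2 0 0 1 0 0) 1 =
    ketState t.1 t.2.1 t.2.2 0 0 1 0 0 from rfl, Circuit.run_append, hdec, superpose_eq_sum,
    Circuit.run_sum]
  rw [← combo_sigma (nonbot (tr (diff₁ L t)) C'.card)
      (fun c' => (nonbot (bucketIdx α' L C' c') L.card).filter (Marked₂ θ' L t))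
      (fun _ => ((1 / Real.sqrt (nonbot (tr (diff₁ L t)) C'.card).card : ℝ) : ℂ))
      (fun c' _ => (aaRun (prob₂ θ' α' L C' t c') ph₂ (1, 1)).1 * amp₂ α' L C' c')
      (fun c' z => ket t.1 t.2.1 t.2.2 c' z 1 1 0),
    ← combo_sigma (nonbot (tr (diff₁ L t)) C'.card)
      (fun c' => (nonbot (bucketIdx α' L C' c') L.card).filter fun z => ¬ Marked₂ θ' L t z)
      (fun _ => ((1 / Real.sqrt (nonbot (tr (diff₁ L t)) C'.card).card : ℝ) : ℂ))
      (fun c' _ => (aaRun (prob₂ θ' α' L C' t c') ph₂ (1, 1)).2 * amp₂ α' L C' c')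
      (fun c' z => ket t.1 t.2.1 t.2.2 c' z 1 0 0), ← Finset.sum_add_distrib]
  refine Finset.sum_congr rfl fun c' hc' => ?_
  have hc'' : c' ≤ C'.card := by
    have : nonbot (tr (udiff (vecAt L t.1) (vecAt L t.2.2))) C'.card ⊆ Finset.range (C'.card + 1) :=
      nonbot_subset (fun i hi => Finset.mem_range.2 (by
        have := nbrIdx_lt α' (h.tr_subset _ hi); omega)) (by simp)
    exact Nat.lt_succ_iff.1 (Finset.mem_range.1 (this hc'))
  rw [Circuit.run_smul, h.amp₂_run ht hc'' ph₂, smul_add]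
  simp only [combo_smul]
  rfl

/-- The state splits into the explicit good outcomes, the part `F` on which the second check failed,
and the image `G` of the part on which the first check failed. On the last part the later circuits
may meet y = ⊥, so their effect is left open. Only two facts are used: they do not write flags 1 and
3, and they preserve the norm, which makes `nsq G` the failure probability of the first level. -/
theorem Routine.tupleSamp_run (hL : 0 < L.card) (ph₁ ph₂ : List (ℝ × ℝ)) :
    ∃ F G : State, Circuit.run mem (tupleSamp A ph₁ ph₂) (ketState 0 0 0 0 0 0 0 0) =
        combo (good₃ θ θ' α α' L C C' tr) (amp₃ θ θ' α α' L C C' tr ph₁ ph₂) (ket₃ 1 0) + (F + G) ∧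
      (∀ s ∈ F.support, s.q (.flag₂, 0) = false ∧ s.q (.flag₃, 0) = false) ∧
      (∀ s ∈ G.support, s.q (.flag₁, 0) = false ∧ s.q (.flag₃, 0) = false) ∧
      nsq G = 1 - prob₁ θ α L C * ‖(aaRun (prob₁ θ α L C) ph₁ (1, 1)).1‖ ^ 2 := by
  obtain ⟨hp, hrun⟩ := h.amp₁_run hL ph₁
  set a := aaRun (prob₁ θ α L C) ph₁ (1, 1) with ha
  set bad := (samples₁ α L C).filter fun t => ¬ Marked₁ θ L t
  set k0 : Idx₁ → Config := fun t => ket t.1 t.2.1 t.2.2 0 0 0 0 0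
  set D := A.dec ++ ampAmp A.zSamp A.zCheck (.flag₂, 0) {.x, .c, .y, .c'} ph₂ with hD
  have hinj : Function.Injective k0 := by
    rintro ⟨x, c, y⟩ ⟨x₂, c₂, y₂⟩ h
    obtain ⟨rfl, rfl, rfl, -⟩ := ket_inj h
    rfl
  have hwr : Circuit.Writes {w : QWire | w.1 ≠ .flag₁ ∧ w.1 ≠ .flag₃} Set.univ D := by
    refine (h.dec_changes.writes.mono ?_ subset_rfl).append (Circuit.Writes.ampAmp
      (h.zSamp_changes.writes.mono ?_ subset_rfl) (h.zCheck_changes.writes.mono ?_ subset_rfl) _ _ _)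
    all_goals
      rintro w (hw | hw)
      · simp_all
      · rw [Set.mem_ofPred_eq] at hw; simp [hw]
  refine ⟨∑ t ∈ good₁ θ α L C, (a.1 * amp₁ α L C t) •
      combo ((nonbot (tr (diff₁ L t)) C'.card).sigma fun c' =>
          (nonbot (bucketIdx α' L C' c') L.card).filter fun z => ¬ Marked₂ θ' L t z)
        (fun j => ((1 / Real.sqrt (nonbot (tr (diff₁ L t)) C'.card).card : ℝ) : ℂ) *
          ((aaRun (prob₂ θ' α' L C' t j.1) ph₂ (1, 1)).2 * amp₂ α' L C' j.1))
        (fun j => ket t.1 t.2.1 t.2.2 j.1 j.2 1 0 0),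
    a.2 • Circuit.run mem D (combo bad (amp₁ α L C) k0), ?_, ?_, ?_, ?_⟩
  · rw [tupleSamp, List.append_assoc, Circuit.run_append, hrun, Circuit.run_add,
      ← Circuit.run_smul, combo_smul, Circuit.run_smul, ← add_assoc]
    congr 1
    conv_lhs => rw [combo]
    rw [Circuit.run_sum]
    have : combo (good₃ θ θ' α α' L C C' tr) (amp₃ θ θ' α α' L C C' tr ph₁ ph₂) (ket₃ 1 0) =
        ∑ t ∈ good₁ θ α L C, (a.1 * amp₁ α L C t) •
          combo ((nonbot (tr (diff₁ L t)) C'.card).sigma fun c' =>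
            (nonbot (bucketIdx α' L C' c') L.card).filter (Marked₂ θ' L t))
          (fun j => ((1 / Real.sqrt (nonbot (tr (diff₁ L t)) C'.card).card : ℝ) : ℂ) *
            ((aaRun (prob₂ θ' α' L C' t j.1) ph₂ (1, 1)).1 * amp₂ α' L C' j.1))
          (fun j => ket t.1 t.2.1 t.2.2 j.1 j.2 1 1 0) := by
      rw [combo_sigma]; rfl
    rw [this, ← Finset.sum_add_distrib]
    refine Finset.sum_congr rfl fun t ht => ?_
    rw [Circuit.run_smul, ← smul_add, ← h.second_run ph₂ ht]
  · intro s hs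
    obtain ⟨t, -, hs⟩ := Finset.mem_biUnion.1 (Finsupp.support_finsetSum hs)
    obtain ⟨j, -, rfl⟩ := exists_of_mem_support_combo (Finsupp.support_smul hs)
    simp [ket]
  · intro s hs
    have hs := Finsupp.support_smul hs
    refine ⟨run_support_q mem hwr (by simp) ?_ s hs, run_support_q mem hwr (by simp) ?_ s hs⟩ <;>
    · intro s' hs'
      obtain ⟨t, -, rfl⟩ := exists_of_mem_support_combo hs'
      simp [k0, ket]
  · have hn := aaRun_norm (prob₁ θ α L C) ph₁
    rw [nsq_smul, Circuit.nsq_run, nsq_combo hinj.injOn]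
    rw [← ha] at hn
    have : ∑ t ∈ bad, ‖amp₁ α L C t‖ ^ 2 = 1 - prob₁ θ α L C := by linarith
    rw [this]; linarith

/-- The marked weight `p₃` consists of the explicit good outcomes plus an unknown piece of `G`,
whose weight is at most the failure probability of the first level. That piece carries flag 1 equal
to zero, so it is orthogonal to the good outcomes and leaves their amplitudes untouched. -/
theorem Routine.search_run (hL : 0 < L.card) (ph₁ ph₂ ph₃ : List (ℝ × ℝ)) :
    ∃ p₃ : ℝ, p₃ ≤ 1 ∧
      p₃ ≤ ∑ j ∈ good₃ θ θ' α α' L C C' tr, ‖amp₃ θ θ' α α' L C C' tr ph₁ ph₂ j‖ ^ 2 +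
        (1 - prob₁ θ α L C * ‖(aaRun (prob₁ θ α L C) ph₁ (1, 1)).1‖ ^ 2) ∧
      ∀ j ∈ good₃ θ θ' α α' L C C' tr, ‖amp₃ θ θ' α α' L C C' tr ph₁ ph₂ j‖ ^ 2 ≤ p₃ ∧
        Circuit.run mem (solutionSearch A ph₁ ph₂ ph₃) (ketState 0 0 0 0 0 0 0 0) (ket₃ 1 1 j) =
          (aaRun p₃ ph₃ (1, 1)).1 * amp₃ θ θ' α α' L C C' tr ph₁ ph₂ j := by
  obtain ⟨F, G, hrun, hF, hG, hn⟩ := h.tupleSamp_run hL ph₁ ph₂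
  set ψ := Circuit.run mem (tupleSamp A ph₁ ph₂) (ketState 0 0 0 0 0 0 0 0) with hψ
  set I := good₃ θ θ' α α' L C C' tr
  set am := amp₃ θ θ' α α' L C C' tr ph₁ ph₂
  have hsupp : ∀ s ∈ ψ.support, s.q (.flag₃, 0) = false := by
    intro s hs
    rw [hrun] at hs
    rcases Finset.mem_union.1 (Finsupp.support_add hs) with hs | hs
    · obtain ⟨j, -, rfl⟩ := exists_of_mem_support_combo hs
      simp [ket₃, ket]
    · rcases Finset.mem_union.1 (Finsupp.support_add hs) with hs | hs
      exacts [(hF s hs).2, (hG s hs).2]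
  obtain ⟨mark, hmark⟩ : ∃ mark : Config → Prop, ∀ s, mark s ↔ s.q (.flag₂, 0) = true :=
    ⟨_, fun _ => Iff.rfl⟩
  obtain ⟨hp, hfin⟩ := ampAmp_run_filter mem ph₃ (ctx := ket 0 0 0 0 0 0 0 0) (ctrl := ∅)
    (samp := tupleSamp A ph₁ ph₂)
    (check := [Gate.cnot (.flag₂, 0) (.flag₃, 0) (by decide)]) (flag := (.flag₃, 0))
    mark hψ.symm hsupp
    (by
      intro s hs
      rw [Circuit.run, Circuit.run, Gate.apply, Finsupp.linearCombination_single, one_smul, Gate.act,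
        hsupp s hs]
      by_cases hm : mark s
      · simp [hm, (hmark s).1 hm]
      · rw [if_neg hm, Bool.eq_false_iff.2 fun hm' => hm ((hmark s).2 hm')]
        congr 1
        ext w
        · by_cases hw : w = (.flag₃, 0)
          · subst hw; simp [Config.setQ, hsupp s hs]
          · simp [Config.setQ, hw]
        · rfl)
    ((Circuit.writes_self _).mono (fun w hw => by simpa using hw) subset_rfl)
    (fun w _ _ => by obtain ⟨ρ, k⟩ := w; cases ρ <;> simp [ket]) (fun _ _ => rfl)
  set M := ψ.filter mark with hM
  have hMeq : M = combo I am (ket₃ 1 0) + G.filter mark := by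
    rw [hM, hrun, Finsupp.filter_add, Finsupp.filter_add,
      (Finsupp.filter_eq_self_iff _ _).2, (Finsupp.filter_eq_zero_iff _ _).2, zero_add]
    · intro s hs
      by_contra hne
      have h1 := (hF s (Finsupp.mem_support_iff.2 hne)).1
      rw [(hmark s).1 hs] at h1
      exact absurd h1 (by simp)
    · intro s hs
      obtain ⟨j, -, rfl⟩ := exists_of_mem_support_combo (Finsupp.mem_support_iff.2 hs)
      exact (hmark _).2 (by simp [ket₃, ket])
  have hzero : ∀ j, G (ket₃ 1 0 j) = 0 := fun j => by
    by_contra hne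
    have := (hG _ (Finsupp.mem_support_iff.2 hne)).1
    simp [ket₃, ket] at this
  have hMj : ∀ j ∈ I, M (ket₃ 1 0 j) = am j := fun j hj => by
    rw [hMeq, Finsupp.add_apply, combo_apply (ket₃_injective 1 0).injOn hj, Finsupp.filter_apply,
      hzero, ite_self, add_zero]
  refine ⟨nsq M, ?_, ?_, fun j hj => ⟨?_, ?_⟩⟩
  · linarith [nsq_nonneg (ψ.filter fun s => ¬ mark s)]
  · rw [hMeq, nsq_add_of_ip_eq_zero, nsq_combo (ket₃_injective 1 0).injOn, ← hn]
    · gcongr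
      exact nsq_filter_le G _
    · rw [ip, Finsupp.sum]
      refine Finset.sum_eq_zero fun s hs => ?_
      obtain ⟨j, -, rfl⟩ := exists_of_mem_support_combo hs
      rw [Finsupp.filter_apply, hzero, ite_self, mul_zero]
  · rw [← hMj j hj]
    exact normSq_apply_le M _
  · have e : ket₃ 1 1 j = (ket₃ 1 0 j).setQ (.flag₃, 0) true := by
      ext w
      · obtain ⟨ρ, k⟩ := w
        rcases eq_or_ne (ρ, k) ((.flag₃, 0) : QWire) with hw | hw
        · rw [hw]; simp [Config.setQ, ket₃, ket]
        · change _ = Function.update (ket₃ 1 0 j).q (.flag₃, 0) true (ρ, k)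
          rw [Function.update_of_ne hw]
          cases ρ <;> try rfl
          have hk : k ≠ 0 := fun hk => hw (by rw [hk])
          obtain ⟨k, rfl⟩ := Nat.exists_eq_succ_of_ne_zero hk
          simp [ket₃, ket, Nat.testBit_succ]
      · rfl
    have hfin' : Circuit.run mem (solutionSearch A ph₁ ph₂ ph₃) (ketState 0 0 0 0 0 0 0 0) = _ := hfin
    rw [hfin', Finsupp.add_apply, Finsupp.smul_apply, Finsupp.smul_apply]
    have h2 : (ψ.filter fun s => ¬ mark s) (ket₃ 1 1 j) = 0 := by
      rw [Finsupp.filter_apply, if_neg (not_not.2 ((hmark _).2 (by simp [ket₃, ket])))]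
    have h1 : (M.mapDomain fun s => s.setQ (.flag₃, 0) true) (ket₃ 1 1 j) = am j := by
      rw [e, ← hMj j hj]
      refine Finsupp.mapDomain_apply' {s : Config | s.q (.flag₃, 0) = false} _ ?_ ?_ ?_
      · intro s hs
        rw [Finset.mem_coe, hM, Finsupp.support_filter, Finset.mem_filter] at hs
        exact hsupp s hs.1
      · intro s hs s' hs' he
        ext w
        · by_cases hw : w = (.flag₃, 0)
          · rw [hw]; exact (show s.q _ = false from hs).trans (show s'.q _ = false from hs').symm
          · have := congrArg (fun c => c.q w) he
            simpa [Config.setQ, hw] using this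
        · exact congrFun (congrArg Config.r he) _
      · simp [ket₃, ket]
    rw [h1, h2, smul_zero, add_zero, smul_eq_mul]

end

end

section

/-! ## Probabilities of the sampling operations on good inputs -/

/-- Double counting: the fibre of `g` over a point q injects into `w q` through `e`, so with weights
1/|w q| it contributes at most one. -/
theorem sum_inv_card_le {ι κ β : Type*} [DecidableEq κ] {I : Finset ι} {J : Finset κ} {g : ι → κ}
    (hg : ∀ i ∈ I, g i ∈ J) (w : κ → Finset β) (e : ι → β) (he : ∀ i ∈ I, e i ∈ w (g i))
    (hinj : ∀ i ∈ I, ∀ j ∈ I, g i = g j → e i = e j → i = j) :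
    ∑ i ∈ I, 1 / ((w (g i)).card : ℝ) ≤ J.card := by
  rw [← Finset.sum_fiberwise_of_maps_to hg, ← nsmul_one]
  refine Finset.sum_le_card_nsmul _ _ _ fun q _ => ?_
  have h1 : ∑ i ∈ I.filter (fun i => g i = q), 1 / ((w (g i)).card : ℝ) =
      ∑ i ∈ I.filter (fun i => g i = q), 1 / ((w q).card : ℝ) :=
    Finset.sum_congr rfl fun i hi => by rw [(Finset.mem_filter.1 hi).2]
  rw [h1, Finset.sum_const, nsmul_eq_mul, mul_one_div]
  refine div_le_one_of_le₀ (Nat.cast_le.2 ?_) (Nat.cast_nonneg _)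
  refine Finset.card_le_card_of_injOn e (fun i hi => ?_) fun i hi j hj h => ?_
  · obtain ⟨hi, hq⟩ := Finset.mem_filter.1 (Finset.mem_coe.1 hi)
    rw [← hq]
    exact he i hi
  · obtain ⟨hi, hqi⟩ := Finset.mem_filter.1 (Finset.mem_coe.1 hi)
    obtain ⟨hj, hqj⟩ := Finset.mem_filter.1 (Finset.mem_coe.1 hj)
    exact hinj i hi j hj (hqi.trans hqj.symm) h

section
open Classical
variable {d : ℕ}

theorem card_bucketIdx {α : ℝ} {L C : Finset (Vec d)} {j : ℕ} (hj : j < C.card) :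
    (bucketIdx α L C j).card = (bucket α L (vecAt C j)).card := by
  refine Finset.card_bij (fun k _ => vecAt L k) (fun k hk => (Finset.mem_filter.1 hk).2.2) ?_ ?_
  · intro i hi k hk h
    exact vecAt_inj (bucketIdx_lt _ hi) (bucketIdx_lt _ hk) h
  · intro v hv
    obtain ⟨k, hk, rfl⟩ := exists_vecAt (Finset.mem_filter.1 hv).1
    exact ⟨k, Finset.mem_filter.2 ⟨Finset.mem_range.2 hk, hj, hv⟩, rfl⟩

/-- The consequences of goodness used in the analysis, with all factors `2^s` replaced by `σ`. -/
structure Balanced (σ θ θ' α α' : ℝ) (L C C' : Finset (Vec d)) : Prop where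
  one_le : 1 ≤ σ
  card_pos : 0 < L.card
  W_pos : 0 < wedgeRatio d θ α α
  W_pos' : 0 < wedgeRatio d θ' α' α'
  p_pos : 0 < capP d α
  p_pos' : 0 < capP d α'
  bucket_le : ∀ c ∈ C, ((bucket α L c).card : ℝ) ≤ σ * (L.card * capP d α)
  le_bucket : ∀ c ∈ C, (L.card * capP d α) ≤ σ * (bucket α L c).card
  bucket_le' : ∀ c ∈ C', ((bucket α' L c).card : ℝ) ≤ σ * (L.card * capP d α')
  le_bucket' : ∀ c ∈ C', (L.card * capP d α') ≤ σ * (bucket α' L c).card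
  third_card : ∀ x ∈ L, ∀ y ∈ L,
    ((L.filter fun z => Near d (inner ℝ (udiff x y) z) (Real.cos θ') ∧
        (nbrs α' C' (udiff x y) ∩ nbrs α' C' z).Nonempty).card : ℝ)
      ≤ σ * max 1 (L.card * wedgeRatio d θ' α' α')
  pairs_le : ((collPairs θ α L C).card : ℝ) ≤ σ ^ 2 * ((L.card : ℝ) ^ 2 * wedgeRatio d θ α α)
  le_pairs : (L.card : ℝ) ^ 2 * wedgeRatio d θ α α ≤ σ * (collPairsStar θ α L C).card
  triples_le : ((collTriples θ θ' α α' L C C').card : ℝ) ≤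
    σ ^ 2 * ((L.card : ℝ) ^ 3 * wedgeRatio d θ α α * wedgeRatio d θ' α' α')
  le_triples : (L.card : ℝ) ^ 3 * wedgeRatio d θ α α * wedgeRatio d θ' α' α' ≤
    σ * (collTriplesStar θ θ' α α' L C C').card
  one_le_triples : 1 ≤ (L.card : ℝ) ^ 3 * wedgeRatio d θ α α * wedgeRatio d θ' α' α'

theorem EqUpTo.le_mul {s a b : ℝ} (h : EqUpTo s a b) (hb : 0 ≤ b) :
    a ≤ (2 : ℝ) ^ |s| * b :=
  h.2.trans (mul_le_mul_of_nonneg_right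
    (Real.rpow_le_rpow_of_exponent_le (by norm_num) (le_abs_self s)) hb)

theorem EqUpTo.mul_le {s a b : ℝ} (h : EqUpTo s a b) (hb : 0 ≤ b) :
    b ≤ (2 : ℝ) ^ |s| * a := by
  have h1 : (2 : ℝ) ^ (-|s|) * b ≤ a := (mul_le_mul_of_nonneg_right
    (Real.rpow_le_rpow_of_exponent_le (by norm_num) (neg_le_neg (le_abs_self s))) hb).trans h.1
  rwa [Real.rpow_neg (by norm_num), inv_mul_le_iff₀ (by positivity)] at h1

theorem wedgeRatio_nonneg (d : ℕ) (α β θ : ℝ) : 0 ≤ wedgeRatio d α β θ :=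
  div_nonneg ENNReal.toReal_nonneg ENNReal.toReal_nonneg

/-- The exponent s may be negative; passing to |s| ensures σ ≥ 1. That the list and both wedge
ratios are positive follows from the lower bound on the expected number of triples. -/
theorem IsGood.balanced {s θ θ' α α' : ℝ} {L C C' : Finset (Vec d)}
    (h : IsGood s θ θ' α α' L C C') (hp : 0 < capP d α) (hp' : 0 < capP d α')
    (h1 : 1 ≤ (L.card : ℝ) ^ 3 * wedgeRatio d θ α α * wedgeRatio d θ' α' α') :
    Balanced ((2 : ℝ) ^ |s|) θ θ' α α' L C C' := by
  have hW := wedgeRatio_nonneg d θ α α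
  have hW' := wedgeRatio_nonneg d θ' α' α'
  have hL0 : (0 : ℝ) ≤ L.card := Nat.cast_nonneg _
  have hσ : (0 : ℝ) < 2 ^ |s| := by positivity
  refine ⟨Real.one_le_rpow (by norm_num) (abs_nonneg s), ?_, ?_, ?_, hp, hp',
    fun c hc => (h.bucket_card c hc).le_mul (by positivity),
    fun c hc => (h.bucket_card c hc).mul_le (by positivity),
    fun c hc => (h.bucket_card' c hc).le_mul (by positivity),
    fun c hc => (h.bucket_card' c hc).mul_le (by positivity),
    fun x hx y hy => (h.third_card x hx y hy).trans (mul_le_mul_of_nonneg_right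
      (Real.rpow_le_rpow_of_exponent_le (by norm_num) (le_abs_self s)) (by positivity)), ?_,
    h.pairs_card.mul_le (by positivity), ?_, h.triples_card.mul_le (by positivity), h1⟩
  · rcases Nat.eq_zero_or_pos L.card with h0 | h0
    · rw [h0] at h1; norm_num at h1
    · exact h0
  · refine hW.lt_of_ne fun h0 => ?_
    rw [← h0] at h1; norm_num at h1
  · refine hW'.lt_of_ne fun h0 => ?_
    rw [← h0] at h1; norm_num at h1
  · rw [pow_two ((2 : ℝ) ^ |s|), mul_assoc]
    exact (h.pairs_star.le_mul (Nat.cast_nonneg _)).trans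
      (mul_le_mul_of_nonneg_left (h.pairs_card.le_mul (by positivity)) hσ.le)
  · rw [pow_two ((2 : ℝ) ^ |s|), mul_assoc]
    exact (h.triples_star.le_mul (Nat.cast_nonneg _)).trans
      (mul_le_mul_of_nonneg_left (h.triples_card.le_mul (by positivity)) hσ.le)

variable {σ θ θ' α α' : ℝ} {L C C' : Finset (Vec d)} {tr : Vec d → Finset ℕ}

theorem mem_nbrIdx {u : Vec d} {j : ℕ} :
    j ∈ nbrIdx α C u ↔ j < C.card ∧ Near d (inner ℝ u (vecAt C j)) (Real.cos α) := by
  rw [nbrIdx, Finset.mem_filter, Finset.mem_range, nbrs, Finset.mem_filter]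
  exact ⟨fun h => ⟨h.1, h.2.2⟩, fun h => ⟨h.1, vecAt_mem h.1, h.2⟩⟩

theorem mem_bucketIdx {i j : ℕ} : i ∈ bucketIdx α L C j ↔ i < L.card ∧ j < C.card ∧
    Near d (inner ℝ (vecAt L i) (vecAt C j)) (Real.cos α) := by
  rw [bucketIdx, Finset.mem_filter, Finset.mem_range, bucket, Finset.mem_filter]
  exact ⟨fun h => ⟨h.1, h.2.1, h.2.2.2⟩, fun h => ⟨h.1, h.2.1, vecAt_mem h.1, h.2.2⟩⟩

theorem exists_of_inter_nonempty {u z : Vec d} (hz : z ∈ L)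
    (h : (nbrs α C u ∩ nbrs α C z).Nonempty) :
    ∃ c ∈ nbrIdx α C u, ∃ k ∈ bucketIdx α L C c, vecAt L k = z := by
  obtain ⟨v, hv⟩ := h
  obtain ⟨h1, h2⟩ := Finset.mem_inter.1 hv
  obtain ⟨hvC, h1⟩ := Finset.mem_filter.1 h1
  obtain ⟨-, h2⟩ := Finset.mem_filter.1 h2
  obtain ⟨c, hc, rfl⟩ := exists_vecAt hvC
  obtain ⟨k, hk, rfl⟩ := exists_vecAt hz
  exact ⟨c, mem_nbrIdx.2 ⟨hc, h1⟩, k, mem_bucketIdx.2 ⟨hk, hc, h2⟩, rfl⟩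

theorem inter_nonempty {u : Vec d} {c k : ℕ} (hc : c ∈ nbrIdx α C u) (hk : k ∈ bucketIdx α L C c) :
    (nbrs α C u ∩ nbrs α C (vecAt L k)).Nonempty := by
  obtain ⟨hc1, hc2⟩ := mem_nbrIdx.1 hc
  obtain ⟨-, -, hk⟩ := mem_bucketIdx.1 hk
  exact ⟨vecAt C c, Finset.mem_inter.2 ⟨Finset.mem_filter.2 ⟨vecAt_mem hc1, hc2⟩,
    Finset.mem_filter.2 ⟨vecAt_mem hc1, hk⟩⟩⟩

/-- The pair of vectors of an outcome. -/
def pair₁ (L : Finset (Vec d)) (t : Idx₁) : Vec d × Vec d := (vecAt L t.1, vecAt L t.2.2)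

/-- The triple of vectors of an outcome. -/
def triple₃ (L : Finset (Vec d)) (j : Idx₃) : Vec d × Vec d × Vec d :=
  (vecAt L j.1.1, vecAt L j.1.2.2, vecAt L j.2.2)

theorem pair₁_mem {t : Idx₁} (ht : t ∈ good₁ θ α L C) : pair₁ L t ∈ collPairs θ α L C := by
  obtain ⟨hx, hc, hy, hn⟩ := mem_good₁.1 ht
  exact Finset.mem_filter.2 ⟨Finset.mem_product.2 ⟨vecAt_mem hx, vecAt_mem (bucketIdx_lt _ hy)⟩, hn,
    inter_nonempty hc hy⟩

theorem exists_pair₁ {v w : Vec d} (h : (v, w) ∈ collPairs θ α L C) :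
    ∃ t ∈ good₁ θ α L C, pair₁ L t = (v, w) := by
  obtain ⟨hvw, hn, hR⟩ := Finset.mem_filter.1 h
  obtain ⟨hv, hw⟩ := Finset.mem_product.1 hvw
  obtain ⟨c, hc, y, hy, e⟩ := exists_of_inter_nonempty hw hR
  obtain ⟨x, hx, e'⟩ := exists_vecAt hv
  subst e' e
  exact ⟨⟨x, c, y⟩, mem_good₁.2 ⟨hx, hc, hy, hn⟩, rfl⟩

theorem sum_weight₁_le :
    ∑ t ∈ good₁ θ α L C, 1 / ((nbrIdx α C (vecAt L t.1)).card : ℝ) ≤ (collPairs θ α L C).card := by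
  refine sum_inv_card_le (g := pair₁ L) (fun t ht => pair₁_mem ht) (fun q => nbrIdx α C q.1)
    (fun t => t.2.1) (fun t ht => (mem_good₁.1 ht).2.1) ?_
  rintro ⟨x, c, y⟩ ht ⟨x₂, c₂, y₂⟩ ht₂ hp (rfl : c = c₂)
  obtain ⟨hx, -, hy, -⟩ := mem_good₁.1 ht
  obtain ⟨hx₂, -, hy₂, -⟩ := mem_good₁.1 ht₂
  have e1 := vecAt_inj hx hx₂ (congrArg Prod.fst hp)
  have e2 := vecAt_inj (bucketIdx_lt _ hy) (bucketIdx_lt _ hy₂) (congrArg Prod.snd hp)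
  simp only at e1 e2
  rw [e1, e2]

theorem mem_good₃ {j : Idx₃} :
    j ∈ good₃ θ θ' α α' L C C' tr ↔ j.1 ∈ good₁ θ α L C ∧ j.2.1 ∈ tr (diff₁ L j.1) ∧
      j.2.2 ∈ bucketIdx α' L C' j.2.1 ∧
      Near d (inner ℝ (diff₁ L j.1) (vecAt L j.2.2)) (Real.cos θ') := by
  rw [good₃, Finset.mem_sigma, Finset.mem_sigma, Finset.mem_filter, Marked₂]
  refine and_congr_right fun ht => ?_
  constructor
  · rintro ⟨hc, hz, hlt, hn⟩
    have hz' : j.2.2 ∈ bucketIdx α' L C' j.2.1 := by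
      unfold nonbot at hz
      split_ifs at hz
      · exact absurd (Finset.mem_singleton.1 hz) hlt.ne
      · exact hz
    refine ⟨?_, hz', hn⟩
    unfold nonbot at hc
    split_ifs at hc
    · have := (Finset.mem_filter.1 hz').2.1
      exact absurd (Finset.mem_singleton.1 hc) this.ne
    · exact hc
  · rintro ⟨hc, hz, hn⟩
    refine ⟨?_, ?_, bucketIdx_lt _ hz, hn⟩
    · rwa [nonbot_eq hc]
    · rwa [nonbot_eq hz]

theorem triple₃_mem (htr : ∀ u, tr u ⊆ nbrIdx α' C' u) {j : Idx₃}
    (hj : j ∈ good₃ θ θ' α α' L C C' tr) : triple₃ L j ∈ collTriples θ θ' α α' L C C' := by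
  obtain ⟨ht, hc', hz, hn'⟩ := mem_good₃.1 hj
  obtain ⟨hx, hc, hy, hn⟩ := mem_good₁.1 ht
  exact Finset.mem_filter.2 ⟨Finset.mem_filter.2 ⟨Finset.mem_product.2 ⟨vecAt_mem hx,
    Finset.mem_product.2 ⟨vecAt_mem (bucketIdx_lt _ hy), vecAt_mem (bucketIdx_lt _ hz)⟩⟩, hn, hn'⟩,
    inter_nonempty hc hy, inter_nonempty (htr _ hc') hz⟩

/-- The outcomes above one triple differ only in (c, c'), and these lie in the product of R(x) and
the truncated R'(u). -/
theorem sum_weight₃_le (htr : ∀ u, tr u ⊆ nbrIdx α' C' u) :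
    ∑ j ∈ good₃ θ θ' α α' L C C' tr,
      1 / (((nbrIdx α C (vecAt L j.1.1)).card : ℝ) * (tr (diff₁ L j.1)).card) ≤
      (collTriples θ θ' α α' L C C').card := by
  have := sum_inv_card_le (I := good₃ θ θ' α α' L C C' tr) (g := triple₃ L)
    (fun j hj => triple₃_mem htr hj)
    (fun q => nbrIdx α C q.1 ×ˢ tr (udiff q.1 q.2.1)) (fun j => (j.1.2.1, j.2.1))
    (fun j hj => by
      obtain ⟨ht, hc', -, -⟩ := mem_good₃.1 hj
      exact Finset.mem_product.2 ⟨(mem_good₁.1 ht).2.1, hc'⟩)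
    (by
      rintro ⟨⟨x, c, y⟩, c', z⟩ hj ⟨⟨x₂, c₂, y₂⟩, c₂', z₂⟩ hj₂ hp he
      obtain ⟨ht, -, hz, -⟩ := mem_good₃.1 hj
      obtain ⟨ht₂, -, hz₂, -⟩ := mem_good₃.1 hj₂
      obtain ⟨hx, -, hy, -⟩ := mem_good₁.1 ht
      obtain ⟨hx₂, -, hy₂, -⟩ := mem_good₁.1 ht₂
      simp only [triple₃, Prod.mk.injEq] at hp he
      obtain rfl := vecAt_inj hx hx₂ hp.1
      obtain rfl := vecAt_inj (bucketIdx_lt _ hy) (bucketIdx_lt _ hy₂) hp.2.1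
      obtain rfl := vecAt_inj (bucketIdx_lt _ hz) (bucketIdx_lt _ hz₂) hp.2.2
      obtain ⟨rfl, rfl⟩ := he
      rfl)
  refine le_trans (le_of_eq (Finset.sum_congr rfl fun j _ => ?_)) this
  rw [Finset.card_product]
  push_cast
  rfl

theorem sq_norm_amp₂ {z c' : ℕ} (hz : z ∈ bucketIdx α' L C' c') :
    ‖amp₂ α' L C' c'‖ ^ 2 = 1 / ((bucketIdx α' L C' c').card : ℝ) := by
  rw [amp₂, sq_norm_inv_sqrt, nonbot_eq hz]

theorem prob₂_le_one (t : Idx₁) (c' : ℕ) : prob₂ θ' α' L C' t c' ≤ 1 := by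
  rw [prob₂, Finset.sum_const, nsmul_eq_mul, amp₂, sq_norm_inv_sqrt, mul_one_div]
  exact div_le_one_of_le₀ (Nat.cast_le.2 (Finset.card_filter_le _ _)) (Nat.cast_nonneg _)

section
variable (hB : Balanced σ θ θ' α α' L C C')
include hB

theorem Balanced.bucketIdx_le {j : ℕ} (hj : j < C.card) :
    ((bucketIdx α L C j).card : ℝ) ≤ σ * (L.card * capP d α) := by
  rw [card_bucketIdx hj]; exact hB.bucket_le _ (vecAt_mem hj)

theorem Balanced.inv_bucketIdx_le {j : ℕ} (hj : j < C.card) :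
    1 / ((bucketIdx α L C j).card : ℝ) ≤ σ / (L.card * capP d α) := by
  have h1 := hB.le_bucket _ (vecAt_mem hj)
  rw [← card_bucketIdx hj] at h1
  have h2 : 0 < L.card * capP d α := mul_pos (Nat.cast_pos.2 hB.card_pos) hB.p_pos
  have h3 : (0 : ℝ) < (bucketIdx α L C j).card :=
    pos_of_mul_pos_right (h2.trans_le h1) (zero_le_one.trans hB.one_le)
  rwa [div_le_div_iff₀ h3 h2, one_mul]

theorem Balanced.bucketIdx_le' {j : ℕ} (hj : j < C'.card) :
    ((bucketIdx α' L C' j).card : ℝ) ≤ σ * (L.card * capP d α') := by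
  rw [card_bucketIdx hj]; exact hB.bucket_le' _ (vecAt_mem hj)

theorem Balanced.inv_bucketIdx_le' {j : ℕ} (hj : j < C'.card) :
    1 / ((bucketIdx α' L C' j).card : ℝ) ≤ σ / (L.card * capP d α') := by
  have h1 := hB.le_bucket' _ (vecAt_mem hj)
  rw [← card_bucketIdx hj] at h1
  have h2 : 0 < L.card * capP d α' := mul_pos (Nat.cast_pos.2 hB.card_pos) hB.p_pos'
  have h3 : (0 : ℝ) < (bucketIdx α' L C' j).card :=
    pos_of_mul_pos_right (h2.trans_le h1) (zero_le_one.trans hB.one_le)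
  rwa [div_le_div_iff₀ h3 h2, one_mul]

/-- An outcome (x,c,y) has probability 1/(m·|R(x)|·|bucket|). Buckets have size at least mp/σ, and
the sum of 1/|R(x)| is at most the number of pairs, at most σ²m²W. -/
theorem Balanced.prob₁_le :
    prob₁ θ α L C ≤ σ ^ 3 * wedgeRatio d θ α α / capP d α := by
  have hm : (0 : ℝ) < L.card := Nat.cast_pos.2 hB.card_pos
  have hp := hB.p_pos
  have hσ : 0 < σ := zero_lt_one.trans_le hB.one_le
  calc prob₁ θ α L C ≤ ∑ t ∈ good₁ θ α L C, σ / (L.card * capP d α) / L.card *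
        (1 / ((nbrIdx α C (vecAt L t.1)).card : ℝ)) := by
        refine Finset.sum_le_sum fun t ht => ?_
        rw [sq_norm_amp₁ ht]
        obtain ⟨-, hc, hy, -⟩ := mem_good₁.1 ht
        calc 1 / ((L.card : ℝ) * ((nbrIdx α C (vecAt L t.1)).card * (bucketIdx α L C t.2.1).card))
            = 1 / ((bucketIdx α L C t.2.1).card : ℝ) / L.card *
              (1 / ((nbrIdx α C (vecAt L t.1)).card : ℝ)) := by
              rw [div_div, div_mul_div_comm, one_mul]; congr 1; ring
          _ ≤ _ := by
              exact mul_le_mul_of_nonneg_right (div_le_div_of_nonneg_right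
                (hB.inv_bucketIdx_le (nbrIdx_lt _ hc)) hm.le) (by positivity)
    _ = σ / (L.card * capP d α) / L.card *
        ∑ t ∈ good₁ θ α L C, (1 / ((nbrIdx α C (vecAt L t.1)).card : ℝ)) := by
        rw [Finset.mul_sum]
    _ ≤ σ / (L.card * capP d α) / L.card * (σ ^ 2 * ((L.card : ℝ) ^ 2 * wedgeRatio d θ α α)) := by
        gcongr
        exact sum_weight₁_le.trans hB.pairs_le
    _ = σ ^ 3 * wedgeRatio d θ α α / capP d α := by field_simp

theorem Balanced.sq_norm_amp₁_ge {t : Idx₁} (ht : t ∈ good₁ θ α L C)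
    (hR : ((nbrs α C (vecAt L t.1)).card : ℝ) ≤ trunc d) :
    1 / (L.card * (trunc d * (σ * (L.card * capP d α)))) ≤ ‖amp₁ α L C t‖ ^ 2 := by
  have hm : (0 : ℝ) < L.card := Nat.cast_pos.2 hB.card_pos
  rw [sq_norm_amp₁ ht]
  obtain ⟨-, hc, hy, -⟩ := mem_good₁.1 ht
  rw [← card_nbrIdx] at hR
  have h1 : (0 : ℝ) < (nbrIdx α C (vecAt L t.1)).card :=
    Nat.cast_pos.2 (Finset.card_pos.2 ⟨_, hc⟩)
  have h2 : (0 : ℝ) < (bucketIdx α L C t.2.1).card := Nat.cast_pos.2 (Finset.card_pos.2 ⟨_, hy⟩)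
  have h3 := hB.bucketIdx_le (nbrIdx_lt _ hc)
  have h4 := h1.trans_le hR
  gcongr

/-- Every pair of M₁* is hit by at least one outcome, whose probability is at least 1/(m·τ·σmp)
because |R(x)| is at most τ. -/
theorem Balanced.prob₁_ge :
    wedgeRatio d θ α α / (σ ^ 2 * trunc d * capP d α) ≤ prob₁ θ α L C := by
  have hm : (0 : ℝ) < L.card := Nat.cast_pos.2 hB.card_pos
  have hp := hB.p_pos
  have hσ : 0 < σ := zero_lt_one.trans_le hB.one_le
  have hτ : 0 < trunc d := Real.rpow_pos_of_pos (by norm_num) _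
  have hcard : (collPairsStar θ α L C).card ≤
      ((good₁ θ α L C).filter fun t => ((nbrs α C (vecAt L t.1)).card : ℝ) ≤ trunc d).card := by
    refine Finset.card_le_card_of_surjOn (pair₁ L) fun q hq => ?_
    obtain ⟨hq, hR⟩ := Finset.mem_filter.1 (Finset.mem_coe.1 hq)
    obtain ⟨t, ht, e⟩ := exists_pair₁ (show (q.1, q.2) ∈ _ from hq)
    refine ⟨t, Finset.mem_coe.2 (Finset.mem_filter.2 ⟨ht, ?_⟩), e⟩
    rwa [← show vecAt L t.1 = q.1 from congrArg Prod.fst e] at hR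
  calc wedgeRatio d θ α α / (σ ^ 2 * trunc d * capP d α)
      = (L.card : ℝ) ^ 2 * wedgeRatio d θ α α / σ *
        (1 / (L.card * (trunc d * (σ * (L.card * capP d α))))) := by field_simp
    _ ≤ (collPairsStar θ α L C).card * (1 / (L.card * (trunc d * (σ * (L.card * capP d α))))) := by
        gcongr
        rw [div_le_iff₀' hσ]
        exact hB.le_pairs
    _ ≤ ((good₁ θ α L C).filter fun t => ((nbrs α C (vecAt L t.1)).card : ℝ) ≤ trunc d).card *
        (1 / (L.card * (trunc d * (σ * (L.card * capP d α))))) := by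
        gcongr
    _ ≤ ∑ t ∈ (good₁ θ α L C).filter fun t => ((nbrs α C (vecAt L t.1)).card : ℝ) ≤ trunc d,
        ‖amp₁ α L C t‖ ^ 2 := by
        rw [← nsmul_eq_mul]
        refine Finset.card_nsmul_le_sum _ _ _ fun t ht => ?_
        obtain ⟨ht, hR⟩ := Finset.mem_filter.1 ht
        exact hB.sq_norm_amp₁_ge ht hR
    _ ≤ prob₁ θ α L C := Finset.sum_le_sum_of_subset_of_nonneg (Finset.filter_subset _ _)
        fun _ _ _ => by positivity

/-- A good z in the bucket of c' collides with u through c', so the third goodness condition bounds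
the number of such z, while the bucket has size at least mp'/σ. -/
theorem Balanced.prob₂_le {t : Idx₁} (ht : t ∈ good₁ θ α L C) {c' : ℕ}
    (hc' : c' ∈ nbrIdx α' C' (diff₁ L t)) :
    prob₂ θ' α' L C' t c' ≤
      σ ^ 2 * max 1 (L.card * wedgeRatio d θ' α' α') / (L.card * capP d α') := by
  have hm : (0 : ℝ) < L.card := Nat.cast_pos.2 hB.card_pos
  have hp := hB.p_pos'
  have hσ : 0 < σ := zero_lt_one.trans_le hB.one_le
  have hlt := nbrIdx_lt _ hc'
  have h1 := hB.inv_bucketIdx_le' hlt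
  have hne : bucketIdx α' L C' c' ≠ ∅ := fun h0 => by
    have h2 := hB.le_bucket' _ (vecAt_mem hlt)
    rw [← card_bucketIdx hlt, h0, Finset.card_empty, Nat.cast_zero, mul_zero] at h2
    exact absurd h2 (not_le.2 (by positivity))
  obtain ⟨z₀, hz₀⟩ := Finset.nonempty_iff_ne_empty.2 hne
  obtain ⟨hx, -, hy, -⟩ := mem_good₁.1 ht
  rw [prob₂, Finset.sum_const, nsmul_eq_mul, sq_norm_amp₂ hz₀]
  have h3 : (((nonbot (bucketIdx α' L C' c') L.card).filter (Marked₂ θ' L t)).card : ℝ) ≤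
      σ * max 1 (L.card * wedgeRatio d θ' α' α') := by
    refine le_trans (Nat.cast_le.2 (Finset.card_le_card_of_injOn (vecAt L) ?_ ?_))
      (hB.third_card _ (vecAt_mem hx) _ (vecAt_mem (bucketIdx_lt _ hy)))
    · intro z hz
      rw [nonbot_eq hz₀] at hz
      obtain ⟨hz, hlt, hn⟩ := Finset.mem_filter.1 (Finset.mem_coe.1 hz)
      exact Finset.mem_filter.2 ⟨vecAt_mem hlt, hn, inter_nonempty hc' hz⟩
    · intro z hz z' hz' e
      exact vecAt_inj (Finset.mem_filter.1 (Finset.mem_coe.1 hz)).2.1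
        (Finset.mem_filter.1 (Finset.mem_coe.1 hz')).2.1 e
  calc _ ≤ σ * max 1 (L.card * wedgeRatio d θ' α' α') * (σ / (L.card * capP d α')) := by gcongr
    _ = _ := by ring

theorem Balanced.star_nonempty : (collTriplesStar θ θ' α α' L C C').Nonempty := by
  rw [← Finset.card_pos, ← Nat.cast_pos (α := ℝ)]
  exact pos_of_mul_pos_right ((zero_lt_one.trans_le hB.one_le_triples).trans_le hB.le_triples)
    (zero_le_one.trans hB.one_le)

/-- A triple of 𝒯* exists, so some bucket of the second code is nonempty, and its size is at most
σmp'. -/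
theorem Balanced.one_le_cap' : 1 ≤ σ * (L.card * capP d α') := by
  obtain ⟨t, ht⟩ := hB.star_nonempty
  obtain ⟨ht, -⟩ := Finset.mem_filter.1 ht
  obtain ⟨ht, -, hR⟩ := Finset.mem_filter.1 ht
  obtain ⟨ht, -⟩ := Finset.mem_filter.1 ht
  obtain ⟨-, ht⟩ := Finset.mem_product.1 ht
  obtain ⟨-, hz⟩ := Finset.mem_product.1 ht
  obtain ⟨c, hc, k, hk, -⟩ := exists_of_inter_nonempty hz hR
  refine le_trans ?_ (hB.bucketIdx_le' (nbrIdx_lt _ hc))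
  exact Nat.one_le_cast.2 (Finset.card_pos.2 ⟨k, hk⟩)

/-- A triple of 𝒯* is a pair from M₁ together with z in one of at most τ buckets of size at most
σmp'. Comparing this count with the lower bound on |𝒯*| and cancelling m³W gives the claim. -/
theorem Balanced.wedge_le' : wedgeRatio d θ' α' α' ≤ σ ^ 4 * trunc d * capP d α' := by
  have hm : (0 : ℝ) < L.card := Nat.cast_pos.2 hB.card_pos
  have hp := hB.p_pos'
  have hW := hB.W_pos
  have hσ : 0 < σ := zero_lt_one.trans_le hB.one_le
  have hτ : 0 < trunc d := Real.rpow_pos_of_pos (by norm_num) _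
  set X : Vec d × Vec d → Finset (Vec d × Vec d × Vec d) := fun q =>
    if ((nbrs α' C' (udiff q.1 q.2)).card : ℝ) ≤ trunc d then
      (nbrs α' C' (udiff q.1 q.2)).biUnion fun c => (bucket α' L c).image fun z => (q.1, q.2, z)
    else ∅ with hX
  have hsub : collTriplesStar θ θ' α α' L C C' ⊆ (collPairs θ α L C).biUnion X := by
    intro t ht
    obtain ⟨ht, -, hτ⟩ := Finset.mem_filter.1 ht
    obtain ⟨ht, hR, hR'⟩ := Finset.mem_filter.1 ht
    obtain ⟨ht, hn, -⟩ := Finset.mem_filter.1 ht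
    obtain ⟨hx, ht⟩ := Finset.mem_product.1 ht
    obtain ⟨hy, hz⟩ := Finset.mem_product.1 ht
    refine Finset.mem_biUnion.2 ⟨(t.1, t.2.1),
      Finset.mem_filter.2 ⟨Finset.mem_product.2 ⟨hx, hy⟩, hn, hR⟩, ?_⟩
    rw [hX]
    simp only
    rw [if_pos hτ]
    obtain ⟨c, hc⟩ := hR'
    obtain ⟨h1, h2⟩ := Finset.mem_inter.1 hc
    exact Finset.mem_biUnion.2 ⟨c, h1, Finset.mem_image.2 ⟨t.2.2, Finset.mem_filter.2 ⟨hz,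
      (Finset.mem_filter.1 h2).2⟩, rfl⟩⟩
  have hXc : ∀ q, ((X q).card : ℝ) ≤ trunc d * (σ * (L.card * capP d α')) := by
    intro q
    rw [hX]
    simp only
    split_ifs with hq
    · refine (Nat.cast_le.2 Finset.card_biUnion_le).trans ?_
      push_cast
      refine (Finset.sum_le_card_nsmul _ _ (σ * (L.card * capP d α')) fun c hc => ?_).trans ?_
      · exact (Nat.cast_le.2 Finset.card_image_le).trans
          (hB.bucket_le' c (Finset.mem_filter.1 hc).1)
      · rw [nsmul_eq_mul]
        gcongr
    · rw [Finset.card_empty, Nat.cast_zero]; positivity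
  have h1 : ((collTriplesStar θ θ' α α' L C C').card : ℝ) ≤
      σ ^ 2 * ((L.card : ℝ) ^ 2 * wedgeRatio d θ α α) * (trunc d * (σ * (L.card * capP d α'))) := by
    refine (Nat.cast_le.2 ((Finset.card_le_card hsub).trans Finset.card_biUnion_le)).trans ?_
    push_cast
    refine (Finset.sum_le_card_nsmul _ _ _ fun q _ => hXc q).trans ?_
    rw [nsmul_eq_mul]
    gcongr
    exact hB.pairs_le
  have h2 := hB.le_triples.trans (mul_le_mul_of_nonneg_left h1 hσ.le)
  have h3 : 0 < (L.card : ℝ) ^ 3 * wedgeRatio d θ α α := by positivity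
  refine le_of_mul_le_mul_left (h2.trans_eq ?_) h3
  ring

end

end

end

section

/-! ## The probability of finding a given triple -/

/-- An upper bound on the success probability of the first sampling operation. -/
def maxProb₁ (d : ℕ) (σ θ α : ℝ) : ℝ := σ ^ 3 * wedgeRatio d θ α α / capP d α

/-- An upper bound on the success probability of the second sampling operation. -/
def maxProb₂ (d m : ℕ) (σ θ' α' : ℝ) : ℝ :=
  σ ^ 2 * max 1 (m * wedgeRatio d θ' α' α') / (m * capP d α')

/-- An upper bound on the success probability of `TupleSamp`. -/
def maxProb₃ (d m : ℕ) (σ θ' α' : ℝ) : ℝ :=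
  4 * σ ^ 10 * trunc d ^ 2 * min 1 (m * wedgeRatio d θ' α' α')

/-- A lower bound on the probability of finding a given triple. -/
def minProb (d m : ℕ) (σ θ θ' α α' : ℝ) : ℝ :=
  1 / (10368 * σ ^ 17 * trunc d ^ 4 *
    ((m : ℝ) ^ 3 * wedgeRatio d θ α α * wedgeRatio d θ' α' α'))

/-- The factors of the final probability: 10368 = 36·36·4·2, σ occurs to the power 10+3+1+2+1 and τ
to the power 2+1+1. The maximum M and the minimum μ of 1 and mW' enter only through their product
mW'. -/
theorem minProb_aux {σ m τ p p' W W' M μ : ℝ} (hMμ : M * μ = m * W') (hσ : 0 < σ) (hm : 0 < m)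
    (hτ : 0 < τ) (hp : 0 < p) (hp' : 0 < p') (hW : 0 < W) (hM : 0 < M) (hμ : 0 < μ) :
    1 / (10368 * σ ^ 17 * τ ^ 4 * (m ^ 3 * W * W')) =
      1 / (36 * (4 * σ ^ 10 * τ ^ 2 * μ)) *
        (p / (2 * (σ ^ 3 * W)) * (1 / (m * (τ * (σ * (m * p))))) *
          (1 / τ * (1 / (36 * (σ ^ 2 * M / (m * p'))) * (1 / (σ * (m * p')))))) := by
  have e : m ^ 3 * W * W' = m ^ 2 * W * (M * μ) := by rw [hMμ]; ring
  rw [e]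
  field_simp
  norm_num

section
open Classical
variable {d : ℕ} {σ θ θ' α α' : ℝ} {L C C' : Finset (Vec d)} {tr : Vec d → Finset ℕ}

theorem sq_norm_amp₃ {ph₁ ph₂ : List (ℝ × ℝ)} {j : Idx₃} (hj : j ∈ good₃ θ θ' α α' L C C' tr) :
    ‖amp₃ θ θ' α α' L C C' tr ph₁ ph₂ j‖ ^ 2 =
      ‖(aaRun (prob₁ θ α L C) ph₁ (1, 1)).1‖ ^ 2 * ‖amp₁ α L C j.1‖ ^ 2 *
      (1 / ((tr (diff₁ L j.1)).card : ℝ) *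
      (‖(aaRun (prob₂ θ' α' L C' j.1 j.2.1) ph₂ (1, 1)).1‖ ^ 2 *
        (1 / ((bucketIdx α' L C' j.2.1).card : ℝ)))) := by
  obtain ⟨-, hc', hz, -⟩ := mem_good₃.1 hj
  rw [amp₃, norm_mul, norm_mul, norm_mul, norm_mul, mul_pow, mul_pow, mul_pow, mul_pow,
    sq_norm_inv_sqrt, sq_norm_amp₂ hz, nonbot_eq hc']

theorem prob₂_pos {t : Idx₁} {c' z : ℕ} (hz : z ∈ bucketIdx α' L C' c')
    (hn : Near d (inner ℝ (diff₁ L t) (vecAt L z)) (Real.cos θ')) :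
    0 < prob₂ θ' α' L C' t c' := by
  have hmem : z ∈ (nonbot (bucketIdx α' L C' c') L.card).filter (Marked₂ θ' L t) :=
    Finset.mem_filter.2 ⟨by rwa [nonbot_eq hz], bucketIdx_lt _ hz, hn⟩
  refine Finset.sum_pos (fun i _ => ?_) ⟨z, hmem⟩
  rw [sq_norm_amp₂ hz]
  have : 0 < (bucketIdx α' L C' c').card := Finset.card_pos.2 ⟨z, hz⟩
  positivity

theorem one_le_trunc (d : ℕ) : 1 ≤ trunc d := by
  refine Real.one_le_rpow (by norm_num) (div_nonneg (Nat.cast_nonneg _) ?_)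
  rcases Nat.eq_zero_or_pos d with h | h
  · simp [h]
  · exact Real.logb_nonneg (by norm_num) (Nat.one_le_cast.2 h)

section
variable (hB : Balanced σ θ θ' α α' L C C')
include hB

theorem Balanced.maxProb₁_pos : 0 < maxProb₁ d σ θ α := by
  have := hB.W_pos
  have := hB.p_pos
  have : 0 < σ := zero_lt_one.trans_le hB.one_le
  unfold maxProb₁; positivity

theorem Balanced.maxProb₂_pos : 0 < maxProb₂ d L.card σ θ' α' := by
  have := hB.p_pos'
  have : 0 < σ := zero_lt_one.trans_le hB.one_le
  have hm : (0 : ℝ) < L.card := Nat.cast_pos.2 hB.card_pos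
  have : (0 : ℝ) < max 1 (L.card * wedgeRatio d θ' α' α') := lt_max_of_lt_left one_pos
  unfold maxProb₂; positivity

theorem Balanced.maxProb₃_pos : 0 < maxProb₃ d L.card σ θ' α' := by
  have : 0 < σ := zero_lt_one.trans_le hB.one_le
  have hm : (0 : ℝ) < L.card := Nat.cast_pos.2 hB.card_pos
  have := hB.W_pos'
  have : (0 : ℝ) < min 1 (L.card * wedgeRatio d θ' α' α') := lt_min one_pos (by positivity)
  have := zero_lt_one.trans_le (one_le_trunc d)
  unfold maxProb₃; positivity

theorem Balanced.prob₁_pos : 0 < prob₁ θ α L C := by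
  refine lt_of_lt_of_le ?_ hB.prob₁_ge
  have := hB.W_pos
  have := hB.p_pos
  have : 0 < σ := zero_lt_one.trans_le hB.one_le
  have := zero_lt_one.trans_le (one_le_trunc d)
  positivity

/-- Grover rounds raise the success probability to at least the quotient of the lower and upper
bounds on `prob₁` divided by 36, namely 1/(36σ⁵τ). Each boosting step then cubes the failure
probability. -/
theorem Balanced.first_amp (h1 : prob₁ θ α L C ≤ 1) (k : ℕ) :
    1 - prob₁ θ α L C * ‖(aaRun (prob₁ θ α L C)
      (boostPhases k (groverPhases (rounds (maxProb₁ d σ θ α)))) (1, 1)).1‖ ^ 2 ≤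
      (1 - 1 / (36 * σ ^ 5 * trunc d)) ^ 3 ^ k := by
  set r := groverPhases (rounds (maxProb₁ d σ θ α))
  have e1 := aaRun_norm (prob₁ θ α L C) (boostPhases k r)
  have e2 := aaRun_norm (prob₁ θ α L C) r
  have e3 := boostPhases_snd (prob₁ θ α L C) k r
  have hg := grover_rounds hB.maxProb₁_pos hB.prob₁_pos h1 hB.prob₁_le
  have hlow := mul_le_mul hB.prob₁_ge hg
    (by have := hB.maxProb₁_pos; positivity) hB.prob₁_pos.le
  have e4 : wedgeRatio d θ α α / (σ ^ 2 * trunc d * capP d α) * (1 / (36 * maxProb₁ d σ θ α)) =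
      1 / (36 * σ ^ 5 * trunc d) := by
    have := hB.W_pos
    have := hB.p_pos
    have : 0 < σ := zero_lt_one.trans_le hB.one_le
    have := zero_lt_one.trans_le (one_le_trunc d)
    unfold maxProb₁
    field_simp
  rw [e4] at hlow
  have e5 : 1 - prob₁ θ α L C * ‖(aaRun (prob₁ θ α L C) (boostPhases k r) (1, 1)).1‖ ^ 2 =
      ((1 - prob₁ θ α L C) * ‖(aaRun (prob₁ θ α L C) r (1, 1)).2‖ ^ 2) ^ 3 ^ k := by
    rw [← e3]; linarith
  rw [e5]
  refine pow_le_pow_left₀ (mul_nonneg (by linarith) (by positivity)) ?_ _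
  linarith

theorem Balanced.sq_norm_second_le {t : Idx₁} (ht : t ∈ good₁ θ α L C) {c' z : ℕ}
    (hc' : c' ∈ nbrIdx α' C' (diff₁ L t)) (hz : z ∈ bucketIdx α' L C' c')
    (hn : Near d (inner ℝ (diff₁ L t) (vecAt L z)) (Real.cos θ')) :
    ‖(aaRun (prob₂ θ' α' L C' t c') (groverPhases (rounds (maxProb₂ d L.card σ θ' α')))
      (1, 1)).1‖ ^ 2 ≤ max 1 (1 / maxProb₂ d L.card σ θ' α') ∧
    1 / (36 * maxProb₂ d L.card σ θ' α') ≤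
      ‖(aaRun (prob₂ θ' α' L C' t c') (groverPhases (rounds (maxProb₂ d L.card σ θ' α')))
        (1, 1)).1‖ ^ 2 := by
  have hpos := prob₂_pos hz hn
  refine ⟨?_, grover_rounds hB.maxProb₂_pos hpos (prob₂_le_one t c') (hB.prob₂_le ht hc')⟩
  have h1 := (grover_bounds hpos.le (prob₂_le_one t c') (rounds (maxProb₂ d L.card σ θ' α'))).1
  rw [mul_comm] at h1
  exact (le_of_mul_le_mul_right h1 hpos).trans (rounds_upper_sq hB.maxProb₂_pos)

/-- The amplification gains and the bucket sizes are bounded uniformly over outcomes; what remains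
is the weighted count of `sum_weight₃_le`. -/
theorem Balanced.sum_amp₃_le (htr : ∀ u, tr u ⊆ nbrIdx α' C' u) (ph₁ : List (ℝ × ℝ)) :
    ∑ j ∈ good₃ θ θ' α α' L C C' tr, ‖amp₃ θ θ' α α' L C C' tr ph₁
        (groverPhases (rounds (maxProb₂ d L.card σ θ' α'))) j‖ ^ 2 ≤
      ‖(aaRun (prob₁ θ α L C) ph₁ (1, 1)).1‖ ^ 2 * max 1 (1 / maxProb₂ d L.card σ θ' α') *
        (σ ^ 4 * wedgeRatio d θ α α * wedgeRatio d θ' α' α' / (capP d α * capP d α')) := by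
  have hm : (0 : ℝ) < L.card := Nat.cast_pos.2 hB.card_pos
  have hp := hB.p_pos
  have hp' := hB.p_pos'
  have hσ : 0 < σ := zero_lt_one.trans_le hB.one_le
  set a := ‖(aaRun (prob₁ θ α L C) ph₁ (1, 1)).1‖ ^ 2
  set b := max 1 (1 / maxProb₂ d L.card σ θ' α')
  have hb : 0 < b := lt_max_of_lt_left one_pos
  set w := a * b * (σ / (L.card * capP d α)) * (σ / (L.card * capP d α')) / L.card
  calc _ ≤ ∑ j ∈ good₃ θ θ' α α' L C C' tr, w *
        (1 / (((nbrIdx α C (vecAt L j.1.1)).card : ℝ) * (tr (diff₁ L j.1)).card)) := by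
        refine Finset.sum_le_sum fun j hj => ?_
        obtain ⟨ht, hc', hz, hn⟩ := mem_good₃.1 hj
        rw [sq_norm_amp₃ hj, sq_norm_amp₁ ht]
        have h1 := (hB.sq_norm_second_le ht (htr _ hc') hz hn).1
        have h2 := hB.inv_bucketIdx_le' (nbrIdx_lt _ (htr _ hc'))
        have h3 := hB.inv_bucketIdx_le (nbrIdx_lt _ (mem_good₁.1 ht).2.1)
        calc _ = a * ‖(aaRun (prob₂ θ' α' L C' j.1 j.2.1) (groverPhases
              (rounds (maxProb₂ d L.card σ θ' α'))) (1, 1)).1‖ ^ 2 *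
              (1 / ((bucketIdx α L C j.1.2.1).card : ℝ)) *
              (1 / ((bucketIdx α' L C' j.2.1).card : ℝ)) / L.card *
              (1 / (((nbrIdx α C (vecAt L j.1.1)).card : ℝ) * (tr (diff₁ L j.1)).card)) := by
              simp only [one_div, mul_inv]; ring
          _ ≤ _ := by
              refine mul_le_mul_of_nonneg_right (div_le_div_of_nonneg_right ?_ hm.le) (by positivity)
              refine mul_le_mul (mul_le_mul (mul_le_mul_of_nonneg_left h1 (by positivity)) h3
                (by positivity) (by positivity)) h2 (by positivity) (by positivity)
    _ = w * ∑ j ∈ good₃ θ θ' α α' L C C' tr,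
        (1 / (((nbrIdx α C (vecAt L j.1.1)).card : ℝ) * (tr (diff₁ L j.1)).card)) := by
        rw [Finset.mul_sum]
    _ ≤ w * (σ ^ 2 * ((L.card : ℝ) ^ 3 * wedgeRatio d θ α α * wedgeRatio d θ' α' α')) := by
        gcongr
        exact (sum_weight₃_le htr).trans hB.triples_le
    _ = _ := by
        simp only [w]
        field_simp

/-- If the second level amplifies, the gain 1/P₂ cancels p' and leaves μ/σ², where μ is the minimum
of 1 and mW'. If it does not, W'/p' itself must be compared with μ: `Balanced.wedge_le'` serves for
μ = 1 and `Balanced.one_le_cap'` for μ = mW'. -/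
theorem Balanced.wedge_ratio_le :
    wedgeRatio d θ' α' α' / capP d α' * max 1 (1 / maxProb₂ d L.card σ θ' α') ≤
      σ ^ 4 * trunc d * min 1 (L.card * wedgeRatio d θ' α' α') := by
  have hm : (0 : ℝ) < L.card := Nat.cast_pos.2 hB.card_pos
  have hp' := hB.p_pos'
  have hW' := hB.W_pos'
  have hσ : 0 < σ := zero_lt_one.trans_le hB.one_le
  have hσ1 := hB.one_le
  have hτ := one_le_trunc d
  set W' := wedgeRatio d θ' α' α'
  set M := max 1 (L.card * W') with hM
  set μ := min 1 (L.card * W') with hμ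
  have hMμ : M * μ = L.card * W' := by rw [hM, hμ, max_mul_min, one_mul]
  have hM0 : 0 < M := lt_max_of_lt_left one_pos
  have hμ0 : 0 < μ := lt_min one_pos (by positivity)
  have h1τ : 1 ≤ σ ^ 3 * trunc d := one_le_mul_of_one_le_of_one_le (one_le_pow₀ hσ1) hτ
  rcases le_total (1 / maxProb₂ d L.card σ θ' α') 1 with h | h
  · rw [max_eq_left h, mul_one, div_le_iff₀ hp', hμ]
    rcases min_choice 1 (L.card * W') with h' | h' <;> rw [h']
    · rw [mul_one]; exact hB.wedge_le'
    · calc W' ≤ W' * (σ * (L.card * capP d α')) := le_mul_of_one_le_right hW'.le hB.one_le_cap'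
        _ ≤ W' * (σ * (L.card * capP d α')) * (σ ^ 3 * trunc d) :=
            le_mul_of_one_le_right (mul_pos hW' (mul_pos hσ (mul_pos hm hp'))).le h1τ
        _ = _ := by ring
  · rw [max_eq_right h]
    have e : W' / capP d α' * (1 / maxProb₂ d L.card σ θ' α') = μ / σ ^ 2 := by
      rw [maxProb₂, ← hM]
      field_simp
      rw [mul_comm W']; exact hMμ.symm
    rw [e]
    calc μ / σ ^ 2 ≤ μ := div_le_self hμ0.le (one_le_pow₀ hσ1)
      _ ≤ σ ^ 4 * trunc d * μ :=
        le_mul_of_one_le_left hμ0.le (one_le_mul_of_one_le_of_one_le (one_le_pow₀ hσ1) hτ)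

theorem Balanced.wedge_le : wedgeRatio d θ α α ≤ σ := by
  have hm : (0 : ℝ) < L.card := Nat.cast_pos.2 hB.card_pos
  have h1 : ((collPairsStar θ α L C).card : ℝ) ≤ (L.card : ℝ) ^ 2 := by
    rw [pow_two]
    exact_mod_cast ((Finset.card_filter_le _ _).trans (Finset.card_filter_le _ _)).trans_eq
      (Finset.card_product _ _)
  have h2 := hB.le_pairs.trans
    (mul_le_mul_of_nonneg_left h1 (zero_le_one.trans hB.one_le))
  rw [mul_comm] at h2
  exact le_of_mul_le_mul_right h2 (by positivity)

/-- At least one triple is expected and W ≤ σ, so mW' ≥ 1/(σm²). This a priori bound determines how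
small the error of the first level has to be. -/
theorem Balanced.min_ge : 1 / (σ * (L.card : ℝ) ^ 2) ≤ min 1 (L.card * wedgeRatio d θ' α' α') := by
  have hm : (1 : ℝ) ≤ L.card := Nat.one_le_cast.2 hB.card_pos
  have hm0 : (0 : ℝ) < L.card := zero_lt_one.trans_le hm
  have hσ : 0 < σ := zero_lt_one.trans_le hB.one_le
  have hW' := hB.W_pos'
  refine le_min ?_ ?_
  · exact div_le_one_of_le₀ (one_le_mul_of_one_le_of_one_le hB.one_le (one_le_pow₀ hm))
      (by positivity)
  · rw [div_le_iff₀ (by positivity)]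
    calc (1 : ℝ) ≤ (L.card : ℝ) ^ 3 * wedgeRatio d θ α α * wedgeRatio d θ' α' α' := hB.one_le_triples
      _ ≤ (L.card : ℝ) ^ 3 * σ * wedgeRatio d θ' α' α' := by
          gcongr
          exact hB.wedge_le
      _ = _ := by ring

variable {A : Subroutines} {mem : Memory} (hR : Routine A mem θ θ' α α' L C C' tr)
include hR

/-- A triple of 𝒯* has an outcome (x,c,y,c',z), and since |R'(u)| ≤ τ its c' survives truncation.
The squared amplitude of this outcome is bounded below by the product of the gains at the first two
levels and the reciprocals of the sizes of the sets sampled from. The third level multiplies it by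
at least 1/(36P₃), where P₃ dominates the total marked weight, including the uncontrolled failed
branch. -/
theorem Balanced.output_prob {k : ℕ}
    (hk : (1 - 1 / (36 * σ ^ 5 * trunc d)) ^ 3 ^ k ≤ 1 / (2 * σ * (L.card : ℝ) ^ 2))
    {t : Vec d × Vec d × Vec d} (ht : t ∈ collTriplesStar θ θ' α α' L C C') :
    ∃ s : Config, s.Outputs L t ∧ minProb d L.card σ θ θ' α α' ≤
      ‖Circuit.run mem (solutionSearch A
          (boostPhases k (groverPhases (rounds (maxProb₁ d σ θ α))))
          (groverPhases (rounds (maxProb₂ d L.card σ θ' α')))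
          (groverPhases (rounds (maxProb₃ d L.card σ θ' α'))))
        (ketState 0 0 0 0 0 0 0 0) s‖ ^ 2 := by
  have hm1 : (1 : ℝ) ≤ L.card := Nat.one_le_cast.2 hB.card_pos
  have hm : (0 : ℝ) < L.card := zero_lt_one.trans_le hm1
  have hσ1 := hB.one_le
  have hσ : 0 < σ := zero_lt_one.trans_le hσ1
  have hW := hB.W_pos
  have hW' := hB.W_pos'
  have hp := hB.p_pos
  have hp' := hB.p_pos'
  have hτ1 := one_le_trunc d
  have hτ : 0 < trunc d := zero_lt_one.trans_le hτ1
  set ph₁ := boostPhases k (groverPhases (rounds (maxProb₁ d σ θ α)))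
  set ph₂ := groverPhases (rounds (maxProb₂ d L.card σ θ' α'))
  set W := wedgeRatio d θ α α
  set W' := wedgeRatio d θ' α' α'
  set M := max 1 (L.card * W') with hM
  set μ := min 1 (L.card * W') with hμ
  have hMμ : M * μ = L.card * W' := by rw [hM, hμ, max_mul_min, one_mul]
  have hM0 : 0 < M := lt_max_of_lt_left one_pos
  have hμ0 : 0 < μ := lt_min one_pos (by positivity)
  -- The weights of the good and the remaining outcomes add up to one.
  have hp1 : prob₁ θ α L C ≤ 1 := by
    have h1 := (hR.amp₁_run hB.card_pos []).1
    have : 0 ≤ ∑ t ∈ (samples₁ α L C).filter (fun t => ¬ Marked₁ θ L t), ‖amp₁ α L C t‖ ^ 2 := by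
      positivity
    linarith
  set a := ‖(aaRun (prob₁ θ α L C) ph₁ (1, 1)).1‖ ^ 2 with ha
  have hδ : 1 - prob₁ θ α L C * a ≤ 1 / (2 * σ * (L.card : ℝ) ^ 2) :=
    (hB.first_amp hp1 k).trans hk
  have hδ2 : 1 - prob₁ θ α L C * a ≤ 1 / 2 := hδ.trans (by
    refine one_div_le_one_div_of_le two_pos ?_
    have := one_le_mul_of_one_le_of_one_le hσ1 (one_le_pow₀ (n := 2) hm1)
    linarith)
  -- The failed branch weighs at most μ, so it does not spoil the bound P₃, which is proportional to
  -- μ.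
  have hδμ : 1 - prob₁ θ α L C * a ≤ μ := by
    refine hδ.trans (le_trans ?_ hB.min_ge)
    refine one_div_le_one_div_of_le (by positivity) ?_
    have : 0 < σ * (L.card : ℝ) ^ 2 := by positivity
    linarith
  have hp0 := hB.prob₁_pos
  have ha_low : capP d α / (2 * (σ ^ 3 * W)) ≤ a := by
    have h1 : (1 / 2 : ℝ) ≤ maxProb₁ d σ θ α * a :=
      le_trans (by linarith) (mul_le_mul_of_nonneg_right hB.prob₁_le (by positivity))
    rw [maxProb₁, div_mul_eq_mul_div, le_div_iff₀ hp] at h1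
    rw [div_le_iff₀ (by positivity)]
    linarith
  have ha_up : a ≤ σ ^ 2 * trunc d * capP d α / W := by
    have h1 : prob₁ θ α L C * a ≤ 1 := by
      have h2 := aaRun_norm (prob₁ θ α L C) ph₁
      have h3 := mul_nonneg (sub_nonneg.2 hp1)
        (sq_nonneg ‖(aaRun (prob₁ θ α L C) ph₁ (1, 1)).2‖)
      linarith
    have h4 := (mul_le_mul_of_nonneg_right hB.prob₁_ge (by positivity : 0 ≤ a)).trans h1
    rw [div_mul_eq_mul_div, div_le_one (by positivity)] at h4
    rw [le_div_iff₀ hW]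
    linarith
  obtain ⟨p₃, hp31, hp3, hj⟩ := hR.search_run hB.card_pos ph₁ ph₂
    (groverPhases (rounds (maxProb₃ d L.card σ θ' α')))
  have hp3max : p₃ ≤ maxProb₃ d L.card σ θ' α' := by
    have h1 := hB.sum_amp₃_le hR.tr_subset ph₁
    have h2 : a * max 1 (1 / maxProb₂ d L.card σ θ' α') *
        (σ ^ 4 * W * W' / (capP d α * capP d α')) ≤ σ ^ 10 * trunc d ^ 2 * μ := by
      have hb : 0 < max 1 (1 / maxProb₂ d L.card σ θ' α') := lt_max_of_lt_left one_pos
      calc _ ≤ σ ^ 2 * trunc d * capP d α / W * max 1 (1 / maxProb₂ d L.card σ θ' α') *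
            (σ ^ 4 * W * W' / (capP d α * capP d α')) := by gcongr
        _ = σ ^ 6 * trunc d * (W' / capP d α' * max 1 (1 / maxProb₂ d L.card σ θ' α')) := by
            field_simp
        _ ≤ σ ^ 6 * trunc d * (σ ^ 4 * trunc d * μ) := by
            exact mul_le_mul_of_nonneg_left hB.wedge_ratio_le (by positivity)
        _ = _ := by ring
    have h3 : μ ≤ σ ^ 10 * trunc d ^ 2 * μ := le_mul_of_one_le_left hμ0.le
      (one_le_mul_of_one_le_of_one_le (one_le_pow₀ hσ1) (one_le_pow₀ hτ1))
    have h4 : maxProb₃ d L.card σ θ' α' = 4 * (σ ^ 10 * trunc d ^ 2 * μ) := by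
      rw [maxProb₃]; ring
    rw [h4]
    linarith
  obtain ⟨ht, hτx, hτu⟩ := Finset.mem_filter.1 ht
  obtain ⟨ht, hRx, hRu⟩ := Finset.mem_filter.1 ht
  obtain ⟨ht, hn, hn'⟩ := Finset.mem_filter.1 ht
  obtain ⟨hx, ht⟩ := Finset.mem_product.1 ht
  obtain ⟨hy, hz⟩ := Finset.mem_product.1 ht
  obtain ⟨c, hc, y, hyB, ey⟩ := exists_of_inter_nonempty hy hRx
  obtain ⟨x, hxL, ex⟩ := exists_vecAt hx
  obtain ⟨c', hc', z, hzB, ez⟩ := exists_of_inter_nonempty hz hRu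
  rw [← ex, ← ey] at hn
  rw [← ex] at hc hτx
  rw [← ex, ← ey] at hc' hτu
  rw [← ex, ← ey, ← ez] at hn'
  -- For a triple of 𝒯* the truncation removes nothing.
  have htr : tr (udiff (vecAt L x) (vecAt L y)) = nbrIdx α' C' (udiff (vecAt L x) (vecAt L y)) := by
    refine Finset.eq_of_subset_of_card_le (hR.tr_subset _) ?_
    rw [hR.tr_card]
    refine le_min le_rfl (Nat.le_floor ?_)
    rwa [card_nbrIdx]
  set j : Idx₃ := ⟨⟨x, c, y⟩, c', z⟩ with hj_def
  have ht1 : j.1 ∈ good₁ θ α L C := mem_good₁.2 ⟨hxL, hc, hyB, hn⟩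
  have hjg : j ∈ good₃ θ θ' α α' L C C' tr :=
    mem_good₃.2 ⟨ht1, by rw [diff₁]; simp only [j]; rw [htr]; exact hc', hzB, hn'⟩
  obtain ⟨hj3, hfin⟩ := hj j hjg
  have hb_low := (hB.sq_norm_second_le ht1 hc' hzB hn').2
  have hamp : a * (1 / (L.card * (trunc d * (σ * (L.card * capP d α))))) *
      (1 / trunc d * (1 / (36 * maxProb₂ d L.card σ θ' α') * (1 / (σ * (L.card * capP d α'))))) ≤
      ‖amp₃ θ θ' α α' L C C' tr ph₁ ph₂ j‖ ^ 2 := by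
    rw [sq_norm_amp₃ hjg]
    have h1 := hB.sq_norm_amp₁_ge ht1 hτx
    have h2 : 1 / trunc d ≤ 1 / ((tr (diff₁ L j.1)).card : ℝ) := by
      have h3 : tr (diff₁ L j.1) = nbrIdx α' C' (udiff (vecAt L x) (vecAt L y)) := htr
      rw [h3]
      refine one_div_le_one_div_of_le (Nat.cast_pos.2 (Finset.card_pos.2 ⟨c', hc'⟩)) ?_
      rwa [card_nbrIdx]
    have h3 : 1 / (σ * (L.card * capP d α')) ≤ 1 / ((bucketIdx α' L C' j.2.1).card : ℝ) :=
      one_div_le_one_div_of_le (Nat.cast_pos.2 (Finset.card_pos.2 ⟨z, hzB⟩))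
        (hB.bucketIdx_le' (nbrIdx_lt _ hc'))
    have hP2 := hB.maxProb₂_pos
    have hb0 : 0 ≤ 1 / (σ * (L.card * capP d α')) :=
      one_div_nonneg.2 (mul_nonneg hσ.le (mul_nonneg hm.le hp'.le))
    have hb1 : 0 ≤ 1 / (36 * maxProb₂ d L.card σ θ' α') :=
      one_div_nonneg.2 (mul_nonneg (by norm_num) hP2.le)
    exact mul_le_mul (mul_le_mul_of_nonneg_left h1 (sq_nonneg _))
      (mul_le_mul h2 (mul_le_mul hb_low h3 hb0 (sq_nonneg _)) (mul_nonneg hb1 hb0)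
        (one_div_nonneg.2 (Nat.cast_nonneg _)))
      (mul_nonneg (one_div_nonneg.2 hτ.le) (mul_nonneg hb1 hb0))
      (mul_nonneg (sq_nonneg _) (sq_nonneg _))
  have hP2 := hB.maxProb₂_pos
  have hP3 := hB.maxProb₃_pos
  have hapos : 0 < a := lt_of_lt_of_le (by positivity) ha_low
  have hp30 : 0 < p₃ := lt_of_lt_of_le (by positivity) (hamp.trans hj3)
  refine ⟨ket₃ 1 1 j, ⟨x, hxL, y, bucketIdx_lt _ hyB, z, bucketIdx_lt _ hzB, fun _ => rfl,
    fun _ => rfl, fun _ => rfl, ?_⟩, ?_⟩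
  · rw [ex, ey, ez]
  · rw [hfin, norm_mul, mul_pow]
    have hg3 := grover_rounds hP3 hp30 hp31 hp3max
    calc minProb d L.card σ θ θ' α α' = 1 / (36 * maxProb₃ d L.card σ θ' α') *
          (capP d α / (2 * (σ ^ 3 * W)) * (1 / (L.card * (trunc d * (σ * (L.card * capP d α))))) *
          (1 / trunc d * (1 / (36 * maxProb₂ d L.card σ θ' α') *
            (1 / (σ * (L.card * capP d α')))))) := by
          rw [minProb, maxProb₃, maxProb₂]
          exact minProb_aux hMμ hσ hm hτ hp hp' hW hM0 hμ0
      _ ≤ 1 / (36 * maxProb₃ d L.card σ θ' α') *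
          (a * (1 / (L.card * (trunc d * (σ * (L.card * capP d α))))) *
          (1 / trunc d * (1 / (36 * maxProb₂ d L.card σ θ' α') *
            (1 / (σ * (L.card * capP d α')))))) := by gcongr
      _ ≤ _ := mul_le_mul hg3 hamp (by positivity) (by positivity)

end

/-- A single run misses a given triple with probability at most 1 - pr ≤ e^{-pr}. Independence
multiplies this over the runs, and a union bound runs over the triples. -/
theorem missProb_le {S : Circuit} {mem : Memory} {T : Finset (Vec d × Vec d × Vec d)} {pr : ℝ}
    (h : ∀ t ∈ T, ∃ s : Config, s.Outputs L t ∧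
      pr ≤ ‖Circuit.run mem S (ketState 0 0 0 0 0 0 0 0) s‖ ^ 2) (ℓ : ℕ) :
    missProb S mem L T ℓ ≤ T.card * Real.exp (-(pr * ℓ)) := by
  set ψ := Circuit.run mem S (ketState 0 0 0 0 0 0 0 0) with hψ
  have hn : ∑ s ∈ ψ.support, ‖ψ s‖ ^ 2 = 1 := by
    have : nsq ψ = 1 := by rw [hψ, Circuit.nsq_run, ketState, nsq_single]; simp
    exact this
  have hone : ∀ t ∈ T, (∑ o ∈ Fintype.piFinset (fun _ : Fin ℓ =>
      ψ.support.filter fun s => ¬ s.Outputs L t), ∏ i, ‖ψ (o i)‖ ^ 2) ≤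
      Real.exp (-(pr * ℓ)) := by
    intro t ht
    obtain ⟨s, hs, hpr⟩ := h t ht
    have h1 := Finset.prod_univ_sum (fun _ : Fin ℓ => ψ.support.filter fun s => ¬ s.Outputs L t)
      (fun _ s => ‖ψ s‖ ^ 2)
    rw [← h1, Finset.prod_const, Finset.card_univ, Fintype.card_fin]
    have h2 : ∑ s ∈ ψ.support.filter (fun s => ¬ s.Outputs L t), ‖ψ s‖ ^ 2 ≤ Real.exp (-pr) := by
      have h3 := Finset.sum_filter_add_sum_filter_not ψ.support (fun s => s.Outputs L t)
        (fun s => ‖ψ s‖ ^ 2)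
      have h4 : ‖ψ s‖ ^ 2 ≤ ∑ s ∈ ψ.support.filter (fun s => s.Outputs L t), ‖ψ s‖ ^ 2 := by
        by_cases hs0 : s ∈ ψ.support
        · exact Finset.single_le_sum (f := fun s => ‖ψ s‖ ^ 2) (fun _ _ => by positivity)
            (Finset.mem_filter.2 ⟨hs0, hs⟩)
        · rw [Finsupp.notMem_support_iff.1 hs0]
          simp only [norm_zero, ne_eq, OfNat.ofNat_ne_zero, not_false_eq_true, zero_pow]
          positivity
      have h5 := Real.add_one_le_exp (-pr)
      linarith
    calc _ ≤ Real.exp (-pr) ^ ℓ := pow_le_pow_left₀ (by positivity) h2 ℓ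
      _ = _ := by rw [← Real.exp_nat_mul]; congr 1; ring
  calc missProb S mem L T ℓ ≤ ∑ t ∈ T, ∑ o ∈ Fintype.piFinset (fun _ : Fin ℓ =>
        ψ.support.filter fun s => ¬ s.Outputs L t), ∏ i, ‖ψ (o i)‖ ^ 2 := by
        rw [missProb, runsProb, Finset.sum_filter]
        refine (Finset.sum_le_sum (g := fun o => ∑ t ∈ T,
          if ∀ i, ¬ (o i).Outputs L t then ∏ i, ‖ψ (o i)‖ ^ 2 else 0) fun o _ => ?_).trans ?_
        · have hnn : ∀ t ∈ T, (0 : ℝ) ≤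
              if ∀ i, ¬ (o i).Outputs L t then ∏ i, ‖ψ (o i)‖ ^ 2 else 0 := fun t _ => by
            split_ifs
            · positivity
            · exact le_rfl
          split_ifs with hE
          · obtain ⟨t, ht, hi⟩ := hE
            refine le_trans (le_of_eq ?_) (Finset.single_le_sum hnn ht)
            rw [if_pos hi]
          · exact Finset.sum_nonneg hnn
        · rw [Finset.sum_comm]
          refine Finset.sum_le_sum fun t _ => ?_
          rw [← Finset.sum_filter]
          refine Finset.sum_le_sum_of_subset_of_nonneg (fun o ho => ?_) fun _ _ _ => by positivity
          obtain ⟨ho, hi⟩ := Finset.mem_filter.1 ho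
          exact Fintype.mem_piFinset.2 fun i =>
            Finset.mem_filter.2 ⟨Fintype.mem_piFinset.1 ho i, hi i⟩
    _ ≤ ∑ _t ∈ T, Real.exp (-(pr * ℓ)) := Finset.sum_le_sum hone
    _ = _ := by rw [Finset.sum_const, nsmul_eq_mul]

end

end

section

/-! ## Circuits for all inputs of given sizes, and the cost of the search -/

section
variable {d b N q m n n' : ℕ} {B : ℕ}

theorem norm_udiff_le (x y : Vec d) : ‖udiff x y‖ ≤ 1 := by
  rw [udiff, norm_smul, norm_inv, norm_norm]
  exact inv_mul_le_one

open Classical in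
/-- The elements to which `R'(u)` is truncated. -/
def truncated (α' : ℝ) (G T : ℕ) (P : ProductCode d b N q) (u : Vec d) : Finset ℕ :=
  if ‖u‖ ≤ 1 then least T (P.candidateIdx α' G T u) else least T (nbrIdx α' P.points u)

theorem exists_routine (θ θ' α α' : ℝ) {G Z : ℕ} (hpos : 0 < m) (htol : 0 < tol d)
    (hG : (2 * b : ℝ) < G * tol d)
    (hm : m < 2 ^ B) (hn : n < 2 ^ B) (hd : d ≤ 2 ^ B) (hq : q ≤ 2 ^ B) (hb : b ≤ 2 ^ B)
    (hN : N ≤ 2 ^ B) (hn' : n' < 2 ^ B)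
    (hZ : 2 * G * ⌊trunc d⌋₊ * (N + q + 1) + d + b + 12 * B + 5 ≤ Z) :
    ∃ S : Subroutines, (Circuit.time S.rCollisionSamp ≤ 100000 * Z ^ 8 ∧
      Circuit.time S.rCollisionCheck ≤ 100000 * Z ^ 8 ∧ Circuit.time S.dec ≤ 100000 * Z ^ 8 ∧
      Circuit.time S.zSamp ≤ 100000 * Z ^ 8 ∧ Circuit.time S.zCheck ≤ 100000 * Z ^ 8) ∧
      ∀ I : Inst d b N q m n n', Routine S (I.mem α α') θ θ' α α' I.L I.C I.P.points
        (truncated α' G ⌊trunc d⌋₊ I.P) := by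
  set T := ⌊trunc d⌋₊ with hT
  have hT0 : 0 < T := Nat.floor_pos.2 (one_le_trunc d)
  have hexp : 2 * G * T * (N + q + 1) = 2 * G * T * N + 2 * G * T * q + 2 * G * T := by ring
  have hslot : Fintype.card (Slot G T) = 2 * G * T := by simp [Slot]; ring
  obtain ⟨D₁, a1, a2⟩ := exists_rCollisionSamp (d := d) (b := b) (N := N) (q := q) (n' := n')
    α α' hpos hm hn
  obtain ⟨D₂, b1, b2⟩ := exists_rCollisionCheck (b := b) (N := N) (q := q) (n := n) (n' := n')
    α α' hm hd θ
  obtain ⟨D₃, c1, c2, c3⟩ := exists_dec (n := n) (G := G) (T := T) (Z := Z) α α' hm hd hq hb hN hn'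
    (by rw [Fintype.card_prod, hslot, Fintype.card_fin]; omega)
    (by rw [Fintype.card_prod, hslot, Fintype.card_fin, mul_comm]; omega)
    (by rw [hslot]; omega) (by omega) (by omega) (by omega)
  obtain ⟨D₄, d1, d2, d3⟩ := exists_zSamp (d := d) (b := b) (N := N) (q := q) (n := n) α α' hm hn'
  obtain ⟨D₅, e1, e2, e3⟩ := exists_zCheck (b := b) (N := N) (q := q) (n := n) (n' := n')
    α α' hm hd θ'
  have hBZ : B + 1 ≤ Z := by omega
  have hdZ : d + 1 ≤ Z := by omega
  have hZ1 : 1 ≤ Z := by omega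
  have h4 : (B + 1) ^ 4 ≤ Z ^ 8 :=
    (Nat.pow_le_pow_left hBZ 4).trans (Nat.pow_le_pow_right hZ1 (by norm_num))
  have h2 : (d + 1) * (B + 1) ≤ Z ^ 8 :=
    (Nat.mul_le_mul hdZ hBZ).trans (by
      rw [← pow_two]; exact Nat.pow_le_pow_right hZ1 (by norm_num))
  refine ⟨⟨D₁, D₂, D₃, D₄, D₅⟩, ⟨a1.trans (by omega), b1.trans ?_, c1.trans (by omega),
    d1.trans (by omega), e1.trans ?_⟩, ?_⟩
  · rw [mul_assoc]; omega
  · rw [mul_assoc]; omega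
  intro I
  have a2 := a2 I
  have b2 := b2 I
  have c3 := c3 I
  have d3 := d3 I
  have e3 := e3 I
  obtain ⟨L, C, P, hL, hC, hP⟩ := I
  subst hL hC hP
  refine ⟨?_, ?_, a2, ?_, ?_, ?_, ?_, c2, d2, e2⟩
  · intro u
    rw [truncated]
    split_ifs
    · exact (Finset.filter_subset _ _).trans P.candidateIdx_subset
    · exact Finset.filter_subset _ _
  · intro u
    rw [truncated]
    split_ifs with hu
    · exact P.card_least_candidateIdx hu htol hG hT0
    -- For vectors outside the unit ball, where decoding is not guaranteed to be complete, the
    -- truncated set is defined abstractly; no circuit is ever run on such a vector.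
    · rw [card_least, min_comm]
  · intro x hx c _ y hy f₁ hf₁
    exact (b2 x c y f₁ hx hy hf₁).trans (by unfold ketState; congr!)
  · intro x hx c _ y hy f₁ _
    -- Normalized differences have norm 0 or 1, so the decoding branch applies.
    rw [truncated, if_pos (norm_udiff_le _ _)]
    exact c3 x c y f₁ hx hy
  · intro x _ c _ y _ c' hc' f₁ _
    exact d3 x c y c' f₁ hc'
  · intro x hx c _ y hy c' _ z hz f₁ _ f₂ hf₂
    exact (e3 x c y c' z f₁ f₂ hx hy hz hf₂).trans (by unfold ketState; congr!)

end

theorem Circuit.queries_le_time (S : Circuit) : S.queries ≤ S.time := by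
  induction S with
  | nil => simp [Circuit.queries, Circuit.time]
  | cons g S ih =>
    rw [Circuit.queries, List.countP_cons, Circuit.time, List.map_cons, List.sum_cons]
    have : (if g.isQuery = true then 1 else 0) ≤ g.cost := by
      split_ifs
      · cases g <;> (simp [Gate.cost]; try omega)
      · exact Nat.zero_le _
    have := Nat.add_le_add ih this
    rw [Circuit.queries, Circuit.time] at this
    omega

theorem Gate.card_wires_le (g : Gate) : g.qubits.card + g.reals.card ≤ 3 * g.cost := by
  cases g with
  | toffoli a b t _ _ => simpa [Gate.qubits, Gate.reals, Gate.cost] using Finset.card_le_three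
  | cnot a t _ =>
    have := Finset.card_le_two (a := a) (b := t)
    simp only [Gate.qubits, Gate.reals, Gate.cost, Finset.card_empty]; omega
  | arith _ _ i j k _ _ =>
    have := Finset.card_le_three (a := i) (b := j) (c := k)
    simp only [Gate.qubits, Gate.reals, Gate.cost, Finset.card_empty]; omega
  | compare i j t =>
    have := Finset.card_le_two (a := i) (b := j)
    simp only [Gate.qubits, Gate.reals, Gate.cost, Finset.card_singleton]; omega
  | queryBit A a₁ a₂ a₃ t _ =>
    have h1 := Finset.card_insert_le t (a₁ ++ a₂ ++ a₃).toFinset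
    have h2 := List.toFinset_card_le (a₁ ++ a₂ ++ a₃)
    simp only [Gate.qubits, Gate.reals, Gate.cost, Finset.card_empty]; omega
  | queryReal _ A a₁ a₂ a₃ k =>
    have h2 := List.toFinset_card_le (a₁ ++ a₂ ++ a₃)
    simp only [Gate.qubits, Gate.reals, Gate.cost, Finset.card_singleton]; omega
  | zeroPhase _ Q S => simp only [Gate.qubits, Gate.reals, Gate.cost]; omega
  | _ => simp [Gate.qubits, Gate.reals, Gate.cost]

/-- A gate touches at most three wires per unit of cost. In particular the reflection, which tests
all wires of the sampler, costs at most a constant times the sampler. -/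
theorem Circuit.width_le (S : Circuit) : S.width ≤ 3 * S.time := by
  induction S with
  | nil => simp [Circuit.width, Circuit.qubits, Circuit.reals]
  | cons g S ih =>
    rw [Circuit.width, Circuit.qubits_cons, Circuit.reals_cons, Circuit.time, List.map_cons,
      List.sum_cons]
    have h1 := Finset.card_union_le g.qubits (Circuit.qubits S)
    have h2 := Finset.card_union_le g.reals (Circuit.reals S)
    have h3 := g.card_wires_le
    rw [Circuit.width, Circuit.time] at ih
    omega

/-- All wires of the circuit lie in the given sets. -/
def Circuit.Uses (Q : Finset QWire) (R : Finset ℕ) (S : Circuit) : Prop :=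
  ∀ g ∈ S, g.qubits ⊆ Q ∧ g.reals ⊆ R

section
variable {Q : Finset QWire} {R : Finset ℕ} {S T : Circuit}

theorem Circuit.Uses.append (hS : Circuit.Uses Q R S) (hT : Circuit.Uses Q R T) :
    Circuit.Uses Q R (S ++ T) := fun g hg => (List.mem_append.1 hg).elim (hS g) (hT g)

theorem Circuit.Uses.inverse (hS : Circuit.Uses Q R S) : Circuit.Uses Q R (Circuit.inverse S) := by
  intro g hg
  obtain ⟨g', hg', rfl⟩ := List.mem_map.1 (List.mem_reverse.1 hg)
  rw [Gate.qubits_inverse, Gate.reals_inverse]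
  exact hS g' hg'

theorem Circuit.Uses.qubits_subset (hS : Circuit.Uses Q R S) : Circuit.qubits S ⊆ Q := fun w hw => by
  obtain ⟨g, hg, hw⟩ := Circuit.mem_qubits.1 hw
  exact (hS g hg).1 hw

theorem Circuit.Uses.reals_subset (hS : Circuit.Uses Q R S) : Circuit.reals S ⊆ R := fun w hw => by
  obtain ⟨g, hg, hw⟩ := Circuit.mem_reals.1 hw
  exact (hS g hg).2 hw

theorem Circuit.uses_of_subset (hQ : Circuit.qubits S ⊆ Q) (hR : Circuit.reals S ⊆ R) :
    Circuit.Uses Q R S := fun g hg =>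
  ⟨fun _ hw => hQ (Circuit.mem_qubits.2 ⟨g, hg, hw⟩), fun _ hw => hR (Circuit.mem_reals.2 ⟨g, hg, hw⟩)⟩

theorem Circuit.Uses.ampAmp (hS : Circuit.Uses Q R S) (hT : Circuit.Uses Q R T) {flag : QWire}
    (hf : flag ∈ Q) (ctrl : Finset Reg) (ph : List (ℝ × ℝ)) :
    Circuit.Uses Q R (ampAmp S T flag ctrl ph) := by
  refine (hS.append fun g hg => ?_).append hT
  obtain ⟨p, -, hg⟩ := List.mem_flatMap.1 hg
  have h1 : Circuit.Uses Q R [Gate.phase p.1 flag] := fun g hg => by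
    rw [List.mem_singleton.1 hg]
    exact ⟨Finset.singleton_subset_iff.2 hf, Finset.empty_subset _⟩
  have h2 : Circuit.Uses Q R [Gate.zeroPhase p.2 ((Circuit.qubits S).filter fun w => w.1 ∉ ctrl)
      (Circuit.reals S)] := fun g hg => by
    rw [List.mem_singleton.1 hg]
    exact ⟨(Finset.filter_subset _ _).trans hS.qubits_subset, hS.reals_subset⟩
  exact (((((hT.append h1).append hT.inverse).append hS.inverse).append h2).append hS) g hg

end

/-- A round contains the sampler twice and a reflection costing at most three times its time plus
one, and the check twice with a phase gate in between. -/
theorem time_ampAmp_le (S T : Circuit) (flag : QWire) (ctrl : Finset Reg) (ph : List (ℝ × ℝ)) :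
    Circuit.time (ampAmp S T flag ctrl ph) ≤
      (ph.length + 1) * (5 * Circuit.time S + 2 * Circuit.time T + 2) := by
  have h : Circuit.time (ph.flatMap fun p =>
      T ++ [Gate.phase p.1 flag] ++ Circuit.inverse T ++ Circuit.inverse S ++
      [Gate.zeroPhase p.2 ((Circuit.qubits S).filter fun w => w.1 ∉ ctrl) (Circuit.reals S)] ++ S) ≤
      ph.length * (5 * Circuit.time S + 2 * Circuit.time T + 2) := by
    induction ph with
    | nil => simp [Circuit.time]
    | cons p ph ih =>
      rw [List.flatMap_cons, Circuit.time_append, List.length_cons]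
      have h1 := Circuit.width_le S
      have h2 := Finset.card_filter_le (Circuit.qubits S) (fun w => w.1 ∉ ctrl)
      rw [Circuit.width] at h1
      have h3 : Circuit.time (T ++ [Gate.phase p.1 flag] ++ Circuit.inverse T ++
          Circuit.inverse S ++ [Gate.zeroPhase p.2 ((Circuit.qubits S).filter fun w => w.1 ∉ ctrl)
          (Circuit.reals S)] ++ S) ≤ 5 * Circuit.time S + 2 * Circuit.time T + 2 := by
        simp only [Circuit.time_append, Circuit.time_inverse]
        have e1 : Circuit.time [Gate.phase p.1 flag] = 1 := rfl
        have e2 : Circuit.time [Gate.zeroPhase p.2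
            ((Circuit.qubits S).filter fun w => w.1 ∉ ctrl) (Circuit.reals S)] =
            1 + ((Circuit.qubits S).filter fun w => w.1 ∉ ctrl).card + (Circuit.reals S).card := rfl
        rw [e1, e2]
        omega
      linarith [Nat.add_le_add h3 ih]
  rw [ampAmp, Circuit.time_append, Circuit.time_append]
  linarith

section
variable {A : Subroutines} {t : ℕ} (h₀ : 1 ≤ t) (h₁ : Circuit.time A.rCollisionSamp ≤ t)
  (h₂ : Circuit.time A.rCollisionCheck ≤ t) (h₃ : Circuit.time A.dec ≤ t)
  (h₄ : Circuit.time A.zSamp ≤ t) (h₅ : Circuit.time A.zCheck ≤ t)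
include h₀ h₁ h₂ h₃ h₄ h₅

theorem time_solutionSearch_le (ph₁ ph₂ ph₃ : List (ℝ × ℝ)) :
    Circuit.time (solutionSearch A ph₁ ph₂ ph₃) ≤
      54 * t * ((ph₃.length + 1) * ((ph₁.length + 1) + (ph₂.length + 1))) := by
  have k1 := time_ampAmp_le A.rCollisionSamp A.rCollisionCheck (.flag₁, 0) ∅ ph₁
  have k2 := time_ampAmp_le A.zSamp A.zCheck (.flag₂, 0) {.x, .c, .y, .c'} ph₂
  have k3 := time_ampAmp_le (tupleSamp A ph₁ ph₂) [Gate.cnot (.flag₂, 0) (.flag₃, 0) (by decide)]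
    (.flag₃, 0) ∅ ph₃
  have e : Circuit.time [Gate.cnot (.flag₂, 0) (.flag₃, 0) (by decide)] = 1 := rfl
  rw [e] at k3
  set l₁ := ph₁.length + 1
  set l₂ := ph₂.length + 1
  set l₃ := ph₃.length + 1
  have hl : 2 ≤ l₁ + l₂ := by omega
  have k1' : l₁ * (5 * Circuit.time A.rCollisionSamp + 2 * Circuit.time A.rCollisionCheck + 2) ≤
      l₁ * (9 * t) := Nat.mul_le_mul_left _ (by omega)
  have k2' : l₂ * (5 * Circuit.time A.zSamp + 2 * Circuit.time A.zCheck + 2) ≤ l₂ * (9 * t) :=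
    Nat.mul_le_mul_left _ (by omega)
  have k4 : Circuit.time (tupleSamp A ph₁ ph₂) ≤ 10 * (t * (l₁ + l₂)) := by
    rw [tupleSamp, Circuit.time_append, Circuit.time_append]
    nlinarith
  have k5 : 1 * 2 ≤ t * (l₁ + l₂) := Nat.mul_le_mul h₀ hl
  refine k3.trans ?_
  calc l₃ * (5 * Circuit.time (tupleSamp A ph₁ ph₂) + 2 * 1 + 2) ≤ l₃ * (54 * (t * (l₁ + l₂))) :=
        Nat.mul_le_mul_left _ (by omega)
    _ = _ := by ring

/-- All rounds at all levels act on the wires of the five subroutines and the three flags, so the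
width is independent of the numbers of rounds. -/
theorem width_solutionSearch_le (ph₁ ph₂ ph₃ : List (ℝ × ℝ)) :
    Circuit.width (solutionSearch A ph₁ ph₂ ph₃) ≤ 18 * t := by
  set D : Circuit := A.rCollisionSamp ++ A.rCollisionCheck ++ A.dec ++ A.zSamp ++ A.zCheck with hD
  set Q : Finset QWire := Circuit.qubits D ∪ {(.flag₁, 0), (.flag₂, 0), (.flag₃, 0)}
  have hu : Circuit.Uses Q (Circuit.reals D) D :=
    Circuit.uses_of_subset Finset.subset_union_left subset_rfl
  have hsub : ∀ {E : Circuit}, E ⊆ D → Circuit.Uses Q (Circuit.reals D) E :=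
    fun hE g hg => hu g (hE hg)
  have hf : ∀ w ∈ ({(.flag₁, 0), (.flag₂, 0), (.flag₃, 0)} : Finset QWire), w ∈ Q :=
    fun w hw => Finset.mem_union_right _ hw
  have hall : Circuit.Uses Q (Circuit.reals D) (solutionSearch A ph₁ ph₂ ph₃) := by
    refine Circuit.Uses.ampAmp (((Circuit.Uses.ampAmp (hsub ?_) (hsub ?_) (hf _ (by simp)) _ _).append
      (hsub ?_)).append (Circuit.Uses.ampAmp (hsub ?_) (hsub ?_) (hf _ (by simp)) _ _)) ?_
      (hf _ (by simp)) _ _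
    · intro g hg; simp [hD, hg]
    · intro g hg; simp [hD, hg]
    · intro g hg; simp [hD, hg]
    · intro g hg; simp [hD, hg]
    · intro g hg; simp [hD, hg]
    · intro g hg
      rw [List.mem_singleton.1 hg]
      refine ⟨fun w hw => hf w ?_, Finset.empty_subset _⟩
      simp only [Gate.qubits, Finset.mem_insert, Finset.mem_singleton] at hw ⊢
      tauto
  have h1 := Finset.card_le_card hall.qubits_subset
  have h2 := Finset.card_le_card hall.reals_subset
  have h3 : Q.card ≤ (Circuit.qubits D).card + 3 :=
    (Finset.card_union_le _ _).trans (Nat.add_le_add_left Finset.card_le_three _)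
  have h4 := Circuit.width_le D
  have h5 : Circuit.time D ≤ 5 * t := by
    simp only [hD, Circuit.time_append]; omega
  rw [Circuit.width] at h4 ⊢
  omega

end

section
variable {d : ℕ} {σ θ θ' α α' : ℝ} {L C C' : Finset (Vec d)}

/-- The three levels need about √(p/W), √(mp') and 1/√μ rounds, μ being the minimum of 1 and mW',
since the bounds P₁, P₂, P₃ on the success probabilities are at least W/p, 1/(mp') and μ. The first
two numbers add and the third multiplies. A level without rounds still costs one run; this is
absorbed by σ√(mp') ≥ 1. -/
theorem Balanced.rounds_cost (hB : Balanced σ θ θ' α α' L C C') (k : ℕ) :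
    (((groverPhases (rounds (maxProb₃ d L.card σ θ' α'))).length + 1 : ℕ) : ℝ) *
      ((((boostPhases k (groverPhases (rounds (maxProb₁ d σ θ α)))).length + 1 : ℕ) : ℝ) +
        (((groverPhases (rounds (maxProb₂ d L.card σ θ' α'))).length + 1 : ℕ) : ℝ)) ≤
      2 * 4 ^ k * σ * searchCost d L.card θ θ' α α' := by
  have hm1 : (1 : ℝ) ≤ L.card := Nat.one_le_cast.2 hB.card_pos
  have hm : (0 : ℝ) < L.card := zero_lt_one.trans_le hm1
  have hσ1 := hB.one_le
  have hσ : 0 < σ := zero_lt_one.trans_le hσ1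
  have hW := hB.W_pos
  have hW' := hB.W_pos'
  have hp := hB.p_pos
  have hp' := hB.p_pos'
  have hτ1 := one_le_trunc d
  set W := wedgeRatio d θ α α
  set W' := wedgeRatio d θ' α' α'
  set μ := min 1 (L.card * W') with hμ
  have hμ0 : 0 < μ := lt_min one_pos (mul_pos hm hW')
  have hμ1 : μ ≤ 1 := min_le_left _ _
  have hone : 1 ≤ σ * Real.sqrt (L.card * capP d α') := by
    have h1 : 1 ≤ Real.sqrt (σ * (L.card * capP d α')) := Real.one_le_sqrt.2 hB.one_le_cap'
    rw [Real.sqrt_mul hσ.le] at h1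
    refine h1.trans (mul_le_mul_of_nonneg_right ?_ (Real.sqrt_nonneg _))
    exact Real.sqrt_le_iff.2 ⟨hσ.le, by nlinarith⟩
  have hlen : ∀ P : ℝ, 0 < P → (((groverPhases (rounds P)).length + 1 : ℕ) : ℝ) ≤
      max 1 (1 / Real.sqrt P) := fun P hP => by
    refine le_trans ?_ (rounds_upper hP)
    rw [groverPhases, List.length_replicate]
    push_cast
    linarith [Nat.cast_nonneg (α := ℝ) (rounds P)]
  have h3 : max 1 (1 / Real.sqrt (maxProb₃ d L.card σ θ' α')) ≤ 1 / Real.sqrt μ := by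
    have hs := Real.sqrt_pos.2 hμ0
    refine max_le ?_ (one_div_le_one_div_of_le hs (Real.sqrt_le_sqrt ?_))
    · rw [le_div_iff₀ hs, one_mul]; exact Real.sqrt_le_one.2 hμ1
    · rw [maxProb₃, ← hμ]
      refine le_mul_of_one_le_left hμ0.le ?_
      have := one_le_mul_of_one_le_of_one_le (one_le_pow₀ (n := 10) hσ1) (one_le_pow₀ (n := 2) hτ1)
      linarith
  have h2 : max 1 (1 / Real.sqrt (maxProb₂ d L.card σ θ' α')) ≤
      σ * Real.sqrt (L.card * capP d α') := by
    refine max_le hone ?_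
    rw [← Real.sqrt_one, ← Real.sqrt_div zero_le_one]
    refine (Real.sqrt_le_sqrt (y := L.card * capP d α') ?_).trans
      (le_mul_of_one_le_left (Real.sqrt_nonneg _) hσ1)
    rw [maxProb₂, one_div_div]
    refine div_le_self (mul_pos hm hp').le ?_
    exact one_le_mul_of_one_le_of_one_le (one_le_pow₀ hσ1) (le_max_left _ _)
  have h1 : max 1 (1 / Real.sqrt (maxProb₁ d σ θ α)) ≤
      σ * (Real.sqrt (capP d α / W) + Real.sqrt (L.card * capP d α')) := by
    rw [mul_add]
    refine max_le (hone.trans (le_add_of_nonneg_left (mul_nonneg hσ.le (Real.sqrt_nonneg _))))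
      (le_add_of_le_of_nonneg ?_ (mul_nonneg hσ.le (Real.sqrt_nonneg _)))
    rw [← Real.sqrt_one, ← Real.sqrt_div zero_le_one]
    refine (Real.sqrt_le_sqrt (y := capP d α / W) ?_).trans
      (le_mul_of_one_le_left (Real.sqrt_nonneg _) hσ1)
    rw [maxProb₁, one_div_div]
    exact div_le_div_of_nonneg_left hp.le hW (le_mul_of_one_le_left hW.le (one_le_pow₀ hσ1))
  have k1 : (((boostPhases k (groverPhases (rounds (maxProb₁ d σ θ α)))).length + 1 : ℕ) : ℝ) ≤
      4 ^ k * (σ * (Real.sqrt (capP d α / W) + Real.sqrt (L.card * capP d α'))) := by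
    refine (Nat.cast_le.2 (boostPhases_length k _)).trans ?_
    rw [Nat.cast_mul, Nat.cast_pow]
    exact mul_le_mul_of_nonneg_left ((hlen _ hB.maxProb₁_pos).trans h1) (by positivity)
  have k2 := (hlen _ hB.maxProb₂_pos).trans h2
  have k3 := (hlen _ hB.maxProb₃_pos).trans h3
  have h4k : (1 : ℝ) ≤ 4 ^ k := one_le_pow₀ (by norm_num)
  set X := Real.sqrt (capP d α / W) + Real.sqrt (L.card * capP d α') with hX
  have hX0 : 0 ≤ X := by positivity
  have k2' : σ * Real.sqrt (L.card * capP d α') ≤ 4 ^ k * (σ * X) := by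
    refine le_trans ?_ (le_mul_of_one_le_left (mul_nonneg hσ.le hX0) h4k)
    exact mul_le_mul_of_nonneg_left (le_add_of_nonneg_left (Real.sqrt_nonneg _)) hσ.le
  calc _ ≤ 1 / Real.sqrt μ * (4 ^ k * (σ * X) + 4 ^ k * (σ * X)) :=
        mul_le_mul k3 (add_le_add k1 (k2.trans k2')) (by positivity) (by positivity)
    _ = _ := by rw [searchCost, ← hX, ← hμ]; ring

end

end

section

/-! ## Subexponential functions -/

open Filter

/-- `f d = 2^(o(d))`. -/
def SubExp (f : ℕ → ℝ) : Prop := ∀ ε : ℝ, 0 < ε → ∀ᶠ d : ℕ in atTop, |f d| ≤ (2 : ℝ) ^ (ε * d)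

theorem SubExp.mono {f g : ℕ → ℝ} (hg : SubExp g) (h : ∀ᶠ d in atTop, |f d| ≤ |g d|) : SubExp f :=
  fun ε hε => by
    filter_upwards [hg ε hε, h] with d h1 h2
    exact h2.trans h1

theorem SubExp.mul {f g : ℕ → ℝ} (hf : SubExp f) (hg : SubExp g) : SubExp fun d => f d * g d :=
  fun ε hε => by
    filter_upwards [hf (ε / 2) (half_pos hε), hg (ε / 2) (half_pos hε)] with d h1 h2
    rw [abs_mul, show ε * (d : ℝ) = ε / 2 * d + ε / 2 * d by ring,
      Real.rpow_add (by norm_num)]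
    exact mul_le_mul h1 h2 (abs_nonneg _) (by positivity)

theorem subExp_rpow {h : ℕ → ℝ} (hh : h =o[atTop] fun d : ℕ => (d : ℝ)) :
    SubExp fun d => (2 : ℝ) ^ h d := fun ε hε => by
  filter_upwards [hh.def hε] with d hd
  rw [abs_of_pos (by positivity)]
  refine Real.rpow_le_rpow_of_exponent_le (by norm_num) ((le_abs_self _).trans ?_)
  simpa using hd

theorem subExp_natCast : SubExp fun d => (d : ℝ) := fun ε hε => by
  have h := tendsto_pow_const_div_const_pow_of_one_lt 1
    (Real.one_lt_rpow (by norm_num : (1 : ℝ) < 2) hε)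
  filter_upwards [h.eventually (ge_mem_nhds one_pos)] with d hd
  rw [div_le_one (by positivity), pow_one, ← Real.rpow_mul_natCast (by norm_num)] at hd
  rwa [Nat.abs_cast]

theorem subExp_const (c : ℝ) : SubExp fun _ => c := by
  refine subExp_natCast.mono ?_
  filter_upwards [eventually_ge_atTop ⌈|c|⌉₊] with d hd
  rw [Nat.abs_cast]
  exact Nat.ceil_le.1 hd

theorem SubExp.add {f g : ℕ → ℝ} (hf : SubExp f) (hg : SubExp g) : SubExp fun d => f d + g d := by
  intro ε hε
  filter_upwards [hf (ε / 2) (half_pos hε), hg (ε / 2) (half_pos hε),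
    subExp_const 2 (ε / 2) (half_pos hε)] with d h1 h2 h3
  rw [show ε * (d : ℝ) = ε / 2 * d + ε / 2 * d by ring, Real.rpow_add (by norm_num)]
  rw [abs_of_pos two_pos] at h3
  have h4 := mul_le_mul_of_nonneg_right h3
    (by positivity : (0 : ℝ) ≤ (2 : ℝ) ^ (ε / 2 * (d : ℝ)))
  linarith [abs_add_le (f d) (g d)]

theorem SubExp.pow {f : ℕ → ℝ} (hf : SubExp f) (k : ℕ) : SubExp fun d => f d ^ k := by
  induction k with
  | zero => simpa using subExp_const 1
  | succ k ih => simpa only [pow_succ] using ih.mul hf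

/-- Converts a subexponential factor into an exponent o(d), the form required by the conclusion. -/
theorem SubExp.logb {f : ℕ → ℝ} (hf : SubExp f) (h1 : ∀ d, 1 ≤ f d) :
    (fun d => Real.logb 2 (f d)) =o[atTop] fun d : ℕ => (d : ℝ) := by
  refine Asymptotics.IsLittleO.of_bound fun ε hε => ?_
  filter_upwards [hf ε hε] with d hd
  rw [Real.norm_of_nonneg (Real.logb_nonneg (by norm_num) (h1 d)), Real.norm_natCast,
    Real.logb_le_iff_le_rpow (by norm_num) (zero_lt_one.trans_le (h1 d))]
  exact (le_abs_self _).trans hd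

theorem div_isLittleO {f : ℕ → ℝ} (hf : Tendsto f atTop atTop) (c : ℝ) :
    (fun d : ℕ => c * (d / f d)) =o[atTop] fun d : ℕ => (d : ℝ) := by
  refine Asymptotics.IsLittleO.of_bound fun ε hε => ?_
  filter_upwards [hf.eventually_ge_atTop (|c| / ε), hf.eventually_gt_atTop 0] with d h1 h2
  rw [Real.norm_natCast, Real.norm_eq_abs, abs_mul, abs_div, Nat.abs_cast, abs_of_pos h2,
    mul_div_assoc', div_le_iff₀ h2]
  rw [div_le_iff₀ hε] at h1
  nlinarith [Nat.cast_nonneg (α := ℝ) d]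

theorem subExp_trunc : SubExp trunc := by
  have h := div_isLittleO (f := fun d : ℕ => Real.logb 2 d)
    ((Real.tendsto_logb_atTop (by norm_num)).comp tendsto_natCast_atTop_atTop) 1
  exact subExp_rpow (by simpa using h)

theorem tendsto_numBlocks : Tendsto (fun d => (numBlocks d : ℝ)) atTop atTop :=
  tendsto_natCast_atTop_atTop.comp (tendsto_atTop.2 fun b => by
    filter_upwards [eventually_ge_atTop (2 ^ b)] with d hd
    exact Nat.le_log_of_pow_le (by norm_num) hd)

/-- An upper bound on the number of codewords per block. -/
def wordsBound (κ : ℝ) (d : ℕ) : ℝ :=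
  (2 : ℝ) ^ (Real.logb 2 (1 / Real.sin κ) * (d / numBlocks d)) + 1

theorem subExp_wordsBound (κ : ℝ) : SubExp (wordsBound κ) :=
  (subExp_rpow (div_isLittleO tendsto_numBlocks _)).add (subExp_const 1)

theorem sin_le_sin_of_mem {κ α : ℝ} (hκ : 0 < κ) (hα : α ∈ Set.Icc κ (Real.pi / 2 - κ)) :
    0 < Real.sin κ ∧ Real.sin κ ≤ Real.sin α := by
  have := Real.pi_pos
  refine ⟨Real.sin_pos_of_pos_of_lt_pi hκ (by linarith [hα.1, hα.2]),
    Real.sin_le_sin_of_le_of_le_pi_div_two (by linarith) (by linarith [hα.2]) hα.1⟩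

theorem capP_eq {κ α : ℝ} (d : ℕ) (hκ : 0 < κ) (hα : α ∈ Set.Icc κ (Real.pi / 2 - κ)) :
    capP d α = Real.sin α ^ (d : ℝ) := by
  obtain ⟨h1, h2⟩ := sin_le_sin_of_mem hκ hα
  rw [capP, ← Real.sin_sq, ← Real.rpow_natCast, ← Real.rpow_mul (h1.le.trans h2)]
  congr 1
  push_cast; ring

/-- A code of size 1/p = (1/sin α)^d is split over about log d blocks, so a block has roughly (1/sin
α)^(d/log d) words, which is subexponential uniformly for α ≥ κ. -/
theorem wordsPerBlock_le {κ α : ℝ} (d : ℕ) (hκ : 0 < κ) (hα : α ∈ Set.Icc κ (Real.pi / 2 - κ)) :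
    (wordsPerBlock d α : ℝ) ≤ wordsBound κ d := by
  obtain ⟨h1, h2⟩ := sin_le_sin_of_mem hκ hα
  have h3 := h1.trans_le h2
  have e1 : 1 / Real.sin α ^ (d : ℝ) = (1 / Real.sin α) ^ (d : ℝ) := by
    rw [Real.div_rpow zero_le_one h3.le, Real.one_rpow]
  have e2 : (2 : ℝ) ^ (Real.logb 2 (1 / Real.sin κ) * (d / numBlocks d)) =
      (1 / Real.sin κ) ^ ((d : ℝ) / numBlocks d) := by
    rw [Real.rpow_mul (by norm_num), Real.rpow_logb (by norm_num) (by norm_num) (by positivity)]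
  rw [wordsPerBlock, capP_eq d hκ hα, e1, wordsBound, e2, ← Real.rpow_mul (by positivity),
    mul_one_div]
  refine (Nat.ceil_lt_add_one (by positivity)).le.trans (add_le_add_left ?_ 1)
  exact Real.rpow_le_rpow (by positivity) (one_div_le_one_div_of_le h1 h2) (by positivity)

theorem card_points_le {d b N q : ℕ} (P : ProductCode d b N q) : P.points.card ≤ q * N ^ b := by
  refine Finset.card_image_le.trans_eq ?_
  simp

end

section

/-! ## The subexponential factor -/

/-- An upper bound on the running time of the subroutines. -/
def opBound (κ A s : ℝ) (d : ℕ) : ℝ :=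
  100000 * (2 * (2 * d ^ 3 + 1) * trunc d * (wordsBound κ d + 2 ^ |s| + 1) + 2 * d +
    12 * (|A| * d + 3 * d + wordsBound κ d * d + wordsBound κ d + 2) + 5) ^ 8

/-- A bound on the logarithm of the inverse of the error at the first level. -/
def errBound (A : ℝ) (d : ℕ) : ℝ := d + 2 * |A| * d + 1

/-- A bound on the number of boosting rounds. -/
def boostBound (A s : ℝ) (d : ℕ) : ℝ := 36 * ((2 : ℝ) ^ |s|) ^ 5 * trunc d * errBound A d

/-- The ratio of the number of runs and the number of triples. -/
def runsBound (A s : ℝ) (d : ℕ) : ℝ :=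
  10368 * ((2 : ℝ) ^ |s|) ^ 17 * trunc d ^ 4 * (d ^ 2 + 3 * |A| * d + 1)

/-- The subexponential factor in the cost of the search. -/
def costFactor (κ A s : ℝ) (d : ℕ) : ℝ :=
  2 * runsBound A s d + 108 * opBound κ A s d * (36 * boostBound A s d ^ 2) * 2 ^ |s| +
    18 * opBound κ A s d + 1

theorem subExp_costFactor (κ A : ℝ) {slack : ℕ → ℝ}
    (hslack : slack =o[Filter.atTop] (fun d : ℕ => (d : ℝ))) :
    SubExp fun d => costFactor κ A (slack d) d := by
  have hσ : SubExp fun d => (2 : ℝ) ^ |slack d| := subExp_rpow (by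
    simpa only [← Real.norm_eq_abs] using hslack.norm_left)
  have hd := subExp_natCast
  have hτ := subExp_trunc
  have hw := subExp_wordsBound κ
  have hA := subExp_const |A|
  have c := subExp_const
  have hop : SubExp fun d => opBound κ A (slack d) d :=
    (c 100000).mul (((((((c 2).mul (((c 2).mul (hd.pow 3)).add (c 1))).mul hτ).mul
      ((hw.add hσ).add (c 1))).add ((c 2).mul hd)).add ((c 12).mul (((((hA.mul hd).add
      ((c 3).mul hd)).add (hw.mul hd)).add hw).add (c 2)))).add (c 5) |>.pow 8)
  have herr : SubExp fun d => errBound A d := (hd.add (((c 2).mul hA).mul hd)).add (c 1)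
  have hboost : SubExp fun d => boostBound A (slack d) d :=
    (((c 36).mul (hσ.pow 5)).mul hτ).mul herr
  have hruns : SubExp fun d => runsBound A (slack d) d :=
    (((c 10368).mul (hσ.pow 17)).mul (hτ.pow 4)).mul
      (((hd.pow 2).add (((c 3).mul hA).mul hd)).add (c 1))
  exact ((((c 2).mul hruns).add ((((c 108).mul hop).mul ((c 36).mul (hboost.pow 2))).mul hσ)).add
    ((c 18).mul hop)).add (c 1)

theorem opBound_nonneg (κ A s : ℝ) (d : ℕ) : 0 ≤ opBound κ A s d := by unfold opBound; positivity

theorem one_le_runsBound (A s : ℝ) (d : ℕ) : 1 ≤ runsBound A s d := by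
  have h1 : (1 : ℝ) ≤ 2 ^ |s| := Real.one_le_rpow (by norm_num) (abs_nonneg s)
  have h2 := one_le_mul_of_one_le_of_one_le
    (one_le_mul_of_one_le_of_one_le (one_le_pow₀ (n := 17) h1)
      (one_le_pow₀ (n := 4) (one_le_trunc d)))
    (le_add_of_nonneg_left (by positivity) : (1 : ℝ) ≤ (d ^ 2 + 3 * |A| * d) + 1)
  rw [runsBound]
  linarith

theorem one_le_costFactor (κ A s : ℝ) (d : ℕ) : 1 ≤ costFactor κ A s d := by
  have := opBound_nonneg κ A s d
  have := one_le_runsBound A s d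
  have : 0 ≤ 108 * opBound κ A s d * (36 * boostBound A s d ^ 2) * 2 ^ |s| := by positivity
  rw [costFactor]
  linarith

theorem two_rpow_le_exp {x : ℝ} (hx : 0 ≤ x) : (2 : ℝ) ^ x ≤ Real.exp x := by
  rw [Real.rpow_def_of_pos two_pos, Real.exp_le_exp]
  have := Real.log_two_lt_d9
  exact mul_le_of_le_one_left hx (by linarith)

/-- Take the least k with 3^k at least Y (rounded up), so that 3^k ≤ 6Y. Then 4^k ≤ 9^k ≤ 36Y², and
(1-ρ)^(3^k) ≤ e^(-ρ3^k) ≤ e^(-Λ). The overhead 4^k in rounds is thus polynomial in Y. -/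
theorem exists_boost {ρ Λ Y : ℝ} (hρ : 0 < ρ) (hρ1 : ρ ≤ 1) (hY : 1 ≤ Y) (hΛ : Λ ≤ ρ * Y) :
    ∃ k : ℕ, (4 : ℝ) ^ k ≤ 36 * Y ^ 2 ∧ (1 - ρ) ^ 3 ^ k ≤ Real.exp (-Λ) := by
  have hc : 0 < ⌈Y⌉₊ := Nat.ceil_pos.2 (zero_lt_one.trans_le hY)
  set k := Nat.clog 3 ⌈Y⌉₊ with hk
  have h1 : Y ≤ 3 ^ k := (Nat.le_ceil Y).trans (by exact_mod_cast Nat.le_pow_clog (by norm_num) _)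
  have h2 : (3 : ℝ) ^ k ≤ 6 * Y := by
    have h3 : (⌈Y⌉₊ : ℝ) ≤ 2 * Y := (Nat.ceil_lt_add_one (by linarith)).le.trans (by linarith)
    rcases Nat.eq_zero_or_pos k with h0 | h0
    · rw [h0]; norm_num; linarith
    · have h4 : 3 ^ (k - 1) ≤ ⌈Y⌉₊ := by
        by_contra hcon
        have := Nat.clog_le_of_le_pow (not_le.1 hcon).le
        omega
      have h5 : (3 : ℝ) ^ (k - 1) ≤ ⌈Y⌉₊ := by exact_mod_cast h4
      rw [← Nat.sub_add_cancel h0, pow_succ]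
      linarith
  refine ⟨k, ?_, ?_⟩
  · calc (4 : ℝ) ^ k ≤ 9 ^ k := pow_le_pow_left₀ (by norm_num) (by norm_num) k
      _ = (3 ^ k) ^ 2 := by rw [← pow_mul, mul_comm, pow_mul]; norm_num
      _ ≤ (6 * Y) ^ 2 := pow_le_pow_left₀ (by positivity) h2 2
      _ = _ := by ring
  · have h3 : 1 - ρ ≤ Real.exp (-ρ) := by linarith [Real.add_one_le_exp (-ρ)]
    calc (1 - ρ) ^ 3 ^ k ≤ Real.exp (-ρ) ^ 3 ^ k := pow_le_pow_left₀ (by linarith) h3 _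
      _ = Real.exp (-(ρ * 3 ^ k)) := by rw [← Real.exp_nat_mul]; congr 1; push_cast; ring
      _ ≤ _ := Real.exp_le_exp.2 (neg_le_neg (hΛ.trans (mul_le_mul_of_nonneg_left h1 hρ.le)))

section
variable {d m n n' q : ℕ} {κ A s θ θ' α α' : ℝ}

/-- The target error 1/(2σm²) is only exponentially small in d, so `errBound`, linear in d, suffices
as exponent. The required number 3^k of repetitions is then subexponential. -/
theorem exists_first_boost (hs : |s| ≤ d) (hm0 : 0 < m) (hm : (m : ℝ) ≤ (2 : ℝ) ^ (A * d)) :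
    ∃ k : ℕ, (4 : ℝ) ^ k ≤ 36 * boostBound A s d ^ 2 ∧
      (1 - 1 / (36 * ((2 : ℝ) ^ |s|) ^ 5 * trunc d)) ^ 3 ^ k ≤
        1 / (2 * (2 : ℝ) ^ |s| * (m : ℝ) ^ 2) := by
  have h1 : (1 : ℝ) ≤ 2 ^ |s| := Real.one_le_rpow (by norm_num) (abs_nonneg s)
  have h2 := one_le_mul_of_one_le_of_one_le (one_le_pow₀ (n := 5) h1) (one_le_trunc d)
  have h3 : 1 ≤ 36 * ((2 : ℝ) ^ |s|) ^ 5 * trunc d := by linarith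
  have hE : 1 ≤ errBound A d := le_add_of_nonneg_left (by positivity)
  obtain ⟨k, hk1, hk2⟩ := exists_boost (ρ := 1 / (36 * ((2 : ℝ) ^ |s|) ^ 5 * trunc d))
    (Λ := errBound A d) (Y := boostBound A s d) (by positivity)
    (div_le_one_of_le₀ h3 (by positivity)) (one_le_mul_of_one_le_of_one_le h3 hE) (by
      rw [boostBound, ← mul_assoc, one_div, inv_mul_cancel₀ (by positivity), one_mul])
  refine ⟨k, hk1, hk2.trans ?_⟩
  have hmr : (0 : ℝ) < m := Nat.cast_pos.2 hm0
  rw [Real.exp_neg, ← one_div]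
  refine one_div_le_one_div_of_le (by positivity) ?_
  have e1 : (2 : ℝ) ^ |s| ≤ Real.exp d :=
    (two_rpow_le_exp (abs_nonneg s)).trans (Real.exp_le_exp.2 hs)
  have e2 : (m : ℝ) ≤ Real.exp (|A| * d) := by
    refine (hm.trans (Real.rpow_le_rpow_of_exponent_le (by norm_num)
      (mul_le_mul_of_nonneg_right (le_abs_self A) (Nat.cast_nonneg d)))).trans
      (two_rpow_le_exp (by positivity))
  have e3 : (2 : ℝ) ≤ Real.exp 1 := by linarith [Real.add_one_le_exp (1 : ℝ)]
  calc 2 * (2 : ℝ) ^ |s| * (m : ℝ) ^ 2 ≤ Real.exp 1 * Real.exp d * Real.exp (|A| * d) ^ 2 := by gcongr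
    _ = Real.exp (errBound A d) := by
      rw [← Real.exp_nat_mul, ← Real.exp_add, ← Real.exp_add, errBound]; congr 1; push_cast; ring

theorem exists_bounded_routine (hκ : 0 < κ) (hα' : α' ∈ Set.Icc κ (Real.pi / 2 - κ)) (hd : 2 ≤ d)
    (hs : |s| ≤ d) (hm0 : 0 < m) (hm : (m : ℝ) ≤ (2 : ℝ) ^ (A * d))
    (hn : (n : ℝ) ≤ (2 : ℝ) ^ (A * d)) (hq : (q : ℝ) ≤ (2 : ℝ) ^ s)
    (hn' : n' ≤ q * wordsPerBlock d α' ^ numBlocks d) (θ θ' α : ℝ) :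
    ∃ (S : Subroutines) (t : ℕ), 1 ≤ t ∧ (t : ℝ) ≤ opBound κ A s d ∧
      (Circuit.time S.rCollisionSamp ≤ t ∧ Circuit.time S.rCollisionCheck ≤ t ∧
        Circuit.time S.dec ≤ t ∧ Circuit.time S.zSamp ≤ t ∧ Circuit.time S.zCheck ≤ t) ∧
      ∀ I : Inst d (numBlocks d) (wordsPerBlock d α') q m n n', ∃ tr : Vec d → Finset ℕ,
        Routine S (I.mem α α') θ θ' α α' I.L I.C I.P.points tr := by
  set N := wordsPerBlock d α' with hN
  set b := numBlocks d with hb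
  have hbd : b ≤ d := Nat.log_le_self 2 d
  have hlog0 : 0 < Real.logb 2 d := Real.logb_pos (by norm_num) (by exact_mod_cast hd)
  have hlog : Real.logb 2 d ≤ d := by
    rw [Real.logb_le_iff_le_rpow (by norm_num) (by positivity), Real.rpow_natCast]
    exact_mod_cast Nat.lt_two_pow_self.le
  have htol : 0 < tol d := by unfold tol; positivity
  -- The least natural number of cells whose total width exceeds 2b; it is polynomial in d because
  -- `tol d` is 1/log² d.
  set G := ⌊2 * b / tol d⌋₊ + 1 with hG
  have hG1 : (2 * b : ℝ) < G * tol d := by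
    rw [← div_lt_iff₀ htol, hG]
    exact_mod_cast Nat.lt_floor_add_one (2 * b / tol d : ℝ)
  have hG2 : (G : ℝ) ≤ 2 * d ^ 3 + 1 := by
    rw [hG]
    push_cast
    refine add_le_add_left ((Nat.floor_le (by positivity)).trans ?_) 1
    rw [tol, div_div_eq_mul_div, div_one, pow_succ' (d : ℝ) 2, ← mul_assoc]
    have : (b : ℝ) ≤ d := Nat.cast_le.2 hbd
    gcongr
  have hpow : ∀ x : ℕ, (x : ℝ) ≤ (2 : ℝ) ^ (A * d) → x ≤ 2 ^ ⌈|A| * d⌉₊ := fun x hx => by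
    have : (x : ℝ) ≤ (2 : ℝ) ^ (⌈|A| * d⌉₊ : ℝ) := hx.trans
      (Real.rpow_le_rpow_of_exponent_le (by norm_num)
        ((mul_le_mul_of_nonneg_right (le_abs_self A) (Nat.cast_nonneg d)).trans (Nat.le_ceil _)))
    rw [Real.rpow_natCast] at this
    exact_mod_cast this
  have hqσ : (q : ℝ) ≤ 2 ^ |s| :=
    hq.trans (Real.rpow_le_rpow_of_exponent_le (by norm_num) (le_abs_self s))
  have hq2 : q ≤ 2 ^ d := by
    have : (q : ℝ) ≤ (2 : ℝ) ^ (d : ℝ) :=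
      hqσ.trans (Real.rpow_le_rpow_of_exponent_le (by norm_num) hs)
    rw [Real.rpow_natCast] at this
    exact_mod_cast this
  -- One address length for all registers. The term `N * b` covers the number of centers q·N^b,
  -- using N < 2^N; it is subexponential because N is.
  set B := ⌈|A| * d⌉₊ + 2 * d + N * b + N + b + 1 with hB
  have hlt : ∀ {x e : ℕ}, x ≤ 2 ^ e → e < B → x < 2 ^ B := fun hx he =>
    lt_of_le_of_lt hx (Nat.pow_lt_pow_right (by norm_num) he)
  have hn2 : n' ≤ 2 ^ (d + N * b) := by
    rw [pow_add, pow_mul]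
    exact hn'.trans (Nat.mul_le_mul hq2 (Nat.pow_le_pow_left Nat.lt_two_pow_self.le _))
  obtain ⟨S, ht, hS⟩ := exists_routine (N := N) (q := q) (b := b) θ θ' α α' hm0 htol hG1
    (hlt (hpow m hm) (by omega)) (hlt (hpow n hn) (by omega))
    (hlt (e := d) Nat.lt_two_pow_self.le (by omega)).le (hlt hq2 (by omega)).le
    (hlt (e := b) Nat.lt_two_pow_self.le (by omega)).le
    (hlt (e := N) Nat.lt_two_pow_self.le (by omega)).le (hlt hn2 (by omega)) le_rfl
  refine ⟨S, _, ?_, ?_, ht, fun I => ⟨_, hS I⟩⟩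
  · exact Nat.mul_pos (by norm_num) (Nat.pow_pos (by omega))
  · rw [opBound]
    push_cast
    have hNw : (N : ℝ) ≤ wordsBound κ d := wordsPerBlock_le d hκ hα'
    have hτ : ((⌊trunc d⌋₊ : ℕ) : ℝ) ≤ trunc d :=
      Nat.floor_le (zero_le_one.trans (one_le_trunc d))
    have hbr : (b : ℝ) ≤ d := Nat.cast_le.2 hbd
    have hw0 : 0 ≤ wordsBound κ d := (Nat.cast_nonneg N).trans hNw
    have hBr : (B : ℝ) ≤ |A| * d + 3 * d + wordsBound κ d * d + wordsBound κ d + 2 := by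
      rw [hB]
      push_cast
      have h1 := (Nat.ceil_lt_add_one (by positivity : 0 ≤ |A| * (d : ℝ))).le
      have h2 : (N : ℝ) * b ≤ wordsBound κ d * d := mul_le_mul hNw hbr (Nat.cast_nonneg _) hw0
      linarith
    have hτ0 := zero_lt_one.trans_le (one_le_trunc d)
    have hprod : 2 * (G : ℝ) * (⌊trunc d⌋₊ : ℕ) * (N + q + 1) ≤
        2 * (2 * d ^ 3 + 1) * trunc d * (wordsBound κ d + 2 ^ |s| + 1) := by gcongr
    refine mul_le_mul_of_nonneg_left (pow_le_pow_left₀ (by positivity) ?_ 8) (by norm_num)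
    linarith

open Classical in
-- The subroutines, phases and number of runs are chosen from the sizes before any input is given.
-- The number of runs is the expected number of triples times `runsBound`, which pays for both the
-- loss in `minProb` and the union bound.
theorem exists_search (hκ : 0 < κ) (hα : α ∈ Set.Icc κ (Real.pi / 2 - κ))
    (hα' : α' ∈ Set.Icc κ (Real.pi / 2 - κ)) (hd : 2 ≤ d) (hs : |s| ≤ d)
    (hm : (m : ℝ) ≤ (2 : ℝ) ^ (A * d)) (hn : (n : ℝ) ≤ (2 : ℝ) ^ (A * d))
    (hq : (q : ℝ) ≤ (2 : ℝ) ^ s)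
    (hX : 1 ≤ (m : ℝ) ^ 3 * wedgeRatio d θ α α * wedgeRatio d θ' α' α') :
    ∃ (S : Subroutines) (ph₁ ph₂ ph₃ : List (ℝ × ℝ)) (ℓ : ℕ),
      ((m : ℝ) ^ 3 * wedgeRatio d θ α α * wedgeRatio d θ' α' α' ≤ ℓ ∧
        ℓ ≤ costFactor κ A s d * ((m : ℝ) ^ 3 * wedgeRatio d θ α α * wedgeRatio d θ' α' α')) ∧
      ∀ (L C : Finset (Vec d)) (P : ProductCode d (numBlocks d) (wordsPerBlock d α') q),
        L.card = m → C.card = n → P.points.card = n' → IsGood s θ θ' α α' L C P.points →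
        S.Implements (qcram α α' L C P) θ θ' α α' L C P.points ∧
        ((solutionSearch S ph₁ ph₂ ph₃).time : ℝ)
          ≤ costFactor κ A s d * searchCost d m θ θ' α α' ∧
        ((solutionSearch S ph₁ ph₂ ph₃).width : ℝ) ≤ costFactor κ A s d ∧
        missProb (solutionSearch S ph₁ ph₂ ph₃) (qcram α α' L C P) L
          (collTriplesStar θ θ' α α' L C P.points) ℓ ≤ Real.exp (-(d : ℝ) ^ 2) := by
  set X := (m : ℝ) ^ 3 * wedgeRatio d θ α α * wedgeRatio d θ' α' α' with hXdef
  set σ := (2 : ℝ) ^ |s| with hσ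
  have hm0 : 0 < m := by
    rcases Nat.eq_zero_or_pos m with h | h
    · rw [hXdef, h] at hX; norm_num at hX
    · exact h
  have hK := one_le_runsBound A s d
  have hop := opBound_nonneg κ A s d
  have hmid : 0 ≤ 108 * opBound κ A s d * (36 * boostBound A s d ^ 2) * 2 ^ |s| := by positivity
  have hℓ : X ≤ (⌈runsBound A s d * X⌉₊ : ℕ) ∧
      -- Rounding up costs at most a factor 2, since the product is at least 1.
      ((⌈runsBound A s d * X⌉₊ : ℕ) : ℝ) ≤ costFactor κ A s d * X := by
    have h1 : X ≤ runsBound A s d * X := le_mul_of_one_le_left (by linarith) hK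
    refine ⟨h1.trans (Nat.le_ceil _), (Nat.ceil_lt_add_one (by linarith)).le.trans ?_⟩
    have h2 : 2 * runsBound A s d * X ≤ costFactor κ A s d * X := by
      refine mul_le_mul_of_nonneg_right ?_ (by linarith)
      rw [costFactor]; linarith
    linarith
  by_cases hn' : n' ≤ q * wordsPerBlock d α' ^ numBlocks d
  swap
  -- No product code has this many points, so there is no input to treat and any choice will do.
  · exact ⟨⟨[], [], [], [], []⟩, [], [], [], _, hℓ, fun L C P _ _ hP _ =>
      absurd (hP ▸ card_points_le P) hn'⟩
  obtain ⟨S, t, ht1, htb, ⟨h₁, h₂, h₃, h₄, h₅⟩, hS⟩ :=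
    exists_bounded_routine hκ hα' hd hs hm0 hm hn hq hn' θ θ' α
  obtain ⟨k, hk1, hk2⟩ := exists_first_boost hs hm0 hm
  refine ⟨S, boostPhases k (groverPhases (rounds (maxProb₁ d σ θ α))),
    groverPhases (rounds (maxProb₂ d m σ θ' α')), groverPhases (rounds (maxProb₃ d m σ θ' α')),
    _, hℓ, fun L C P hL hC hP hgood => ?_⟩
  obtain ⟨tr, hR⟩ := hS ⟨L, C, P, hL, hC, hP⟩
  have hcap : ∀ {β : ℝ}, β ∈ Set.Icc κ (Real.pi / 2 - κ) → 0 < capP d β := fun hβ => by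
    rw [capP_eq d hκ hβ]
    exact Real.rpow_pos_of_pos ((sin_le_sin_of_mem hκ hβ).1.trans_le (sin_le_sin_of_mem hκ hβ).2) _
  subst hL
  have hB := hgood.balanced (hcap hα) (hcap hα') hX
  have hlen := hB.rounds_cost k
  refine ⟨hR.implements, ?_, ?_, ?_⟩
  · refine (Nat.cast_le.2 (time_solutionSearch_le ht1 h₁ h₂ h₃ h₄ h₅ _ _ _)).trans ?_
    have hsc : 0 ≤ searchCost d L.card θ θ' α α' := by unfold searchCost; positivity
    have e : ∀ x y z : ℕ, ((54 * t * (x * (y + z)) : ℕ) : ℝ) = 54 * t * ((x : ℝ) * (y + z)) :=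
      fun x y z => by push_cast; ring
    rw [e]
    calc _ ≤ 54 * (t : ℝ) * (2 * 4 ^ k * σ * searchCost d L.card θ θ' α α') :=
          mul_le_mul_of_nonneg_left hlen (by positivity)
      _ = 108 * t * 4 ^ k * σ * searchCost d L.card θ θ' α α' := by ring
      _ ≤ 108 * opBound κ A s d * (36 * boostBound A s d ^ 2) * σ *
          searchCost d L.card θ θ' α α' := by gcongr
      _ ≤ costFactor κ A s d * searchCost d L.card θ θ' α α' := by
          refine mul_le_mul_of_nonneg_right ?_ hsc
          rw [costFactor]
          linarith
  · refine (Nat.cast_le.2 (width_solutionSearch_le ht1 h₁ h₂ h₃ h₄ h₅ _ _ _)).trans ?_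
    rw [costFactor]
    push_cast
    linarith
  · refine (missProb_le (fun v hv => hB.output_prob hR hk2 hv) _).trans ?_
    have hmr : (0 : ℝ) < L.card := Nat.cast_pos.2 hm0
    have hcard : ((collTriplesStar θ θ' α α' L C P.points).card : ℝ) ≤
        Real.exp (3 * |A| * d) := by
      have e1 : (collTriplesStar θ θ' α α' L C P.points).card ≤ L.card ^ 3 :=
        (((Finset.card_filter_le _ _).trans (Finset.card_filter_le _ _)).trans
          (Finset.card_filter_le _ _)).trans_eq (by
            rw [Finset.card_product, Finset.card_product]; ring)
      have e2 : (L.card : ℝ) ≤ Real.exp (|A| * d) :=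
        (hm.trans (Real.rpow_le_rpow_of_exponent_le (by norm_num)
          (mul_le_mul_of_nonneg_right (le_abs_self A) (Nat.cast_nonneg d)))).trans
          (two_rpow_le_exp (by positivity))
      calc _ ≤ (L.card : ℝ) ^ 3 := by exact_mod_cast e1
        _ ≤ Real.exp (|A| * d) ^ 3 := pow_le_pow_left₀ hmr.le e2 3
        _ = _ := by rw [← Real.exp_nat_mul]; congr 1; push_cast; ring
    -- `runsBound` is the reciprocal of `minProb` times the number of triples, multiplied by d² +
    -- 3|A|d + 1. The middle term pays for the m³ triples and leaves e^(-d²).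
    have hpr : (d : ℝ) ^ 2 + 3 * |A| * d + 1 ≤
        minProb d L.card σ θ θ' α α' * (⌈runsBound A s d * X⌉₊ : ℕ) := by
      have hσ0 : 0 < σ := by positivity
      have hτ0 := zero_lt_one.trans_le (one_le_trunc d)
      have hX0 : 0 < X := zero_lt_one.trans_le hX
      have hmin : 0 < minProb d L.card σ θ θ' α α' := by
        rw [minProb, ← hXdef]; positivity
      refine le_trans (le_of_eq ?_) (mul_le_mul_of_nonneg_left (Nat.le_ceil _) hmin.le)
      rw [minProb, ← hXdef, runsBound, ← hσ]
      have hc : 0 < 10368 * σ ^ 17 * trunc d ^ 4 := by positivity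
      set c := 10368 * σ ^ 17 * trunc d ^ 4
      field_simp
    calc _ ≤ Real.exp (3 * |A| * d) *
          Real.exp (-(minProb d L.card σ θ θ' α α' * (⌈runsBound A s d * X⌉₊ : ℕ))) :=
          mul_le_mul_of_nonneg_right hcard (Real.exp_pos _).le
      _ ≤ _ := by
          rw [← Real.exp_add, Real.exp_le_exp]
          linarith

end

end

end TupleSieve

end

/-! ### Conclusion -/

open TupleSieve in
theorem mainTheorem3 (κ κ' A a : ℝ) (hκ : 0 < κ) (hκ4 : κ < Real.pi / 4) (hκ' : 0 < κ')
    (ha : 0 < a) (slack : ℕ → ℝ)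
    (hslack : slack =o[Filter.atTop] (fun d : ℕ => (d : ℝ))) :
    ∃ g h : ℕ → ℝ,
      g =o[Filter.atTop] (fun d : ℕ => (d : ℝ)) ∧
      Filter.Tendsto (fun d : ℕ => h d / d) Filter.atTop Filter.atTop ∧
      ∀ᶠ d : ℕ in Filter.atTop,
        ∀ θ ∈ Set.Icc κ (Real.pi / 2 - κ), ∀ θ' ∈ Set.Icc κ (Real.pi / 2 - κ),
        ∀ α ∈ Set.Icc κ (Real.pi / 2 - κ), ∀ α' ∈ Set.Icc κ (Real.pi / 2 - κ),
        WellDefined κ' θ α α → WellDefined κ' α α θ →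
        WellDefined κ' θ' α' α' → WellDefined κ' α' α' θ' →
        ∀ m n n' q : ℕ,
        (m : ℝ) ≤ (2 : ℝ) ^ (A * d) →
        (2 : ℝ) ^ (a * d) ≤ (m : ℝ) ^ 3 * wedgeRatio d θ α α * wedgeRatio d θ' α' α' →
        (n : ℝ) ≤ (2 : ℝ) ^ (A * d) →
        (q : ℝ) ≤ (2 : ℝ) ^ slack d →
        ∃ (S : Subroutines) (ph₁ ph₂ ph₃ : List (ℝ × ℝ)) (ℓ₂ : ℕ),
          EqUpTo (g d) (ℓ₂ : ℝ)
            ((m : ℝ) ^ 3 * wedgeRatio d θ α α * wedgeRatio d θ' α' α') ∧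
          ∀ (L C : Finset (Vec d))
            (P : ProductCode d (numBlocks d) (wordsPerBlock d α') q),
            (∀ x ∈ L, ‖x‖ = 1) → (∀ c ∈ C, ‖c‖ = 1) →
            L.card = m → C.card = n → P.points.card = n' →
            IsGood (slack d) θ θ' α α' L C P.points →
            S.Implements (qcram α α' L C P) θ θ' α α' L C P.points ∧
            ((solutionSearch S ph₁ ph₂ ph₃).time : ℝ)
              ≤ (2 : ℝ) ^ g d * searchCost d m θ θ' α α' ∧
            ((solutionSearch S ph₁ ph₂ ph₃).queries : ℝ)
              ≤ (2 : ℝ) ^ g d * searchCost d m θ θ' α α' ∧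
            ((solutionSearch S ph₁ ph₂ ph₃).width : ℝ) ≤ (2 : ℝ) ^ g d ∧
            missProb (solutionSearch S ph₁ ph₂ ph₃) (qcram α α' L C P) L
                (collTriplesStar θ θ' α α' L C P.points) ℓ₂
              ≤ Real.exp (-h d) := by
  -- The exponent g is the logarithm of the collected factor, and h = d² grows faster than linearly.
  refine ⟨fun d => Real.logb 2 (costFactor κ A (slack d) d), fun d => (d : ℝ) ^ 2,
    (subExp_costFactor κ A hslack).logb fun d => one_le_costFactor κ A _ d, ?_, ?_⟩
  · refine tendsto_natCast_atTop_atTop.congr' ?_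
    filter_upwards [Filter.eventually_gt_atTop 0] with d hd
    have : (d : ℝ) ≠ 0 := Nat.cast_ne_zero.2 hd.ne'
    field_simp
  · filter_upwards [Filter.eventually_ge_atTop 2, hslack.def one_pos] with d hd hs
    intro θ _ θ' _ α hα α' hα' _ _ _ _ m n n' q hm hX hn hq
    rw [one_mul, Real.norm_eq_abs, Real.norm_natCast] at hs
    have hX1 := (Real.one_le_rpow (by norm_num : (1 : ℝ) ≤ 2)
      (mul_nonneg ha.le (Nat.cast_nonneg d))).trans hX
    obtain ⟨S, ph₁, ph₂, ph₃, ℓ, ⟨hℓ1, hℓ2⟩, hS⟩ :=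
      exists_search (n' := n') hκ hα hα' hd hs hm hn hq hX1
    have hF := one_le_costFactor κ A (slack d) d
    have hg : (2 : ℝ) ^ Real.logb 2 (costFactor κ A (slack d) d) = costFactor κ A (slack d) d :=
      Real.rpow_logb (by norm_num) (by norm_num) (zero_lt_one.trans_le hF)
    refine ⟨S, ph₁, ph₂, ph₃, ℓ, ⟨?_, by rwa [hg]⟩, fun L C P _ _ hL hC hP hgood => ?_⟩
    -- The number of runs is at least the expected number of triples, so the lower half of the
    -- comparison has room to spare.
    · rw [Real.rpow_neg (by norm_num), hg]
      exact (mul_le_of_le_one_left (zero_le_one.trans hX1) (inv_le_one_of_one_le₀ hF)).trans hℓ1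
    · rw [hg]
      obtain ⟨h1, h2, h3, h4⟩ := hS L C P hL hC hP hgood
      exact ⟨h1, h2, (Nat.cast_le.2 (Circuit.queries_le_time _)).trans h2, h3, h4⟩
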